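/- **Setting.** Let $\mathcal D\subset\mathbb R^n$ be compact, with a set of pairwise disjoint connected regions $R\subseteq\mathcal D$ of non-empty interior (the connected components of the remaining free space also have non-empty interior), each region carrying a subset of a finite set $\Pi$ of properties; $h(x)\subseteq\Pi$ is the set of properties of the region containing $x$. Let $\mathcal B=(S,S_0,2^\Pi,\delta,F)$ be a Büchi automaton with finite state set $S$. For a finite transition system $\mathcal T=(X,x_0,\Delta,\Pi,h)$ with $X\subset\mathcal D$, the product automaton $\mathcal T\times\mathcal B$ has the states $(x,s)$ reachable from $\{x_0\}\times S_0$ along the transitions $(x,s)\to(x',s')$ with $(x,x')\in\Delta$ and $s'\in\delta(s,h(x))$. The steer function satisfies $\|\mathrm{Steer}(x,g)-g\|<\|x-g\|$ for $x\ne g$, and $\eta_1(k)<\eta_2(k)<c\,\eta_1(k)$ for all $k\ge 1$ and some $c>1$, with $\eta_1(k)\to0$. **Sparse RRG (Algorithm 1)** starts with $\mathcal T=(\{x_0\},\emptyset)$ and $\mathcal P=\mathcal T\times\mathcal B$. As long as no accepting state of $\mathcal P$ lies in a strongly connected component with more than one element, it draws a sample $x_r\in\mathcal D$ and then runs two loops.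 (i) For every state $x$ at distance at most $\eta_2(|X|)$ from $x_r$, provided that no state is closer to $x_r$ than $\eta_1(|X|)$, it puts $x'=\mathrm{Steer}(x,x_r)$ and, if the segment $[x,x']$ is simple, calls Algorithm 2 with $(x,x')$. A segment is simple if it lies in $\mathcal D$ and either stays in one region or free-space component, or passes exactly once from one of these to another, not both being free. (ii) For every new state $x'$ and every state $x$ at distance at most $\eta_2(|X|)$ from $x'$ with $x=\mathrm{Steer}(x',x)$ and $[x',x]$ simple, it calls Algorithm 2 with $(x',x)$. A transition for which Algorithm 2 returns True is added to $\mathcal T$; otherwise it is discarded. **Incremental search (Algorithm 2)**, called with $(x,x')$, computes the set $S'$ of all $(x',s')$ with $s'\in\delta(s,h(x))$ for some state $(x,s)$ of $\mathcal P$ and such that $s'$ has an outgoing transition in $\mathcal B$. If $S'=\emptyset$ it returns False. Otherwise it adds $S'$ and the corresponding transitions to $\mathcal P$, and puts $S'$ on a stack. Until the stack is empty, it pops a state, adds to $\mathcal P$ all its product successors and the transitions to them, and pushes the successors that were not yet in $\mathcal P$. Finally it updates the strongly connected components of $\mathcal P$ and returns True. **Theorem.** Algorithm 2 has total execution time $O(m^{3/2})$,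 where $m=|\Delta|$ is the number of transitions that Sparse RRG has added to $\mathcal T$. Precisely: for every $\mathcal B$ (and every fixed numbering of its states and of its letters) there are a word-RAM program and a constant $C$ such that, for every environment, every steer function, all bound functions and all samples, and after any number of iterations of Sparse RRG, the program has executed all the calls of Algorithm 2 made so far, maintaining in memory after each call the returned value, the states and transitions of $\mathcal P$, names of its strongly connected components, and whether an accepting state lies in a component with more than one element. The setup for the initial product automaton takes at most $C$ steps. The calls that add a transition to $\mathcal T$ take at most $C\,m^{3/2}$ steps in total, and all calls together take at most $C\,(m^{3/2}+r)$ steps, where $r$ is the number of calls that add no transition to $\mathcal T$. (After $N$ calls all words stored are bounded by $C(N+1)^C$, i.e. they have $O(\log N)$ bits.) -/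

import Mathlib

open scoped BigOperators

/-! ### Transition systems, Büchi automata, product automata -/

/-- A deterministic transition system with a finite set of states drawn from `α` and atomic
propositions `AP`. -/
structure DTS (α AP : Type*) where
  states : Finset α
  start : α
  start_mem : start ∈ states
  trans : Finset (α × α)
  trans_mem : ∀ e ∈ trans, e.1 ∈ states ∧ e.2 ∈ states
  label : α → Set AP

/-- A nondeterministic Büchi automaton over the alphabet `Set AP`
(finiteness of `S` is a hypothesis where it is used). -/
structure BuchiAutomaton (AP S : Type*) where
  start : Set S
  step : S → Set AP → Set S
  accept : Set S

/-- A state of the Büchi automaton is non-blocking if it has an outgoing transition. -/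
def BuchiAutomaton.NonBlocking {AP S : Type*} (B : BuchiAutomaton AP S) (s : S) : Prop :=
  ∃ σ, (B.step s σ).Nonempty

/-- The states and transitions of a (partially built) product automaton. -/
structure ProductGraph (α S : Type*) where
  states : Set (α × S)
  trans : Set ((α × S) × (α × S))

section Product

variable {α AP S : Type*}

/-- `(x, s)` moves to `(x', s')` if `x → x'` in the transition system and `s → s'` in the Büchi
automaton on reading the label of `x`. -/
def ProductStep (T : DTS α AP) (B : BuchiAutomaton AP S) (p p' : α × S) : Prop :=
  (p.1, p'.1) ∈ T.trans ∧ p'.2 ∈ B.step p.2 (T.label p.1)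

/-- The product automaton `T × B`, restricted to the states reachable from an initial state. -/
def productAutomaton (T : DTS α AP) (B : BuchiAutomaton AP S) : ProductGraph α S where
  states := {p | ∃ s₀ ∈ B.start, Relation.ReflTransGen (ProductStep T B) (T.start, s₀) p}
  trans := {e | (∃ s₀ ∈ B.start, Relation.ReflTransGen (ProductStep T B) (T.start, s₀) e.1) ∧
    ProductStep T B e.1 e.2}

/-- Two states of a product automaton reach each other. -/
def ProductGraph.SameSCC (P : ProductGraph α S) (p p' : α × S) : Prop :=
  Relation.ReflTransGen (fun a b => (a, b) ∈ P.trans) p p' ∧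
    Relation.ReflTransGen (fun a b => (a, b) ∈ P.trans) p' p

/-- The strongly connected component of `p`. -/
def ProductGraph.scc (P : ProductGraph α S) (p : α × S) : Set (α × S) :=
  {p' | p' ∈ P.states ∧ P.SameSCC p p'}

/-- The stopping test of the planner: some accepting state has a component with more than one
element. -/
def ProductGraph.Found (P : ProductGraph α S) (B : BuchiAutomaton AP S) : Prop :=
  ∃ p ∈ P.states, p.2 ∈ B.accept ∧ 1 < (P.scc p).encard

open Classical in
/-- Add the transition `(x, x')`, with its end points, to the transition system. -/
noncomputable def DTS.addTransition (T : DTS α AP) (x x' : α) : DTS α AP where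
  states := insert x' (insert x T.states)
  start := T.start
  start_mem := by simp [T.start_mem]
  trans := insert (x, x') T.trans
  trans_mem := by
    intro e he
    rcases Finset.mem_insert.1 he with rfl | he
    · simp
    · have := T.trans_mem e he
      simp [this.1, this.2]
  label := T.label

/-- The transition system with the single state `x₀` and no transition. -/
def DTS.single (x₀ : α) (label : α → Set AP) : DTS α AP where
  states := {x₀}
  start := x₀
  start_mem := by simp
  trans := ∅
  trans_mem := by simp
  label := label

end Product

/-! ### Incremental search for a satisfying run: one update of the product automaton -/

/-- The state of the planner: the transition system `T`, its states in the order of their creation,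
and the product automaton `P`. -/
structure SearchState (α AP S : Type*) where
  T : DTS α AP
  order : List α
  P : ProductGraph α S

section Update

variable {α AP S : Type*}

/-- Non-blocking product states over `x'` that are entered from the product states over `x`. -/
def newStates (h : α → Set AP) (B : BuchiAutomaton AP S) (P : ProductGraph α S) (x x' : α) :
    Set (α × S) :=
  {p | p.1 = x' ∧ (∃ s, (x, s) ∈ P.states ∧ p.2 ∈ B.step s (h x)) ∧ B.NonBlocking p.2}

/-- The product transitions from the product states over `x` into `newStates`. -/
def newTrans (h : α → Set AP) (B : BuchiAutomaton AP S) (P : ProductGraph α S) (x x' : α) :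
    Set ((α × S) × (α × S)) :=
  {e | e.1.1 = x ∧ e.1 ∈ P.states ∧ e.2.2 ∈ B.step e.1.2 (h x) ∧ e.2 ∈ newStates h B P x x'}

/-- The body of the traversal loop: all successors of `p` and all transitions from `p` to them are
added to the product automaton. -/
def ProductGraph.expand (P : ProductGraph α S) (T : DTS α AP) (B : BuchiAutomaton AP S)
    (p : α × S) : ProductGraph α S where
  states := P.states ∪ {p' | ProductStep T B p p'}
  trans := P.trans ∪ {e | e.1 = p ∧ ProductStep T B p e.2}

/-- `Traverse T B P stack P'`: the traversal loop, started with the product automaton `P` and the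
given stack, ends with `P'`. Any element of the stack may be popped; the successors that were not
yet in the product automaton are pushed. -/
inductive Traverse (T : DTS α AP) (B : BuchiAutomaton AP S) :
    ProductGraph α S → Set (α × S) → ProductGraph α S → Prop
  | done (P : ProductGraph α S) : Traverse T B P ∅ P
  | pop (P P' : ProductGraph α S) (stack : Set (α × S)) (p : α × S) (hp : p ∈ stack)
      (h : Traverse T B (P.expand T B p)
        ((stack \ {p}) ∪ {p' | ProductStep T B p p' ∧ p' ∉ P.states}) P') :
      Traverse T B P stack P'

open Classical in
/-- One call of the incremental search with the transition `(x, x')`. The Boolean is the returned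
value. If it is `false`, the transition is discarded; if it is `true`, the transition belongs to
the transition system from this call on. -/
inductive UpdatePA (B : BuchiAutomaton AP S) :
    SearchState α AP S → α → α → Bool → SearchState α AP S → Prop
  | rejected (st : SearchState α AP S) (x x' : α)
      (h : newStates st.T.label B st.P x x' = ∅) : UpdatePA B st x x' false st
  | accepted (st : SearchState α AP S) (x x' : α) (P' : ProductGraph α S)
      (h : (newStates st.T.label B st.P x x').Nonempty)
      (hP : Traverse (st.T.addTransition x x') B
        ⟨st.P.states ∪ newStates st.T.label B st.P x x',
          st.P.trans ∪ newTrans st.T.label B st.P x x'⟩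
        (newStates st.T.label B st.P x x') P') :
      UpdatePA B st x x' true
        ⟨st.T.addTransition x x', if x' ∈ st.order then st.order else st.order ++ [x'], P'⟩

/-- The record of one call: the planner before the call, the argument `(src, dst)`, the returned
value, and the planner after the call. -/
structure CallRecord (α AP S : Type*) where
  pre : SearchState α AP S
  src : α
  dst : α
  added : Bool
  post : SearchState α AP S

/-- The call adds a transition to the transition system. -/
def CallRecord.AddsTransition (c : CallRecord α AP S) : Prop :=
  c.added = true ∧ (c.src, c.dst) ∉ c.pre.T.trans

end Update

/-! ### Sparse RRG -/

/-- The environment of the robot: a compact configuration space in `ℝⁿ` with disjoint,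
connected, full-dimensional regions, and the properties that hold in each region. -/
structure Environment (n : ℕ) (AP : Type*) where
  space : Set (EuclideanSpace ℝ (Fin n))
  compact : IsCompact space
  regions : Set (Set (EuclideanSpace ℝ (Fin n)))
  prop : Set (EuclideanSpace ℝ (Fin n)) → Set AP
  subset : ∀ R ∈ regions, R ⊆ space
  disjoint : regions.PairwiseDisjoint id
  connected : ∀ R ∈ regions, IsConnected R
  fullDim : ∀ R ∈ regions, (interior R).Nonempty
  free_fullDim : ∀ x ∈ space \ ⋃₀ regions,
    (interior (connectedComponentIn (space \ ⋃₀ regions) x)).Nonempty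

section RRG

variable {n : ℕ} {AP S : Type*}

/-- The properties that hold at a configuration. -/
def Environment.label (env : Environment n AP) (x : EuclideanSpace ℝ (Fin n)) : Set AP :=
  {a | ∃ R ∈ env.regions, x ∈ R ∧ a ∈ env.prop R}

/-- The free space regions: the connected components of the complement of the regions. -/
def Environment.freeRegions (env : Environment n AP) : Set (Set (EuclideanSpace ℝ (Fin n))) :=
  {C | ∃ x ∈ env.space \ ⋃₀ env.regions,
    C = connectedComponentIn (env.space \ ⋃₀ env.regions) x}

/-- The segment from `x` to `y` is simple: it lies in the configuration space, and either it stays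
in one region or free space region, or it passes once from a region `R₁` to a region `R₂`, at most
one of which is a free space region. -/
def Environment.IsSimpleSegment (env : Environment n AP) (x y : EuclideanSpace ℝ (Fin n)) : Prop :=
  segment ℝ x y ⊆ env.space ∧
    ((∃ R ∈ env.regions ∪ env.freeRegions, segment ℝ x y ⊆ R) ∨
      ∃ R₁ ∈ env.regions ∪ env.freeRegions, ∃ R₂ ∈ env.regions ∪ env.freeRegions,
        (R₁ ∈ env.regions ∨ R₂ ∈ env.regions) ∧ x ∈ R₁ ∧ y ∈ R₂ ∧
        ∃ t ∈ Set.Icc (0 : ℝ) 1,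
          AffineMap.lineMap x y t ∈ R₁ ∪ R₂ ∧
          (∀ r ∈ Set.Ico (0 : ℝ) t, AffineMap.lineMap x y r ∈ R₁) ∧
          (∀ r ∈ Set.Ioc t (1 : ℝ), AffineMap.lineMap x y r ∈ R₂))

/-- A steer function returns a configuration that is closer to the goal `g` than `x` is. -/
def Environment.IsSteer (env : Environment n AP)
    (steer : EuclideanSpace ℝ (Fin n) → EuclideanSpace ℝ (Fin n) → EuclideanSpace ℝ (Fin n)) :
    Prop :=
  ∀ x ∈ env.space, ∀ g ∈ env.space,
    steer x g ∈ env.space ∧ (x ≠ g → dist (steer x g) g < dist x g)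

/-- Admissible lower and upper bound functions. -/
def IsBoundPair (η₁ η₂ : ℕ → ℝ) : Prop :=
  (∀ k, 1 ≤ k → η₁ k < η₂ k) ∧ (∃ c : ℝ, 1 < c ∧ ∀ k, 1 ≤ k → η₂ k < c * η₁ k) ∧
    Filter.Tendsto η₁ Filter.atTop (nhds 0)

/-- The states at distance at most `r` from `x`. -/
def nearStates (X : Finset (EuclideanSpace ℝ (Fin n))) (x : EuclideanSpace ℝ (Fin n)) (r : ℝ) :
    Set (EuclideanSpace ℝ (Fin n)) :=
  {y | y ∈ X ∧ dist x y ≤ r}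

/-- The states at distance at most `r₂` from `x`, provided that no state is closer to `x` than
`r₁`; otherwise no state at all. -/
def farStates (X : Finset (EuclideanSpace ℝ (Fin n))) (x : EuclideanSpace ℝ (Fin n)) (r₁ r₂ : ℝ) :
    Set (EuclideanSpace ℝ (Fin n)) :=
  {y | y ∈ X ∧ dist x y ≤ r₂ ∧ ∀ z ∈ X, r₁ ≤ dist x z}

/-- `L` lists the elements of the set `A`, each once, in some order. -/
def Enumerates {β : Type*} (L : List β) (A : Set β) : Prop :=
  L.Nodup ∧ ∀ a, a ∈ L ↔ a ∈ A

/-- The first inner loop for the sample `xr`, over the remaining list of far states. The trace of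
the calls, the set of new states and the final planner are returned. -/
inductive ExploreLoop (env : Environment n AP)
    (steer : EuclideanSpace ℝ (Fin n) → EuclideanSpace ℝ (Fin n) → EuclideanSpace ℝ (Fin n))
    (B : BuchiAutomaton AP S) (xr : EuclideanSpace ℝ (Fin n)) :
    List (EuclideanSpace ℝ (Fin n)) → SearchState (EuclideanSpace ℝ (Fin n)) AP S →
    List (CallRecord (EuclideanSpace ℝ (Fin n)) AP S) → Set (EuclideanSpace ℝ (Fin n)) →
    SearchState (EuclideanSpace ℝ (Fin n)) AP S → Prop
  | nil (st) : ExploreLoop env steer B xr [] st [] ∅ st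
  | skip (x L st tr X' st') (hx : ¬ env.IsSimpleSegment x (steer x xr))
      (h : ExploreLoop env steer B xr L st tr X' st') :
      ExploreLoop env steer B xr (x :: L) st tr X' st'
  | call (x L st b st₁ tr X' st') (hx : env.IsSimpleSegment x (steer x xr))
      (hc : UpdatePA B st x (steer x xr) b st₁)
      (h : ExploreLoop env steer B xr L st₁ tr X' st') :
      ExploreLoop env steer B xr (x :: L) st (⟨st, x, steer x xr, b, st₁⟩ :: tr)
        ({y | b = true ∧ y = steer x xr} ∪ X') st'

/-- The inner part of the second loop, for the new state `x'`, over the remaining list of near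
states. -/
inductive CloseInner (env : Environment n AP)
    (steer : EuclideanSpace ℝ (Fin n) → EuclideanSpace ℝ (Fin n) → EuclideanSpace ℝ (Fin n))
    (B : BuchiAutomaton AP S) (x' : EuclideanSpace ℝ (Fin n)) :
    List (EuclideanSpace ℝ (Fin n)) → SearchState (EuclideanSpace ℝ (Fin n)) AP S →
    List (CallRecord (EuclideanSpace ℝ (Fin n)) AP S) →
    SearchState (EuclideanSpace ℝ (Fin n)) AP S → Prop
  | nil (st) : CloseInner env steer B x' [] st [] st
  | skip (x L st tr st') (hx : ¬ (x = steer x' x ∧ env.IsSimpleSegment x' x))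
      (h : CloseInner env steer B x' L st tr st') :
      CloseInner env steer B x' (x :: L) st tr st'
  | call (x L st b st₁ tr st') (hx : x = steer x' x ∧ env.IsSimpleSegment x' x)
      (hc : UpdatePA B st x' x b st₁) (h : CloseInner env steer B x' L st₁ tr st') :
      CloseInner env steer B x' (x :: L) st (⟨st, x', x, b, st₁⟩ :: tr) st'

/-- The second loop, which closes cycles, over the remaining list of new states. -/
inductive CloseLoop (env : Environment n AP)
    (steer : EuclideanSpace ℝ (Fin n) → EuclideanSpace ℝ (Fin n) → EuclideanSpace ℝ (Fin n))
    (η₂ : ℕ → ℝ) (B : BuchiAutomaton AP S) :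
    List (EuclideanSpace ℝ (Fin n)) → SearchState (EuclideanSpace ℝ (Fin n)) AP S →
    List (CallRecord (EuclideanSpace ℝ (Fin n)) AP S) →
    SearchState (EuclideanSpace ℝ (Fin n)) AP S → Prop
  | nil (st) : CloseLoop env steer η₂ B [] st [] st
  | cons (x' L M st tr₁ st₁ tr₂ st₂)
      (hM : Enumerates M (nearStates st.T.states x' (η₂ st.T.states.card)))
      (h₁ : CloseInner env steer B x' M st tr₁ st₁)
      (h₂ : CloseLoop env steer η₂ B L st₁ tr₂ st₂) :
      CloseLoop env steer η₂ B (x' :: L) st (tr₁ ++ tr₂) st₂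

/-- The planner at the start. -/
def startState (env : Environment n AP) (x₀ : EuclideanSpace ℝ (Fin n))
    (B : BuchiAutomaton AP S) : SearchState (EuclideanSpace ℝ (Fin n)) AP S where
  T := DTS.single x₀ env.label
  order := [x₀]
  P := productAutomaton (DTS.single x₀ env.label) B

/-- `SparseRRG … tr st`: after some number of iterations, Sparse RRG has made the calls `tr` of the
incremental search and has reached `st`. The samples may be any points of the configuration space,
and the loops may go through the sets in any order. -/
inductive SparseRRG (env : Environment n AP) (x₀ : EuclideanSpace ℝ (Fin n))
    (steer : EuclideanSpace ℝ (Fin n) → EuclideanSpace ℝ (Fin n) → EuclideanSpace ℝ (Fin n))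
    (η₁ η₂ : ℕ → ℝ) (B : BuchiAutomaton AP S) :
    List (CallRecord (EuclideanSpace ℝ (Fin n)) AP S) →
    SearchState (EuclideanSpace ℝ (Fin n)) AP S → Prop
  | start : SparseRRG env x₀ steer η₁ η₂ B [] (startState env x₀ B)
  | iterate (tr st xr L X' tr₁ st₁ L' tr₂ st₂)
      (h : SparseRRG env x₀ steer η₁ η₂ B tr st)
      (hguard : ¬ st.P.Found B)
      (hxr : xr ∈ env.space)
      (hL : Enumerates L
        (farStates st.T.states xr (η₁ st.T.states.card) (η₂ st.T.states.card)))
      (h₁ : ExploreLoop env steer B xr L st tr₁ X' st₁)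
      (hL' : Enumerates L' X')
      (h₂ : CloseLoop env steer η₂ B L' st₁ tr₂ st₂) :
      SparseRRG env x₀ steer η₁ η₂ B (tr ++ tr₁ ++ tr₂) st₂

end RRG

/-! ### Machine model: a word RAM with structured programs -/

/-- The memory: the word at index `i` of array `a` is `mem a i`. A program mentions finitely many
arrays. -/
abbrev Mem := ℕ → ℕ → ℕ

/-- Expressions: constants, memory reads, and the unit-cost word operations. -/
inductive Expr where
  | const (k : ℕ)
  | read (a : ℕ) (i : Expr)
  | add (e f : Expr)
  | sub (e f : Expr)
  | mul (e f : Expr)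
  | div (e f : Expr)
  | lt (e f : Expr)
  | eq (e f : Expr)

/-- The value of an expression; comparisons give `1` or `0`. -/
def Expr.eval (mem : Mem) : Expr → ℕ
  | const k => k
  | read a i => mem a (i.eval mem)
  | add e f => e.eval mem + f.eval mem
  | sub e f => e.eval mem - f.eval mem
  | mul e f => e.eval mem * f.eval mem
  | div e f => e.eval mem / f.eval mem
  | lt e f => if e.eval mem < f.eval mem then 1 else 0
  | eq e f => if e.eval mem = f.eval mem then 1 else 0

/-- The number of elementary operations in the evaluation of an expression. -/
def Expr.cost : Expr → ℕ
  | const _ => 1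
  | read _ i => i.cost + 1
  | add e f => e.cost + f.cost + 1
  | sub e f => e.cost + f.cost + 1
  | mul e f => e.cost + f.cost + 1
  | div e f => e.cost + f.cost + 1
  | lt e f => e.cost + f.cost + 1
  | eq e f => e.cost + f.cost + 1

/-- Programs. -/
inductive Cmd where
  | skip
  | store (a : ℕ) (i e : Expr)
  | seq (c d : Cmd)
  | ite (e : Expr) (c d : Cmd)
  | loop (e : Expr) (c : Cmd)

/-- Change one word of the memory. -/
def Mem.write (mem : Mem) (a i v : ℕ) : Mem :=
  fun a' i' => if a' = a ∧ i' = i then v else mem a' i'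

/-- `Exec W c mem t mem'`: the program `c`, started in the memory `mem`, halts after `t` elementary
steps in the memory `mem'`, and never stores a word that exceeds `W` or writes to an address that exceeds
`W`. -/
inductive Exec (W : ℕ) : Cmd → Mem → ℕ → Mem → Prop
  | skip (mem) : Exec W .skip mem 1 mem
  | store (a i e mem) (hi : i.eval mem ≤ W) (he : e.eval mem ≤ W) :
      Exec W (.store a i e) mem (i.cost + e.cost + 1) (mem.write a (i.eval mem) (e.eval mem))
  | seq (c d mem t₁ mem₁ t₂ mem₂) (h₁ : Exec W c mem t₁ mem₁) (h₂ : Exec W d mem₁ t₂ mem₂) :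
      Exec W (.seq c d) mem (t₁ + t₂) mem₂
  | ite_true (e c d mem t mem') (he : e.eval mem ≠ 0) (h : Exec W c mem t mem') :
      Exec W (.ite e c d) mem (e.cost + 1 + t) mem'
  | ite_false (e c d mem t mem') (he : e.eval mem = 0) (h : Exec W d mem t mem') :
      Exec W (.ite e c d) mem (e.cost + 1 + t) mem'
  | loop_done (e c mem) (he : e.eval mem = 0) : Exec W (.loop e c) mem (e.cost + 1) mem
  | loop_step (e c mem t₁ mem₁ t₂ mem₂) (he : e.eval mem ≠ 0) (h₁ : Exec W c mem t₁ mem₁)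
      (h₂ : Exec W (.loop e c) mem₁ t₂ mem₂) :
      Exec W (.loop e c) mem (e.cost + 1 + t₁ + t₂) mem₂

/-! ### Implementations of the incremental search -/

section Implementation

variable {α AP S : Type*}

open Classical in
/-- The number of the product state `(x, s)`, where `x` is numbered by its place in the order of
creation and `s` by `q`. -/
noncomputable def stateCode {K : ℕ} (q : S ≃ Fin K) (order : List α) (p : α × S) : ℕ :=
  order.idxOf p.1 * K + q p.2

/-- The memory holds the product automaton and its strongly connected components:
array `2` is the indicator of the states, arrays `3` and `4` hold the sources and the targets of the
transitions, whose number is word `2` of array `1`; array `5` holds names of the components, and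
word `1` of array `1` says whether the stopping test succeeds. -/
def Represents {K : ℕ} (B : BuchiAutomaton AP S) (q : S ≃ Fin K) (st : SearchState α AP S)
    (mem : Mem) : Prop :=
  (∀ x ∈ st.order, ∀ s, mem 2 (stateCode q st.order (x, s)) ≠ 0 ↔ (x, s) ∈ st.P.states) ∧
  {e : ℕ × ℕ | ∃ j < mem 1 2, e = (mem 3 j, mem 4 j)} =
    {e : ℕ × ℕ | ∃ f ∈ st.P.trans, e = (stateCode q st.order f.1, stateCode q st.order f.2)} ∧
  (∀ p ∈ st.P.states, ∀ p' ∈ st.P.states,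
    mem 5 (stateCode q st.order p) = mem 5 (stateCode q st.order p') ↔ st.P.SameSCC p p') ∧
  (mem 1 1 ≠ 0 ↔ st.P.Found B)

/-- Write the four arguments of a program to array `0`. -/
def Mem.args (mem : Mem) (i j a b : ℕ) : Mem :=
  (((mem.write 0 0 i).write 0 1 j).write 0 2 a).write 0 3 b

open Classical in
/-- The memory in which the call `c` starts: the arguments are the numbers of the states `src` and
`dst` (a state that is not yet in the transition system gets the next free number) and their
labels. -/
noncomputable def CallRecord.load (c : CallRecord α AP S) (lab : Set AP ↪ ℕ) (mem : Mem) : Mem :=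
  mem.args (c.pre.order.idxOf c.src) (c.pre.order.idxOf c.dst)
    (lab (c.pre.T.label c.src)) (lab (c.pre.T.label c.dst))

/-- With words bounded by `W`, the program `setup` followed by one execution of `call` for every
element of the trace `tr` performs the calls of the trace: `mem 0` is the memory after `setup`, which
takes `t₀` steps; the `i`-th call takes `time i` steps, leads to `mem (i + 1)`, leaves there the
updated product automaton and its components, and returns its value in word `0` of array `1`. -/
def Implements {K : ℕ} (B : BuchiAutomaton AP S) (lab : Set AP ↪ ℕ) (q : S ≃ Fin K)
    (setup call : Cmd) (W : ℕ) (first : SearchState α AP S) (tr : List (CallRecord α AP S))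
    (t₀ : ℕ) (mem : ℕ → Mem) (time : ℕ → ℕ) : Prop :=
  Exec W setup (Mem.args (fun _ _ => 0) 0 0 (lab (first.T.label first.T.start)) 0) t₀ (mem 0) ∧
  Represents B q first (mem 0) ∧
  ∀ i : Fin tr.length,
    Exec W call ((tr.get i).load lab (mem i)) (time i) (mem (i + 1)) ∧
    Represents B q (tr.get i).post (mem (i + 1)) ∧
    (mem (i + 1) 1 0 ≠ 0 ↔ (tr.get i).added = true)

end Implementation

/-! The heart is an incremental algorithm for strongly connected components that spends `O(m ^
(3/2))` steps on `m` arc insertions, by the method of levels of Bender, Fineman, Gilbert and Tarjan.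
Every vertex carries a level, and levels do not decrease along arcs, so each cycle lies within one
level. When an arc `v → w` joins two components and `w` is not above `v`, a backward search from
`v`, confined to the level of `v`, is stopped after `lev v + 1` arcs. If it finishes before being
stopped, `w` must get at least the level of `v`; if it is stopped, at least one more. Everything
reached from `w` is raised along with it (`adjustLevels_runs`). A second backward search, now
without limit, decides whether `w` reaches `v`. If it does, a forward search along the arcs just
recorded finds the components on the cycles through the new arc, and they are merged into the
largest of them (`closeCycle_runs`).

Levels stay small because a vertex is raised to a new level `k + 1` only if `k + 1` arcs of level
`k` lie behind it. `LevelOK` keeps such arcs as witnesses, `LevelOK.insert` shows that they survive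
an insertion, and counting them over all levels gives `lev ≤ √(2M)` after `M` insertions
(`LevelOK.bound`). Arcs swallowed by a component leave the search lists, but go on counting for the
level at which this happened. The limit of the search depends on the level and not on `√m`, so the
final number of arcs need not be known.

The time is amortized against `potential`. Apart from `O(√M)` steps, an insertion pays for the
raised vertices (each gains a level), for their outgoing arcs (the tail of each gains a level) and
for renamed vertices (the size of the component of each doubles). The second search is paid for as
well: it meets only arcs of a completed first search, arcs with a raised tail, and the new arc. All
levels are `O(√M)` and logarithms are below square roots, so the whole potential is `O(M ^ (3/2))`.

For an automaton with `K` states, the product state over the `i`-th vertex with automaton state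
number `s` has the number `i * K + s`. With `m` transitions in the transition system there are at
most `K (m + 1)` product states and `K² m` product arcs. Incremental search may pop the same product
state in many calls. A counter per product state remembers how many transitions of its vertex have
been expanded already, so a later visit looks only at those added since. Over all calls this makes
at most `K m` expansions, besides one queue entry for each newly found state and at most `K` entries
per call (`expandLoop_runs`).

Correctness is a simulation. The result of the traversal does not depend on the order in which the
stack is popped: `traverse_eq` describes it by reachability through states not yet in the product
automaton. So the queue of the program agrees with every run of the nondeterministic algorithm, and
the relation `Matches` between planner and memory is kept by every call (`Matches.call`). Of the
geometry only one fact is needed: every call starts at a state of the transition system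
(`callChain_of_sparseRRG`).

Finally, `exists_simulation` sums over the run. Each call takes at most a constant more than the
rise of `planPotential`, which never falls. Hence the calls that add a transition can be charged on
their own, by the final potential plus a constant for each of them. The other calls cost one further
constant each, and `potential_bound` estimates the final potential. -/

namespace IncSCC

/-! ### Reachability along the first `M` arcs of a growing digraph -/

section Graph

variable {src dst : ℕ → ℕ} {M : ℕ}

/-- There is an arc from `a` to `b` among the first `M` arcs. -/
def Arc (src dst : ℕ → ℕ) (M : ℕ) (a b : ℕ) : Prop := ∃ e < M, src e = a ∧ dst e = b

/-- Reachability along the first `M` arcs. -/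
def Rch (src dst : ℕ → ℕ) (M : ℕ) : ℕ → ℕ → Prop := Relation.ReflTransGen (Arc src dst M)

/-- Mutual reachability along the first `M` arcs. -/
def Mut (src dst : ℕ → ℕ) (M : ℕ) (a b : ℕ) : Prop := Rch src dst M a b ∧ Rch src dst M b a

theorem Rch.refl (a : ℕ) : Rch src dst M a a := Relation.ReflTransGen.refl

theorem Rch.trans {a b c : ℕ} (h : Rch src dst M a b) (h' : Rch src dst M b c) :
    Rch src dst M a c := Relation.ReflTransGen.trans h h'

theorem Rch.of_arc {e : ℕ} (he : e < M) : Rch src dst M (src e) (dst e) :=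
  Relation.ReflTransGen.single ⟨e, he, rfl, rfl⟩

theorem Rch.mono {M' : ℕ} (h : M ≤ M') {a b : ℕ} (hr : Rch src dst M a b) : Rch src dst M' a b :=
  Relation.ReflTransGen.mono (r := Arc src dst M) (p := Arc src dst M')
    (fun _ _ ⟨e, he, h1⟩ => ⟨e, he.trans_le h, h1⟩) _ _ hr

theorem Rch.congr {src' dst' : ℕ → ℕ} (hs : ∀ e < M, src' e = src e) (hd : ∀ e < M, dst' e = dst e)
    {a b : ℕ} : Rch src' dst' M a b ↔ Rch src dst M a b := by
  have : Arc src' dst' M = Arc src dst M := by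
    funext a b
    apply propext
    constructor
    · rintro ⟨e, he, h1, h2⟩
      exact ⟨e, he, by rw [← hs e he, h1], by rw [← hd e he, h2]⟩
    · rintro ⟨e, he, h1, h2⟩
      exact ⟨e, he, by rw [hs e he, h1], by rw [hd e he, h2]⟩
  simp [Rch, this]

/-- Paths along an additional arc. -/
theorem rch_succ {a b : ℕ} : Rch src dst (M + 1) a b ↔
    Rch src dst M a b ∨ (Rch src dst M a (src M) ∧ Rch src dst M (dst M) b) := by
  constructor
  · intro h
    induction h with
    | refl => exact Or.inl (Rch.refl _)
    | tail _ h ih =>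
      obtain ⟨e, he, rfl, rfl⟩ := h
      rcases Nat.lt_succ_iff_lt_or_eq.1 he with he | rfl
      · rcases ih with ih | ⟨ih, ih'⟩
        · exact Or.inl (ih.trans (Rch.of_arc he))
        · exact Or.inr ⟨ih, ih'.trans (Rch.of_arc he)⟩
      · rcases ih with ih | ⟨ih, _⟩
        · exact Or.inr ⟨ih, Rch.refl _⟩
        · exact Or.inr ⟨ih, Rch.refl _⟩
  · rintro (h | ⟨h, h'⟩)
    · exact h.mono (Nat.le_succ _)
    · exact ((h.mono (Nat.le_succ _)).trans (Rch.of_arc (Nat.lt_succ_self _))).trans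
        (h'.mono (Nat.le_succ _))

/-- A path from the head of the new arc that uses this arc is back at the head afterwards, so the
detour can be cut off. Hence the search for vertices to raise may run over lists that contain the
new arc already. -/
theorem rch_succ_from_dst {b : ℕ} : Rch src dst (M + 1) (dst M) b ↔ Rch src dst M (dst M) b := by
  rw [rch_succ]; tauto

/-- Dually, a path to the tail of the new arc can stop at its first visit there. This transfers the
result of the second backward search to the digraph without the new arc. -/
theorem rch_succ_to_src {a : ℕ} : Rch src dst (M + 1) a (src M) ↔ Rch src dst M a (src M) := by
  rw [rch_succ]; tauto

/-- How an additional arc changes the strongly connected components. -/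
theorem mut_succ {a b : ℕ} : Mut src dst (M + 1) a b ↔ Mut src dst M a b ∨
    ((Rch src dst M (dst M) a ∧ Rch src dst M a (src M)) ∧
      (Rch src dst M (dst M) b ∧ Rch src dst M b (src M))) := by
  constructor
  · rintro ⟨h1, h2⟩
    rw [rch_succ] at h1 h2
    rcases h1 with h1 | ⟨h1, h1'⟩ <;> rcases h2 with h2 | ⟨h2, h2'⟩
    · exact Or.inl ⟨h1, h2⟩
    · exact Or.inr ⟨⟨h2', h1.trans h2⟩, ⟨h2'.trans h1, h2⟩⟩
    · exact Or.inr ⟨⟨h1'.trans h2, h1⟩, ⟨h1', h2.trans h1⟩⟩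
    · exact Or.inr ⟨⟨h2', h1⟩, ⟨h1', h2⟩⟩
  · rintro (⟨h1, h2⟩ | ⟨⟨h1, h2⟩, ⟨h3, h4⟩⟩)
    · exact ⟨h1.mono (Nat.le_succ _), h2.mono (Nat.le_succ _)⟩
    · exact ⟨rch_succ.2 (Or.inr ⟨h2, h3⟩), rch_succ.2 (Or.inr ⟨h4, h1⟩)⟩

theorem Mut.refl (a : ℕ) : Mut src dst M a a := ⟨Rch.refl _, Rch.refl _⟩

/-! ### Levels -/

/-- The levels do not decrease along arcs, and below the level of a vertex every level `k` has at
least `k + 1` arcs, where an arc `e` inside a component counts for the level `l e` at which it was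
when it got there. -/
def LevelOK (src dst : ℕ → ℕ) (V M : ℕ) (lev : ℕ → ℕ) : Prop :=
  (∀ e < M, lev (src e) ≤ lev (dst e)) ∧
  ∃ l : ℕ → ℕ, (∀ e < M, ¬ Rch src dst M (dst e) (src e) → l e = lev (src e)) ∧
    ∀ k u, u < V → k < lev u →
      (∀ x < V, Rch src dst M x u → ¬ Rch src dst M u x → lev x ≤ k) →
      ∃ A : Finset ℕ, k + 1 ≤ A.card ∧
        ∀ e ∈ A, e < M ∧ l e = k ∧ Rch src dst M (dst e) u

theorem Rch.lev_le {lev : ℕ → ℕ} (h : ∀ e < M, lev (src e) ≤ lev (dst e)) {a b : ℕ}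
    (hr : Rch src dst M a b) : lev a ≤ lev b := by
  induction hr with
  | refl => exact le_rfl
  | tail _ h' ih => obtain ⟨e, he, rfl, rfl⟩ := h'; exact ih.trans (h e he)

/-- Among the vertices with a property that reach `u`, one is reached by no further one. -/
theorem exists_first {V : ℕ} (P : ℕ → Prop) {u : ℕ} (hu : u < V) (hP : P u) :
    ∃ x < V, P x ∧ ∀ y < V, P y → Rch src dst M y x → Rch src dst M x y := by
  classical
  let S := (Finset.range V).filter P
  have hS : S.Nonempty := ⟨u, by simp [S, hu, hP]⟩
  -- A vertex of `S` with the fewest ancestors works: an ancestor with the property that is not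
  -- reached back would have strictly fewer.
  let anc : ℕ → Finset ℕ := fun x => (Finset.range V).filter fun y => Rch src dst M y x
  obtain ⟨x, hx, hmin⟩ := S.exists_min_image (fun x => (anc x).card) hS
  simp only [S, Finset.mem_filter, Finset.mem_range] at hx hmin
  refine ⟨x, hx.1, hx.2, fun y hy hPy hyx => ?_⟩
  by_contra hxy
  have : (anc y).card < (anc x).card := by
    apply Finset.card_lt_card
    refine ⟨fun z hz => ?_, fun hsub => ?_⟩
    · simp only [anc, Finset.mem_filter] at hz ⊢
      exact ⟨hz.1, hz.2.trans hyx⟩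
    · have : x ∈ anc y := hsub (by simp [anc, hx.1, Rch.refl])
      simp only [anc, Finset.mem_filter] at this
      exact hxy this.2
  exact absurd (hmin y ⟨hy, hPy⟩) (not_le.2 this)

/-- The levels stay correct if, on the insertion of the arc `M`, some vertices reached from its head
are raised to a level `L` that exceeds the level of its tail only if there are many arcs behind the
tail. -/
theorem LevelOK.insert {V L : ℕ} {lev lev' : ℕ → ℕ} (h : LevelOK src dst V M lev)
    (hs : src M < V) (hle : ∀ y, lev y ≤ lev' y) (hmono : ∀ e < M + 1, lev' (src e) ≤ lev' (dst e))
    (hraise : ∀ y < V, lev' y ≠ lev y → lev' y = L ∧ Rch src dst M (dst M) y)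
    (hL : L ≤ lev (src M) ∨ L = lev (src M) + 1 ∧
      ∃ A : Finset ℕ, lev (src M) + 1 ≤ A.card ∧ ∀ e ∈ A, e < M ∧
        ¬ Rch src dst M (dst e) (src e) ∧ lev (src e) = lev (src M) ∧
        Rch src dst M (dst e) (src M))
    (hsV : ∀ e < M, src e < V) :
    LevelOK src dst V (M + 1) lev' := by
  classical
  obtain ⟨hm, l, hl, hk⟩ := h
  refine ⟨hmono, fun e => if Rch src dst (M + 1) (dst e) (src e) then l e else lev' (src e),
    fun e _ hr => if_neg hr, fun k u hu hku hmin => ?_⟩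
  -- An arc counted for level `k` stays counted. If it now lies inside a component, its value is
  -- kept. If not, its old value was the level of its tail, which cannot have dropped, and which is
  -- still at most `k` because the tail is a strict ancestor of `u`.
  have key : ∀ e < M, l e = k → Rch src dst (M + 1) (dst e) u →
      (if Rch src dst (M + 1) (dst e) (src e) then l e else lev' (src e)) = k := by
    intro e he hle' hru
    split_ifs with hr
    · exact hle'
    · have hdead : ¬ Rch src dst M (dst e) (src e) := fun h => hr (h.mono (Nat.le_succ _))
      have h1 := hl e he hdead
      have h2 : lev' (src e) ≤ k := by
        refine hmin _ (hsV e he) ((Rch.of_arc (he.trans (Nat.lt_succ_self _))).trans hru) ?_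
        exact fun h => hr (hru.trans h)
      have h3 := hle (src e)
      omega
  -- If `u` or something behind it was above level `k` before, the old arcs behind a first such
  -- vertex serve. Otherwise `u` has just been raised while the tail of the new arc, now behind `u`,
  -- is at most at `k`. This forces `L = k + 1`, and the arcs found by the interrupted search serve.
  by_cases hc : ∃ x < V, Rch src dst (M + 1) x u ∧ k < lev x
  · obtain ⟨x₁, hx₁, hx₁u, hx₁k⟩ := hc
    obtain ⟨x, hx, ⟨hxu, hxk⟩, hfirst⟩ := exists_first (src := src) (dst := dst) (M := M)
      (fun x => Rch src dst (M + 1) x u ∧ k < lev x) hx₁ ⟨hx₁u, hx₁k⟩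
    obtain ⟨A, hA, hA'⟩ := hk k x hx hxk (fun y hy hyx hxy => by
      by_contra hlt
      exact hxy (hfirst y hy ⟨(hyx.mono (Nat.le_succ _)).trans hxu, not_le.1 hlt⟩ hyx))
    refine ⟨A, hA, fun e he => ?_⟩
    obtain ⟨h1, h2, h3⟩ := hA' e he
    have h4 := (h3.mono (Nat.le_succ _)).trans hxu
    exact ⟨h1.trans (Nat.lt_succ_self _), key e h1 h2 h4, h4⟩
  · push Not at hc
    have h1 := hc u hu (Rch.refl _)
    obtain ⟨h2, h3⟩ := hraise u hu (by omega)
    have h4 : Rch src dst (M + 1) (src M) u :=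
      (Rch.of_arc (Nat.lt_succ_self _)).trans (h3.mono (Nat.le_succ _))
    have h5 := hc _ hs h4
    rcases hL with hL | ⟨hL, A, hA, hA'⟩
    · omega
    · have h6 : lev (src M) = k := by omega
      refine ⟨A, by omega, fun e he => ?_⟩
      obtain ⟨h7, h8, h9, h10⟩ := hA' e he
      have h11 := (h10.mono (Nat.le_succ _)).trans h4
      exact ⟨h7.trans (Nat.lt_succ_self _), key e h7 (by rw [hl e h7 h8]; omega) h11, h11⟩

/-- There are only about `√(2 * M)` levels. -/
theorem LevelOK.bound {V : ℕ} {lev : ℕ → ℕ} (h : LevelOK src dst V M lev) {u : ℕ} (hu : u < V) :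
    lev u * (lev u + 1) ≤ 2 * M := by
  classical
  obtain ⟨hm, l, hl, hk⟩ := h
  -- The invariant is applied to a first vertex above level `k`, whose strict ancestors are all at
  -- most at `k`. For different `k` the arcs found are disjoint, being fibres of `l`.
  have h1 : ∀ k < lev u, k + 1 ≤ ((Finset.range M).filter fun e => l e = k).card := by
    intro k hku
    obtain ⟨x, hx, hxk, hfirst⟩ := exists_first (src := src) (dst := dst) (M := M)
      (fun x => k < lev x) hu hku
    obtain ⟨A, hA, hA'⟩ := hk k x hx hxk (fun y hy hyx hxy => by
      by_contra hlt
      exact hxy (hfirst y hy (not_le.1 hlt) hyx))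
    refine hA.trans (Finset.card_le_card fun e he => ?_)
    obtain ⟨h1, h2, -⟩ := hA' e he
    simp [h1, h2]
  have h2 : ∑ k ∈ Finset.range (lev u), (k + 1) ≤ M := by
    calc _ ≤ ∑ k ∈ Finset.range (lev u), ((Finset.range M).filter fun e => l e = k).card :=
          Finset.sum_le_sum fun k hk => h1 k (Finset.mem_range.1 hk)
      _ ≤ (Finset.range M).card := by
          rw [← Finset.card_biUnion]
          · exact Finset.card_le_card (Finset.biUnion_subset.2 fun k _ => Finset.filter_subset _ _)
          · intro a _ b _ hab
            exact Finset.disjoint_filter.2 fun e _ h1 h2 => hab (h1.symm.trans h2)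
      _ = M := Finset.card_range M
  have h3 : ∀ n : ℕ, 2 * ∑ k ∈ Finset.range n, (k + 1) = n * (n + 1) := by
    intro n
    induction n with
    | zero => simp
    | succ n ih => rw [Finset.sum_range_succ, mul_add, ih]; ring
  rw [← h3]; omega

theorem LevelOK.le_sqrt {V : ℕ} {lev : ℕ → ℕ} (h : LevelOK src dst V M lev) {u : ℕ} (hu : u < V) :
    lev u ≤ Nat.sqrt (2 * M) := by
  rw [Nat.le_sqrt]
  have := h.bound hu
  nlinarith

/-- New isolated vertices get level `0`. -/
theorem LevelOK.extend {V V' : ℕ} {lev lev' : ℕ → ℕ} (h : LevelOK src dst V M lev) (hV : V ≤ V')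
    (hs : ∀ e < M, src e < V ∧ dst e < V) (h1 : ∀ x < V, lev' x = lev x)
    (h2 : ∀ x < V', V ≤ x → lev' x = 0) : LevelOK src dst V' M lev' := by
  obtain ⟨hm, l, hl, hk⟩ := h
  refine ⟨fun e he => ?_, l, fun e he hr => ?_, fun k u hu hku hmin => ?_⟩
  · rw [h1 _ (hs e he).1, h1 _ (hs e he).2]; exact hm e he
  · rw [h1 _ (hs e he).1]; exact hl e he hr
  · have hu' : u < V := by
      by_contra hc
      rw [h2 u hu (not_lt.1 hc)] at hku
      omega
    rw [h1 u hu'] at hku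
    exact hk k u hu' hku fun x hx => by rw [← h1 x hx]; exact hmin x (hx.trans_le hV)

end Graph

/-! ### Reasoning about programs -/

/-- The program halts; `Q t m'` holds for the number `t` of steps and the final memory `m'`. -/
def Runs (W : ℕ) (c : Cmd) (m : Mem) (Q : ℕ → Mem → Prop) : Prop :=
  ∃ t m', Exec W c m t m' ∧ Q t m'

theorem Runs.mono {W : ℕ} {c : Cmd} {m : Mem} {Q Q' : ℕ → Mem → Prop} (h : Runs W c m Q)
    (hQ : ∀ t m', Q t m' → Q' t m') : Runs W c m Q' := by
  obtain ⟨t, m', h1, h2⟩ := h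
  exact ⟨t, m', h1, hQ _ _ h2⟩

theorem Runs.seq {W : ℕ} {c d : Cmd} {m : Mem} {Q : ℕ → Mem → Prop}
    (h : Runs W c m fun t m' => Runs W d m' fun t' => Q (t + t')) : Runs W (.seq c d) m Q := by
  obtain ⟨t, m', h1, t', m'', h2, h3⟩ := h
  exact ⟨_, _, .seq _ _ _ _ _ _ _ h1 h2, h3⟩

theorem Runs.skip {W : ℕ} {m : Mem} {Q : ℕ → Mem → Prop} (h : Q 1 m) : Runs W .skip m Q :=
  ⟨_, _, .skip _, h⟩

theorem Runs.ite {W : ℕ} {e : Expr} {c d : Cmd} {m : Mem} {Q : ℕ → Mem → Prop}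
    (h1 : e.eval m ≠ 0 → Runs W c m fun t => Q (e.cost + 1 + t))
    (h2 : e.eval m = 0 → Runs W d m fun t => Q (e.cost + 1 + t)) : Runs W (.ite e c d) m Q := by
  by_cases he : e.eval m = 0
  · obtain ⟨t, m', h3, h4⟩ := h2 he
    exact ⟨_, _, .ite_false _ _ _ _ _ _ he h3, h4⟩
  · obtain ⟨t, m', h3, h4⟩ := h1 he
    exact ⟨_, _, .ite_true _ _ _ _ _ _ he h3, h4⟩

/-- The rule for loops: `J k t m` is an invariant for the memory `m` after `t` steps, with a
variant `k`. -/
theorem Runs.loop {W : ℕ} {e : Expr} {c : Cmd} {Q : ℕ → Mem → Prop} (J : ℕ → ℕ → Mem → Prop)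
    (hstep : ∀ k t m, J k t m → e.eval m ≠ 0 →
      Runs W c m fun t' m' => ∃ k' < k, J k' (t + (e.cost + 1 + t')) m')
    (hdone : ∀ k t m, J k t m → e.eval m = 0 → Q (t + (e.cost + 1)) m)
    {k : ℕ} {m : Mem} (h : J k 0 m) : Runs W (.loop e c) m Q := by
  suffices H : ∀ k t m, J k t m → Runs W (.loop e c) m fun t' => Q (t + t') by
    simpa using H k 0 m h
  intro k
  induction k using Nat.strong_induction_on with
  | _ k ih =>
    intro t m hJ
    by_cases he : e.eval m = 0
    · exact ⟨_, _, .loop_done _ _ _ he, hdone k t m hJ he⟩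
    · obtain ⟨t', m', h1, k', hk', h2⟩ := hstep k t m hJ he
      obtain ⟨t'', m'', h3, h4⟩ := ih k' hk' _ m' h2
      refine ⟨_, _, .loop_step _ _ _ _ _ _ _ he h1 h3, ?_⟩
      convert h4 using 1
      omega

/-- An upper bound for the running time of a program without loops. -/
def maxCost : Cmd → ℕ
  | .skip => 1
  | .store _ i e => i.cost + e.cost + 1
  | .seq c d => maxCost c + maxCost d
  | .ite e c d => e.cost + 1 + (maxCost c + maxCost d)
  | .loop _ _ => 0

/-- The weakest precondition of a program without loops. -/
def wp (W : ℕ) : Cmd → (Mem → Prop) → Mem → Prop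
  | .skip, Q, m => Q m
  | .store a i e, Q, m => (i.eval m ≤ W ∧ e.eval m ≤ W) ∧ Q (m.write a (i.eval m) (e.eval m))
  | .seq c d, Q, m => wp W c (wp W d Q) m
  | .ite e c d, Q, m => (e.eval m ≠ 0 → wp W c Q m) ∧ (e.eval m = 0 → wp W d Q m)
  | .loop _ _, _, _ => False

theorem wp.mono {W : ℕ} {c : Cmd} {Q Q' : Mem → Prop} {m : Mem} (h : wp W c Q m)
    (hQ : ∀ m', Q m' → Q' m') : wp W c Q' m := by
  induction c generalizing Q Q' m with
  | skip => exact hQ _ h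
  | store a i e => exact ⟨h.1, hQ _ h.2⟩
  | seq c d ihc ihd => exact ihc h fun m' h' => ihd h' hQ
  | ite e c d ihc ihd => exact ⟨fun he => ihc (h.1 he) hQ, fun he => ihd (h.2 he) hQ⟩
  | loop => exact h.elim

theorem wp.runs {W : ℕ} {c : Cmd} {Q : Mem → Prop} {m : Mem} (h : wp W c Q m) :
    Runs W c m fun t m' => t ≤ maxCost c ∧ Q m' := by
  induction c generalizing Q m with
  | skip => exact ⟨_, _, .skip _, le_rfl, h⟩
  | store a i e => exact ⟨_, _, .store _ _ _ _ h.1.1 h.1.2, le_rfl, h.2⟩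
  | seq c d ihc ihd =>
    obtain ⟨t, m', h1, h2, h3⟩ := ihc h
    obtain ⟨t', m'', h4, h5, h6⟩ := ihd h3
    exact ⟨_, _, .seq _ _ _ _ _ _ _ h1 h4, add_le_add h2 h5, h6⟩
  | ite e c d ihc ihd =>
    by_cases he : e.eval m = 0
    · obtain ⟨t, m', h1, h2, h3⟩ := ihd (h.2 he)
      exact ⟨_, _, .ite_false _ _ _ _ _ _ he h1, by simp only [maxCost]; omega, h3⟩
    · obtain ⟨t, m', h1, h2, h3⟩ := ihc (h.1 he)
      exact ⟨_, _, .ite_true _ _ _ _ _ _ he h1, by simp only [maxCost]; omega, h3⟩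
  | loop => exact h.elim

/-- For a loop-free beginning only an upper bound of the time is tracked, so the continuation has to
accept every `t` below that bound. -/
theorem wp.seq_runs {W : ℕ} {c d : Cmd} {m : Mem} {Q : ℕ → Mem → Prop}
    (h : wp W c (fun m' => Runs W d m' fun t' m'' => ∀ t ≤ maxCost c, Q (t + t') m'') m) :
    Runs W (.seq c d) m Q := by
  obtain ⟨t, m', h1, h2, t', m'', h3, h4⟩ := h.runs
  exact ⟨_, _, .seq _ _ _ _ _ _ _ h1 h3, h4 t h2⟩

/-- Execute the programs of a list one after the other. -/
def seqs : List Cmd → Cmd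
  | [] => .skip
  | c :: l => .seq c (seqs l)

/-- Loops over the states of the Büchi automaton are unrolled when the program is written down,
since their number is a constant. The invariant is indexed by the part of the list already executed.
-/
theorem wp_seqs {W : ℕ} {ι : Type*} (f : ι → Cmd) (I : List ι → Mem → Prop) (l : List ι)
    (hstep : ∀ l₁ i m, l₁ ++ [i] <+: l → I l₁ m → wp W (f i) (I (l₁ ++ [i])) m) {m : Mem}
    (h : I [] m) : wp W (seqs (l.map f)) (I l) m := by
  suffices H : ∀ l₂ l₁ m, l₁ ++ l₂ = l → I l₁ m → wp W (seqs (l₂.map f)) (I l) m from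
    H l [] m rfl h
  intro l₂
  induction l₂ with
  | nil => intro l₁ m hl hm; simp only [List.append_nil] at hl; subst hl; exact hm
  | cons i l₂ ih =>
    intro l₁ m hl hm
    exact (hstep l₁ i m ⟨l₂, by simp [← hl]⟩ hm).mono fun m' hm' => ih _ m' (by simp [← hl]) hm'

/-! ### Memory -/

theorem write_same (m : Mem) (a i v : ℕ) : (m.write a i v) a = Function.update (m a) i v := by
  funext j
  simp [Mem.write, Function.update_apply]

theorem write_other (m : Mem) {a a' : ℕ} (i v : ℕ) (h : a' ≠ a) : (m.write a i v) a' = m a' := by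
  funext j
  simp [Mem.write, h]

/-- Injective numbering of pairs. -/
def pr (i j : ℕ) : ℕ := (i + j) * (i + j) + i

/-- Since `(i + j)² ≤ pr i j < (i + j + 1)²`, the code determines `i + j`, and then `i`. -/
theorem pr_inj {i j i' j' : ℕ} : pr i j = pr i' j' ↔ i = i' ∧ j = j' := by
  constructor
  · intro h
    unfold pr at h
    have h1 : i + j = i' + j' := by
      rcases lt_trichotomy (i + j) (i' + j') with hlt | heq | hlt
      · nlinarith
      · exact heq
      · nlinarith
    rw [h1] at h
    omega
  · rintro ⟨rfl, rfl⟩; rfl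

/-- The word at index `0` of an array. -/
def var (a : ℕ) : Expr := .read a (.const 0)

/-- The expression for `pr`. -/
def prE (e f : Expr) : Expr := .add (.mul (.add e f) (.add e f)) e

theorem eval_prE (m : Mem) (e f : Expr) : (prE e f).eval m = pr (e.eval m) (f.eval m) := rfl

theorem eval_var (m : Mem) (a : ℕ) : (var a).eval m = m a 0 := rfl

/-- Negation. -/
def notE (e : Expr) : Expr := .eq e (.const 0)

theorem eval_notE (m : Mem) (e : Expr) : (notE e).eval m = if e.eval m = 0 then 1 else 0 := rfl

/-- Assignment to a variable. -/
def setv (a : ℕ) (e : Expr) : Cmd := .store a (.const 0) e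

theorem wp_setv {W a : ℕ} {e : Expr} {Q : Mem → Prop} {m : Mem} :
    wp W (setv a e) Q m ↔ e.eval m ≤ W ∧ Q (m.write a 0 (e.eval m)) := by
  simp [setv, wp, Expr.eval]

/-- The list stored in row `c` of the array `a`, with the length stored in array `d`. -/
def lst (d a : ℕ → ℕ) (c : ℕ) : List ℕ := (List.range (d c)).map fun i => a (pr c i)

theorem mem_lst {d a : ℕ → ℕ} {c x : ℕ} : x ∈ lst d a c ↔ ∃ i < d c, a (pr c i) = x := by
  simp [lst]

theorem length_lst {d a : ℕ → ℕ} {c : ℕ} : (lst d a c).length = d c := by simp [lst]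

theorem lst_inj {d a : ℕ → ℕ} {c : ℕ} (h : (lst d a c).Nodup) {i j : ℕ} (hi : i < d c) (hj : j < d c)
    (he : a (pr c i) = a (pr c j)) : i = j := by
  unfold lst at h
  exact List.inj_on_of_nodup_map h (by simpa using hi) (by simpa using hj) he

theorem lst_push (d a : ℕ → ℕ) (c x c' : ℕ) :
    lst (Function.update d c (d c + 1)) (Function.update a (pr c (d c)) x) c' =
      if c' = c then lst d a c ++ [x] else lst d a c' := by
  unfold lst
  split_ifs with h
  · subst h
    simp only [Function.update_self, List.range_succ, List.map_append, List.map_cons, List.map_nil]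
    congr 1
    apply List.map_congr_left
    intro i hi
    rw [List.mem_range] at hi
    rw [Function.update_of_ne]
    rw [Ne, pr_inj]
    omega
  · rw [Function.update_of_ne h]
    apply List.map_congr_left
    intro i _
    rw [Function.update_of_ne]
    rw [Ne, pr_inj]
    tauto

/-- A list is emptied by one store, whatever its length. Searches and the raising of levels depend
on this. -/
theorem lst_reset (d a : ℕ → ℕ) (c c' : ℕ) :
    lst (Function.update d c 0) a c' = if c' = c then [] else lst d a c' := by
  unfold lst
  split_ifs with h
  · subst h; simp
  · rw [Function.update_of_ne h]

/-- Append the value of `x` to the list in row `c`. -/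
def push (d a : ℕ) (c x : Expr) : Cmd :=
  .seq (.store a (prE c (.read d c)) x) (.store d c (.add (.read d c) (.const 1)))

/-- The word size suffices for indices up to `Z` and for pairs with sum up to `Z`. -/
structure Fits (W Z : ℕ) : Prop where
  lin : ∀ z, z ≤ 4 * Z → z ≤ W
  quad : ∀ i j, i + j ≤ Z → pr i j ≤ W

theorem fits_of_le {W Z : ℕ} (h : Z * Z + 4 * Z ≤ W) : Fits W Z := by
  refine ⟨fun z hz => by nlinarith, fun i j hij => ?_⟩
  unfold pr
  have := Nat.mul_le_mul hij hij
  omega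

/-! ### Traversal of lists of lists -/

notation "QUE" => 40
notation "QT" => 41
notation "QH" => 42
notation "IDX" => 43
notation "CUR" => 44
notation "ELM" => 45

/-- For the entries `c` of the queue, as long as `g` holds: for `i < bd`, execute `body` for the
`i`-th element `el` of the list of `c`. The body may extend the queue. -/
def sweep (g bd el : Expr) (body : Cmd) : Cmd :=
  .loop (.mul (.lt (var QH) (var QT)) g)
    (.seq (setv CUR (.read QUE (var QH)))
      (.ite (.lt (var IDX) bd)
        (.seq (setv ELM el) (.seq body (setv IDX (.add (var IDX) (.const 1)))))
        (.seq (setv QH (.add (var QH) (.const 1))) (setv IDX (.const 0)))))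

/-- The factor in the running time of `sweep`. -/
def sweepCost (g bd el : Expr) (body : Cmd) : ℕ :=
  (Expr.mul (.lt (var QH) (var QT)) g).cost + 1 +
    maxCost (.seq (setv CUR (.read QUE (var QH)))
      (.ite (.lt (var IDX) bd)
        (.seq (setv ELM el) (.seq body (setv IDX (.add (var IDX) (.const 1)))))
        (.seq (setv QH (.add (var QH) (.const 1))) (setv IDX (.const 0)))))

theorem length_le_of_nodup {l : List ℕ} {V : ℕ} (h : l.Nodup) (hV : ∀ c ∈ l, c < V) :
    l.length ≤ V := by
  rw [← List.toFinset_card_of_nodup h, ← Finset.card_range V]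
  exact Finset.card_le_card fun c hc => by simpa using hV c (by simpa using hc)

theorem card_pairs_le {dn : Finset (ℕ × ℕ)} {V : ℕ} {dg : ℕ → ℕ}
    (h : ∀ p ∈ dn, p.1 < V ∧ p.2 < dg p.1) : dn.card ≤ ∑ c ∈ Finset.range V, dg c := by
  calc dn.card ≤ ((Finset.range V).sigma fun c => Finset.range (dg c)).card := by
        refine Finset.card_le_card_of_injOn (fun p => ⟨p.1, p.2⟩) (fun p hp => ?_) ?_
        · simpa using h p hp
        · rintro ⟨a, b⟩ _ ⟨c, d⟩ _ h
          simpa using h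
    _ = _ := by simp

/-- The common rule for all searches through lists of lists. The invariant `I qs dn` sees the queue
`qs` so far and the set `dn` of pairs (entry, position) already treated, but not the loop variables.
Every pair is treated at most once, so the time is linear in pairs plus entries. At the end either
everything queued has been treated or the guard `g` has failed. -/
theorem sweep_runs {W V : ℕ} {g bd el : Expr} {body : Cmd} (dg : ℕ → ℕ) (elf : ℕ → ℕ → ℕ)
    (I : List ℕ → Finset (ℕ × ℕ) → Mem → Prop)
    (hins : ∀ qs dn m m', (∀ a, a ≠ QH → a ≠ IDX → a ≠ CUR → a ≠ ELM → m' a = m a) →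
      I qs dn m → I qs dn m')
    (hq : ∀ qs dn m, I qs dn m → qs.Nodup ∧ (∀ c ∈ qs, c < V) ∧ m QT 0 = qs.length ∧
      ∀ (k : ℕ) (c : ℕ), qs[k]? = some c → m QUE k = c)
    (hbd : ∀ qs dn m c, I qs dn m → c ∈ qs → m CUR 0 = c → bd.eval m = dg c)
    (hel : ∀ qs dn m c i, I qs dn m → c ∈ qs → m CUR 0 = c → m IDX 0 = i → i < dg c →
      el.eval m = elf c i)
    (hg : ∀ m m' : Mem, (∀ a, a ≠ QH → a ≠ IDX → a ≠ CUR → a ≠ ELM → m' a = m a) →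
      g.eval m' = g.eval m)
    (hW : V < W)
    (hdgW : ∀ qs dn m c, I qs dn m → c ∈ qs → dg c < W ∧ ∀ i < dg c, elf c i ≤ W)
    (hbody : ∀ qs dn m c i, I qs dn m → c ∈ qs → i < dg c → (c, i) ∉ dn → m CUR 0 = c →
      m ELM 0 = elf c i → g.eval m ≠ 0 →
      (∀ p ∈ dn, p.1 ∈ qs ∧ p.2 < dg p.1) →
      wp W body (fun m' => m' QH = m QH ∧ m' IDX = m IDX ∧
        ∃ ext, I (qs ++ ext) (insert (c, i) dn) m') m)
    {qs₀ : List ℕ} {m : Mem} (h0 : I qs₀ ∅ m) (hqh : m QH 0 = 0) (hidx : m IDX 0 = 0) :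
    Runs W (sweep g bd el body) m fun t m' => ∃ qs dn, I qs dn m' ∧
      t ≤ sweepCost g bd el body * (dn.card + qs.length + 1) ∧
      (∀ p ∈ dn, p.1 ∈ qs ∧ p.2 < dg p.1) ∧
      ((m' QH 0 = m' QT 0 ∧ ∀ c ∈ qs, ∀ i < dg c, (c, i) ∈ dn) ∨
        (m' QH 0 < m' QT 0 ∧ g.eval m' = 0)) := by
  set κ := sweepCost g bd el body with hκ
  let B := V + ∑ c ∈ Finset.range V, dg c
  -- Here `h` and `i` are the values of `QH` and `IDX`; the treated pairs are all those of the
  -- entries before `h` and the first `i` of the entry `h`. The quantity `dn.card + h` grows by one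
  -- in each iteration and is at most `B`, so it serves both as a clock and, subtracted from `B`, as
  -- a variant.
  let St : List ℕ → Finset (ℕ × ℕ) → ℕ → ℕ → Mem → Prop := fun qs dn h i m =>
    I qs dn m ∧ m QH 0 = h ∧ m IDX 0 = i ∧ h ≤ qs.length ∧ (h = qs.length → i = 0) ∧
    (∀ c, qs[h]? = some c → i ≤ dg c) ∧
    ∀ c j, (c, j) ∈ dn ↔ (∃ k < h, qs[k]? = some c ∧ j < dg c) ∨ (qs[h]? = some c ∧ j < i)
  have hdn : ∀ qs dn h i m, St qs dn h i m → ∀ p ∈ dn, p.1 ∈ qs ∧ p.2 < dg p.1 := by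
    rintro qs dn h i m ⟨_, _, _, _, _, h4, h5⟩ ⟨c, j⟩ hp
    rcases (h5 c j).1 hp with ⟨k, _, hk, hj⟩ | ⟨hk, hj⟩
    · exact ⟨List.mem_of_getElem? hk, hj⟩
    · exact ⟨List.mem_of_getElem? hk, hj.trans_le (h4 c hk)⟩
  have hB : ∀ qs dn h i m, St qs dn h i m → dn.card + h ≤ B := by
    intro qs dn h i m hS
    obtain ⟨hnd, hV, -, -⟩ := hq _ _ _ hS.1
    have h1 := length_le_of_nodup hnd hV
    have h2 := card_pairs_le (V := V) (dg := dg) fun p hp =>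
      ⟨hV _ (hdn _ _ _ _ _ hS p hp).1, (hdn _ _ _ _ _ hS p hp).2⟩
    have := hS.2.2.2.1
    simp only [B]; omega
  refine Runs.loop (fun k t m => ∃ qs dn h i, St qs dn h i m ∧ t ≤ κ * (dn.card + h) ∧
    k = B - (dn.card + h)) ?_ ?_ (k := B)
    ⟨qs₀, ∅, 0, 0, ⟨h0, hqh, hidx, Nat.zero_le _, fun _ => rfl, fun _ _ => Nat.zero_le _,
      fun c j => by simp⟩, by simp, by simp⟩
  · rintro k t m ⟨qs, dn, h, i, hS, ht, rfl⟩ hg0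
    obtain ⟨hI, hh, hi, hle, hend, hdeg, hmem⟩ := id hS
    obtain ⟨hnd, hV, hqt, hque⟩ := hq _ _ _ hI
    simp only [Expr.eval, eval_var, ne_eq, mul_eq_zero, not_or, hh, hqt] at hg0
    have hlt : h < qs.length := by
      by_contra hc; simp [hc] at hg0
    have hg' : g.eval m ≠ 0 := hg0.2
    obtain ⟨c, hc⟩ : ∃ c, qs[h]? = some c := ⟨qs[h], by simp [hlt]⟩
    have hcq : c ∈ qs := List.mem_of_getElem? hc
    have hcV := hV c hcq
    set m₁ := m.write CUR 0 c with hm₁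
    have hI₁ : I qs dn m₁ := hins _ _ _ _ (fun a _ _ h3 _ => write_other m 0 c h3) hI
    have hcur : m₁ CUR 0 = c := by simp [hm₁, write_same]
    have hbd₁ := hbd _ _ _ _ hI₁ hcq hcur
    have e1 : m₁ IDX 0 = i := by rw [hm₁, write_other _ _ _ (by decide), hi]
    have e2 : m₁ QH 0 = h := by rw [hm₁, write_other _ _ _ (by decide), hh]
    suffices hwp : wp W (.seq (setv CUR (.read QUE (var QH)))
      (.ite (.lt (var IDX) bd)
        (.seq (setv ELM el) (.seq body (setv IDX (.add (var IDX) (.const 1)))))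
        (.seq (setv QH (.add (var QH) (.const 1))) (setv IDX (.const 0)))))
        (fun m' => ∃ qs' dn' h' i', St qs' dn' h' i' m' ∧ dn'.card + h' = dn.card + h + 1) m by
      refine hwp.runs.mono fun t' m' ⟨ht', qs', dn', h', i', hS', hcard⟩ => ?_
      have hb := hB _ _ _ _ _ hS'
      refine ⟨B - (dn'.card + h'), by omega, qs', dn', h', i', hS', ?_, rfl⟩
      rw [hcard]
      refine le_trans (b := κ * (dn.card + h) + κ) ?_ (le_of_eq (by ring))
      refine add_le_add ht ?_
      rw [hκ, sweepCost]; omega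
    have hread : (Expr.read QUE (var QH)).eval m = c := by
      simp only [Expr.eval, eval_var, hh]; exact hque h c hc
    show wp W (setv CUR _) _ m
    rw [wp_setv, hread]
    refine ⟨hcV.le.trans hW.le, ?_⟩
    rw [← hm₁]
    refine ⟨fun he => ?_, fun he => ?_⟩
    · simp only [Expr.eval, eval_var, e1, hbd₁] at he
      have hilt : i < dg c := by by_contra hc; simp [hc] at he
      have hel₁ := hel _ _ _ _ _ hI₁ hcq hcur e1 hilt
      show wp W (setv ELM _) _ m₁
      rw [wp_setv, hel₁]
      refine ⟨(hdgW _ _ _ _ hI hcq).2 i hilt, ?_⟩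
      set m₂ := m₁.write ELM 0 (elf c i) with hm₂
      have hI₂ : I qs dn m₂ := hins _ _ _ _ (fun a _ _ _ h4 => write_other m₁ 0 _ h4) hI₁
      have hni : (c, i) ∉ dn := by
        rw [hmem]
        rintro (⟨k, hk, hkc, _⟩ | ⟨_, h⟩)
        · have hkl : k < qs.length := hk.trans hlt
          rw [List.getElem?_eq_getElem hkl] at hkc
          rw [List.getElem?_eq_getElem hlt] at hc
          have := (List.Nodup.getElem_inj_iff hnd).1
            ((Option.some.inj hkc).trans (Option.some.inj hc).symm)
          omega
        · omega
      have f1 : m₂ CUR 0 = c := by rw [hm₂, write_other _ _ _ (by decide), hcur]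
      have f2 : m₂ ELM 0 = elf c i := by simp [hm₂, write_same]
      have f3 : m₂ IDX 0 = i := by rw [hm₂, write_other _ _ _ (by decide), e1]
      have f4 : m₂ QH 0 = h := by rw [hm₂, write_other _ _ _ (by decide), e2]
      have hgg : g.eval m₂ ≠ 0 := by
        rw [hg m m₂ fun a _ _ h3 h4 => by rw [hm₂, write_other _ _ _ h4, hm₁, write_other _ _ _ h3]]
        exact hg'
      refine (hbody _ _ _ _ _ hI₂ hcq hilt hni f1 f2 hgg (hdn _ _ _ _ _ hS)).mono ?_
      rintro m₃ ⟨g1, g2, ext, hI₃⟩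
      show wp W (setv IDX _) _ m₃
      rw [wp_setv]
      have hev : (Expr.add (var IDX) (.const 1)).eval m₃ = i + 1 := by
        simp [Expr.eval, eval_var, g2, f3]
      rw [hev]
      refine ⟨Nat.succ_le_of_lt (hilt.trans (hdgW _ _ _ _ hI hcq).1), qs ++ ext, insert (c, i) dn, h, i + 1,
        ⟨hins _ _ _ _ (fun a _ h2 _ _ => write_other m₃ 0 _ h2) hI₃, ?_, ?_, ?_, ?_, ?_, ?_⟩, ?_⟩
      · rw [write_other _ _ _ (by decide), g1, f4]
      · simp [write_same]
      · simp; omega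
      · simp; omega
      · intro c' hc'
        rw [List.getElem?_append_left hlt, hc] at hc'
        cases hc'; exact hilt
      · intro c' j
        rw [Finset.mem_insert, hmem, List.getElem?_append_left hlt, hc]
        have : ∀ k < h, (qs ++ ext)[k]? = qs[k]? := fun k hk =>
          List.getElem?_append_left (hk.trans hlt)
        constructor
        · rintro (h | ⟨k, hk, h1, h2⟩ | ⟨h1, h2⟩)
          · cases h; exact Or.inr ⟨rfl, Nat.lt_succ_self _⟩
          · exact Or.inl ⟨k, hk, by rw [this k hk]; exact h1, h2⟩
          · exact Or.inr ⟨h1, h2.trans (Nat.lt_succ_self _)⟩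
        · rintro (⟨k, hk, h1, h2⟩ | ⟨h1, h2⟩)
          · rw [this k hk] at h1; exact Or.inr (Or.inl ⟨k, hk, h1, h2⟩)
          · rcases Nat.lt_succ_iff_lt_or_eq.1 h2 with h2 | rfl
            · exact Or.inr (Or.inr ⟨h1, h2⟩)
            · cases h1; exact Or.inl rfl
      · rw [Finset.card_insert_of_notMem hni]; omega
    · simp only [Expr.eval, eval_var, e1, hbd₁] at he
      have hige : dg c ≤ i := by by_contra hc; simp [not_le.1 hc] at he
      have hieq : i = dg c := le_antisymm (hdeg c hc) hige
      show wp W (setv QH _) _ m₁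
      rw [wp_setv]
      have hev : (Expr.add (var QH) (.const 1)).eval m₁ = h + 1 := by
        simp [Expr.eval, eval_var, e2]
      rw [hev]
      have hlen := length_le_of_nodup hnd hV
      refine ⟨by omega, ?_⟩
      rw [wp_setv]
      refine ⟨Nat.zero_le _, qs, dn, h + 1, 0, ⟨?_, ?_, ?_, hlt, fun _ => rfl,
        fun _ _ => Nat.zero_le _, ?_⟩, ?_⟩
      · exact hins _ _ _ _ (fun a h1 h2 _ _ => by
          rw [write_other _ _ _ h2, write_other _ _ _ h1]) hI₁
      · rw [write_other _ _ _ (by decide)]; simp [write_same]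
      · simp [write_same, Expr.eval]
      · intro c' j
        rw [hmem]
        constructor
        · rintro (⟨k, hk, h1, h2⟩ | ⟨h1, h2⟩)
          · exact Or.inl ⟨k, hk.trans (Nat.lt_succ_self _), h1, h2⟩
          · rw [hc] at h1; cases h1
            exact Or.inl ⟨h, Nat.lt_succ_self _, hc, by omega⟩
        · rintro (⟨k, hk, h1, h2⟩ | ⟨_, h2⟩)
          · rcases Nat.lt_succ_iff_lt_or_eq.1 hk with hk | rfl
            · exact Or.inl ⟨k, hk, h1, h2⟩
            · rw [hc] at h1; cases h1; exact Or.inr ⟨hc, by omega⟩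
          · omega
      · omega
  · rintro k t m ⟨qs, dn, h, i, hS, ht, rfl⟩ hg0
    obtain ⟨hI, hh, hi, hle, hend, hdeg, hmem⟩ := id hS
    obtain ⟨hnd, hV, hqt, hque⟩ := hq _ _ _ hI
    refine ⟨qs, dn, hI, ?_, hdn _ _ _ _ _ hS, ?_⟩
    · have h1 : (Expr.mul (.lt (var QH) (var QT)) g).cost + 1 ≤ κ := by
        rw [hκ, sweepCost]; omega
      calc t + _ ≤ κ * (dn.card + h) + κ := add_le_add ht h1
        _ = κ * (dn.card + h + 1) := by ring
        _ ≤ _ := Nat.mul_le_mul_left _ (by omega)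
    · simp only [Expr.eval, eval_var, mul_eq_zero, hh, hqt] at hg0 ⊢
      rcases hle.lt_or_eq with hlt | heq
      · right
        rw [if_pos hlt] at hg0
        exact ⟨hlt, by simpa using hg0⟩
      · left
        refine ⟨heq, fun c hc i hi => (hmem c i).2 (Or.inl ?_)⟩
        obtain ⟨k, hk, rfl⟩ := List.getElem_of_mem hc
        exact ⟨k, by omega, by simp [hk], hi⟩

-- Memory layout of the component structure, and the backward search.

notation "SRC" => 3
notation "DST" => 4
notation "COMP" => 5
notation "LEV" => 20
notation "ODEG" => 21
notation "OLST" => 22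
notation "IDEG" => 23
notation "ILST" => 24
notation "SIZE" => 25
notation "MLST" => 26
notation "ACC" => 27
notation "DONE" => 28
notation "MARK" => 29
notation "STAMP" => 30
notation "CNT" => 31
notation "LIM" => 32
notation "TDEG" => 33
notation "TLST" => 34
notation "BUF" => 35
notation "TMP" => 36
notation "BIG" => 37
notation "NEWLEV" => 38
notation "CPL" => 39
notation "TAIL" => 46
notation "HEAD" => 47

/-- Agreement of two memories outside the arrays of a list. -/
def Frame (S : List ℕ) (m m' : Mem) : Prop := ∀ a, a ∉ S → m' a = m a

theorem Frame.refl (S : List ℕ) (m : Mem) : Frame S m m := fun _ _ => rfl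

theorem Frame.trans {S S' S'' : List ℕ} {m m' m'' : Mem} (h : Frame S m m') (h' : Frame S' m' m'')
    (hS : S ⊆ S'' := by decide) (hS' : S' ⊆ S'' := by decide) : Frame S'' m m'' := fun a ha => by
  rw [h' a fun h => ha (hS' h), h a fun h => ha (hS h)]

theorem Frame.mono {S S' : List ℕ} {m m' : Mem} (h : Frame S m m')
    (hS : S ⊆ S' := by decide) : Frame S' m m' := fun a ha => h a fun h => ha (hS h)

theorem Frame.write {S : List ℕ} {m m' : Mem} (h : Frame S m m') {a i v : ℕ}
    (ha : a ∈ S := by decide) : Frame S m (m'.write a i v) := fun b hb => by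
  rw [write_other _ _ _ (by rintro rfl; exact hb ha), h b hb]

/-! ### Search against the arcs of one level -/

/-- Visit the component of the source of the current arc and record the arc. -/
def visitBody : Cmd :=
  .seq (setv TMP (.read COMP (.read SRC (var ELM))))
    (.seq (.ite (.lt (.read MARK (var TMP)) (var STAMP))
        (.seq (.store MARK (var TMP) (var STAMP)) (.seq (.store QUE (var QT) (var TMP))
          (.seq (setv QT (.add (var QT) (.const 1))) (.store TDEG (var TMP) (.const 0)))))
        .skip)
      (.seq (push TDEG TLST (var TMP) (var CUR)) (setv CNT (.add (var CNT) (.const 1)))))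

/-- The search loop. -/
def backLoop : Cmd :=
  sweep (.lt (var CNT) (var LIM)) (.read IDEG (var CUR)) (.read ILST (prE (var CUR) (var IDX)))
    visitBody

/-- The factor in the running time of `backLoop`. -/
def backCost : ℕ :=
  2 * sweepCost (.lt (var CNT) (var LIM)) (.read IDEG (var CUR))
    (.read ILST (prE (var CUR) (var IDX))) visitBody

/-- The component of the source of the `i`-th arc that enters the component `c`. -/
def inComp (m : Mem) (c i : ℕ) : ℕ := m COMP (m SRC (m ILST (pr c i)))

/-- The invariant of the search. -/
structure BackInv (m₀ : Mem) (c₀ : ℕ) (Good : ℕ → Prop) (qs : List ℕ) (dn : Finset (ℕ × ℕ))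
    (m : Mem) : Prop where
  frame : Frame [MARK, QUE, QT, CNT, TDEG, TLST, TMP, QH, IDX, CUR, ELM] m₀ m
  nodup : qs.Nodup
  good : ∀ c ∈ qs, Good c
  start : c₀ ∈ qs
  qt : m QT 0 = qs.length
  que : ∀ (k c : ℕ), qs[k]? = some c → m QUE k = c
  mark : ∀ c, m MARK c = m₀ STAMP 0 ↔ c ∈ qs
  mark_le : ∀ c, m MARK c ≤ m₀ STAMP 0
  cnt : m CNT 0 = dn.card
  closed : ∀ p ∈ dn, inComp m₀ p.1 p.2 ∈ qs
  tmp : ∀ x ∈ qs, ∀ c, c ∈ lst (m TDEG) (m TLST) x ↔ ∃ i, (c, i) ∈ dn ∧ inComp m₀ c i = x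
  tsum : ∑ x ∈ qs.toFinset, m TDEG x = dn.card

theorem BackInv.tdeg_le {m₀ : Mem} {c₀ : ℕ} {Good : ℕ → Prop} {qs : List ℕ}
    {dn : Finset (ℕ × ℕ)} {m : Mem} (h : BackInv m₀ c₀ Good qs dn m) {x : ℕ} (hx : x ∈ qs) :
    m TDEG x ≤ dn.card := by
  rw [← h.tsum]
  exact Finset.single_le_sum (f := fun x => m TDEG x) (fun _ _ => Nat.zero_le _) (by simpa using hx)

theorem BackInv.insensitive {m₀ : Mem} {c₀ : ℕ} {Good : ℕ → Prop} {qs : List ℕ}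
    {dn : Finset (ℕ × ℕ)} {m m' : Mem} (h : BackInv m₀ c₀ Good qs dn m)
    (hm : Frame [QH, IDX, CUR, ELM, TMP] m m') : BackInv m₀ c₀ Good qs dn m' := by
  have e1 := hm MARK (by decide)
  have e2 := hm QUE (by decide)
  have e3 := hm QT (by decide)
  have e4 := hm CNT (by decide)
  have e5 := hm TDEG (by decide)
  have e6 := hm TLST (by decide)
  refine ⟨h.frame.trans hm, h.nodup, h.good, h.start, ?_, ?_, ?_, ?_, ?_, h.closed, ?_, ?_⟩
  · rw [e3]; exact h.qt
  · rw [e2]; exact h.que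
  · rw [e1]; exact h.mark
  · rw [e1]; exact h.mark_le
  · rw [e4]; exact h.cnt
  · rw [e5, e6]; exact h.tmp
  · rw [e5]; exact h.tsum

theorem getElem?_snoc {qs : List ℕ} {y k c : ℕ} (h : (qs ++ [y])[k]? = some c) :
    qs[k]? = some c ∨ (k = qs.length ∧ c = y) := by
  rcases lt_trichotomy k qs.length with hk | rfl | hk
  · rw [List.getElem?_append_left hk] at h; exact Or.inl h
  · simp at h; exact Or.inr ⟨rfl, h.symm⟩
  · rw [List.getElem?_eq_none (by simp; omega)] at h; cases h

theorem lt_of_getElem? {qs : List ℕ} {k c : ℕ} (h : qs[k]? = some c) : k < qs.length :=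
  (List.getElem?_eq_some_iff.1 h).1

theorem que_snoc {m : ℕ → ℕ} {qs : List ℕ} {y : ℕ} (h : ∀ (k c : ℕ), qs[k]? = some c → m k = c)
    {k c : ℕ} (hk : (qs ++ [y])[k]? = some c) : Function.update m qs.length y k = c := by
  rcases getElem?_snoc hk with hk | ⟨rfl, rfl⟩
  · rw [Function.update_of_ne (lt_of_getElem? hk).ne, h k c hk]
  · simp

/-- A new component rightly starts with an empty record: by `closed`, the sources of all traversed
arcs are in the queue, so none of these arcs leaves it. -/
theorem BackInv.visit {m₀ : Mem} {c₀ : ℕ} {Good : ℕ → Prop} {qs : List ℕ}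
    {dn : Finset (ℕ × ℕ)} {m : Mem} (h : BackInv m₀ c₀ Good qs dn m) {y : ℕ} (hy : y ∉ qs)
    (hg : Good y) :
    BackInv m₀ c₀ Good (qs ++ [y]) dn ((((m.write MARK y (m₀ STAMP 0)).write QUE qs.length y).write
      QT 0 (qs.length + 1)).write TDEG y 0) := by
  refine ⟨h.frame.write.write.write.write, ?_, ?_, ?_, ?_, ?_, ?_, ?_, ?_, ?_, ?_, ?_⟩
  · exact List.nodup_append.2 ⟨h.nodup, by simp, by
      intro a ha b hb; simp at hb; subst hb; rintro rfl; exact hy ha⟩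
  · intro c hc
    rcases List.mem_append.1 hc with hc | hc
    · exact h.good c hc
    · simp at hc; subst hc; exact hg
  · exact List.mem_append_left _ h.start
  · simp [write_same, write_other]
  · intro k c hk
    simp only [write_same, write_other, ne_eq, Nat.reduceEqDiff,
      not_false_eq_true]
    exact que_snoc h.que hk
  · intro c
    simp only [write_same, write_other, ne_eq, Nat.reduceEqDiff,
      not_false_eq_true, Function.update_apply, List.mem_append, List.mem_singleton, ← h.mark]
    split_ifs with h1 <;> simp [h1]
  · intro c
    simp only [write_same, write_other, ne_eq, Nat.reduceEqDiff,
      not_false_eq_true, Function.update_apply]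
    split_ifs with h1
    · exact le_rfl
    · exact h.mark_le c
  · simp [write_other, h.cnt]
  · exact fun p hp => List.mem_append_left _ (h.closed p hp)
  · intro x hx c
    simp only [write_same, write_other, ne_eq, Nat.reduceEqDiff,
      not_false_eq_true, lst_reset]
    split_ifs with h1
    · subst h1
      simp only [List.not_mem_nil, false_iff, not_exists, not_and]
      intro i hi he
      exact hy (he ▸ h.closed _ hi)
    · rw [h.tmp x (by simpa [h1] using hx)]
  · simp only [write_same, List.toFinset_append]
    rw [← h.tsum, Finset.sum_union (by simpa using hy)]
    simp only [List.toFinset_cons, List.toFinset_nil, insert_empty_eq, Finset.sum_singleton,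
      Function.update_self, add_zero]
    refine Finset.sum_congr rfl fun x hx => ?_
    rw [Function.update_of_ne (by rintro rfl; exact hy (by simpa using hx))]
    simp [write_other]

/-- The arc is traversed backwards but recorded at its source. The records thus form the forward
adjacency lists of the explored part, ready for the forward search. -/
theorem BackInv.record {m₀ : Mem} {c₀ : ℕ} {Good : ℕ → Prop} {qs : List ℕ}
    {dn : Finset (ℕ × ℕ)} {m : Mem} (h : BackInv m₀ c₀ Good qs dn m) {c i : ℕ}
    (hy : inComp m₀ c i ∈ qs) (hci : (c, i) ∉ dn) :
    BackInv m₀ c₀ Good qs (insert (c, i) dn) (((m.write TLST (pr (inComp m₀ c i)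
      (m TDEG (inComp m₀ c i))) c).write TDEG (inComp m₀ c i)
      (m TDEG (inComp m₀ c i) + 1)).write CNT 0 (dn.card + 1)) := by
  set y := inComp m₀ c i with hyd
  refine ⟨h.frame.write.write.write, h.nodup, h.good, h.start, ?_, ?_, ?_, ?_, ?_, ?_, ?_, ?_⟩
  · simp [write_other, h.qt]
  · simpa [write_other] using h.que
  · simpa [write_other] using h.mark
  · simpa [write_other] using h.mark_le
  · simp [write_same, Finset.card_insert_of_notMem hci]
  · intro p hp
    rcases Finset.mem_insert.1 hp with rfl | hp
    · exact hy
    · exact h.closed p hp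
  · intro x hx c'
    simp only [write_same, write_other, ne_eq, Nat.reduceEqDiff,
      not_false_eq_true, lst_push, Finset.mem_insert, Prod.mk.injEq]
    split_ifs with h1
    · subst h1
      rw [List.mem_append, h.tmp y hy, List.mem_singleton]
      constructor
      · rintro (⟨j, h2, h3⟩ | rfl)
        · exact ⟨j, Or.inr h2, h3⟩
        · exact ⟨i, Or.inl ⟨rfl, rfl⟩, hyd.symm⟩
      · rintro ⟨j, ⟨rfl, rfl⟩ | h2, h3⟩
        · exact Or.inr rfl
        · exact Or.inl ⟨j, h2, h3⟩
    · rw [h.tmp x hx]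
      constructor
      · rintro ⟨j, h2, h3⟩
        exact ⟨j, Or.inr h2, h3⟩
      · rintro ⟨j, ⟨rfl, rfl⟩ | h2, h3⟩
        · exact absurd h3.symm h1
        · exact ⟨j, h2, h3⟩
  · rw [Finset.card_insert_of_notMem hci, ← h.tsum]
    simp only [write_same, write_other, ne_eq, Nat.reduceEqDiff,
      not_false_eq_true]
    have hy' : y ∈ qs.toFinset := by simpa using hy
    rw [Finset.sum_update_of_mem hy', ← Finset.add_sum_erase _ _ hy', Finset.sdiff_singleton_eq_erase]
    ring

/-- Different pairs name different arcs, so any set that contains the traversed arcs bounds the cost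
of the search. In the second search this will be a small set already paid for. -/
theorem BackInv.card_le {m₀ : Mem} {c₀ : ℕ} {Good : ℕ → Prop} {qs : List ℕ}
    {dn : Finset (ℕ × ℕ)} {m : Mem} (h : BackInv m₀ c₀ Good qs dn m) {A : Finset ℕ}
    (hinj : ∀ c c' i i', Good c → Good c' → i < m₀ IDEG c → i' < m₀ IDEG c' →
      m₀ ILST (pr c i) = m₀ ILST (pr c' i') → c = c' ∧ i = i')
    (hM : ∀ p ∈ dn, m₀ ILST (pr p.1 p.2) ∈ A) (hdn : ∀ p ∈ dn, p.1 ∈ qs ∧ p.2 < m₀ IDEG p.1) :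
    dn.card ≤ A.card := by
  refine Finset.card_le_card_of_injOn (fun p => m₀ ILST (pr p.1 p.2)) hM ?_
  rintro ⟨c, i⟩ hp ⟨c', i'⟩ hp' he
  have h1 := hdn _ hp
  have h2 := hdn _ hp'
  obtain ⟨rfl, rfl⟩ := hinj c c' i i' (h.good _ h1.1) (h.good _ h2.1) h1.2 h2.2 he
  rfl

/-- Each traversed arc queues at most one component, so the time is linear in the number of
traversed arcs alone, without a term for the components. -/
theorem backLoop_runs {W V M : ℕ} (hW : Fits W (V + M + 2)) {m₀ : Mem} {c₀ : ℕ} {Good : ℕ → Prop}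
    (hlt : ∀ c, Good c → c < V) (hM : ∀ c i, Good c → i < m₀ IDEG c → m₀ ILST (pr c i) < M)
    (hstep : ∀ c i, Good c → i < m₀ IDEG c → Good (inComp m₀ c i))
    (hinj : ∀ c c' i i', Good c → Good c' → i < m₀ IDEG c → i' < m₀ IDEG c' →
      m₀ ILST (pr c i) = m₀ ILST (pr c' i') → c = c' ∧ i = i')
    (hσ : m₀ STAMP 0 ≤ W) (h0 : BackInv m₀ c₀ Good [c₀] ∅ m₀) (hqh : m₀ QH 0 = 0)
    (hidx : m₀ IDX 0 = 0) :
    Runs W backLoop m₀ fun t m => ∃ qs dn, BackInv m₀ c₀ Good qs dn m ∧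
      t ≤ backCost * (dn.card + 1) ∧ qs.length ≤ dn.card + 1 ∧
      (∀ p ∈ dn, p.1 ∈ qs ∧ p.2 < m₀ IDEG p.1) ∧
      dn.card ≤ M ∧ dn.card ≤ m₀ LIM 0 ∧
      ((m QH 0 = m QT 0 ∧ ∀ c ∈ qs, ∀ i < m₀ IDEG c, (c, i) ∈ dn) ∨
        (m QH 0 < m QT 0 ∧ m₀ LIM 0 ≤ dn.card)) := by
  have hcard : ∀ qs dn m, BackInv m₀ c₀ Good qs dn m →
      (∀ p ∈ dn, p.1 ∈ qs ∧ p.2 < m₀ IDEG p.1) → dn.card ≤ M := by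
    intro qs dn m h hdn
    simpa using h.card_le (A := Finset.range M) hinj (fun p hp => Finset.mem_range.2
      (hM _ _ (h.good _ (hdn p hp).1) (hdn p hp).2)) hdn
  have hdeg : ∀ c, Good c → m₀ IDEG c ≤ M := by
    intro c hc
    have : (Finset.range (m₀ IDEG c)).card ≤ (Finset.range M).card :=
      Finset.card_le_card_of_injOn (fun i => m₀ ILST (pr c i))
        (fun i hi => by simpa using hM c i hc (by simpa using hi))
        (fun i hi j hj he => (hinj c c i j hc hc (by simpa using hi) (by simpa using hj) he).2)
    simpa using this
  refine (sweep_runs (V := V) (m₀ IDEG) (fun c i => m₀ ILST (pr c i))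
    (fun qs dn m => BackInv m₀ c₀ Good qs dn m ∧ qs.length ≤ dn.card + 1 ∧
      dn.card ≤ m₀ LIM 0)
    ?_ ?_ ?_ ?_ ?_ ?_ ?_ ?_ (qs₀ := [c₀]) ⟨h0, by simp, by simp⟩ hqh hidx).mono ?_
  · rintro qs dn m m' hm ⟨h, hl⟩
    exact ⟨h.insensitive fun a ha => hm a (by rintro rfl; simp at ha) (by rintro rfl; simp at ha)
      (by rintro rfl; simp at ha) (by rintro rfl; simp at ha), hl⟩
  · rintro qs dn m ⟨h, -⟩
    exact ⟨h.nodup, fun c hc => hlt c (h.good c hc), h.qt, h.que⟩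
  · rintro qs dn m c ⟨h, -⟩ _ hc
    simp only [Expr.eval, eval_var, hc, h.frame IDEG (by decide)]
  · rintro qs dn m c i ⟨h, -⟩ _ hc hi _
    simp only [Expr.eval, eval_var, eval_prE, hc, hi, h.frame ILST (by decide)]
  · intro m m' hm
    show (if m' CNT 0 < m' LIM 0 then 1 else 0) = if m CNT 0 < m LIM 0 then 1 else 0
    have e1 := hm CNT (by decide) (by decide) (by decide) (by decide)
    have e2 := hm LIM (by decide) (by decide) (by decide) (by decide)
    rw [e1, e2]
  · have := hW.lin (V + 1) (by omega); omega
  · rintro qs dn m c ⟨h, -⟩ hc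
    have h1 := hdeg c (h.good c hc)
    refine ⟨by have := hW.lin (M + 1) (by omega); omega, fun i hi => ?_⟩
    have h2 := hM c i (h.good c hc) hi
    exact hW.lin _ (by omega)
  · rintro qs dn m c i ⟨h, hl, -⟩ hc hi hci hcur helm hg hdn
    have hG := h.good c hc
    have hlim : dn.card < m₀ LIM 0 := by
      simp only [Expr.eval, eval_var, h.cnt, h.frame LIM (by decide)] at hg
      by_contra hc
      simp [hc] at hg
    have hM' := hcard _ _ _ h hdn
    have hgy := hstep c i hG hi
    have hyV := hlt _ hgy
    have hy : (Expr.read COMP (.read SRC (var ELM))).eval m = inComp m₀ c i := by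
      simp only [Expr.eval, eval_var, helm, h.frame COMP (by decide), h.frame SRC (by decide),
        inComp]
    show wp W (setv TMP _) _ m
    rw [wp_setv, hy]
    set y := inComp m₀ c i with hyd
    refine ⟨hW.lin _ (by omega), ?_⟩
    have hrest : ∀ qs' m', BackInv m₀ c₀ Good qs' dn m' → y ∈ qs' → qs'.length ≤ dn.card + 2 →
        m' TMP 0 = y → m' CUR 0 = c → m' QH = m QH → m' IDX = m IDX → (∃ ext, qs' = qs ++ ext) →
        wp W (.seq (push TDEG TLST (var TMP) (var CUR)) (setv CNT (.add (var CNT) (.const 1))))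
          (fun m' => m' QH = m QH ∧ m' IDX = m IDX ∧ ∃ ext,
            BackInv m₀ c₀ Good (qs ++ ext) (insert (c, i) dn) m' ∧
              (qs ++ ext).length ≤ (insert (c, i) dn).card + 1 ∧
              (insert (c, i) dn).card ≤ m₀ LIM 0) m' := by
      rintro qs' m' h' hy' hl' htmp hcur' hqh' hidx' ⟨ext, rfl⟩
      have hrec := h'.record (c := c) (i := i) hy' hci
      have ht := h'.tdeg_le hy'
      have hcV := hlt c hG
      simp only [push, wp, wp_setv, Expr.eval, eval_prE, eval_var, htmp, hcur']
      simp only [write_other, ne_eq, Nat.reduceEqDiff, not_false_eq_true, htmp, h'.cnt,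
        hqh', hidx', true_and]
      refine ⟨⟨hW.quad _ _ (by omega), hW.lin _ (by omega)⟩, ⟨hW.lin _ (by omega),
        hW.lin _ (by omega)⟩, hW.lin _ (by omega), ext, hrec, ?_⟩
      rw [Finset.card_insert_of_notMem hci]
      omega
    -- Each search has a larger stamp than all earlier ones, so old marks mean "not visited" and
    -- never have to be erased.
    have hmark : m MARK y < m₀ STAMP 0 ↔ y ∉ qs := by
      rw [← h.mark]; have := h.mark_le y; omega
    have hlen := length_le_of_nodup h.nodup fun c hc => hlt c (h.good c hc)
    have h1 : BackInv m₀ c₀ Good qs dn (m.write TMP 0 y) :=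
      h.insensitive ((Frame.refl _ _).write)
    have hst : m STAMP 0 = m₀ STAMP 0 := by rw [h.frame STAMP (by decide)]
    refine ⟨fun hlt' => ?_, fun hge => ?_⟩
    · simp only [Expr.eval, eval_var, write_same, write_other, ne_eq, Nat.reduceEqDiff,
        not_false_eq_true, Function.update_self, hst] at hlt'
      have hyq : y ∉ qs := by rw [← hmark]; by_contra hc; simp [hc] at hlt'
      have h2 := h1.visit hyq hgy
      simp only [wp, wp_setv, Expr.eval, eval_var, write_same, write_other, ne_eq,
        Nat.reduceEqDiff, not_false_eq_true, Function.update_self, hst, h.qt]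
      refine ⟨⟨hW.lin _ (by omega), hσ⟩, ⟨hW.lin _ (by omega), hW.lin _ (by omega)⟩,
        hW.lin _ (by omega), ⟨hW.lin _ (by omega), Nat.zero_le _⟩, ?_⟩
      refine hrest _ _ h2 (by simp) (by simp; omega) ?_ ?_ ?_ ?_ ⟨_, rfl⟩
      · simp [write_same, write_other]
      · simp [write_other, hcur]
      · simp [write_other]
      · simp [write_other]
    · simp only [Expr.eval, eval_var, write_same, write_other, ne_eq, Nat.reduceEqDiff,
        not_false_eq_true, Function.update_self, hst] at hge
      have hyq : y ∈ qs := by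
        by_contra hc; rw [← hmark] at hc; simp [hc] at hge
      refine hrest _ _ h1 hyq (by omega) ?_ ?_ ?_ ?_ ⟨[], by simp⟩
      · simp [write_same]
      · simp [write_other, hcur]
      · simp [write_other]
      · simp [write_other]
  · rintro t m ⟨qs, dn, ⟨h, hl, hlim⟩, ht, hdn, hend⟩
    refine ⟨qs, dn, h, ht.trans ?_, hl, hdn, hcard _ _ _ h hdn, hlim, hend.imp id fun ⟨h1, h2⟩ => ⟨h1, ?_⟩⟩
    · rw [backCost, mul_comm 2, mul_assoc]
      exact Nat.mul_le_mul_left _ (by omega)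
    · simp only [Expr.eval, eval_var, h.cnt, h.frame LIM (by decide)] at h2
      by_contra hc
      simp [not_le.1 hc] at h2

/-- The data on which the search relies: component names, the lists of the arcs of one level that
enter a component, and the marks. -/
structure BackPre (V N : ℕ) (m : Mem) : Prop where
  ends : ∀ e < N, m SRC e < V ∧ m DST e < V
  compLt : ∀ x < V, m COMP x < V
  comp : ∀ x < V, ∀ y < V, m COMP x = m COMP y → Rch (m SRC) (m DST) N x y
  inNodup : ∀ x < V, (lst (m IDEG) (m ILST) (m COMP x)).Nodup
  inn : ∀ x < V, ∀ e, e ∈ lst (m IDEG) (m ILST) (m COMP x) ↔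
    e < N ∧ m COMP (m DST e) = m COMP x ∧ m COMP (m SRC e) ≠ m COMP x ∧
      m LEV (m SRC e) = m LEV (m DST e)
  lev : ∀ e < N, m LEV (m SRC e) ≤ m LEV (m DST e)
  mark : ∀ c, m MARK c ≤ m STAMP 0

/-- Search against the arcs of one level, from the component of `TAIL`. -/
def searchBack : Cmd :=
  .seq (.seq (setv STAMP (.add (var STAMP) (.const 1)))
    (.seq (.store QUE (.const 0) (.read COMP (var TAIL)))
    (.seq (setv QT (.const 1)) (.seq (setv QH (.const 0)) (.seq (setv IDX (.const 0))
    (.seq (setv CNT (.const 0)) (.seq (.store MARK (var QUE) (var STAMP))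
      (.store TDEG (var QUE) (.const 0)))))))))
    backLoop

/-- The component `c` contains a vertex of the level of `v` that reaches `v`. -/
def Behind (V N : ℕ) (m : Mem) (v c : ℕ) : Prop :=
  ∃ x < V, m COMP x = c ∧ Rch (m SRC) (m DST) N x v ∧ m LEV x = m LEV v

/-- A path to `v` from a vertex of its level never leaves this level. So an exhausted queue means
that all vertices of this level that reach `v` have been found. An interrupted search has traversed
`LIM` arcs, all between different components, of the level of `v` and with heads that reach `v`:
just the witnesses that `LevelOK.insert` asks for. -/
theorem searchBack_runs {W V N : ℕ} (hW : Fits W (V + N + 2)) {m : Mem} {v : ℕ}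
    (h : BackPre V N m) (hv : v < V) (hTAIL : m TAIL 0 = v) (hσ : m STAMP 0 + 1 ≤ W) :
    Runs W searchBack m fun t m' => ∃ m₀ qs dn,
      Frame [STAMP, MARK, QUE, QT, CNT, TDEG, QH, IDX] m m₀ ∧
      m₀ STAMP 0 = m STAMP 0 + 1 ∧
      BackInv m₀ (m COMP v) (Behind V N m v) qs dn m' ∧
      t ≤ (backCost + 100) * (dn.card + 1) ∧ qs.length ≤ dn.card + 1 ∧
      (∀ p ∈ dn, p.1 ∈ qs ∧ p.2 < m IDEG p.1) ∧
      dn.card ≤ N ∧ dn.card ≤ m LIM 0 ∧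
      (∀ A : Finset ℕ, (∀ p ∈ dn, m ILST (pr p.1 p.2) ∈ A) → dn.card ≤ A.card) ∧
      (∃ A : Finset ℕ, A.card = dn.card ∧
        (∀ e, e ∈ A ↔ ∃ p ∈ dn, m ILST (pr p.1 p.2) = e) ∧
        ∀ e ∈ A, e < N ∧ m COMP (m DST e) ≠ m COMP (m SRC e) ∧
          m LEV (m SRC e) = m LEV v ∧ Rch (m SRC) (m DST) N (m DST e) v) ∧
      ((m' QH 0 = m' QT 0 ∧ (∀ c ∈ qs, ∀ i < m IDEG c, (c, i) ∈ dn) ∧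
          ∀ x < V, Rch (m SRC) (m DST) N x v → m LEV x = m LEV v → m COMP x ∈ qs) ∨
        (m' QH 0 < m' QT 0 ∧ m LIM 0 ≤ dn.card)) := by
  classical
  have hcv := h.compLt v hv
  refine wp.seq_runs ?_
  simp only [wp, wp_setv, Expr.eval, eval_var, write_same, write_other, ne_eq, Nat.reduceEqDiff,
    not_false_eq_true, Function.update_self, hTAIL]
  refine ⟨hσ, ⟨Nat.zero_le _, hW.lin _ (by omega)⟩, hW.lin _ (by omega), Nat.zero_le _,
    Nat.zero_le _, Nat.zero_le _, ⟨hW.lin _ (by omega), hσ⟩, ⟨hW.lin _ (by omega), Nat.zero_le _⟩, ?_⟩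
  set m₀ : Mem := ((((((((m.write STAMP 0 (m STAMP 0 + 1)).write QUE 0 (m COMP v)).write QT 0 1).write
    QH 0 0).write IDX 0 0).write CNT 0 0).write MARK (m COMP v) (m STAMP 0 + 1)).write TDEG
      (m COMP v) 0) with hm₀
  have hfr : Frame [STAMP, MARK, QUE, QT, CNT, TDEG, QH, IDX] m m₀ :=
    (Frame.refl _ _).write.write.write.write.write.write.write.write
  have e1 : m₀ SRC = m SRC := hfr _ (by decide)
  have e2 : m₀ IDEG = m IDEG := hfr _ (by decide)
  have e3 : m₀ ILST = m ILST := hfr _ (by decide)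
  have e4 : m₀ COMP = m COMP := hfr _ (by decide)
  have e5 : m₀ LIM = m LIM := hfr _ (by decide)
  have eσ : m₀ STAMP 0 = m STAMP 0 + 1 := by simp [hm₀, write_same, write_other]
  -- the arcs in the lists
  have harc : ∀ c i, Behind V N m v c → i < m IDEG c → m ILST (pr c i) < N ∧
      m COMP (m DST (m ILST (pr c i))) = c ∧ m COMP (m SRC (m ILST (pr c i))) ≠ c ∧
      m LEV (m SRC (m ILST (pr c i))) = m LEV v ∧
      Rch (m SRC) (m DST) N (m DST (m ILST (pr c i))) v := by
    rintro c i ⟨x, hx, rfl, hxv, hlx⟩ hi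
    have he : m ILST (pr (m COMP x) i) ∈ lst (m IDEG) (m ILST) (m COMP x) := mem_lst.2 ⟨i, hi, rfl⟩
    obtain ⟨h1, h2, h3, h4⟩ := (h.inn x hx _).1 he
    have hd := (h.ends _ h1).2
    -- Mutual reachability forces equal levels, so the arc has the level of the whole component it
    -- enters.
    have hr1 := h.comp _ hd _ hx h2
    have hr2 := h.comp _ hx _ hd h2.symm
    have hl1 := hr1.lev_le h.lev
    have hl2 := hr2.lev_le h.lev
    exact ⟨h1, h2, h3, by omega, hr1.trans hxv⟩
  have hinj : ∀ c c' i i', Behind V N m v c → Behind V N m v c' → i < m IDEG c → i' < m IDEG c' →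
      m ILST (pr c i) = m ILST (pr c' i') → c = c' ∧ i = i' := by
    intro c c' i i' hc hc' hi hi' he
    have h1 := (harc c i hc hi).2.1
    have h2 := (harc c' i' hc' hi').2.1
    have : c = c' := by rw [← h1, he, h2]
    subst this
    obtain ⟨x, hx, rfl, -⟩ := hc
    exact ⟨rfl, lst_inj (h.inNodup x hx) hi hi' he⟩
  have h0 : BackInv m₀ (m COMP v) (Behind V N m v) [m COMP v] ∅ m₀ := by
    refine ⟨Frame.refl _ _, by simp, ?_, by simp, ?_, ?_, ?_, ?_, ?_, by simp, ?_, ?_⟩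
    · intro c hc
      simp only [List.mem_singleton] at hc
      exact ⟨v, hv, hc.symm, Rch.refl _, rfl⟩
    · simp [hm₀, write_same, write_other]
    · intro k c hk
      have : k = 0 := by have := lt_of_getElem? hk; simp at this; omega
      subst this
      simp at hk
      simp [hm₀, write_same, write_other, hk]
    · intro c
      rw [eσ]
      simp only [hm₀, write_same, write_other, ne_eq, Nat.reduceEqDiff, not_false_eq_true,
        Function.update_apply, List.mem_singleton]
      split_ifs with h1
      · simp [h1]
      · have := h.mark c
        constructor
        · intro h; omega
        · intro h; exact absurd h h1
    · intro c
      rw [eσ]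
      simp only [hm₀, write_same, write_other, ne_eq, Nat.reduceEqDiff, not_false_eq_true,
        Function.update_apply]
      split_ifs with h1
      · omega
      · have := h.mark c; omega
    · simp [hm₀, write_same, write_other]
    · intro x hx c
      simp only [List.mem_singleton] at hx
      subst hx
      simp [hm₀, write_same, write_other, lst_reset]
    · simp [hm₀, write_same]
  refine (backLoop_runs (V := V) (M := N) hW (Good := Behind V N m v) ?_ ?_ ?_ ?_ ?_ h0 ?_ ?_).mono ?_
  · rintro c ⟨x, hx, rfl, -⟩; exact h.compLt x hx
  · rw [e2, e3]; exact fun c i hc hi => (harc c i hc hi).1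
  · rw [e2]
    intro c i hc hi
    obtain ⟨h1, h2, h3, h4, h5⟩ := harc c i hc hi
    rw [inComp, e1, e3, e4]
    exact ⟨_, (h.ends _ h1).1, rfl, (Rch.of_arc h1).trans h5, h4⟩
  · rw [e2, e3]; exact hinj
  · rw [eσ]; exact hσ
  · simp [hm₀, write_same, write_other]
  · simp [hm₀, write_same, write_other]
  · rintro t m' ⟨qs, dn, hB, ht, hlen, hdn, hN, hlim, hend⟩ t₁ ht₁
    rw [e2] at hdn hend
    rw [e5] at hlim hend
    have hcl : ∀ c ∈ qs, ∀ i, (c, i) ∈ dn → m COMP (m SRC (m ILST (pr c i))) ∈ qs := by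
      intro c _ i hci
      have := hB.closed _ hci
      rwa [inComp, e1, e3, e4] at this
    refine ⟨m₀, qs, dn, hfr, eσ, hB, ?_, hlen, hdn, hN, hlim, ?_, ?_, ?_⟩
    · have : t₁ ≤ 100 * (dn.card + 1) := by
        refine ht₁.trans ?_
        simp only [maxCost, setv, Expr.cost, var]
        omega
      rw [add_mul]; omega
    · intro A hA
      exact hB.card_le (by rw [e2, e3]; exact hinj) (by rw [e3]; exact hA) (by rw [e2]; exact hdn)
    · refine ⟨dn.image fun p => m ILST (pr p.1 p.2), ?_, by simp, ?_⟩
      · apply Finset.card_image_of_injOn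
        rintro ⟨c, i⟩ hp ⟨c', i'⟩ hp' he
        obtain ⟨rfl, rfl⟩ := hinj c c' i i' (hB.good _ (hdn _ hp).1) (hB.good _ (hdn _ hp').1)
          (hdn _ hp).2 (hdn _ hp').2 he
        rfl
      · intro e he
        obtain ⟨⟨c, i⟩, hp, rfl⟩ := Finset.mem_image.1 he
        obtain ⟨h1, h2, h3, h4, h5⟩ := harc c i (hB.good _ (hdn _ hp).1) (hdn _ hp).2
        exact ⟨h1, by rw [h2]; exact h3.symm, h4, h5⟩
    · refine hend.imp (fun ⟨h1, h2⟩ => ⟨h1, h2, ?_⟩) id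
      intro x hx hxv
      -- Backwards along the path: all levels on it lie between those of its ends, which agree. So
      -- every arc of the path that changes the component is in a list that was traversed
      -- completely.
      induction hxv using Relation.ReflTransGen.head_induction_on with
      | refl => exact fun _ => hB.start
      | head hab hbv ih =>
        rename_i a b
        intro hla
        obtain ⟨e, he, rfl, rfl⟩ := hab
        have hd := (h.ends e he).2
        have h3 := h.lev e he
        have h4 := Rch.lev_le h.lev hbv
        have h5 := ih hd (by omega)
        by_cases hc : m COMP (m SRC e) = m COMP (m DST e)
        · rw [hc]; exact h5
        · have h6 := (h.inn _ hd e).2 ⟨he, rfl, hc, by omega⟩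
          obtain ⟨i, hi, hie⟩ := mem_lst.1 h6
          have h7 := hcl _ h5 i (h2 _ h5 i hi)
          rwa [hie] at h7

/-- The data structure holds the strongly connected components of the digraph with vertices `< V`
and the first `M` arcs, the levels and the lists of incoming arcs refer to the first `L` arcs, and
the lists of outgoing arcs to the first `N` arcs. -/
structure SccInv (acc : ℕ → Prop) (V M L N : ℕ) (m : Mem) : Prop where
  ends : ∀ e < N, m SRC e < V ∧ m DST e < V
  compLt : ∀ x < V, m COMP x < V
  comp : ∀ x < V, ∀ y < V, m COMP x = m COMP y ↔ Mut (m SRC) (m DST) M x y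
  outNodup : ∀ x < V, (lst (m ODEG) (m OLST) x).Nodup
  out : ∀ x < V, ∀ e, e ∈ lst (m ODEG) (m OLST) x ↔ e < N ∧ m SRC e = x
  inNodup : ∀ x < V, (lst (m IDEG) (m ILST) (m COMP x)).Nodup
  inn : ∀ x < V, ∀ e, e ∈ lst (m IDEG) (m ILST) (m COMP x) ↔
    e < L ∧ m COMP (m DST e) = m COMP x ∧ m COMP (m SRC e) ≠ m COMP x ∧
      m LEV (m SRC e) = m LEV (m DST e)
  memNodup : ∀ x < V, (lst (m SIZE) (m MLST) (m COMP x)).Nodup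
  mem : ∀ x < V, ∀ z, z ∈ lst (m SIZE) (m MLST) (m COMP x) ↔ z < V ∧ m COMP z = m COMP x
  accComp : ∀ x < V, m ACC (m COMP x) ≠ 0 ↔ ∃ z < V, m COMP z = m COMP x ∧ acc z
  found : m 1 1 ≠ 0 ↔ ∃ x < V, ∃ y < V, x ≠ y ∧ m COMP x = m COMP y ∧ acc x
  lev : LevelOK (m SRC) (m DST) V L (m LEV)
  mark : ∀ c, m MARK c ≤ m STAMP 0

/-! ### Raising levels -/

/-- Raise the head of the current arc. -/
def raiseBody : Cmd :=
  .seq (setv TMP (.read DST (var ELM)))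
    (.ite (.lt (.read LEV (var TMP)) (var NEWLEV))
      (.seq (.store LEV (var TMP) (var NEWLEV)) (.seq (.store IDEG (.read COMP (var TMP)) (.const 0))
        (.seq (.store QUE (var QT) (var TMP)) (setv QT (.add (var QT) (.const 1))))))
      .skip)

/-- Raise the vertices that are reached from the queue. -/
def raiseLoop : Cmd :=
  sweep (.const 1) (.read ODEG (var CUR)) (.read OLST (prE (var CUR) (var IDX))) raiseBody

/-- Put the current arc into the list of the component of its head if it is an arc of one level. -/
def rebuildBody : Cmd :=
  .seq (setv TMP (.read COMP (.read DST (var ELM))))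
    (.ite (.mul (.eq (.read LEV (.read DST (var ELM))) (var NEWLEV))
        (notE (.eq (.read COMP (.read SRC (var ELM))) (var TMP))))
      (push IDEG ILST (var TMP) (var ELM))
      .skip)

/-- Restore the lists of incoming arcs. -/
def rebuildLoop : Cmd :=
  sweep (.const 1) (.read ODEG (var CUR)) (.read OLST (prE (var CUR) (var IDX))) rebuildBody

/-- Raise all vertices reached from `HEAD` to the level `NEWLEV`. -/
def raiseLevels : Cmd :=
  .seq (.seq (.store LEV (var HEAD) (var NEWLEV))
    (.seq (.store IDEG (.read COMP (var HEAD)) (.const 0))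
    (.seq (.store QUE (.const 0) (var HEAD)) (.seq (setv QT (.const 1)) (.seq (setv QH (.const 0))
      (setv IDX (.const 0)))))))
    (.seq raiseLoop (.seq (.seq (setv QH (.const 0)) (setv IDX (.const 0))) rebuildLoop))

/-- When a vertex is raised, the list of arcs entering its component is emptied on the spot; `ideg`
and `ideg0` say that these are the only lists affected. Levels in `m₀` are those before the whole
operation, so `closed` says that every low head of a treated arc has been queued. -/
structure RaiseInv (m₀ : Mem) (L : ℕ) (Good : ℕ → Prop) (qs : List ℕ) (dn : Finset (ℕ × ℕ))
    (m : Mem) : Prop where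
  frame : Frame [LEV, IDEG, QUE, QT, TMP, QH, IDX, CUR, ELM] m₀ m
  nodup : qs.Nodup
  good : ∀ y ∈ qs, Good y
  qt : m QT 0 = qs.length
  que : ∀ (k c : ℕ), qs[k]? = some c → m QUE k = c
  lev : ∀ y, m LEV y = if y ∈ qs then L else m₀ LEV y
  ideg : ∀ c, (∀ y ∈ qs, m₀ COMP y ≠ c) → m IDEG c = m₀ IDEG c
  ideg0 : ∀ y ∈ qs, m IDEG (m₀ COMP y) = 0
  closed : ∀ p ∈ dn, m₀ LEV (m₀ DST (m₀ OLST (pr p.1 p.2))) < L →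
    m₀ DST (m₀ OLST (pr p.1 p.2)) ∈ qs

theorem RaiseInv.insensitive {m₀ : Mem} {L : ℕ} {Good : ℕ → Prop} {qs : List ℕ}
    {dn : Finset (ℕ × ℕ)} {m m' : Mem} (h : RaiseInv m₀ L Good qs dn m)
    (hm : Frame [QH, IDX, CUR, ELM, TMP] m m') : RaiseInv m₀ L Good qs dn m' := by
  have e1 := hm LEV (by decide)
  have e2 := hm QUE (by decide)
  have e3 := hm QT (by decide)
  have e4 := hm IDEG (by decide)
  exact ⟨h.frame.trans hm, h.nodup, h.good, by rw [e3]; exact h.qt, by rw [e2]; exact h.que,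
    by rw [e1]; exact h.lev, by rw [e4]; exact h.ideg, by rw [e4]; exact h.ideg0, h.closed⟩

theorem nodup_snoc {β : Type*} {qs : List β} {y : β} (h : qs.Nodup) (hy : y ∉ qs) : (qs ++ [y]).Nodup :=
  List.nodup_append.2 ⟨h, by simp, by
    intro a ha b hb; simp at hb; subst hb; rintro rfl; exact hy ha⟩

theorem RaiseInv.raise {m₀ : Mem} {L : ℕ} {Good : ℕ → Prop} {qs : List ℕ}
    {dn : Finset (ℕ × ℕ)} {m : Mem} (h : RaiseInv m₀ L Good qs dn m) {y : ℕ} (hy : y ∉ qs)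
    (hg : Good y) :
    RaiseInv m₀ L Good (qs ++ [y]) dn ((((m.write LEV y L).write IDEG (m₀ COMP y) 0).write
      QUE qs.length y).write QT 0 (qs.length + 1)) := by
  refine ⟨h.frame.write.write.write.write, nodup_snoc h.nodup hy, ?_, ?_, ?_, ?_, ?_, ?_, ?_⟩
  · intro c hc
    rcases List.mem_append.1 hc with hc | hc
    · exact h.good c hc
    · simp at hc; subst hc; exact hg
  · simp [write_same]
  · intro k c hk
    simp only [write_same, write_other, ne_eq, Nat.reduceEqDiff, not_false_eq_true]
    exact que_snoc h.que hk
  · intro z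
    simp only [write_same, write_other, ne_eq, Nat.reduceEqDiff, not_false_eq_true,
      Function.update_apply, List.mem_append, List.mem_singleton, h.lev]
    by_cases h1 : z = y <;> simp [h1]
  · intro c hc
    simp only [write_same, write_other, ne_eq, Nat.reduceEqDiff, not_false_eq_true]
    rw [Function.update_of_ne (hc y (by simp)).symm, h.ideg c fun z hz => hc z (by simp [hz])]
  · intro z hz
    simp only [write_same, write_other, ne_eq, Nat.reduceEqDiff, not_false_eq_true,
      Function.update_apply]
    split_ifs with h1
    · rfl
    · rcases List.mem_append.1 hz with hz | hz
      · exact h.ideg0 z hz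
      · simp at hz; subst hz; exact absurd rfl h1
  · exact fun p hp hl => List.mem_append_left _ (h.closed p hp hl)

theorem frame_of_ne {m m' : Mem} (h : ∀ a, a ≠ QH → a ≠ IDX → a ≠ CUR → a ≠ ELM → m' a = m a) :
    Frame [QH, IDX, CUR, ELM] m m' := fun a ha =>
  h a (by rintro rfl; simp at ha) (by rintro rfl; simp at ha)
    (by rintro rfl; simp at ha) (by rintro rfl; simp at ha)

/-- The outgoing lists of different vertices share no arc. The count on the right is what the
potential can pay when all vertices of `qs` have been raised. -/
theorem card_filter_src {acc : ℕ → Prop} {V M L N : ℕ} {m : Mem} (h : SccInv acc V M L N m)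
    {qs : List ℕ} {dn : Finset (ℕ × ℕ)} (hqs : ∀ c ∈ qs, c < V)
    (hdn : ∀ p ∈ dn, p.1 ∈ qs ∧ p.2 < m ODEG p.1) :
    dn.card ≤ ((Finset.range N).filter fun e => m SRC e ∈ qs).card := by
  refine Finset.card_le_card_of_injOn (fun p => m OLST (pr p.1 p.2)) ?_ ?_
  · rintro ⟨c, i⟩ hp
    obtain ⟨h1, h2⟩ := hdn _ hp
    obtain ⟨h3, h4⟩ := (h.out c (hqs c h1) _).1 (mem_lst.2 ⟨i, h2, rfl⟩)
    simp [h3, h4, h1]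
  · rintro ⟨c, i⟩ hp ⟨c', i'⟩ hp' he
    have h1 := hdn _ hp
    have h2 := hdn _ hp'
    have h3 := ((h.out c (hqs c h1.1) _).1 (mem_lst.2 ⟨i, h1.2, rfl⟩)).2
    have h4 := ((h.out c' (hqs c' h2.1) _).1 (mem_lst.2 ⟨i', h2.2, rfl⟩)).2
    simp only at he
    rw [he, h4] at h3
    subst h3
    have hii := lst_inj (h.outNodup _ (hqs _ h1.1)) h1.2 h2.2 he
    simp only at hii
    rw [hii]

theorem length_le_of_lt {l : List ℕ} {N : ℕ} (h : l.Nodup) (hl : ∀ a ∈ l, a < N) : l.length ≤ N :=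
  length_le_of_nodup h hl

theorem SccInv.odeg_le {acc : ℕ → Prop} {V M L N : ℕ} {m : Mem} (h : SccInv acc V M L N m) {x : ℕ}
    (hx : x < V) : m ODEG x ≤ N := by
  rw [← length_lst (d := m ODEG) (a := m OLST) (c := x)]
  exact length_le_of_lt (h.outNodup x hx) fun a ha => ((h.out x hx a).1 ha).1

/-- The search may stop at vertices that are high enough already: since levels do not decrease along
arcs, a path to a vertex below `L` passes only through vertices below `L`. -/
theorem raiseLoop_runs {W V M : ℕ} {acc : ℕ → Prop} (hW : Fits W (V + M + 2)) {m₀ m : Mem}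
    (h : SccInv acc V M M (M + 1) m₀) {L w : ℕ} (hL : m₀ NEWLEV 0 = L) (hLW : L ≤ W)
    (hdst : m₀ DST M = w)
    (h0 : RaiseInv m₀ L (fun y => y < V ∧ Rch (m₀ SRC) (m₀ DST) M w y ∧ m₀ LEV y < L) [w] ∅ m)
    (hqh : m QH 0 = 0) (hidx : m IDX 0 = 0) :
    Runs W raiseLoop m fun t m' => ∃ qs dn,
      RaiseInv m₀ L (fun y => y < V ∧ Rch (m₀ SRC) (m₀ DST) M w y ∧ m₀ LEV y < L) qs dn m' ∧
      (∀ y, y ∈ qs ↔ y < V ∧ Rch (m₀ SRC) (m₀ DST) M w y ∧ m₀ LEV y < L) ∧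
      t ≤ sweepCost (.const 1) (.read ODEG (var CUR)) (.read OLST (prE (var CUR) (var IDX))) raiseBody
        * (((Finset.range (M + 1)).filter fun e => m₀ SRC e ∈ qs).card + qs.length + 1) := by
  refine (sweep_runs (V := V) (m₀ ODEG) (fun c i => m₀ OLST (pr c i))
    (fun qs dn m => RaiseInv m₀ L
      (fun y => y < V ∧ Rch (m₀ SRC) (m₀ DST) M w y ∧ m₀ LEV y < L) qs dn m ∧ w ∈ qs)
    ?_ ?_ ?_ ?_ ?_ ?_ ?_ ?_ (qs₀ := [w]) ⟨h0, by simp⟩ hqh hidx).mono ?_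
  · rintro qs dn m m' hm ⟨h, hw⟩
    exact ⟨h.insensitive (frame_of_ne hm).mono, hw⟩
  · rintro qs dn m ⟨h, -⟩
    exact ⟨h.nodup, fun c hc => (h.good c hc).1, h.qt, h.que⟩
  · rintro qs dn m c ⟨h, -⟩ _ hc
    simp only [Expr.eval, eval_var, hc, h.frame ODEG (by decide)]
  · rintro qs dn m c i ⟨h, -⟩ _ hc hi _
    simp only [Expr.eval, eval_var, eval_prE, hc, hi, h.frame OLST (by decide)]
  · intro m m' _; rfl
  · have := hW.lin (V + 1) (by omega); omega
  · rintro qs dn m c ⟨h', -⟩ hc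
    have hc' := (h'.good c hc).1
    have h1 := h.odeg_le hc'
    refine ⟨by have := hW.lin (M + 2) (by omega); omega, fun i hi => ?_⟩
    have h2 := ((h.out c hc' _).1 (mem_lst.2 ⟨i, hi, rfl⟩)).1
    exact hW.lin _ (by omega)
  · rintro qs dn m c i ⟨h', hwq⟩ hc hi hci hcur helm - hdn
    obtain ⟨hcV, hcr, hcl⟩ := h'.good c hc
    set e := m₀ OLST (pr c i) with he
    obtain ⟨heM, hes⟩ := (h.out c hcV e).1 (mem_lst.2 ⟨i, hi, rfl⟩)
    have hyV := (h.ends e heM).2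
    set y := m₀ DST e with hyd
    have hy : (Expr.read DST (var ELM)).eval m = y := by
      simp only [Expr.eval, eval_var, helm, h'.frame DST (by decide), hyd]
    show wp W (setv TMP _) _ m
    rw [wp_setv, hy]
    refine ⟨hW.lin _ (by omega), ?_⟩
    have hlen := length_le_of_nodup h'.nodup fun c hc => (h'.good c hc).1
    have h1 := h'.insensitive (m' := m.write TMP 0 y) ((Frame.refl _ _).write)
    have hnl : m NEWLEV 0 = L := by rw [h'.frame NEWLEV (by decide), hL]
    have hco : m COMP = m₀ COMP := h'.frame COMP (by decide)
    have hmark : m LEV y < L ↔ y ∉ qs ∧ m₀ LEV y < L := by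
      rw [h'.lev]; split_ifs with h2 <;> simp [h2]
    -- The outgoing lists contain the new arc, but `w` is its head, so it adds nothing to what `w`
    -- reaches.
    have hyR : Rch (m₀ SRC) (m₀ DST) M w y := by
      have : Rch (m₀ SRC) (m₀ DST) (M + 1) (m₀ DST M) y := by
        rw [hdst]
        refine (hcr.mono (Nat.le_succ _)).trans ?_
        rw [← hes]; exact Rch.of_arc heM
      rwa [rch_succ_from_dst, hdst] at this
    refine ⟨fun hlt' => ?_, fun hge => ?_⟩
    · simp only [Expr.eval, eval_var, write_same, write_other, ne_eq, Nat.reduceEqDiff,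
        not_false_eq_true, Function.update_self, hnl] at hlt'
      have hyq : y ∉ qs ∧ m₀ LEV y < L := by rw [← hmark]; by_contra hc; simp [hc] at hlt'
      have h2 := h1.raise hyq.1 ⟨hyV, hyR, hyq.2⟩
      have hcy := h.compLt y hyV
      simp only [wp, wp_setv, Expr.eval, eval_var, write_same, write_other, ne_eq,
        Nat.reduceEqDiff, not_false_eq_true, Function.update_self, hnl, h'.qt, hco]
      refine ⟨⟨hW.lin _ (by omega), hLW⟩, ⟨hW.lin _ (by omega), Nat.zero_le _⟩,
        ⟨hW.lin _ (by omega), hW.lin _ (by omega)⟩, hW.lin _ (by omega), trivial, trivial, [y], ?_, ?_⟩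
      · refine ⟨h2.frame, h2.nodup, h2.good, h2.qt, h2.que, h2.lev, h2.ideg, h2.ideg0, ?_⟩
        intro p hp hlp
        rcases Finset.mem_insert.1 hp with rfl | hp
        · exact List.mem_append_right _ (List.mem_singleton.2 rfl)
        · exact h2.closed p hp hlp
      · simp [hwq]
    · simp only [Expr.eval, eval_var, write_same, write_other, ne_eq, Nat.reduceEqDiff,
        not_false_eq_true, Function.update_self, hnl] at hge
      have hyq : m₀ LEV y < L → y ∈ qs := by
        intro hl; by_contra hc; rw [if_pos (hmark.2 ⟨hc, hl⟩)] at hge; cases hge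
      refine ⟨by simp [write_other], by simp [write_other], [], ?_, by simpa using hwq⟩
      rw [List.append_nil]
      refine ⟨h1.frame, h1.nodup, h1.good, h1.qt, h1.que, h1.lev, h1.ideg, h1.ideg0, ?_⟩
      intro p hp hlp
      rcases Finset.mem_insert.1 hp with rfl | hp
      · exact hyq hlp
      · exact h1.closed p hp hlp
  · rintro t m' ⟨qs, dn, ⟨h', hwq⟩, ht, hdn, hend⟩
    have hcard := card_filter_src h (fun c hc => (h'.good c hc).1) hdn
    refine ⟨qs, dn, h', fun y => ⟨h'.good y, ?_⟩, ht.trans (Nat.mul_le_mul_left _ (by omega))⟩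
    have hall : ∀ c ∈ qs, ∀ i < m₀ ODEG c, (c, i) ∈ dn := by
      rcases hend with hend | ⟨_, hend⟩
      · exact hend.2
      · simp [Expr.eval] at hend
    rintro ⟨hyV, hyR, hyl⟩
    induction hyR with
    | refl => exact hwq
    | tail _ hab ih =>
      obtain ⟨e, he, rfl, rfl⟩ := hab
      have hs := (h.ends e (by omega)).1
      have hq := ih hs ((h.lev.1 e he).trans_lt hyl)
      obtain ⟨i, hi, hie⟩ := mem_lst.1 ((h.out _ hs e).2 ⟨by omega, rfl⟩)
      have := h'.closed _ (hall _ hq i hi)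
      simp only [hie] at this
      exact this hyl

/-- The invariant of `rebuildLoop`: the arcs of one level of the traversed lists are appended. -/
structure RebInv (V N L : ℕ) (m₀ : Mem) (qs : List ℕ) (dn : Finset (ℕ × ℕ)) (m : Mem) :
    Prop where
  frame : Frame [IDEG, ILST, TMP, QH, IDX, CUR, ELM] m₀ m
  lists : ∀ x < V, ∀ e, e ∈ lst (m IDEG) (m ILST) (m₀ COMP x) ↔
    e ∈ lst (m₀ IDEG) (m₀ ILST) (m₀ COMP x) ∨ ((∃ p ∈ dn, m₀ OLST (pr p.1 p.2) = e) ∧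
      m₀ COMP (m₀ DST e) = m₀ COMP x ∧ m₀ COMP (m₀ SRC e) ≠ m₀ COMP x ∧
      m₀ LEV (m₀ DST e) = L)
  nodup : ∀ x < V, (lst (m IDEG) (m ILST) (m₀ COMP x)).Nodup

theorem RebInv.insensitive {V N L : ℕ} {m₀ : Mem} {qs : List ℕ}
    {dn : Finset (ℕ × ℕ)} {m m' : Mem} (h : RebInv V N L m₀ qs dn m)
    (hm : Frame [QH, IDX, CUR, ELM, TMP] m m') : RebInv V N L m₀ qs dn m' := by
  have e1 := hm IDEG (by decide)
  have e2 := hm ILST (by decide)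
  exact ⟨h.frame.trans hm, by rw [e1, e2]; exact h.lists, by rw [e1, e2]; exact h.nodup⟩

/-- No arc enters a list twice: at the start the lists hold no arc whose tail is in the queue, and
every arc is in the outgoing list of its tail only, and once there. -/
theorem rebuildLoop_runs {W V N : ℕ} (hW : Fits W (V + N + 1)) {m₀ : Mem} {L : ℕ} {qs : List ℕ}
    (hL : m₀ NEWLEV 0 = L) (hends : ∀ e < N, m₀ SRC e < V ∧ m₀ DST e < V)
    (hcomp : ∀ x < V, m₀ COMP x < V) (hqs : qs.Nodup) (hqV : ∀ c ∈ qs, c < V)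
    (hqt : m₀ QT 0 = qs.length) (hque : ∀ (k c : ℕ), qs[k]? = some c → m₀ QUE k = c)
    (hout : ∀ x < V, (lst (m₀ ODEG) (m₀ OLST) x).Nodup ∧
      ∀ e ∈ lst (m₀ ODEG) (m₀ OLST) x, e < N ∧ m₀ SRC e = x)
    (hin : ∀ x < V, (lst (m₀ IDEG) (m₀ ILST) (m₀ COMP x)).Nodup ∧
      ∀ e ∈ lst (m₀ IDEG) (m₀ ILST) (m₀ COMP x), e < N ∧ m₀ SRC e ∉ qs)
    (hqh : m₀ QH 0 = 0) (hidx : m₀ IDX 0 = 0) :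
    Runs W rebuildLoop m₀ fun t m => ∃ dn, RebInv V N L m₀ qs dn m ∧
      (∀ c ∈ qs, ∀ i < m₀ ODEG c, (c, i) ∈ dn) ∧
      (∀ p ∈ dn, p.1 ∈ qs ∧ p.2 < m₀ ODEG p.1) ∧
      t ≤ sweepCost (.const 1) (.read ODEG (var CUR)) (.read OLST (prE (var CUR) (var IDX)))
        rebuildBody * (dn.card + qs.length + 1) := by
  have hdeg : ∀ c < V, m₀ ODEG c ≤ N := by
    intro c hc
    rw [← length_lst (d := m₀ ODEG) (a := m₀ OLST) (c := c)]
    exact length_le_of_lt (hout c hc).1 fun a ha => ((hout c hc).2 a ha).1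
  refine (sweep_runs (V := V) (m₀ ODEG) (fun c i => m₀ OLST (pr c i))
    (fun qs' dn m => RebInv V N L m₀ qs dn m ∧ qs' = qs)
    ?_ ?_ ?_ ?_ ?_ ?_ ?_ ?_ (qs₀ := qs) ⟨⟨Frame.refl _ _, ?_, ?_⟩, rfl⟩ hqh hidx).mono ?_
  · rintro qs' dn m m' hm ⟨h, rfl⟩
    exact ⟨h.insensitive (frame_of_ne hm).mono, rfl⟩
  · rintro qs' dn m ⟨h, rfl⟩
    have e1 := h.frame QT (by decide)
    have e2 := h.frame QUE (by decide)
    exact ⟨hqs, hqV, by rw [e1, hqt], by rw [e2]; exact hque⟩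
  · rintro qs' dn m c ⟨h, -⟩ _ hc
    simp only [Expr.eval, eval_var, hc, h.frame ODEG (by decide)]
  · rintro qs' dn m c i ⟨h, -⟩ _ hc hi _
    simp only [Expr.eval, eval_var, eval_prE, hc, hi, h.frame OLST (by decide)]
  · intro m m' _; rfl
  · have := hW.lin (V + 1) (by omega); omega
  · rintro qs' dn m c ⟨-, rfl⟩ hc
    have hc' := hqV c hc
    have h1 := hdeg c hc'
    refine ⟨by have := hW.lin (N + 1) (by omega); omega, fun i hi => ?_⟩
    have h2 := ((hout c hc').2 _ (mem_lst.2 ⟨i, hi, rfl⟩)).1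
    exact hW.lin _ (by omega)
  · rintro qs' dn m c i ⟨h, rfl⟩ hc hi hci hcur helm - hdn
    have hcV := hqV c hc
    set e := m₀ OLST (pr c i) with he
    obtain ⟨heN, hes⟩ := (hout c hcV).2 e (mem_lst.2 ⟨i, hi, rfl⟩)
    obtain ⟨hsV, hdV⟩ := hends e heN
    have hyV := hcomp _ hdV
    set y := m₀ COMP (m₀ DST e) with hyd
    have e1 : m DST = m₀ DST := h.frame _ (by decide)
    have e2 : m SRC = m₀ SRC := h.frame _ (by decide)
    have e3 : m COMP = m₀ COMP := h.frame _ (by decide)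
    have e4 : m LEV = m₀ LEV := h.frame _ (by decide)
    have hnl : m NEWLEV 0 = L := by rw [h.frame NEWLEV (by decide), hL]
    have hy : (Expr.read COMP (.read DST (var ELM))).eval m = y := by
      simp only [Expr.eval, eval_var, helm, e1, e3, hyd]
    show wp W (setv TMP _) _ m
    rw [wp_setv, hy]
    refine ⟨hW.lin _ (by omega), ?_⟩
    have h1 := h.insensitive (m' := m.write TMP 0 y) ((Frame.refl _ _).write)
    have hnew : ∀ x < V, e ∉ lst (m IDEG) (m ILST) (m₀ COMP x) := by
      intro x hx hmem
      rcases (h.lists x hx e).1 hmem with hmem | ⟨⟨⟨c', i'⟩, hp, hp'⟩, -⟩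
      · exact ((hin x hx).2 e hmem).2 (by rw [hes]; exact hc)
      · have h5 := hdn _ hp
        have h6 := ((hout c' (hqV _ h5.1)).2 _ (mem_lst.2 ⟨i', h5.2, hp'⟩)).2
        rw [hes] at h6
        subst h6
        have h7 := lst_inj (hout c hcV).1 h5.2 hi (by simpa using hp')
        simp only at h7
        subst h7
        exact hci hp
    have hcond : (Expr.mul (.eq (.read LEV (.read DST (var ELM))) (var NEWLEV))
        (notE (.eq (.read COMP (.read SRC (var ELM))) (var TMP)))).eval (m.write TMP 0 y) ≠ 0 ↔
        m₀ LEV (m₀ DST e) = L ∧ m₀ COMP (m₀ SRC e) ≠ y := by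
      simp only [Expr.eval, eval_notE, eval_var, write_same, write_other, ne_eq, Nat.reduceEqDiff,
        not_false_eq_true, Function.update_self, helm, e1, e2, e3, e4, hnl]
      by_cases h1 : m₀ LEV (m₀ DST e) = L <;> by_cases h2 : m₀ COMP (m₀ SRC e) = y <;>
        simp [h1, h2]
    refine ⟨fun hc1 => ?_, fun hc0 => ?_⟩
    · rw [hcond] at hc1
      have hlen : m IDEG y ≤ N := by
        rw [← length_lst (d := m IDEG) (a := m ILST) (c := y)]
        refine length_le_of_lt (h.nodup _ hdV) fun a ha => ?_
        rcases (h.lists _ hdV a).1 ha with ha | ⟨⟨p, hp, hp'⟩, -⟩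
        · exact ((hin _ hdV).2 a ha).1
        · have h5 := hdn _ hp
          exact ((hout _ (hqV _ h5.1)).2 _ (mem_lst.2 ⟨_, h5.2, hp'⟩)).1
      simp only [push, wp, Expr.eval, eval_prE, eval_var, write_same, write_other, ne_eq,
        Nat.reduceEqDiff, not_false_eq_true, Function.update_self, helm]
      refine ⟨⟨hW.quad _ _ (by omega), hW.lin _ (by omega)⟩, ⟨hW.lin _ (by omega),
        hW.lin _ (by omega)⟩, trivial, trivial, [], ⟨h1.frame.write.write, ?_, ?_⟩, by simp⟩
      · intro x hx a
        simp only [write_same, write_other, ne_eq, Nat.reduceEqDiff, not_false_eq_true, lst_push]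
        simp only [Finset.mem_insert, exists_eq_or_imp]
        split_ifs with h5
        · rw [List.mem_append, List.mem_singleton, h.lists _ hdV a, h5]
          constructor
          · rintro ((h6 | ⟨h6, h7⟩) | rfl)
            · exact Or.inl h6
            · exact Or.inr ⟨Or.inr h6, h7⟩
            · exact Or.inr ⟨Or.inl rfl, rfl, hc1.2, hc1.1⟩
          · rintro (h6 | ⟨rfl | h6, h7⟩)
            · exact Or.inl (Or.inl h6)
            · exact Or.inr rfl
            · exact Or.inl (Or.inr ⟨h6, h7⟩)
        · rw [h.lists x hx a]
          constructor
          · rintro (h6 | ⟨h6, h7⟩)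
            · exact Or.inl h6
            · exact Or.inr ⟨Or.inr h6, h7⟩
          · rintro (h6 | ⟨rfl | h6, h7⟩)
            · exact Or.inl h6
            · exact absurd h7.1.symm h5
            · exact Or.inr ⟨h6, h7⟩
      · intro x hx
        simp only [write_same, write_other, ne_eq, Nat.reduceEqDiff, not_false_eq_true, lst_push]
        split_ifs with h5
        · exact nodup_snoc (h.nodup _ hdV) (hnew _ hdV)
        · exact h.nodup x hx
    · rw [← not_iff_not, not_not] at hcond
      rw [hcond] at hc0
      refine ⟨by simp [write_other], by simp [write_other], [], ⟨h1.frame, ?_, h1.nodup⟩,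
        by simp⟩
      intro x hx a
      rw [h1.lists x hx a]
      simp only [Finset.mem_insert, exists_eq_or_imp]
      constructor
      · rintro (h6 | ⟨h6, h7⟩)
        · exact Or.inl h6
        · exact Or.inr ⟨Or.inr h6, h7⟩
      · rintro (h6 | ⟨rfl | h6, h7⟩)
        · exact Or.inl h6
        · exact absurd ⟨h7.2.2, by rw [hyd, h7.1]; exact h7.2.1⟩ hc0
        · exact Or.inr ⟨h6, h7⟩
  · intro x _ e
    simp
  · exact fun x hx => (hin x hx).1
  · rintro t m ⟨qs', dn, ⟨h, rfl⟩, ht, hdn, hend⟩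
    refine ⟨dn, h, ?_, hdn, ht⟩
    rcases hend with hend | ⟨_, hend⟩
    · exact hend.2
    · simp [Expr.eval] at hend

/-- The factor in the running time of `raiseLevels`. -/
def raiseCost : ℕ :=
  sweepCost (.const 1) (.read ODEG (var CUR)) (.read OLST (prE (var CUR) (var IDX))) raiseBody +
  sweepCost (.const 1) (.read ODEG (var CUR)) (.read OLST (prE (var CUR) (var IDX))) rebuildBody + 100

/-- The incoming lists are restored without looking at incoming arcs: the lists of the raised
components are emptied, and then the outgoing arcs of the raised vertices are distributed anew. The
tails of these arcs have just gained a level, and this pays for the work. -/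
theorem raiseLevels_runs {W V M : ℕ} {acc : ℕ → Prop} (hW : Fits W (V + M + 2)) {m : Mem}
    (h : SccInv acc V M M (M + 1) m) {L : ℕ} (hL : m NEWLEV 0 = L) (hLW : L ≤ W)
    (hhead : m HEAD 0 = m DST M) (hlt : m LEV (m DST M) < L) :
    Runs W raiseLevels m fun t m' => ∃ F : Finset ℕ,
      (∀ y, y ∈ F ↔ y < V ∧ Rch (m SRC) (m DST) M (m DST M) y ∧ m LEV y < L) ∧
      Frame [LEV, IDEG, ILST, QUE, QT, TMP, QH, IDX, CUR, ELM] m m' ∧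
      (∀ y, m' LEV y = if y ∈ F then L else m LEV y) ∧
      (∀ x < V, (lst (m' IDEG) (m' ILST) (m COMP x)).Nodup) ∧
      (∀ x < V, ∀ e, e ∈ lst (m' IDEG) (m' ILST) (m COMP x) ↔
        ((∀ y ∈ F, m COMP y ≠ m COMP x) ∧ e ∈ lst (m IDEG) (m ILST) (m COMP x)) ∨
        (e < M + 1 ∧ m SRC e ∈ F ∧ m COMP (m DST e) = m COMP x ∧ m COMP (m SRC e) ≠ m COMP x ∧
          m' LEV (m DST e) = L)) ∧
      t ≤ raiseCost * (((Finset.range (M + 1)).filter fun e => m SRC e ∈ F).card + F.card + 1) := by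
  classical
  have hdV := (h.ends M (Nat.lt_succ_self _)).2
  have hcV := h.compLt _ hdV
  set w := m DST M with hw
  refine wp.seq_runs ?_
  simp only [wp, wp_setv, Expr.eval, eval_var, write_other, ne_eq, Nat.reduceEqDiff,
    not_false_eq_true, hhead, hL]
  refine ⟨⟨hW.lin _ (by omega), hLW⟩, ⟨hW.lin _ (by omega), Nat.zero_le _⟩, ⟨Nat.zero_le _,
    hW.lin _ (by omega)⟩, hW.lin _ (by omega), Nat.zero_le _, Nat.zero_le _, ?_⟩
  set m₀ : Mem := (((((m.write LEV w L).write IDEG (m COMP w) 0).write QUE 0 w).write QT 0 1).write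
    QH 0 0).write IDX 0 0 with hm₀
  have h0 : RaiseInv m L (fun y => y < V ∧ Rch (m SRC) (m DST) M w y ∧ m LEV y < L) [w] ∅ m₀ := by
    refine ⟨(Frame.refl _ _).write.write.write.write.write.write, by simp, ?_, ?_, ?_, ?_, ?_, ?_,
      by simp⟩
    · intro y hy
      simp only [List.mem_singleton] at hy
      subst hy
      exact ⟨hdV, Rch.refl _, hlt⟩
    · simp [hm₀, write_same, write_other]
    · intro k c hk
      have : k = 0 := by have := lt_of_getElem? hk; simp at this; omega
      subst this
      simp at hk
      simp [hm₀, write_same, write_other, hk]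
    · intro y
      simp only [hm₀, write_same, write_other, ne_eq, Nat.reduceEqDiff, not_false_eq_true,
        Function.update_apply, List.mem_singleton]
    · intro c hc
      simp only [hm₀, write_same, write_other, ne_eq, Nat.reduceEqDiff, not_false_eq_true]
      rw [Function.update_of_ne (hc w (by simp)).symm]
    · intro y hy
      simp only [List.mem_singleton] at hy
      subst hy
      simp [hm₀, write_same, write_other]
  refine Runs.seq ((raiseLoop_runs hW h hL hLW rfl h0 ?_ ?_).mono ?_)
  · simp [hm₀, write_same, write_other]
  · simp [hm₀, write_same]
  rintro t m₁ ⟨qs, dn, h₁, hqs, ht⟩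
  refine wp.seq_runs ?_
  simp only [wp, wp_setv, Expr.eval]
  refine ⟨Nat.zero_le _, Nat.zero_le _, ?_⟩
  set m₂ := (m₁.write QH 0 0).write IDX 0 0 with hm₂
  have h₂ := h₁.insensitive (m' := m₂) ((Frame.refl _ _).write.write)
  have e1 : m₂ SRC = m SRC := h₂.frame _ (by decide)
  have e2 : m₂ DST = m DST := h₂.frame _ (by decide)
  have e3 : m₂ COMP = m COMP := h₂.frame _ (by decide)
  have e4 : m₂ ODEG = m ODEG := h₂.frame _ (by decide)
  have e5 : m₂ OLST = m OLST := h₂.frame _ (by decide)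
  have e6 : m₂ ILST = m ILST := h₂.frame _ (by decide)
  have e7 : m₂ NEWLEV = m NEWLEV := h₂.frame _ (by decide)
  have hl0 : ∀ x, (∃ y ∈ qs, m COMP y = m COMP x) →
      lst (m₂ IDEG) (m₂ ILST) (m COMP x) = [] := by
    rintro x ⟨y, hy, hyx⟩
    rw [← hyx, lst, h₂.ideg0 y hy]
    rfl
  have hl1 : ∀ x, (∀ y ∈ qs, m COMP y ≠ m COMP x) →
      lst (m₂ IDEG) (m₂ ILST) (m COMP x) = lst (m IDEG) (m ILST) (m COMP x) := by
    intro x hx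
    rw [lst, lst, h₂.ideg _ hx, e6]
  -- A list that was not emptied contains no arc with a raised tail. The head of such an arc would
  -- be reached from `w` and, being of the same level as the tail, be below `L`, hence raised as
  -- well.
  have hin : ∀ x < V, (lst (m₂ IDEG) (m₂ ILST) (m₂ COMP x)).Nodup ∧
      ∀ e ∈ lst (m₂ IDEG) (m₂ ILST) (m₂ COMP x), e < M + 1 ∧ m₂ SRC e ∉ qs := by
    intro x hx
    rw [e1, e3]
    by_cases hc : ∀ y ∈ qs, m COMP y ≠ m COMP x
    · rw [hl1 x hc]
      refine ⟨h.inNodup x hx, fun e he => ?_⟩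
      obtain ⟨h3, h4, h5, h6⟩ := (h.inn x hx e).1 he
      refine ⟨by omega, fun h7 => ?_⟩
      obtain ⟨h8, h9, h10⟩ := (hqs _).1 h7
      exact hc (m DST e) ((hqs _).2 ⟨(h.ends e (by omega)).2, h9.trans (Rch.of_arc h3),
        by omega⟩) h4
    · push Not at hc
      rw [hl0 x hc]
      simp
  refine (rebuildLoop_runs (V := V) (N := M + 1) (L := L) (qs := qs)
    (by rw [show V + (M + 1) + 1 = V + M + 2 by ring]; exact hW) (by rw [e7, hL]) (by rw [e1, e2]; exact h.ends)
    (by rw [e3]; exact h.compLt) h₂.nodup (fun c hc => ((hqs c).1 hc).1) h₂.qt h₂.que ?_ hin ?_ ?_).mono ?_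
  · rw [e4, e5, e1]
    exact fun x hx => ⟨h.outNodup x hx, fun e he => (h.out x hx e).1 he⟩
  · simp [hm₂, write_same, write_other]
  · simp [hm₂, write_same]
  rintro t' m' ⟨dn', h', hfull, hdn', ht'⟩ t₁ ht₁ t₂ ht₂
  rw [e4] at hfull hdn'
  have hcard := card_filter_src h (fun c hc => ((hqs c).1 hc).1) hdn'
  have hlev : m' LEV = m₂ LEV := h'.frame _ (by decide)
  refine ⟨qs.toFinset, fun y => by rw [List.mem_toFinset, hqs], h₂.frame.trans h'.frame, ?_, ?_, ?_,
    ?_⟩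
  · intro y
    rw [hlev, h₂.lev]
    simp only [List.mem_toFinset]
  · intro x hx
    have := h'.nodup x hx
    rwa [e3] at this
  · intro x hx e
    have hx' := h'.lists x hx e
    rw [e1, e2, e3, e5] at hx'
    rw [hx', hlev]
    simp only [List.mem_toFinset]
    apply or_congr
    · by_cases hc : ∀ y ∈ qs, m COMP y ≠ m COMP x
      · rw [hl1 x hc]; exact (and_iff_right hc).symm
      · rw [hl0 x (by push Not at hc; exact hc)]; simp [hc]
    · constructor
      · rintro ⟨⟨⟨c, i⟩, hp, rfl⟩, h4⟩
        have h5 := hdn' _ hp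
        have h6 := (h.out c ((hqs c).1 h5.1).1 _).1 (mem_lst.2 ⟨i, h5.2, rfl⟩)
        exact ⟨h6.1, by rw [h6.2]; exact h5.1, h4⟩
      · rintro ⟨h4, h5, h6⟩
        obtain ⟨i, hi, hie⟩ := mem_lst.1 ((h.out _ (h.ends e h4).1 e).2 ⟨h4, rfl⟩)
        exact ⟨⟨(m SRC e, i), hfull _ h5 i hi, hie⟩, h6⟩
  · simp only [List.mem_toFinset, List.toFinset_card_of_nodup h₂.nodup]
    set X := ((Finset.range (M + 1)).filter fun e => m SRC e ∈ qs).card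
    have h3 : t₁ + t₂ ≤ 100 := by
      refine (add_le_add ht₁ ht₂).trans ?_
      simp only [maxCost, setv, Expr.cost, var]
      omega
    have h4 := ht'.trans (Nat.mul_le_mul_left _ (show dn'.card + qs.length + 1 ≤
      X + qs.length + 1 by omega))
    have h5 : 100 ≤ 100 * (X + qs.length + 1) := by omega
    rw [raiseCost, add_mul, add_mul]
    omega

/-! ### Forward search along recorded arcs -/

/-- Visit the current element and keep track of the largest component. -/
def forwardBody : Cmd :=
  .ite (.lt (.read MARK (var ELM)) (var STAMP))
    (.seq (.store MARK (var ELM) (var STAMP)) (.seq (.store QUE (var QT) (var ELM))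
      (.seq (setv QT (.add (var QT) (.const 1)))
        (.ite (.lt (.read SIZE (var BIG)) (.read SIZE (var ELM))) (setv BIG (var ELM)) .skip))))
    .skip

/-- Search from the component of `HEAD` along the recorded arcs. -/
def searchForward : Cmd :=
  .seq (.seq (setv STAMP (.add (var STAMP) (.const 1)))
    (.seq (setv BIG (.read COMP (var HEAD)))
    (.seq (.store QUE (.const 0) (var BIG))
    (.seq (setv QT (.const 1)) (.seq (setv QH (.const 0)) (.seq (setv IDX (.const 0))
      (.store MARK (var BIG) (var STAMP))))))))
    (sweep (.const 1) (.read TDEG (var CUR)) (.read TLST (prE (var CUR) (var IDX))) forwardBody)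

/-- The largest component met so far is kept in `BIG`, so that the merging can move the members of
the others into it. -/
structure FwdInv (m₀ : Mem) (c₀ : ℕ) (Good : ℕ → Prop) (qs : List ℕ) (dn : Finset (ℕ × ℕ))
    (m : Mem) : Prop where
  frame : Frame [MARK, QUE, QT, BIG, QH, IDX, CUR, ELM] m₀ m
  nodup : qs.Nodup
  good : ∀ c ∈ qs, Good c
  start : c₀ ∈ qs
  qt : m QT 0 = qs.length
  que : ∀ (k c : ℕ), qs[k]? = some c → m QUE k = c
  mark : ∀ c, m MARK c = m₀ STAMP 0 ↔ c ∈ qs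
  mark_le : ∀ c, m MARK c ≤ m₀ STAMP 0
  big : m BIG 0 ∈ qs
  big_le : ∀ c ∈ qs, m₀ SIZE c ≤ m₀ SIZE (m BIG 0)
  closed : ∀ p ∈ dn, m₀ TLST (pr p.1 p.2) ∈ qs

theorem FwdInv.insensitive {m₀ : Mem} {c₀ : ℕ} {Good : ℕ → Prop} {qs : List ℕ}
    {dn : Finset (ℕ × ℕ)} {m m' : Mem} (h : FwdInv m₀ c₀ Good qs dn m)
    (hm : Frame [QH, IDX, CUR, ELM] m m') : FwdInv m₀ c₀ Good qs dn m' := by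
  have e1 := hm MARK (by decide)
  have e2 := hm QUE (by decide)
  have e3 := hm QT (by decide)
  have e4 := hm BIG (by decide)
  exact ⟨h.frame.trans hm, h.nodup, h.good, h.start, by rw [e3]; exact h.qt, by rw [e2]; exact h.que,
    by rw [e1]; exact h.mark, by rw [e1]; exact h.mark_le, by rw [e4]; exact h.big,
    by rw [e4]; exact h.big_le, h.closed⟩

theorem FwdInv.insert {m₀ : Mem} {c₀ : ℕ} {Good : ℕ → Prop} {qs : List ℕ}
    {dn : Finset (ℕ × ℕ)} {m : Mem} (h : FwdInv m₀ c₀ Good qs dn m) {p : ℕ × ℕ}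
    (hp : m₀ TLST (pr p.1 p.2) ∈ qs) : FwdInv m₀ c₀ Good qs (insert p dn) m :=
  ⟨h.frame, h.nodup, h.good, h.start, h.qt, h.que, h.mark, h.mark_le, h.big, h.big_le, by
    intro p' hp'
    rcases Finset.mem_insert.1 hp' with rfl | hp'
    · exact hp
    · exact h.closed p' hp'⟩

theorem FwdInv.visit {m₀ : Mem} {c₀ : ℕ} {Good : ℕ → Prop} {qs : List ℕ}
    {dn : Finset (ℕ × ℕ)} {m : Mem} (h : FwdInv m₀ c₀ Good qs dn m) {y b : ℕ} (hy : y ∉ qs)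
    (hg : Good y) (hb : b = if m₀ SIZE (m BIG 0) < m₀ SIZE y then y else m BIG 0) :
    FwdInv m₀ c₀ Good (qs ++ [y]) dn ((((m.write MARK y (m₀ STAMP 0)).write QUE qs.length y).write
      QT 0 (qs.length + 1)).write BIG 0 b) := by
  refine ⟨h.frame.write.write.write.write, nodup_snoc h.nodup hy, ?_, ?_, ?_, ?_, ?_, ?_, ?_, ?_, ?_⟩
  · intro c hc
    rcases List.mem_append.1 hc with hc | hc
    · exact h.good c hc
    · simp at hc; subst hc; exact hg
  · exact List.mem_append_left _ h.start
  · simp [write_same, write_other]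
  · intro k c hk
    simp only [write_same, write_other, ne_eq, Nat.reduceEqDiff, not_false_eq_true]
    exact que_snoc h.que hk
  · intro c
    simp only [write_same, write_other, ne_eq, Nat.reduceEqDiff,
      not_false_eq_true, Function.update_apply, List.mem_append, List.mem_singleton, ← h.mark]
    split_ifs with h1 <;> simp [h1]
  · intro c
    simp only [write_same, write_other, ne_eq, Nat.reduceEqDiff,
      not_false_eq_true, Function.update_apply]
    split_ifs with h1
    · exact le_rfl
    · exact h.mark_le c
  · simp only [write_same, Function.update_self, List.mem_append, List.mem_singleton]
    have := h.big
    split_ifs at hb <;> simp [hb, this]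
  · intro c hc
    simp only [write_same, Function.update_self]
    have h1 := h.big_le c
    simp only [List.mem_append, List.mem_singleton] at hc
    rcases hc with hc | rfl <;> split_ifs at hb with h2 <;> subst hb
    · exact (h1 hc).trans h2.le
    · exact h1 hc
    · exact le_rfl
    · omega
  · exact fun p hp => List.mem_append_left _ (h.closed p hp)

/-- The factor in the running time of `searchForward`. -/
def forwardCost : ℕ :=
  2 * sweepCost (.const 1) (.read TDEG (var CUR)) (.read TLST (prE (var CUR) (var IDX)))
    forwardBody + 100

/-- The records of the backward search lead only to components that reach the tail of the new arc.
So what is found from its head lies on a cycle through the new arc; `Good` stands for this property.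
-/
theorem searchForward_runs {W V N : ℕ} (hW : Fits W (V + N + 2)) {m : Mem} {Good : ℕ → Prop}
    (hlt : ∀ c, Good c → c < V) (hdeg : ∀ c, Good c → m TDEG c ≤ N)
    (hstep : ∀ c i, Good c → i < m TDEG c → Good (m TLST (pr c i)))
    (hgood : Good (m COMP (m HEAD 0))) (hσ : m STAMP 0 + 1 ≤ W)
    (hmark : ∀ c, m MARK c ≤ m STAMP 0) :
    Runs W searchForward m fun t m' => ∃ m₀ qs dn, Frame [STAMP, MARK, QUE, QT, BIG, QH, IDX] m m₀ ∧
      m₀ STAMP 0 = m STAMP 0 + 1 ∧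
      FwdInv m₀ (m COMP (m HEAD 0)) Good qs dn m' ∧
      t ≤ forwardCost * (dn.card + 1) ∧ qs.length ≤ dn.card + 1 ∧
      (∀ p ∈ dn, p.1 ∈ qs ∧ p.2 < m TDEG p.1) ∧ ∀ c ∈ qs, ∀ i < m TDEG c, (c, i) ∈ dn := by
  set c₀ := m COMP (m HEAD 0) with hc₀
  have hcV := hlt _ hgood
  refine wp.seq_runs ?_
  simp only [wp, wp_setv, Expr.eval, eval_var, write_same, write_other, ne_eq, Nat.reduceEqDiff,
    not_false_eq_true, Function.update_self]
  refine ⟨hσ, hW.lin _ (by omega), ⟨Nat.zero_le _, hW.lin _ (by omega)⟩, hW.lin _ (by omega),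
    Nat.zero_le _, Nat.zero_le _, ⟨hW.lin _ (by omega), hσ⟩, ?_⟩
  rw [← hc₀]
  set m₀ : Mem := ((((((m.write STAMP 0 (m STAMP 0 + 1)).write BIG 0 c₀).write QUE 0 c₀).write
    QT 0 1).write QH 0 0).write IDX 0 0).write MARK c₀ (m STAMP 0 + 1) with hm₀
  have hfr : Frame [STAMP, MARK, QUE, QT, BIG, QH, IDX] m m₀ :=
    (Frame.refl _ _).write.write.write.write.write.write.write
  have eσ : m₀ STAMP 0 = m STAMP 0 + 1 := by simp [hm₀, write_same, write_other]
  have e1 : m₀ TDEG = m TDEG := hfr _ (by decide)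
  have e2 : m₀ TLST = m TLST := hfr _ (by decide)
  have h0 : FwdInv m₀ c₀ Good [c₀] ∅ m₀ := by
    refine ⟨Frame.refl _ _, by simp, ?_, by simp, ?_, ?_, ?_, ?_, ?_, ?_, by simp⟩
    · intro c hc
      simp only [List.mem_singleton] at hc
      subst hc
      exact hgood
    · simp [hm₀, write_same, write_other]
    · intro k c hk
      have : k = 0 := by have := lt_of_getElem? hk; simp at this; omega
      subst this
      simp at hk
      simp [hm₀, write_same, write_other, hk]
    · intro c
      rw [eσ]
      simp only [hm₀, write_same, write_other, ne_eq, Nat.reduceEqDiff, not_false_eq_true,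
        Function.update_apply, List.mem_singleton]
      split_ifs with h1
      · simp [h1]
      · have := hmark c
        constructor
        · intro h; omega
        · intro h; exact absurd h h1
    · intro c
      rw [eσ]
      simp only [hm₀, write_same, write_other, ne_eq, Nat.reduceEqDiff, not_false_eq_true,
        Function.update_apply]
      split_ifs with h1
      · omega
      · have := hmark c; omega
    · simp [hm₀, write_same, write_other]
    · intro c hc
      simp only [List.mem_singleton] at hc
      subst hc
      simp [hm₀, write_same, write_other]
  refine (sweep_runs (V := V) (m TDEG) (fun c i => m TLST (pr c i))
    (fun qs dn m => FwdInv m₀ c₀ Good qs dn m ∧ qs.length ≤ dn.card + 1)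
    ?_ ?_ ?_ ?_ ?_ ?_ ?_ ?_ (qs₀ := [c₀]) ⟨h0, by simp⟩ ?_ ?_).mono ?_
  · rintro qs dn m m' hm ⟨h, hl⟩
    exact ⟨h.insensitive fun a ha => hm a (by rintro rfl; simp at ha) (by rintro rfl; simp at ha)
      (by rintro rfl; simp at ha) (by rintro rfl; simp at ha), hl⟩
  · rintro qs dn m ⟨h, -⟩
    exact ⟨h.nodup, fun c hc => hlt c (h.good c hc), h.qt, h.que⟩
  · rintro qs dn m c ⟨h, -⟩ _ hc
    simp only [Expr.eval, eval_var, hc, h.frame TDEG (by decide), e1]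
  · rintro qs dn m c i ⟨h, -⟩ _ hc hi _
    simp only [Expr.eval, eval_var, eval_prE, hc, hi, h.frame TLST (by decide), e2]
  · intro m m' _; rfl
  · have := hW.lin (V + 1) (by omega); omega
  · rintro qs dn m c ⟨h, -⟩ hc
    have h1 := hdeg c (h.good c hc)
    refine ⟨by have := hW.lin (N + 1) (by omega); omega, fun i hi => ?_⟩
    have h2 := hlt _ (hstep c i (h.good c hc) hi)
    exact hW.lin _ (by omega)
  · rintro qs dn m₁ c i ⟨h, hl⟩ hc hi hci hcur helm - hdn
    have hgy := hstep c i (h.good c hc) hi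
    set y := m TLST (pr c i) with hyd
    have hyV := hlt _ hgy
    have hst : m₁ STAMP 0 = m₀ STAMP 0 := by rw [h.frame STAMP (by decide)]
    have hsz : m₁ SIZE = m₀ SIZE := h.frame _ (by decide)
    have hmk : m₁ MARK y < m₀ STAMP 0 ↔ y ∉ qs := by
      rw [← h.mark]; have := h.mark_le y; omega
    have hlen := length_le_of_nodup h.nodup fun c hc => hlt c (h.good c hc)
    have hcard : (insert (c, i) dn).card = dn.card + 1 := Finset.card_insert_of_notMem hci
    refine ⟨fun hlt' => ?_, fun hge => ?_⟩
    · simp only [Expr.eval, eval_var, helm, hst] at hlt'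
      have hyq : y ∉ qs := by rw [← hmk]; by_contra hc; simp [hc] at hlt'
      have hbV := hlt _ (h.good _ h.big)
      simp only [wp, wp_setv, Expr.eval, eval_var, write_other, ne_eq,
        Nat.reduceEqDiff, not_false_eq_true, hst, helm, h.qt, hsz]
      refine ⟨⟨hW.lin _ (by omega), by rw [eσ]; exact hσ⟩, ⟨hW.lin _ (by omega), hW.lin _ (by omega)⟩,
        hW.lin _ (by omega), fun hb => ⟨hW.lin _ (by omega), trivial, trivial, [y], ?_, ?_⟩,
        fun hb => ⟨trivial, trivial, [y], ?_, ?_⟩⟩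
      · refine (h.visit hyq hgy ?_).insert (p := (c, i)) ?_
        · rw [if_pos]; by_contra hc; simp [hc] at hb
        · rw [e2]; exact List.mem_append_right _ (List.mem_singleton.2 rfl)
      · simp; omega
      · have hv := (h.visit hyq hgy rfl).insert (p := (c, i))
          (by rw [e2]; exact List.mem_append_right _ (List.mem_singleton.2 rfl))
        have hno : ¬ m₀ SIZE (m₁ BIG 0) < m₀ SIZE y := by by_contra hc; simp [hc] at hb
        rw [if_neg hno] at hv
        convert hv using 1
        funext a j
        simp only [Mem.write]
        split_ifs with h1 h2 h3 h4 h5 <;> simp_all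
      · simp; omega
    · simp only [Expr.eval, eval_var, helm, hst] at hge
      have hyq : y ∈ qs := by
        by_contra hc; rw [if_pos (hmk.2 hc)] at hge; cases hge
      refine ⟨rfl, rfl, [], ?_, by simp; omega⟩
      rw [List.append_nil]
      exact h.insert (by rw [e2]; exact hyq)
  · simp [hm₀, write_same, write_other]
  · simp [hm₀, write_same, write_other]
  · rintro t m' ⟨qs, dn, ⟨h, hl⟩, ht, hdn, hend⟩ t₁ ht₁
    refine ⟨m₀, qs, dn, hfr, eσ, h, ?_, hl, hdn, ?_⟩
    · have h1 : t₁ ≤ 100 * (dn.card + 1) := by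
        refine ht₁.trans ?_
        simp only [maxCost, setv, Expr.cost, var]
        omega
      have h2 := ht.trans (Nat.mul_le_mul_left _ (show dn.card + qs.length + 1 ≤
        2 * (dn.card + 1) by omega))
      rw [forwardCost, add_mul, mul_comm 2, mul_assoc]
      omega
    · rcases hend with hend | ⟨_, hend⟩
      · exact hend.2
      · simp [Expr.eval] at hend

/-! ### Merging components -/

/-- Move the current member to the component `BIG`. -/
def relabelBody : Cmd :=
  .seq (.store COMP (var ELM) (var BIG))
    (.seq (push SIZE MLST (var BIG) (var ELM))
      (.ite (.read ACC (var CUR)) (.store ACC (var BIG) (.const 1)) .skip))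

/-- Move the members of all components of the queue to `BIG`. -/
def relabelLoop : Cmd :=
  sweep (.const 1) (.mul (notE (.eq (var CUR) (var BIG))) (.read SIZE (var CUR)))
    (.read MLST (prE (var CUR) (var IDX))) relabelBody

/-- Only row `big` changes. The other rows are left as they are, although their members move away:
they are being read by the loop, and afterwards no vertex bears their names. -/
structure RelInv (m₀ : Mem) (big : ℕ) (dn : Finset (ℕ × ℕ)) (m : Mem) :
    Prop where
  frame : Frame [COMP, SIZE, MLST, ACC, QH, IDX, CUR, ELM] m₀ m
  comp : ∀ z, ((∃ p ∈ dn, m₀ MLST (pr p.1 p.2) = z) → m COMP z = big) ∧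
    ((∀ p ∈ dn, m₀ MLST (pr p.1 p.2) ≠ z) → m COMP z = m₀ COMP z)
  other : ∀ c, c ≠ big → m SIZE c = m₀ SIZE c ∧ m ACC c = m₀ ACC c ∧
    ∀ i, m MLST (pr c i) = m₀ MLST (pr c i)
  size : m SIZE big = m₀ SIZE big + dn.card
  mem : ∀ z, z ∈ lst (m SIZE) (m MLST) big ↔ z ∈ lst (m₀ SIZE) (m₀ MLST) big ∨
    ∃ p ∈ dn, m₀ MLST (pr p.1 p.2) = z
  nodup : (lst (m SIZE) (m MLST) big).Nodup
  acc : m ACC big ≠ 0 ↔ m₀ ACC big ≠ 0 ∨ ∃ p ∈ dn, m₀ ACC p.1 ≠ 0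

theorem RelInv.insensitive {m₀ : Mem} {big : ℕ}
    {dn : Finset (ℕ × ℕ)} {m m' : Mem} (h : RelInv m₀ big dn m)
    (hm : Frame [QH, IDX, CUR, ELM] m m') : RelInv m₀ big dn m' := by
  have e1 := hm COMP (by decide)
  have e2 := hm SIZE (by decide)
  have e3 := hm MLST (by decide)
  have e4 := hm ACC (by decide)
  exact ⟨h.frame.trans hm, by rw [e1]; exact h.comp, by rw [e2, e3, e4]; exact h.other,
    by rw [e2]; exact h.size, by rw [e2, e3]; exact h.mem, by rw [e2, e3]; exact h.nodup,
    by rw [e4]; exact h.acc⟩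

theorem RelInv.move {m₀ : Mem} {big : ℕ}
    {dn : Finset (ℕ × ℕ)} {m : Mem} (h : RelInv m₀ big dn m) {c i z : ℕ} (hc : c ≠ big)
    (hz : m₀ MLST (pr c i) = z) (hci : (c, i) ∉ dn) (hnew : z ∉ lst (m SIZE) (m MLST) big) {b : ℕ}
    (hb : b ≠ 0 ↔ m ACC big ≠ 0 ∨ m₀ ACC c ≠ 0) :
    RelInv m₀ big (insert (c, i) dn) ((((m.write COMP z big).write MLST
      (pr big (m SIZE big)) z).write SIZE big (m SIZE big + 1)).write ACC big b) := by
  refine ⟨h.frame.write.write.write.write, ?_, ?_, ?_, ?_, ?_, ?_⟩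
  · intro y
    simp only [write_same, write_other, ne_eq, Nat.reduceEqDiff, not_false_eq_true,
      Finset.mem_insert, exists_eq_or_imp, forall_eq_or_imp, hz, Function.update_apply]
    constructor
    · rintro (rfl | h1)
      · simp
      · split_ifs
        · rfl
        · exact (h.comp y).1 h1
    · rintro ⟨h1, h2⟩
      rw [if_neg (Ne.symm h1)]
      exact (h.comp y).2 h2
  · intro d hd
    simp only [write_same, write_other, ne_eq, Nat.reduceEqDiff, not_false_eq_true,
      Function.update_apply, pr_inj, hd, false_and, if_false]
    exact h.other d hd
  · simp only [write_same, write_other, ne_eq, Nat.reduceEqDiff, not_false_eq_true,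
      Function.update_self, h.size, Finset.card_insert_of_notMem hci]
    ring
  · intro y
    simp only [write_same, write_other, ne_eq, Nat.reduceEqDiff, not_false_eq_true, lst_push,
      if_true, List.mem_append, List.mem_singleton, h.mem, Finset.mem_insert, exists_eq_or_imp, hz]
    constructor
    · rintro ((h1 | h1) | rfl) <;> simp_all
    · rintro (h1 | rfl | h1) <;> simp_all
  · simp only [write_same, write_other, ne_eq, Nat.reduceEqDiff, not_false_eq_true, lst_push,
      if_true]
    exact nodup_snoc h.nodup hnew
  · simp only [write_same, Function.update_self, hb, h.acc, Finset.mem_insert, exists_eq_or_imp]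
    rw [or_right_comm, or_assoc]

theorem relabelLoop_runs {W V : ℕ} (hW : Fits W (2 * V + 1)) {m₀ : Mem} {big : ℕ} {qs : List ℕ}
    (hbig : big < V) (hB : m₀ BIG 0 = big) (hqs : qs.Nodup) (hqV : ∀ c ∈ qs, c < V)
    (hqt : m₀ QT 0 = qs.length) (hque : ∀ (k c : ℕ), qs[k]? = some c → m₀ QUE k = c)
    (hmem : ∀ c, c = big ∨ c ∈ qs → (lst (m₀ SIZE) (m₀ MLST) c).Nodup ∧
      ∀ z ∈ lst (m₀ SIZE) (m₀ MLST) c, z < V ∧ m₀ COMP z = c)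
    (hqh : m₀ QH 0 = 0) (hidx : m₀ IDX 0 = 0) :
    Runs W relabelLoop m₀ fun t m => ∃ dn, RelInv m₀ big dn m ∧
      (∀ c ∈ qs, c ≠ big → ∀ i < m₀ SIZE c, (c, i) ∈ dn) ∧
      (∀ p ∈ dn, p.1 ∈ qs ∧ p.1 ≠ big ∧ p.2 < m₀ SIZE p.1) ∧
      t ≤ sweepCost (.const 1) (.mul (notE (.eq (var CUR) (var BIG))) (.read SIZE (var CUR)))
        (.read MLST (prE (var CUR) (var IDX))) relabelBody * (dn.card + qs.length + 1) := by
  have hsize : ∀ c, c = big ∨ c ∈ qs → m₀ SIZE c ≤ V := by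
    intro c hc
    rw [← length_lst (d := m₀ SIZE) (a := m₀ MLST) (c := c)]
    exact length_le_of_lt (hmem c hc).1 fun a ha => ((hmem c hc).2 a ha).1
  -- The component `big` is itself in the queue. Its bound is set to zero, since its members stay
  -- and its list grows during the loop.
  set dg : ℕ → ℕ := fun c => if c = big then 0 else m₀ SIZE c with hdg
  have hdg0 : ∀ c i, i < dg c → c ≠ big ∧ i < m₀ SIZE c := by
    intro c i hi
    simp only [hdg] at hi
    split_ifs at hi with h1
    · omega
    · exact ⟨h1, hi⟩
  refine (sweep_runs (V := V) dg (fun c i => m₀ MLST (pr c i))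
    (fun qs' dn m => RelInv m₀ big dn m ∧ qs' = qs ∧ ∀ p ∈ dn, p.1 ∈ qs ∧ p.2 < dg p.1)
    ?_ ?_ ?_ ?_ ?_ ?_ ?_ ?_ (qs₀ := qs) ⟨⟨Frame.refl _ _, ?_, ?_, ?_, ?_, ?_, ?_⟩, rfl, by simp⟩
      hqh hidx).mono ?_
  · rintro qs' dn m m' hm ⟨h, rfl, h'⟩
    exact ⟨h.insensitive (frame_of_ne hm), rfl, h'⟩
  · rintro qs' dn m ⟨h, rfl, -⟩
    have e1 := h.frame QT (by decide)
    have e2 := h.frame QUE (by decide)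
    exact ⟨hqs, hqV, by rw [e1, hqt], by rw [e2]; exact hque⟩
  · rintro qs' dn m c ⟨h, -, -⟩ _ hc
    simp only [Expr.eval, eval_var, eval_notE, hc, h.frame BIG (by decide), hB, hdg]
    split_ifs with h1 h2 <;> simp_all [h.other]
  · rintro qs' dn m c i ⟨h, -, -⟩ _ hc hi hlt
    simp only [Expr.eval, eval_var, eval_prE, hc, hi]
    exact (h.other c (hdg0 c i hlt).1).2.2 i
  · intro m m' _; rfl
  · have := hW.lin (V + 1) (by omega); omega
  · rintro qs' dn m c ⟨-, rfl, -⟩ hc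
    have h1 := hsize c (Or.inr hc)
    have h2 : dg c ≤ V := by simp only [hdg]; split_ifs <;> omega
    refine ⟨by have := hW.lin (V + 1) (by omega); omega, fun i hi => ?_⟩
    have h2 := ((hmem c (Or.inr hc)).2 _ (mem_lst.2 ⟨i, (hdg0 c i hi).2, rfl⟩)).1
    exact hW.lin _ (by omega)
  · rintro qs' dn m c i ⟨h, rfl, hdn⟩ hc hi hci hcur helm - -
    obtain ⟨hcb, hi'⟩ := hdg0 c i hi
    set z := m₀ MLST (pr c i) with hz
    obtain ⟨hzV, hzc⟩ := (hmem c (Or.inr hc)).2 z (mem_lst.2 ⟨i, hi', rfl⟩)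
    have hnew : z ∉ lst (m SIZE) (m MLST) big := by
      rw [h.mem]
      rintro (h1 | ⟨⟨c', i'⟩, hp, h1⟩)
      · exact hcb (hzc.symm.trans ((hmem big (Or.inl rfl)).2 z h1).2)
      · obtain ⟨h2, h3⟩ := hdn _ hp
        have h4 := hdg0 _ _ h3
        have h5 := ((hmem c' (Or.inr h2)).2 _ (mem_lst.2 ⟨i', h4.2, h1⟩)).2
        rw [hzc] at h5
        subst h5
        have := lst_inj (hmem c (Or.inr hc)).1 h4.2 hi' h1
        subst this
        exact hci hp
    have hlen : m SIZE big ≤ V := by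
      rw [← length_lst (d := m SIZE) (a := m MLST) (c := big)]
      refine length_le_of_lt h.nodup fun a ha => ?_
      rcases (h.mem a).1 ha with ha | ⟨p, hp, ha⟩
      · exact ((hmem big (Or.inl rfl)).2 a ha).1
      · obtain ⟨h2, h3⟩ := hdn _ hp
        exact ((hmem _ (Or.inr h2)).2 _ (mem_lst.2 ⟨_, (hdg0 _ _ h3).2, ha⟩)).1
    have hlen1 : m SIZE big + 1 ≤ V + 1 := by omega
    have hlen2 : big + m SIZE big ≤ 2 * V := by omega
    have hsz : m SIZE big + 1 ≤ V := by
      have := length_le_of_lt (nodup_snoc h.nodup hnew) (N := V) fun a ha => by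
        rcases List.mem_append.1 ha with ha | ha
        · rcases (h.mem a).1 ha with ha | ⟨p, hp, ha⟩
          · exact ((hmem big (Or.inl rfl)).2 a ha).1
          · obtain ⟨h2, h3⟩ := hdn _ hp
            exact ((hmem _ (Or.inr h2)).2 _ (mem_lst.2 ⟨_, (hdg0 _ _ h3).2, ha⟩)).1
        · simp at ha; omega
      simpa [length_lst] using this
    have hins : ∀ p ∈ insert (c, i) dn, p.1 ∈ qs' ∧ p.2 < dg p.1 := by
      intro p hp
      rcases Finset.mem_insert.1 hp with rfl | hp
      · exact ⟨hc, hi⟩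
      · exact hdn p hp
    have eB : m BIG 0 = big := by rw [h.frame BIG (by decide), hB]
    have eA := (h.other c hcb).2.1
    simp only [relabelBody, push, wp, Expr.eval, eval_prE, eval_var, write_other, ne_eq,
      Nat.reduceEqDiff, not_false_eq_true, helm, eB, hcur, eA]
    refine ⟨⟨hW.lin _ (by omega), hW.lin _ (by omega)⟩, ⟨hW.quad _ _ ?_, hW.lin _ (by omega)⟩,
      ⟨hW.lin _ (by omega), hW.lin _ (by omega)⟩, fun h1 => ⟨⟨hW.lin _ (by omega),
      hW.lin _ (by omega)⟩, trivial, trivial, [], ⟨?_, by simp, hins⟩⟩,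
      fun h1 => ⟨trivial, trivial, [], ⟨?_, by simp, hins⟩⟩⟩
    · omega
    · exact h.move hcb hz.symm hci hnew (by simp [h1])
    · have := h.move hcb hz.symm hci hnew (b := m ACC big) (by simp [h1])
      convert this using 1
      funext a j
      simp only [Mem.write]
      split_ifs with h1 h2 h3 h4 h5 <;> simp_all
  · intro z; simp
  · intro c _; simp
  · simp
  · intro z; simp
  · exact (hmem big (Or.inl rfl)).1
  · simp
  · rintro t m ⟨qs', dn, ⟨h, rfl, hdn⟩, ht, -, hend⟩
    refine ⟨dn, h, ?_, fun p hp => ⟨(hdn p hp).1, hdg0 _ _ (hdn p hp).2⟩, ht⟩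
    intro c hc hcb i hi
    rcases hend with hend | ⟨_, hend⟩
    · exact hend.2 c hc i (by simp [hdg, hcb, hi])
    · simp [Expr.eval] at hend

/-- Collect the current arc if it enters `BIG` from outside. -/
def collectBody : Cmd :=
  .ite (notE (.eq (.read COMP (.read SRC (var ELM))) (var BIG)))
    (.seq (.store BUF (var CNT) (var ELM)) (setv CNT (.add (var CNT) (.const 1))))
    .skip

/-- Collect the arcs of one level that enter a component of the queue from outside. -/
def collectLoop : Cmd :=
  sweep (.const 1) (.read IDEG (var CUR)) (.read ILST (prE (var CUR) (var IDX))) collectBody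

/-- The arcs go to a buffer first, because the list of `BIG`, which they are to replace, is among
those being read. -/
structure ColInv (m₀ : Mem) (big : ℕ) (l : List ℕ) (dn : Finset (ℕ × ℕ)) (m : Mem) :
    Prop where
  frame : Frame [BUF, CNT, QH, IDX, CUR, ELM] m₀ m
  cnt : m CNT 0 = l.length
  buf : ∀ (k c : ℕ), l[k]? = some c → m BUF k = c
  nodup : l.Nodup
  mem : ∀ e, e ∈ l ↔ (∃ p ∈ dn, m₀ ILST (pr p.1 p.2) = e) ∧ m₀ COMP (m₀ SRC e) ≠ big
  le : l.length ≤ dn.card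

theorem ColInv.insensitive {m₀ : Mem} {big : ℕ} {l : List ℕ}
    {dn : Finset (ℕ × ℕ)} {m m' : Mem} (h : ColInv m₀ big l dn m)
    (hm : Frame [QH, IDX, CUR, ELM] m m') : ColInv m₀ big l dn m' := by
  have e1 := hm BUF (by decide)
  have e2 := hm CNT (by decide)
  exact ⟨h.frame.trans hm, by rw [e2]; exact h.cnt, by rw [e1]; exact h.buf, h.nodup, h.mem, h.le⟩

theorem collectLoop_runs {W V N : ℕ} (hW : Fits W (V + N + 1)) {m₀ : Mem} {big : ℕ} {qs : List ℕ}
    (hB : m₀ BIG 0 = big) (hqs : qs.Nodup) (hqV : ∀ c ∈ qs, c < V)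
    (hqt : m₀ QT 0 = qs.length) (hque : ∀ (k c : ℕ), qs[k]? = some c → m₀ QUE k = c)
    (hin : ∀ c ∈ qs, (lst (m₀ IDEG) (m₀ ILST) c).Nodup ∧
      ∀ e ∈ lst (m₀ IDEG) (m₀ ILST) c, e < N)
    (hdisj : ∀ c ∈ qs, ∀ c' ∈ qs, ∀ e, e ∈ lst (m₀ IDEG) (m₀ ILST) c →
      e ∈ lst (m₀ IDEG) (m₀ ILST) c' → c = c')
    (hqh : m₀ QH 0 = 0) (hidx : m₀ IDX 0 = 0) (hcnt : m₀ CNT 0 = 0) :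
    Runs W collectLoop m₀ fun t m => ∃ l dn, ColInv m₀ big l dn m ∧
      (∀ c ∈ qs, ∀ i < m₀ IDEG c, (c, i) ∈ dn) ∧
      (∀ p ∈ dn, p.1 ∈ qs ∧ p.2 < m₀ IDEG p.1) ∧
      t ≤ sweepCost (.const 1) (.read IDEG (var CUR)) (.read ILST (prE (var CUR) (var IDX)))
        collectBody * (dn.card + qs.length + 1) := by
  refine (sweep_runs (V := V) (m₀ IDEG) (fun c i => m₀ ILST (pr c i))
    (fun qs' dn m => (∃ l, ColInv m₀ big l dn m) ∧ qs' = qs)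
    ?_ ?_ ?_ ?_ ?_ ?_ ?_ ?_ (qs₀ := qs) ⟨⟨[], ⟨Frame.refl _ _, by simp [hcnt], by simp, by simp,
      by simp, by simp⟩⟩, rfl⟩ hqh hidx).mono ?_
  · rintro qs' dn m m' hm ⟨⟨l, h⟩, rfl⟩
    exact ⟨⟨l, h.insensitive (frame_of_ne hm)⟩, rfl⟩
  · rintro qs' dn m ⟨⟨l, h⟩, rfl⟩
    have e1 := h.frame QT (by decide)
    have e2 := h.frame QUE (by decide)
    exact ⟨hqs, hqV, by rw [e1, hqt], by rw [e2]; exact hque⟩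
  · rintro qs' dn m c ⟨⟨l, h⟩, -⟩ _ hc
    simp only [Expr.eval, eval_var, hc, h.frame IDEG (by decide)]
  · rintro qs' dn m c i ⟨⟨l, h⟩, -⟩ _ hc hi _
    simp only [Expr.eval, eval_var, eval_prE, hc, hi, h.frame ILST (by decide)]
  · intro m m' _; rfl
  · have := hW.lin (V + 1) (by omega); omega
  · rintro qs' dn m c ⟨-, rfl⟩ hc
    have h1 : m₀ IDEG c ≤ N := by
      rw [← length_lst (d := m₀ IDEG) (a := m₀ ILST) (c := c)]
      exact length_le_of_lt (hin c hc).1 (hin c hc).2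
    refine ⟨by have := hW.lin (N + 1) (by omega); omega, fun i hi => ?_⟩
    have h2 := (hin c hc).2 _ (mem_lst.2 ⟨i, hi, rfl⟩)
    exact hW.lin _ (by omega)
  · rintro qs' dn m c i ⟨⟨l, h⟩, rfl⟩ hc hi hci hcur helm - hdn
    set e := m₀ ILST (pr c i) with he
    have heN := (hin c hc).2 e (mem_lst.2 ⟨i, hi, rfl⟩)
    have hlN : l.length ≤ N := length_le_of_lt h.nodup fun a ha => by
      obtain ⟨⟨p, hp, hpa⟩, -⟩ := (h.mem a).1 ha
      exact (hin _ (hdn _ hp).1).2 a (mem_lst.2 ⟨_, (hdn _ hp).2, hpa⟩)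
    have e1 : m COMP = m₀ COMP := h.frame _ (by decide)
    have e2 : m SRC = m₀ SRC := h.frame _ (by decide)
    have e3 : m BIG 0 = big := by rw [h.frame BIG (by decide), hB]
    have hnew : e ∉ l := by
      rw [h.mem]
      rintro ⟨⟨⟨c', i'⟩, hp, hpe⟩, -⟩
      obtain ⟨h1, h2⟩ := hdn _ hp
      have h3 := hdisj c' h1 c hc e (mem_lst.2 ⟨i', h2, hpe⟩) (mem_lst.2 ⟨i, hi, rfl⟩)
      subst h3
      have := lst_inj (hin c' hc).1 h2 hi hpe
      simp only at this
      subst this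
      exact hci hp
    have hcard := Finset.card_insert_of_notMem hci
    refine ⟨fun h1 => ?_, fun h1 => ?_⟩
    · simp only [Expr.eval, eval_notE, eval_var, helm, e1, e2, e3] at h1
      have h2 : m₀ COMP (m₀ SRC e) ≠ big := by intro hc; simp [hc] at h1
      simp only [wp, wp_setv, Expr.eval, eval_var, write_other, ne_eq,
        Nat.reduceEqDiff, not_false_eq_true, helm, h.cnt]
      refine ⟨⟨hW.lin _ (by omega), hW.lin _ (by omega)⟩, hW.lin _ (by omega), trivial, trivial, [],
        ⟨l ++ [e], h.frame.write.write, ?_, ?_, nodup_snoc h.nodup hnew, ?_, ?_⟩, by simp⟩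
      · simp [write_same]
      · intro k c hk
        simp only [write_same, write_other, ne_eq, Nat.reduceEqDiff, not_false_eq_true]
        exact que_snoc h.buf hk
      · intro a
        simp only [List.mem_append, List.mem_singleton, h.mem, Finset.mem_insert, exists_eq_or_imp]
        constructor
        · rintro (⟨h3, h4⟩ | rfl)
          · exact ⟨Or.inr h3, h4⟩
          · exact ⟨Or.inl rfl, h2⟩
        · rintro ⟨rfl | h3, h4⟩
          · exact Or.inr rfl
          · exact Or.inl ⟨h3, h4⟩
      · rw [hcard]; simp [h.le]
    · simp only [Expr.eval, eval_notE, eval_var, helm, e1, e2, e3] at h1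
      have h2 : m₀ COMP (m₀ SRC e) = big := by
        by_contra hc; simp [hc] at h1
      refine ⟨rfl, rfl, [], ⟨l, h.frame, h.cnt, h.buf, h.nodup, ?_, by rw [hcard]; have := h.le; omega⟩,
        by simp⟩
      intro a
      simp only [h.mem, Finset.mem_insert, exists_eq_or_imp]
      constructor
      · rintro ⟨h3, h4⟩
        exact ⟨Or.inr h3, h4⟩
      · rintro ⟨rfl | h3, h4⟩
        · exact absurd h2 h4
        · exact ⟨h3, h4⟩
  · rintro t m ⟨qs', dn, ⟨⟨l, h⟩, rfl⟩, ht, hdn, hend⟩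
    refine ⟨l, dn, h, ?_, hdn, ht⟩
    rcases hend with hend | ⟨_, hend⟩
    · exact hend.2
    · simp [Expr.eval] at hend

/-- Make the collected arcs the list of `BIG`. -/
def copyLoop : Cmd :=
  .seq (.loop (.lt (var IDX) (var CNT))
      (.seq (.store ILST (prE (var BIG) (var IDX)) (.read BUF (var IDX)))
        (setv IDX (.add (var IDX) (.const 1)))))
    (.store IDEG (var BIG) (var CNT))

theorem copyLoop_runs {W N : ℕ} {m : Mem} {big : ℕ} (hW : Fits W (big + N + 1)) {l : List ℕ}
    (hB : m BIG 0 = big) (hcnt : m CNT 0 = l.length)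
    (hbuf : ∀ (k c : ℕ), l[k]? = some c → m BUF k = c) (hl : ∀ e ∈ l, e < N) (hlen : l.length ≤ N)
    (hidx : m IDX 0 = 0) :
    Runs W copyLoop m fun t m' => Frame [ILST, IDEG, IDX] m m' ∧
      lst (m' IDEG) (m' ILST) big = l ∧
      (∀ c, c ≠ big → lst (m' IDEG) (m' ILST) c = lst (m IDEG) (m ILST) c) ∧
      t ≤ 50 * (l.length + 1) := by
  refine Runs.seq ((Runs.loop (fun k t m' => Frame [ILST, IDX] m m' ∧
    m' IDX 0 + k = l.length ∧ t ≤ 40 * m' IDX 0 ∧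
    (∀ j < m' IDX 0, m' ILST (pr big j) = m BUF j) ∧
    (∀ c, c ≠ big → ∀ j, m' ILST (pr c j) = m ILST (pr c j))) (Q := fun t m' =>
      Frame [ILST, IDX] m m' ∧ t ≤ 40 * l.length + 10 ∧
      (∀ j < l.length, m' ILST (pr big j) = m BUF j) ∧
      (∀ c, c ≠ big → ∀ j, m' ILST (pr c j) = m ILST (pr c j))) ?_ ?_ (k := l.length)
      ⟨Frame.refl _ _, by simp [hidx], by simp, by simp [hidx], by simp⟩).mono ?_)
  · rintro k t m' ⟨hfr, hk, ht, h1, h2⟩ hg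
    have e1 : m' CNT 0 = l.length := by rw [hfr CNT (by decide), hcnt]
    have e2 : m' BIG 0 = big := by rw [hfr BIG (by decide), hB]
    have e3 : m' BUF = m BUF := hfr _ (by decide)
    simp only [Expr.eval, eval_var, e1] at hg
    have hlt : m' IDX 0 < l.length := by by_contra hc; simp [hc] at hg
    have hb := hbuf _ _ (List.getElem?_eq_getElem hlt)
    have hbN : m BUF (m' IDX 0) < N := by rw [hb]; exact hl _ (List.getElem_mem hlt)
    refine (wp.runs (Q := fun m'' => m'' = (m'.write ILST (pr big (m' IDX 0))
      (m BUF (m' IDX 0))).write IDX 0 (m' IDX 0 + 1)) ?_).mono ?_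
    · simp only [wp, wp_setv, Expr.eval, eval_var, eval_prE, write_other, ne_eq,
        Nat.reduceEqDiff, not_false_eq_true, e2, e3]
      exact ⟨⟨hW.quad _ _ (by omega), hW.lin _ (by omega)⟩, hW.lin _ (by omega), trivial⟩
    · rintro t' _ ⟨ht', rfl⟩
      refine ⟨k - 1, by omega, hfr.write.write, ?_, ?_, ?_, ?_⟩
      · simp [write_same]; omega
      · simp only [write_same, Function.update_self]
        have : t' ≤ 33 := by
          refine ht'.trans ?_
          simp only [maxCost, setv, Expr.cost, var, prE]
          omega
        simp only [Expr.cost, var]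
        omega
      · simp only [write_same, write_other, ne_eq, Nat.reduceEqDiff, not_false_eq_true,
          Function.update_self]
        intro j hj
        rcases Nat.lt_succ_iff_lt_or_eq.1 hj with hj | rfl
        · rw [Function.update_of_ne (by rw [Ne, pr_inj]; omega)]; exact h1 j hj
        · simp
      · intro c hc j
        simp only [write_same, write_other, ne_eq, Nat.reduceEqDiff, not_false_eq_true]
        rw [Function.update_of_ne (by rw [Ne, pr_inj]; tauto)]
        exact h2 c hc j
  · rintro k t m' ⟨hfr, hk, ht, h1, h2⟩ hg
    have e1 : m' CNT 0 = l.length := by rw [hfr CNT (by decide), hcnt]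
    simp only [Expr.eval, eval_var, e1] at hg
    have hge : l.length ≤ m' IDX 0 := by by_contra hc; simp [not_le.1 hc] at hg
    have heq : m' IDX 0 = l.length := by omega
    rw [heq] at h1 ht
    refine ⟨hfr, ?_, h1, h2⟩
    simp only [Expr.cost, var]; omega
  · rintro t m' ⟨hfr, ht, h1, h2⟩
    have e1 : m' CNT 0 = l.length := by rw [hfr CNT (by decide), hcnt]
    have e2 : m' BIG 0 = big := by rw [hfr BIG (by decide), hB]
    have e3 : m' IDEG = m IDEG := hfr _ (by decide)
    refine (wp.runs (Q := fun m'' => m'' = m'.write IDEG big l.length) ?_).mono ?_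
    · simp only [wp, eval_var, e1, e2]
      exact ⟨⟨hW.lin _ (by omega), hW.lin _ (by omega)⟩, trivial⟩
    · rintro t' _ ⟨ht', rfl⟩
      refine ⟨hfr.mono.write, ?_, ?_, ?_⟩
      · apply List.ext_getElem?
        intro k
        by_cases hk : k < l.length
        · have := hbuf k l[k] (by simp [hk])
          simp [lst, write_same, write_other, hk, h1 k hk, this]
        · simp [lst, write_same, write_other, hk]
      · intro c hc
        simp only [lst, write_same, write_other, ne_eq, Nat.reduceEqDiff, not_false_eq_true,
          Function.update_of_ne hc, h2 c hc, e3]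
      · simp only [maxCost, Expr.cost, var] at ht'
        omega

/-! ### Merging the components on a cycle -/

theorem Fits.mono {W Z Z' : ℕ} (h : Fits W Z) (hZ : Z' ≤ Z) : Fits W Z' :=
  ⟨fun z hz => h.lin z (by omega), fun i j hij => h.quad i j (by omega)⟩

theorem SccInv.scratch {acc : ℕ → Prop} {V M L N : ℕ} {m m' : Mem} (h : SccInv acc V M L N m)
    (hm : Frame [DONE, MARK, STAMP, CNT, LIM, TDEG, TLST, BUF, TMP, BIG, NEWLEV, CPL, QUE, QT, QH,
      IDX, CUR, ELM, TAIL, HEAD] m m') (hmark : ∀ c, m' MARK c ≤ m' STAMP 0) :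
    SccInv acc V M L N m' := by
  have e1 : m' SRC = m SRC := hm _ (by decide)
  have e2 : m' DST = m DST := hm _ (by decide)
  have e3 : m' COMP = m COMP := hm _ (by decide)
  have e4 : m' LEV = m LEV := hm _ (by decide)
  have e5 : m' ODEG = m ODEG := hm _ (by decide)
  have e6 : m' OLST = m OLST := hm _ (by decide)
  have e7 : m' IDEG = m IDEG := hm _ (by decide)
  have e8 : m' ILST = m ILST := hm _ (by decide)
  have e9 : m' SIZE = m SIZE := hm _ (by decide)
  have e10 : m' MLST = m MLST := hm _ (by decide)
  have e11 : m' ACC = m ACC := hm _ (by decide)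
  have e12 : m' 1 = m 1 := hm _ (by decide)
  refine ⟨?_, ?_, ?_, ?_, ?_, ?_, ?_, ?_, ?_, ?_, ?_, ?_, hmark⟩ <;>
    simp only [e1, e2, e3, e4, e5, e6, e7, e8, e9, e10, e11, e12]
  exacts [h.ends, h.compLt, h.comp, h.outNodup, h.out, h.inNodup, h.inn, h.memNodup, h.mem,
    h.accComp, h.found, h.lev]

/-- Merge the components in the queue into the component `BIG`. -/
def mergeComps : Cmd :=
  .seq (.seq (setv QH (.const 0)) (setv IDX (.const 0)))
    (.seq relabelLoop
    (.seq (.seq (setv QH (.const 0)) (.seq (setv IDX (.const 0)) (setv CNT (.const 0))))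
    (.seq collectLoop
    (.seq (setv IDX (.const 0))
    (.seq copyLoop
      (.ite (.read ACC (var BIG)) (.store 1 (.const 1) (.const 1)) .skip))))))

theorem card_moved {V : ℕ} {m : Mem} {qs : List ℕ} {big : ℕ} {dn : Finset (ℕ × ℕ)}
    (hnodup : ∀ c ∈ qs, (lst (m SIZE) (m MLST) c).Nodup)
    (hmem : ∀ c ∈ qs, ∀ z ∈ lst (m SIZE) (m MLST) c, z < V ∧ m COMP z = c)
    (hdn : ∀ p ∈ dn, p.1 ∈ qs ∧ p.1 ≠ big ∧ p.2 < m SIZE p.1) :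
    dn.card ≤ ((Finset.range V).filter fun z => m COMP z ∈ qs ∧ m COMP z ≠ big).card := by
  refine Finset.card_le_card_of_injOn (fun p => m MLST (pr p.1 p.2)) ?_ ?_
  · intro p hp
    obtain ⟨h1, h2, h3⟩ := hdn p hp
    obtain ⟨h4, h5⟩ := hmem _ h1 _ (mem_lst.2 ⟨p.2, h3, rfl⟩)
    simp only [Finset.coe_filter, Finset.mem_range, Set.mem_ofPred_eq]
    rw [h5]
    exact ⟨h4, h1, h2⟩
  · rintro ⟨c, i⟩ hp ⟨c', i'⟩ hp' h
    obtain ⟨h1, -, h3⟩ := hdn _ hp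
    obtain ⟨h1', -, h3'⟩ := hdn _ hp'
    have h5 := (hmem _ h1 _ (mem_lst.2 ⟨i, h3, rfl⟩)).2
    have h5' := (hmem _ h1' _ (mem_lst.2 ⟨i', h3', rfl⟩)).2
    simp only at h h5 h5' h3 h3'
    rw [h] at h5
    have hc : c = c' := h5.symm.trans h5'
    subst hc
    rw [lst_inj (hnodup c h1) h3 h3' h]

/-- The part of the potential that pays for renaming components. -/
def logSize (V : ℕ) (m : Mem) : ℕ := ∑ y ∈ Finset.range V, Nat.log 2 (m SIZE (m COMP y))

/-- Smaller into larger: a vertex whose component at least doubles gains one unit of the logarithm,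
and no vertex loses any. -/
theorem logSize_add_le {V : ℕ} {m m' : Mem} {P : ℕ → Prop} [DecidablePred P]
    (hpos : ∀ y < V, 0 < m SIZE (m COMP y))
    (hP : ∀ y < V, P y → 2 * m SIZE (m COMP y) ≤ m' SIZE (m' COMP y))
    (hle : ∀ y < V, m SIZE (m COMP y) ≤ m' SIZE (m' COMP y)) :
    logSize V m + ((Finset.range V).filter P).card ≤ logSize V m' := by
  unfold logSize
  rw [Finset.card_filter, ← Finset.sum_add_distrib]
  refine Finset.sum_le_sum fun y hy => ?_
  rw [Finset.mem_range] at hy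
  split_ifs with h
  · rw [← Nat.log_mul_base (by norm_num) (hpos y hy).ne', mul_comm]
    exact Nat.log_mono_right (hP y hy h)
  · exact (Nat.add_zero _).trans_le (Nat.log_mono_right (hle y hy))

/-- The time for merging. -/
def mergeCost : ℕ :=
  sweepCost (.const 1) (.mul (notE (.eq (var CUR) (var BIG))) (.read SIZE (var CUR)))
      (.read MLST (prE (var CUR) (var IDX))) relabelBody +
    sweepCost (.const 1) (.read IDEG (var CUR)) (.read ILST (prE (var CUR) (var IDX)))
      collectBody + 100

/-- By `mut_succ` the only change is that the components between `w` and `v` become one. Three kinds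
of work occur: renamed vertices, paid for by `logSize`; incoming arcs that are inspected, all of
them in `A`; and the entries of the queue. Arcs that now run inside the component are dropped from
its list. -/
theorem mergeComps_runs {W V M : ℕ} {acc : ℕ → Prop} (hW : Fits W (2 * V + M + 2)) {m : Mem}
    (h : SccInv acc V M (M + 1) (M + 1) m) {qs : List ℕ} {big : ℕ} {A : Finset ℕ}
    (hB : m BIG 0 = big) (hqs : qs.Nodup) (hqt : m QT 0 = qs.length)
    (hque : ∀ (k c : ℕ), qs[k]? = some c → m QUE k = c)
    (hq : ∀ c, c ∈ qs ↔ ∃ x < V, m COMP x = c ∧ Rch (m SRC) (m DST) M (m DST M) x ∧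
      Rch (m SRC) (m DST) M x (m SRC M))
    (hcyc : Rch (m SRC) (m DST) M (m DST M) (m SRC M))
    (hne : m COMP (m SRC M) ≠ m COMP (m DST M))
    (hbig : big ∈ qs) (hbigle : ∀ c ∈ qs, m SIZE c ≤ m SIZE big)
    (hA : ∀ c ∈ qs, ∀ e ∈ lst (m IDEG) (m ILST) c, e ∈ A) :
    Runs W mergeComps m fun t m' => SccInv acc V (M + 1) (M + 1) (M + 1) m' ∧
      Frame [COMP, SIZE, MLST, ACC, QH, IDX, CUR, ELM, BUF, CNT, ILST, IDEG, 1] m m' ∧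
      (∀ i, i ≠ 1 → m' 1 i = m 1 i) ∧ logSize V m ≤ logSize V m' ∧
      t + mergeCost * logSize V m ≤
        mergeCost * (logSize V m' + 3 * A.card + 2 * qs.length + 3) := by
  classical
  obtain ⟨hvV, hwV⟩ := h.ends M (Nat.lt_succ_self _)
  set v := m SRC M with hv
  set w := m DST M with hw
  have hW1 := hW.lin 1 (by omega)
  -- components in the queue
  have hin : ∀ x < V, m COMP x ∈ qs ↔ Rch (m SRC) (m DST) M w x ∧ Rch (m SRC) (m DST) M x v := by
    intro x hx
    rw [hq]
    constructor
    · rintro ⟨y, hy, hxy, h1, h2⟩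
      have h3 := (h.comp y hy x hx).1 hxy
      exact ⟨h1.trans h3.1, h3.2.trans h2⟩
    · exact fun ⟨h1, h2⟩ => ⟨x, hx, rfl, h1, h2⟩
  have hrep : ∀ c ∈ qs, ∃ x < V, m COMP x = c := fun c hc => by
    obtain ⟨x, hx, hxc, -⟩ := (hq c).1 hc
    exact ⟨x, hx, hxc⟩
  have hqV : ∀ c ∈ qs, c < V := by
    intro c hc
    obtain ⟨x, hx, rfl⟩ := hrep c hc
    exact h.compLt x hx
  have hmemN : ∀ c ∈ qs, (lst (m SIZE) (m MLST) c).Nodup := by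
    intro c hc
    obtain ⟨x, hx, rfl⟩ := hrep c hc
    exact h.memNodup x hx
  have hmemV : ∀ c ∈ qs, ∀ z, z ∈ lst (m SIZE) (m MLST) c ↔ z < V ∧ m COMP z = c := by
    intro c hc
    obtain ⟨x, hx, rfl⟩ := hrep c hc
    exact h.mem x hx
  have hpos : ∀ y < V, 0 < m SIZE (m COMP y) := by
    intro y hy
    have h1 := (h.mem y hy y).2 ⟨hy, rfl⟩
    obtain ⟨i, hi, -⟩ := mem_lst.1 h1
    omega
  refine wp.seq_runs ?_
  simp only [wp, wp_setv, Expr.eval]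
  refine ⟨Nat.zero_le _, Nat.zero_le _, ?_⟩
  set m₁ : Mem := (m.write QH 0 0).write IDX 0 0 with hm₁
  have f1 : Frame [QH, IDX] m m₁ := (Frame.refl _ _).write.write
  have g1 : m₁ SIZE = m SIZE := f1 _ (by decide)
  have g2 : m₁ MLST = m MLST := f1 _ (by decide)
  have g3 : m₁ COMP = m COMP := f1 _ (by decide)
  have g4 : m₁ ACC = m ACC := f1 _ (by decide)
  refine Runs.seq ((relabelLoop_runs (V := V) (hW.mono (by omega)) (hqV _ hbig)
    (by rw [f1 BIG (by decide), hB]) hqs hqV (by rw [f1 QT (by decide), hqt])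
    (by rw [f1 QUE (by decide)]; exact hque) (by
      rw [g1, g2, g3]
      intro c hc
      have hc' : c ∈ qs := by rcases hc with rfl | hc <;> assumption
      exact ⟨hmemN c hc', fun z hz => (hmemV c hc' z).1 hz⟩)
    (by simp [hm₁, write_same, write_other]) (by simp [hm₁, write_same])).mono ?_)
  rintro t₁ m₂ ⟨dn, hR, hall, hdn, ht₁⟩
  have f2 := hR.frame
  have hsub : ∀ z, (∃ p ∈ dn, m₁ MLST (pr p.1 p.2) = z) ↔ z < V ∧ m COMP z ∈ qs ∧ m COMP z ≠ big := by
    intro z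
    rw [g2]
    constructor
    · rintro ⟨p, hp, rfl⟩
      obtain ⟨h1, h2, h3⟩ := hdn p hp
      rw [g1] at h3
      have h4 := (hmemV _ h1 _).1 (mem_lst.2 ⟨p.2, h3, rfl⟩)
      rw [h4.2]
      exact ⟨h4.1, h1, h2⟩
    · rintro ⟨h1, h2, h3⟩
      obtain ⟨i, hi, hz⟩ := mem_lst.1 ((hmemV _ h2 z).2 ⟨h1, rfl⟩)
      exact ⟨(m COMP z, i), hall _ h2 h3 i (by rw [g1]; exact hi), hz⟩
  have hcomp : ∀ z < V, m₂ COMP z = if m COMP z ∈ qs then big else m COMP z := by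
    intro z hz
    by_cases h1 : ∃ p ∈ dn, m₁ MLST (pr p.1 p.2) = z
    · rw [(hR.comp z).1 h1, if_pos ((hsub z).1 h1).2.1]
    · rw [(hR.comp z).2 (by push Not at h1; exact h1), g3]
      split_ifs with h2
      · by_contra h3
        exact h1 ((hsub z).2 ⟨hz, h2, h3⟩)
      · rfl
  have hcin : ∀ z < V, m₂ COMP z = big ↔ m COMP z ∈ qs := by
    intro z hz
    rw [hcomp z hz]
    split_ifs with h1
    · simp [h1]
    · simp only [h1, iff_false]
      rintro rfl
      exact h1 hbig
  have hcout : ∀ z < V, ∀ c, c ∉ qs → (m₂ COMP z = c ↔ m COMP z = c) := by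
    intro z hz c hc
    rw [hcomp z hz]
    split_ifs with h1
    · constructor
      · rintro rfl; exact absurd hbig hc
      · rintro rfl; exact absurd h1 hc
    · rfl
  have hcard : dn.card ≤ ((Finset.range V).filter fun z => m COMP z ∈ qs ∧ m COMP z ≠ big).card := by
    refine card_moved hmemN (fun c hc z hz => (hmemV c hc z).1 hz) fun p hp => ?_
    have := hdn p hp
    rwa [g1] at this
  refine wp.seq_runs ?_
  simp only [wp, wp_setv, Expr.eval]
  refine ⟨Nat.zero_le _, Nat.zero_le _, Nat.zero_le _, ?_⟩
  set m₃ : Mem := ((m₂.write QH 0 0).write IDX 0 0).write CNT 0 0 with hm₃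
  have f3 : Frame [QH, IDX, CNT] m₂ m₃ := (Frame.refl _ _).write.write.write
  have f13 : Frame [COMP, SIZE, MLST, ACC, QH, IDX, CUR, ELM, CNT] m m₃ :=
    (f1.trans (S'' := [COMP, SIZE, MLST, ACC, QH, IDX, CUR, ELM]) f2).trans f3
  have i1 : m₃ IDEG = m IDEG := f13 _ (by decide)
  have i2 : m₃ ILST = m ILST := f13 _ (by decide)
  have i3 : m₃ SRC = m SRC := f13 _ (by decide)
  have i4 : m₃ COMP = m₂ COMP := f3 _ (by decide)
  have hinV : ∀ c ∈ qs, ∀ e, e ∈ lst (m IDEG) (m ILST) c ↔ e < M + 1 ∧ m COMP (m DST e) = c ∧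
      m COMP (m SRC e) ≠ c ∧ m LEV (m SRC e) = m LEV (m DST e) := by
    intro c hc
    obtain ⟨x, hx, rfl⟩ := hrep c hc
    exact h.inn x hx
  have hinN : ∀ c ∈ qs, (lst (m IDEG) (m ILST) c).Nodup := by
    intro c hc
    obtain ⟨x, hx, rfl⟩ := hrep c hc
    exact h.inNodup x hx
  refine Runs.seq ((collectLoop_runs (V := V) (N := M + 1) (hW.mono (by omega)) (big := big)
    (by rw [f13 BIG (by decide), hB]) hqs hqV (by rw [f13 QT (by decide), hqt])
    (by rw [f13 QUE (by decide)]; exact hque)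
    (by rw [i1, i2]; exact fun c hc => ⟨hinN c hc, fun e he => ((hinV c hc e).1 he).1⟩)
    (by
      rw [i1, i2]
      intro c hc c' hc' e he he'
      exact ((hinV c hc e).1 he).2.1.symm.trans ((hinV c' hc' e).1 he').2.1)
    (by simp [hm₃, write_same, write_other]) (by simp [hm₃, write_same, write_other])
    (by simp [hm₃, write_same])).mono ?_)
  rintro t₂ m₄ ⟨l, dn', hC, hall', hdn', ht₂⟩
  rw [i1] at hall' hdn'
  have f4 := hC.frame
  have hl : ∀ e, e ∈ l ↔ e < M + 1 ∧ m COMP (m DST e) ∈ qs ∧ m COMP (m SRC e) ∉ qs ∧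
      m LEV (m SRC e) = m LEV (m DST e) := by
    intro e
    rw [hC.mem, i2, i3, i4]
    constructor
    · rintro ⟨⟨p, hp, rfl⟩, h1⟩
      obtain ⟨h2, h3⟩ := hdn' p hp
      obtain ⟨h4, h5, h6, h7⟩ := (hinV _ h2 _).1 (mem_lst.2 ⟨p.2, h3, rfl⟩)
      refine ⟨h4, by rw [h5]; exact h2, fun h8 => h1 ((hcin _ (h.ends _ h4).1).2 h8), h7⟩
    · rintro ⟨h1, h2, h3, h4⟩
      refine ⟨?_, fun h5 => h3 ((hcin _ (h.ends _ h1).1).1 h5)⟩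
      have h5 := (hinV _ h2 e).2 ⟨h1, rfl, fun h6 => h3 (by rw [h6]; exact h2), h4⟩
      obtain ⟨i, hi, he⟩ := mem_lst.1 h5
      exact ⟨(_, i), hall' _ h2 i hi, he⟩
  have hdnA : dn'.card ≤ A.card := by
    refine Finset.card_le_card_of_injOn (fun p => m ILST (pr p.1 p.2)) ?_ ?_
    · intro p hp
      obtain ⟨h2, h3⟩ := hdn' p hp
      exact hA _ h2 _ (mem_lst.2 ⟨p.2, h3, rfl⟩)
    · rintro ⟨c, i⟩ hp ⟨c', i'⟩ hp' he
      obtain ⟨h2, h3⟩ := hdn' _ hp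
      obtain ⟨h2', h3'⟩ := hdn' _ hp'
      simp only at he h2 h3 h2' h3'
      have h5 := ((hinV _ h2 _).1 (mem_lst.2 ⟨i, h3, rfl⟩)).2.1
      have h5' := ((hinV _ h2' _).1 (mem_lst.2 ⟨i', h3', rfl⟩)).2.1
      rw [he] at h5
      have hc : c = c' := h5.symm.trans h5'
      subst hc
      rw [lst_inj (hinN c h2) h3 h3' he]
  refine wp.seq_runs ?_
  simp only [wp_setv, Expr.eval]
  refine ⟨Nat.zero_le _, ?_⟩
  set m₅ : Mem := m₄.write IDX 0 0 with hm₅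
  have f5 : Frame [IDX] m₄ m₅ := (Frame.refl _ _).write
  have f15 : Frame [COMP, SIZE, MLST, ACC, QH, IDX, CUR, ELM, CNT, BUF] m m₅ :=
    (f13.trans (S'' := [COMP, SIZE, MLST, ACC, QH, IDX, CUR, ELM, CNT, BUF]) f4).trans f5
  have f35 : Frame [BUF, CNT, QH, IDX, CUR, ELM] m₂ m₅ :=
    (f3.trans (S'' := [BUF, CNT, QH, IDX, CUR, ELM]) f4).trans f5
  have hlM : l.length ≤ M + 1 := length_le_of_lt hC.nodup fun e he => ((hl e).1 he).1
  refine Runs.seq ((copyLoop_runs (N := M + 1) (big := big) (l := l)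
    (hW.mono (by have := hqV _ hbig; omega)) (by rw [f15 BIG (by decide), hB])
    (by rw [f5 CNT (by decide)]; exact hC.cnt) (by rw [f5 BUF (by decide)]; exact hC.buf)
    (fun e he => ((hl e).1 he).1) hlM (by simp [hm₅, write_same])).mono ?_)
  rintro t₃ m₆ ⟨f6, hlist, hother, ht₃⟩
  rw [f15 IDEG (by decide), f15 ILST (by decide)] at hother
  have f26 : Frame [BUF, CNT, QH, IDX, CUR, ELM, ILST, IDEG] m₂ m₆ := f35.trans f6
  have f16 : Frame [COMP, SIZE, MLST, ACC, QH, IDX, CUR, ELM, CNT, BUF, ILST, IDEG] m m₆ :=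
    f15.trans f6
  have j1 : m₆ SRC = m SRC := f16 _ (by decide)
  have j2 : m₆ DST = m DST := f16 _ (by decide)
  have j3 : m₆ COMP = m₂ COMP := f26 _ (by decide)
  have j4 : m₆ LEV = m LEV := f16 _ (by decide)
  have j5 : m₆ ODEG = m ODEG := f16 _ (by decide)
  have j6 : m₆ OLST = m OLST := f16 _ (by decide)
  have j7 : m₆ SIZE = m₂ SIZE := f26 _ (by decide)
  have j8 : m₆ MLST = m₂ MLST := f26 _ (by decide)
  have j9 : m₆ ACC = m₂ ACC := f26 _ (by decide)
  have j10 : m₆ 1 = m 1 := f16 _ (by decide)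
  have j11 : m₆ MARK = m MARK := f16 _ (by decide)
  have j12 : m₆ STAMP = m STAMP := f16 _ (by decide)
  have j13 : m₆ BIG 0 = big := by rw [f16 BIG (by decide), hB]
  have hmem' : ∀ c ∈ qs, ∀ z, (m COMP z = c → z < V → c = big ∨ ∃ p ∈ dn, m₁ MLST (pr p.1 p.2) = z) := by
    intro c hc z hz hzV
    by_cases h1 : c = big
    · exact Or.inl h1
    · exact Or.inr ((hsub z).2 ⟨hzV, hz ▸ hc, hz ▸ h1⟩)
  have haccBig : m₂ ACC big ≠ 0 ↔ ∃ z < V, m COMP z ∈ qs ∧ acc z := by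
    rw [hR.acc, g4]
    constructor
    · rintro (h1 | ⟨p, hp, h1⟩)
      · obtain ⟨x, hx, hxb⟩ := hrep _ hbig
        rw [← hxb] at h1
        obtain ⟨z, hz, hzx, hza⟩ := (h.accComp x hx).1 h1
        exact ⟨z, hz, by rw [hzx, hxb]; exact hbig, hza⟩
      · obtain ⟨x, hx, hxb⟩ := hrep _ (hdn p hp).1
        rw [← hxb] at h1
        obtain ⟨z, hz, hzx, hza⟩ := (h.accComp x hx).1 h1
        exact ⟨z, hz, by rw [hzx, hxb]; exact (hdn p hp).1, hza⟩
    · rintro ⟨z, hz, hzq, hza⟩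
      have h1 := (h.accComp z hz).2 ⟨z, hz, rfl, hza⟩
      by_cases h2 : m COMP z = big
      · rw [h2] at h1; exact Or.inl h1
      · obtain ⟨i, hi, -⟩ := mem_lst.1 ((hmemV _ hzq z).2 ⟨hz, rfl⟩)
        exact Or.inr ⟨(m COMP z, i), hall _ hzq h2 i (by rw [g1]; exact hi), h1⟩
  have hvq : m COMP v ∈ qs := (hin v hvV).2 ⟨hcyc, Rch.refl _⟩
  have hwq : m COMP w ∈ qs := (hin w hwV).2 ⟨Rch.refl _, hcyc⟩
  have hmut : ∀ x < V, ∀ y < V, m₂ COMP x = m₂ COMP y ↔ Mut (m SRC) (m DST) (M + 1) x y := by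
    intro x hx y hy
    rw [mut_succ, ← h.comp x hx y hy, ← hin x hx, ← hin y hy, hcomp x hx, hcomp y hy]
    by_cases h1 : m COMP x ∈ qs <;> by_cases h2 : m COMP y ∈ qs
    · simp [h1, h2]
    · simp only [h1, h2, if_true, if_false, and_false, or_false]
      constructor
      · rintro rfl; exact absurd hbig h2
      · intro h3; exact absurd (h3 ▸ h1) h2
    · simp only [h1, h2, if_true, if_false, false_and, or_false]
      constructor
      · intro h3; exact absurd (h3.symm ▸ hbig) h1
      · intro h3; exact absurd (h3.symm ▸ h2) h1
    · simp [h1, h2]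
  have hmemF : ∀ x < V, ∀ z, z ∈ lst (m₂ SIZE) (m₂ MLST) (m₂ COMP x) ↔
      z < V ∧ m₂ COMP z = m₂ COMP x := by
    intro x hx z
    by_cases h1 : m COMP x ∈ qs
    · rw [(hcin x hx).2 h1, hR.mem, g1, g2, hmemV _ hbig, ← g2, hsub]
      constructor
      · rintro (⟨h2, h3⟩ | ⟨h2, h3, h4⟩)
        · exact ⟨h2, (hcin z h2).2 (h3 ▸ hbig)⟩
        · exact ⟨h2, (hcin z h2).2 h3⟩
      · rintro ⟨h2, h3⟩
        have h4 := (hcin z h2).1 h3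
        by_cases h5 : m COMP z = big
        · exact Or.inl ⟨h2, h5⟩
        · exact Or.inr ⟨h2, h4, h5⟩
    · have h2 : m₂ COMP x = m COMP x := by rw [hcomp x hx, if_neg h1]
      have h3 : m COMP x ≠ big := fun h3 => h1 (h3 ▸ hbig)
      obtain ⟨o1, -, o3⟩ := hR.other _ h3
      have : lst (m₂ SIZE) (m₂ MLST) (m COMP x) = lst (m SIZE) (m MLST) (m COMP x) := by
        simp only [lst, o1, o3, g1, g2]
      rw [h2, this, h.mem x hx]
      refine and_congr_right fun hz => ?_
      rw [hcout z hz _ h1]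
  have hmemNF : ∀ x < V, (lst (m₂ SIZE) (m₂ MLST) (m₂ COMP x)).Nodup := by
    intro x hx
    by_cases h1 : m COMP x ∈ qs
    · rw [(hcin x hx).2 h1]; exact hR.nodup
    · have h2 : m₂ COMP x = m COMP x := by rw [hcomp x hx, if_neg h1]
      have h3 : m COMP x ≠ big := fun h3 => h1 (h3 ▸ hbig)
      obtain ⟨o1, -, o3⟩ := hR.other _ h3
      have : lst (m₂ SIZE) (m₂ MLST) (m COMP x) = lst (m SIZE) (m MLST) (m COMP x) := by
        simp only [lst, o1, o3, g1, g2]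
      rw [h2, this]
      exact h.memNodup x hx
  have haccF : ∀ x < V, m₂ ACC (m₂ COMP x) ≠ 0 ↔ ∃ z < V, m₂ COMP z = m₂ COMP x ∧ acc z := by
    intro x hx
    by_cases h1 : m COMP x ∈ qs
    · rw [(hcin x hx).2 h1, haccBig]
      refine exists_congr fun z => and_congr_right fun hz => ?_
      rw [hcin z hz]
    · have h2 : m₂ COMP x = m COMP x := by rw [hcomp x hx, if_neg h1]
      have h3 : m COMP x ≠ big := fun h3 => h1 (h3 ▸ hbig)
      rw [h2, (hR.other _ h3).2.1, g4, h.accComp x hx]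
      refine exists_congr fun z => and_congr_right fun hz => ?_
      rw [hcout z hz _ h1]
  have hinF : ∀ x < V, (lst (m₆ IDEG) (m₆ ILST) (m₂ COMP x)).Nodup ∧
      ∀ e, e ∈ lst (m₆ IDEG) (m₆ ILST) (m₂ COMP x) ↔ e < M + 1 ∧ m₂ COMP (m DST e) = m₂ COMP x ∧
        m₂ COMP (m SRC e) ≠ m₂ COMP x ∧ m LEV (m SRC e) = m LEV (m DST e) := by
    intro x hx
    by_cases h1 : m COMP x ∈ qs
    · rw [(hcin x hx).2 h1, hlist]
      refine ⟨hC.nodup, fun e => ?_⟩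
      rw [hl]
      refine and_congr_right fun he => ?_
      rw [hcin _ (h.ends e he).2, Ne, hcin _ (h.ends e he).1]
    · have h2 : m₂ COMP x = m COMP x := by rw [hcomp x hx, if_neg h1]
      have h3 : m COMP x ≠ big := fun h3 => h1 (h3 ▸ hbig)
      rw [h2, hother _ h3]
      refine ⟨h.inNodup x hx, fun e => ?_⟩
      rw [h.inn x hx]
      refine and_congr_right fun he => ?_
      rw [hcout _ (h.ends e he).2 _ h1, Ne, Ne, hcout _ (h.ends e he).1 _ h1]
  -- The merged component contains `v` and `w`, which are different vertices, so an accepting member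
  -- always has a partner there.
  have hfoundF : (m 1 1 ≠ 0 ∨ m₂ ACC big ≠ 0) ↔
      ∃ x < V, ∃ y < V, x ≠ y ∧ m₂ COMP x = m₂ COMP y ∧ acc x := by
    rw [h.found, haccBig]
    constructor
    · rintro (⟨x, hx, y, hy, hxy, he, ha⟩ | ⟨z, hz, hzq, ha⟩)
      · exact ⟨x, hx, y, hy, hxy, by rw [hcomp x hx, hcomp y hy, he], ha⟩
      · have h1 : v ≠ w := by rintro h1; exact hne (by rw [h1])
        by_cases h2 : z = v
        · exact ⟨z, hz, w, hwV, h2 ▸ h1, by rw [(hcin z hz).2 hzq, (hcin w hwV).2 hwq], ha⟩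
        · exact ⟨z, hz, v, hvV, h2, by rw [(hcin z hz).2 hzq, (hcin v hvV).2 hvq], ha⟩
    · rintro ⟨x, hx, y, hy, hxy, he, ha⟩
      by_cases h1 : m COMP x ∈ qs
      · exact Or.inr ⟨x, hx, h1, ha⟩
      · refine Or.inl ⟨x, hx, y, hy, hxy, ?_, ha⟩
        have h2 : m₂ COMP x = m COMP x := by rw [hcomp x hx, if_neg h1]
        rw [h2] at he
        exact ((hcout y hy _ h1).1 he.symm).symm
  have hfin : ∀ b : ℕ, (b ≠ 0 ↔ m 1 1 ≠ 0 ∨ m₂ ACC big ≠ 0) →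
      SccInv acc V (M + 1) (M + 1) (M + 1) (m₆.write 1 1 b) := by
    intro b hb
    refine ⟨?_, ?_, ?_, ?_, ?_, ?_, ?_, ?_, ?_, ?_, ?_, ?_, ?_⟩ <;>
      simp only [write_same, write_other, ne_eq, not_false_eq_true,
        OfNat.ofNat_ne_one, j1, j2, j3, j4, j5, j6, j7, j8, j9, j11, j12, Function.update_self]
    · exact h.ends
    · intro x hx
      rw [hcomp x hx]
      split_ifs
      exacts [hqV _ hbig, h.compLt x hx]
    · exact hmut
    · exact h.outNodup
    · exact h.out
    · exact fun x hx => (hinF x hx).1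
    · exact fun x hx => (hinF x hx).2
    · exact hmemNF
    · exact hmemF
    · exact haccF
    · rw [← ne_eq, hb, hfoundF]
    · exact h.lev
    · exact h.mark
  -- A component that is moved was at most as large as `big`, and the result contains both; hence
  -- the factor 2.
  have hlog : logSize V m + dn.card ≤ logSize V m₆ := by
    have hsz : ∀ y < V, m COMP y ∈ qs → m COMP y ≠ big → 2 * m SIZE (m COMP y) ≤ m₂ SIZE big := by
      intro y hy h1 h2
      have h3 : m SIZE (m COMP y) ≤ dn.card := by
        have : ((Finset.range (m SIZE (m COMP y))).image fun i => (m COMP y, i)) ⊆ dn := by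
          intro p hp
          obtain ⟨i, hi, rfl⟩ := Finset.mem_image.1 hp
          exact hall _ h1 h2 i (by rw [g1]; simpa using hi)
        have h4 := Finset.card_le_card this
        rwa [Finset.card_image_of_injective _ (fun a b hab => by simpa using hab),
          Finset.card_range] at h4
      have := hbigle _ h1
      rw [hR.size, g1]
      omega
    refine (Nat.add_le_add_left hcard _).trans (logSize_add_le hpos ?_ ?_)
    · rintro y hy ⟨h1, h2⟩
      rw [j7, j3, (hcin y hy).2 h1]
      exact hsz y hy h1 h2
    · intro y hy
      rw [j7, j3]
      by_cases h1 : m COMP y ∈ qs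
      · rw [(hcin y hy).2 h1, hR.size, g1]
        have := hbigle _ h1
        omega
      · have h2 : m₂ COMP y = m COMP y := by rw [hcomp y hy, if_neg h1]
        have h3 : m COMP y ≠ big := fun h3 => h1 (h3 ▸ hbig)
        rw [h2, (hR.other _ h3).1, g1]
  have htime : ∀ t ≤ maxCost (.seq (setv QH (.const 0)) (setv IDX (.const 0))), ∀ t' ≤ maxCost
      (.seq (setv QH (.const 0)) (.seq (setv IDX (.const 0)) (setv CNT (.const 0)))),
      ∀ t'' ≤ maxCost (setv IDX (.const 0)), ∀ s ≤ 10,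
      t + (t₁ + (t' + (t₂ + (t'' + (t₃ + s))))) + mergeCost * logSize V m ≤
        mergeCost * (logSize V m₆ + 3 * A.card + 2 * qs.length + 3) := by
    intro t ht t' ht' t'' ht'' s hs
    simp only [maxCost, setv, Expr.cost] at ht ht' ht''
    have h1 := hC.le
    set a := sweepCost (.const 1) (.mul (notE (.eq (var CUR) (var BIG))) (.read SIZE (var CUR)))
      (.read MLST (prE (var CUR) (var IDX))) relabelBody
    set b := sweepCost (.const 1) (.read IDEG (var CUR)) (.read ILST (prE (var CUR) (var IDX)))
      collectBody
    have hk : mergeCost = a + b + 100 := rfl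
    have h2 : mergeCost * (logSize V m + dn.card) ≤ mergeCost * logSize V m₆ :=
      Nat.mul_le_mul_left _ hlog
    have h3 : a * (dn.card + qs.length + 1) ≤ mergeCost * (dn.card + qs.length + 1) :=
      Nat.mul_le_mul_right _ (by omega)
    have h4 : b * (dn'.card + qs.length + 1) ≤ mergeCost * (A.card + qs.length + 1) :=
      Nat.mul_le_mul (by omega) (by omega)
    have h5 : 50 * (l.length + 1) ≤ mergeCost * A.card + 50 := by nlinarith
    have h6 : 100 ≤ mergeCost := by omega
    nlinarith
  refine Runs.ite (fun h1 => ?_) (fun h1 => ?_)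
  · simp only [Expr.eval, eval_var, j9, j13] at h1
    refine (wp.runs (Q := fun m' => m' = m₆.write 1 1 1) ?_).mono ?_
    · simp only [wp, Expr.eval, and_true]
      exact ⟨hW1, hW1⟩
    · rintro t _ ⟨ht, rfl⟩
      intro s'' hs'' s' hs' s hs
      refine ⟨hfin 1 (by simp [h1]), f16.mono.write, fun i hi => by simp [write_same, hi, j10], ?_⟩
      have hlog' : logSize V (m₆.write 1 1 1) = logSize V m₆ := by
        simp only [logSize, write_other, ne_eq, OfNat.ofNat_ne_one, not_false_eq_true]
      rw [hlog']
      refine ⟨by omega, htime s hs s' hs' s'' hs'' _ ?_⟩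
      simp only [maxCost, Expr.cost, var] at ht ⊢
      omega
  · simp only [Expr.eval, eval_var, j9, j13] at h1
    refine Runs.skip ?_
    intro s'' hs'' s' hs' s hs
    refine ⟨?_, f16.mono, fun i _ => by rw [j10], by omega, htime s hs s' hs' s'' hs'' _ ?_⟩
    · have := hfin (m₆ 1 1) (by rw [j10]; simp [h1])
      convert this using 1
      funext a i
      simp only [Mem.write]
      split_ifs with h2
      · rw [h2.1, h2.2]
      · rfl
    · simp only [Expr.cost, var]
      omega

/-! ### Insertion of an arc -/

theorem card_le_sum_of_pairs {dn : Finset (ℕ × ℕ)} {s : Finset ℕ} {dg : ℕ → ℕ}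
    (h : ∀ p ∈ dn, p.1 ∈ s ∧ p.2 < dg p.1) : dn.card ≤ ∑ c ∈ s, dg c := by
  calc dn.card ≤ (s.sigma fun c => Finset.range (dg c)).card := by
        refine Finset.card_le_card_of_injOn (fun p => ⟨p.1, p.2⟩) (fun p hp => ?_) ?_
        · simpa using h p hp
        · rintro ⟨a, b⟩ _ ⟨c, d⟩ _ h
          simpa using h
    _ = _ := by simp

theorem SccInv.backPre {acc : ℕ → Prop} {V M L : ℕ} {m : Mem} (h : SccInv acc V M L L m)
    (hM : M ≤ L) : BackPre V L m :=
  ⟨h.ends, h.compLt, fun x hx y hy hxy => ((h.comp x hx y hy).1 hxy).1.mono hM, h.inNodup, h.inn,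
    h.lev.1, h.mark⟩

/-- The components do not change if the new arc closes no cycle through different components. -/
theorem SccInv.step {acc : ℕ → Prop} {V M L N : ℕ} {m : Mem} (h : SccInv acc V M L N m)
    (hM : M < N) (hc : m COMP (m SRC M) = m COMP (m DST M) ∨
      ¬ Rch (m SRC) (m DST) M (m DST M) (m SRC M)) : SccInv acc V (M + 1) L N m := by
  refine { h with comp := fun x hx y hy => ?_ }
  rw [mut_succ, h.comp x hx y hy]
  constructor
  · exact Or.inl
  · rintro (h1 | ⟨⟨h1, h2⟩, h3, h4⟩)
    · exact h1
    · rcases hc with hc | hc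
      · obtain ⟨h5, h6⟩ := (h.comp _ (h.ends M hM).1 _ (h.ends M hM).2).1 hc
        exact ⟨(h2.trans h5).trans h3, (h4.trans h5).trans h1⟩
      · exact absurd (h1.trans h2) hc

/-- Look for a cycle through the arc from `TAIL` to `HEAD`, and merge the components on it. -/
def closeCycle : Cmd :=
  .ite (.eq (.read LEV (var TAIL)) (.read LEV (var HEAD)))
    (.seq (setv LIM (.add (var DONE) (.const 2)))
    (.seq searchBack
      (.ite (.eq (.read MARK (.read COMP (var HEAD))) (var STAMP))
        (.seq searchForward mergeComps)
        .skip)))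
    .skip

/-- The factor in the running time of `closeCycle`. -/
def cycleCost : ℕ := backCost + forwardCost + 8 * mergeCost + 200

/-- If the levels of `v` and `w` differ after the adjustment, the new arc closes no cycle. Otherwise
every path from `w` to `v` stays in their level, so the backward search decides whether there is
one. The set `A` contains every arc that this search can traverse, and its size bounds both
searches. -/
theorem closeCycle_runs {W V M : ℕ} {acc : ℕ → Prop} (hW : Fits W (2 * V + M + 3)) {m : Mem}
    (h : SccInv acc V M (M + 1) (M + 1) m) (hDONE : m DONE 0 = M) (hTAIL : m TAIL 0 = m SRC M)
    (hHEAD : m HEAD 0 = m DST M) (hne : m COMP (m SRC M) ≠ m COMP (m DST M))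
    (hσ : m STAMP 0 + 2 ≤ W) {A : Finset ℕ}
    (hA : m LEV (m SRC M) = m LEV (m DST M) → ∀ e < M + 1, m COMP (m SRC e) ≠ m COMP (m DST e) →
      m LEV (m SRC e) = m LEV (m SRC M) → m LEV (m DST e) = m LEV (m SRC M) →
      Rch (m SRC) (m DST) M (m DST e) (m SRC M) → e ∈ A) :
    Runs W closeCycle m fun t m' => SccInv acc V (M + 1) (M + 1) (M + 1) m' ∧
      Frame [1, COMP, IDEG, ILST, SIZE, MLST, ACC, MARK, STAMP, CNT, LIM, TDEG, TLST, BUF, TMP, BIG,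
        QUE, QT, QH, IDX, CUR, ELM] m m' ∧
      (∀ i, i ≠ 1 → m' 1 i = m 1 i) ∧ m' STAMP 0 ≤ m STAMP 0 + 2 ∧ logSize V m ≤ logSize V m' ∧
      t + cycleCost * logSize V m ≤ cycleCost * (logSize V m' + A.card + 1) := by
  classical
  obtain ⟨hvV, hwV⟩ := h.ends M (Nat.lt_succ_self _)
  set v := m SRC M with hv
  set w := m DST M with hw
  have hmon := h.lev.1
  have hmonM : ∀ e < M, m LEV (m SRC e) ≤ m LEV (m DST e) := fun e he => hmon e (by omega)
  refine Runs.ite (fun h0 => ?_) (fun h0 => ?_)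
  swap
  · simp only [Expr.eval, eval_var, hTAIL, hHEAD] at h0
    have h1 : m LEV v ≠ m LEV w := by intro h1; simp [h1] at h0
    refine Runs.skip ⟨h.step (Nat.lt_succ_self _) (Or.inr fun h2 => h1 ?_), Frame.refl _ _,
      fun _ _ => rfl, by omega, le_rfl, ?_⟩
    · exact le_antisymm (hmon M (Nat.lt_succ_self _)) (h2.lev_le hmonM)
    · have : (11 : ℕ) ≤ cycleCost := by unfold cycleCost; omega
      simp only [Expr.cost, var]
      nlinarith
  simp only [Expr.eval, eval_var, hTAIL, hHEAD] at h0
  have hlev : m LEV v = m LEV w := by by_contra h1; simp [h1] at h0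
  specialize hA hlev
  refine wp.seq_runs ?_
  simp only [wp_setv, Expr.eval, eval_var, hDONE]
  refine ⟨hW.lin _ (by omega), ?_⟩
  -- The limit exceeds the number `M + 1` of arcs, so this search is never interrupted.
  set m₁ : Mem := m.write LIM 0 (M + 2) with hm₁
  have f1 : Frame [LIM] m m₁ := (Frame.refl _ _).write
  have hS1 : SccInv acc V M (M + 1) (M + 1) m₁ := h.scratch f1.mono (by
    rw [f1 MARK (by decide), f1 STAMP (by decide)]; exact h.mark)
  have a1 : m₁ SRC = m SRC := f1 _ (by decide)
  have a2 : m₁ DST = m DST := f1 _ (by decide)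
  have a3 : m₁ COMP = m COMP := f1 _ (by decide)
  have a4 : m₁ LEV = m LEV := f1 _ (by decide)
  have a5 : m₁ IDEG = m IDEG := f1 _ (by decide)
  have a6 : m₁ ILST = m ILST := f1 _ (by decide)
  have a7 : m₁ STAMP = m STAMP := f1 _ (by decide)
  refine Runs.seq ((searchBack_runs (hW.mono (by omega)) (hS1.backPre (Nat.le_succ _)) hvV
    (by rw [f1 TAIL (by decide), hTAIL]) (by rw [a7]; omega)).mono ?_)
  rintro t₁ m₃ ⟨m₂, qs, dn, f2, hσ2, hB, ht₁, hqlen, hdn, hdnN, -, hdnA, -, hend⟩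
  rw [a5] at hdn hend
  rw [a6] at hdnA
  simp only [a1, a2, a3, a4, a7] at hB hend hσ2
  have hlim : m₁ LIM 0 = M + 2 := by simp [hm₁, write_same]
  have f3 := hB.frame
  have f13 : Frame [MARK, STAMP, CNT, LIM, TDEG, TLST, TMP, QUE, QT, QH, IDX, CUR, ELM] m m₃ :=
    (f1.trans (S'' := [STAMP, MARK, QUE, QT, CNT, TDEG, QH, IDX, LIM]) f2).trans f3
  have b1 : m₃ SRC = m SRC := f13 _ (by decide)
  have b2 : m₃ DST = m DST := f13 _ (by decide)
  have b3 : m₃ COMP = m COMP := f13 _ (by decide)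
  have b5 : m₃ IDEG = m IDEG := f13 _ (by decide)
  have b6 : m₃ ILST = m ILST := f13 _ (by decide)
  have b7 : m₃ STAMP 0 = m STAMP 0 + 1 := by rw [f3 STAMP (by decide), hσ2]
  have b8 : m₃ HEAD 0 = w := by rw [f13 HEAD (by decide), hHEAD]
  have b9 : m₃ SIZE = m SIZE := f13 _ (by decide)
  have c1 : m₂ SRC = m SRC := by rw [f2 SRC (by decide), a1]
  have c3 : m₂ COMP = m COMP := by rw [f2 COMP (by decide), a3]
  have c6 : m₂ ILST = m ILST := by rw [f2 ILST (by decide), a6]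
  have hcic : ∀ c i, inComp m₂ c i = m COMP (m SRC (m ILST (pr c i))) := by
    intro c i; simp only [inComp, c1, c3, c6]
  obtain ⟨-, hall, hcompl⟩ : m₃ QH 0 = m₃ QT 0 ∧ (∀ c ∈ qs, ∀ i < m IDEG c, (c, i) ∈ dn) ∧
      ∀ x < V, Rch (m SRC) (m DST) (M + 1) x v → m LEV x = m LEV v → m COMP x ∈ qs := by
    rcases hend with hend | ⟨-, hend⟩
    · exact hend
    · omega
  have hmark : ∀ c, m₃ MARK c ≤ m₃ STAMP 0 := by
    rw [b7, ← hσ2]; exact hB.mark_le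
  have hS3 : SccInv acc V M (M + 1) (M + 1) m₃ := h.scratch f13.mono hmark
  -- arcs in the lists of the components found
  have harc : ∀ c ∈ qs, ∀ i < m IDEG c, m ILST (pr c i) < M + 1 ∧ m COMP (m DST (m ILST (pr c i))) = c ∧
      m COMP (m SRC (m ILST (pr c i))) ≠ c ∧ m ILST (pr c i) ∈ A ∧
      Rch (m SRC) (m DST) M (m DST (m ILST (pr c i))) v := by
    intro c hc i hi
    obtain ⟨x, hx, rfl, hxv, hlx⟩ := hB.good c hc
    simp only [a1, a2, a3, a4] at hxv hlx hi ⊢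
    have he : m ILST (pr (m COMP x) i) ∈ lst (m IDEG) (m ILST) (m COMP x) := mem_lst.2 ⟨i, hi, rfl⟩
    obtain ⟨h1, h2, h3, h4⟩ := (h.inn x hx _).1 he
    have hd := (h.ends _ h1).2
    obtain ⟨h5, h6⟩ := (h.comp _ hd _ hx).1 h2
    have h7 : Rch (m SRC) (m DST) M (m DST (m ILST (pr (m COMP x) i))) v :=
      h5.trans (rch_succ_to_src.1 hxv)
    have h8 : m LEV (m DST (m ILST (pr (m COMP x) i))) = m LEV v := by
      rw [← hlx]
      exact le_antisymm (h5.lev_le hmonM) (h6.lev_le hmonM)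
    exact ⟨h1, h2, h3, hA _ h1 (fun h9 => h3 (h9.trans h2)) (h4.trans h8) h8 h7, h7⟩
  have hdnA' : dn.card ≤ A.card := hdnA A fun p hp => by
    obtain ⟨h1, h2⟩ := hdn p hp
    exact (harc _ h1 _ h2).2.2.2.1
  have hcard1 : 1 ≤ cycleCost := by unfold cycleCost; omega
  refine Runs.ite (fun h1 => ?_) (fun h1 => ?_)
  swap
  · simp only [Expr.eval, eval_var, b8, b3, b7] at h1
    have h2 : m₃ MARK (m COMP w) ≠ m STAMP 0 + 1 := by intro h2; simp [h2] at h1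
    rw [← hσ2, Ne, hB.mark] at h2
    have h3 : ¬ Rch (m SRC) (m DST) M w v := fun h3 =>
      h2 (hcompl w hwV (h3.mono (Nat.le_succ _)) hlev.symm)
    refine Runs.skip ?_
    intro s hs
    refine ⟨hS3.step (Nat.lt_succ_self _) (Or.inr ?_), f13.mono, fun i _ => by rw [f13 1 (by decide)],
      by omega, ?_⟩
    · rw [b1, b2]; exact h3
    · have h4 : logSize V m₃ = logSize V m := by simp only [logSize, b3, b9]
      rw [h4]
      refine ⟨le_rfl, ?_⟩
      simp only [maxCost, setv, Expr.cost, var] at hs ⊢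
      have h5 : (backCost + 100) * (dn.card + 1) ≤ (backCost + 100) * (A.card + 1) :=
        Nat.mul_le_mul_left _ (by omega)
      have h6 : cycleCost * (A.card + 1) =
          (backCost + 100) * (A.card + 1) + (forwardCost + 8 * mergeCost + 100) * (A.card + 1) := by
        unfold cycleCost; ring
      have h7 : 100 * 1 ≤ (forwardCost + 8 * mergeCost + 100) * (A.card + 1) :=
        Nat.mul_le_mul (by omega) (by omega)
      rw [add_assoc (logSize V m), mul_add]
      omega
  simp only [Expr.eval, eval_var, b8, b3, b7] at h1
  have h2 : m₃ MARK (m COMP w) = m STAMP 0 + 1 := by by_contra h2; simp [h2] at h1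
  rw [← hσ2, hB.mark] at h2
  have hwv : Rch (m SRC) (m DST) M w v := by
    obtain ⟨x, hx, hxw, hxv, -⟩ := hB.good _ h2
    simp only [a1, a2, a3] at hxw hxv
    exact ((h.comp w hwV x hx).1 hxw.symm).1.trans (rch_succ_to_src.1 hxv)
  -- Components found by the backward search that moreover lie on a path from `w` to `v`. Each
  -- recorded arc leads from such a component to another one, because it ends in a component that
  -- reaches `v`.
  set Good : ℕ → Prop := fun c => c ∈ qs ∧ ∃ x < V, m COMP x = c ∧ Rch (m SRC) (m DST) M w x ∧
    Rch (m SRC) (m DST) M x v with hGood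
  have htl : ∀ c ∈ qs, ∀ c', c' ∈ lst (m₃ TDEG) (m₃ TLST) c ↔
      ∃ i, (c', i) ∈ dn ∧ m COMP (m SRC (m ILST (pr c' i))) = c := by
    intro c hc c'
    rw [hB.tmp c hc c']
    simp only [hcic]
  refine Runs.seq ((searchForward_runs (V := V) (N := M + 1) (hW.mono (by omega)) (Good := Good)
    ?_ ?_ ?_ ?_ (by omega) hmark).mono ?_)
  · rintro c ⟨-, x, hx, rfl, -⟩
    exact h.compLt x hx
  · rintro c ⟨hc, -⟩
    exact (hB.tdeg_le hc).trans hdnN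
  · rintro c i ⟨hc, x, hx, hxc, hwx, hxv⟩ hi
    obtain ⟨j, hj, hjc⟩ := (htl c hc _).1 (mem_lst.2 ⟨i, hi, rfl⟩)
    set c' := m₃ TLST (pr c i)
    obtain ⟨hc', hj'⟩ := hdn _ hj
    obtain ⟨h3, h4, h5, -, h6⟩ := harc c' hc' j hj'
    set f := m ILST (pr c' j)
    refine ⟨hc', m DST f, (h.ends f h3).2, h4, ?_, h6⟩
    rcases Nat.lt_succ_iff_lt_or_eq.1 h3 with h7 | h7
    · have h8 := ((h.comp x hx _ (h.ends f h3).1).1 (hxc.trans hjc.symm)).1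
      exact (hwx.trans h8).trans (Rch.of_arc h7)
    · rw [h7]; exact Rch.refl _
  · rw [b8, b3]
    exact ⟨h2, w, hwV, rfl, Rch.refl _, hwv⟩
  rintro t₂ m₅ ⟨m₄, qs', dn', f4, hσ4, hF, ht₂, hqlen', hdn', hall'⟩
  have f5 := hF.frame
  rw [b8, b3] at hF
  have f45 : Frame [STAMP, MARK, QUE, QT, BIG, QH, IDX, CUR, ELM] m₃ m₅ := f4.trans f5
  have f15 : Frame [MARK, STAMP, CNT, LIM, TDEG, TLST, TMP, QUE, QT, QH, IDX, CUR, ELM, BIG] m m₅ :=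
    f13.trans f45
  have d1 : m₅ SRC = m SRC := f15 _ (by decide)
  have d2 : m₅ DST = m DST := f15 _ (by decide)
  have d3 : m₅ COMP = m COMP := f15 _ (by decide)
  have d4 : m₅ IDEG = m IDEG := f15 _ (by decide)
  have d5 : m₅ ILST = m ILST := f15 _ (by decide)
  have d6 : m₅ SIZE = m SIZE := f15 _ (by decide)
  have d7 : m₅ STAMP 0 = m STAMP 0 + 2 := by rw [f5 STAMP (by decide), hσ4, b7]
  have d8 : m₄ SIZE = m SIZE := by rw [f4 SIZE (by decide), b9]
  have d9 : m₄ TLST = m₃ TLST := f4 _ (by decide)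
  have hS5 : SccInv acc V M (M + 1) (M + 1) m₅ := h.scratch f15.mono (by
    rw [d7]
    intro c
    have := hF.mark_le c
    rw [hσ4, b7] at this
    exact this)
  have hsub : ∀ c ∈ qs', c ∈ qs := fun c hc => (hF.good c hc).1
  -- Every record comes from one arc of the backward search, so the forward search is not longer.
  have hdn'card : dn'.card ≤ dn.card := by
    rw [← hB.tsum]
    refine card_le_sum_of_pairs fun p hp => ?_
    obtain ⟨h3, h4⟩ := hdn' p hp
    exact ⟨by simpa using hsub _ h3, h4⟩
  -- Forward along a path from `w` to `v`: all its vertices have the level of `v`, so each arc that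
  -- changes the component was traversed backwards and is on record.
  have hreach : ∀ x, Rch (m SRC) (m DST) M w x → Rch (m SRC) (m DST) M x v → m COMP x ∈ qs' := by
    intro x hwx
    induction hwx with
    | refl => exact fun _ => hF.start
    | @tail y x hwy hyx ih =>
      intro hxv
      have hyx' := hyx
      obtain ⟨e, he, rfl, rfl⟩ := hyx
      have hyv := (Rch.of_arc he).trans hxv
      have h3 := ih hyv
      by_cases h4 : m COMP (m SRC e) = m COMP (m DST e)
      · rwa [← h4]
      have he' : e < M + 1 := by omega
      have hl1 : m LEV (m DST e) = m LEV v := by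
        refine le_antisymm (hxv.lev_le hmonM) ?_
        rw [hlev]
        exact Rch.lev_le hmonM (hwy.tail hyx')
      have hl2 : m LEV (m SRC e) = m LEV v := by
        refine le_antisymm (hyv.lev_le hmonM) ?_
        rw [hlev]
        exact Rch.lev_le hmonM hwy
      have h5 := hcompl _ (h.ends e he').2 (hxv.mono (Nat.le_succ _)) hl1
      obtain ⟨i, hi, hie⟩ := mem_lst.1 ((h.inn _ (h.ends e he').2 e).2 ⟨he', rfl, h4, hl2.trans hl1.symm⟩)
      obtain ⟨j, hj, hje⟩ := mem_lst.1 ((htl _ (hsub _ h3) _).2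
        ⟨i, hall _ h5 i hi, by rw [hie]⟩)
      have h6 := hF.closed _ (hall' _ h3 j hj)
      rw [d9] at h6
      simp only [hje] at h6
      exact h6
  refine (mergeComps_runs (hW.mono (by omega)) hS5 (qs := qs') (A := A) rfl hF.nodup hF.qt hF.que
    ?_ ?_ ?_ hF.big ?_ ?_).mono ?_
  · intro c
    rw [d1, d2, d3]
    constructor
    · exact fun hc => (hF.good c hc).2
    · rintro ⟨x, hx, rfl, h3, h4⟩
      exact hreach x h3 h4
  · rw [d1, d2]; exact hwv
  · rw [d1, d2, d3]; exact hne
  · rw [d6, ← d8]; exact hF.big_le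
  · rw [d4, d5]
    intro c hc e he
    obtain ⟨i, hi, rfl⟩ := mem_lst.1 he
    exact (harc c (hsub c hc) i hi).2.2.2.1
  · rintro t₃ m₆ ⟨hS, f6, hone, hmonlog, ht₃⟩ s hs
    refine ⟨hS, f15.trans f6, fun i hi => by rw [hone i hi, f15 1 (by decide)], ?_, ?_⟩
    · rw [f6 STAMP (by decide), d7]
    · have h4 : logSize V m₅ = logSize V m := by simp only [logSize, d3, d6]
      rw [h4] at ht₃ hmonlog
      refine ⟨hmonlog, ?_⟩
      simp only [maxCost, setv, Expr.cost, var] at hs ⊢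
      have h5 : (backCost + 100) * (dn.card + 1) ≤ (backCost + 100) * (A.card + 1) :=
        Nat.mul_le_mul_left _ (by omega)
      have h6 : forwardCost * (dn'.card + 1) ≤ forwardCost * (A.card + 1) :=
        Nat.mul_le_mul_left _ (by omega)
      have h7 : mergeCost * (logSize V m₆ + 3 * A.card + 2 * qs'.length + 3) ≤
          mergeCost * logSize V m₆ + mergeCost * (8 * (A.card + 1)) := by
        rw [← mul_add]
        exact Nat.mul_le_mul_left _ (by omega)
      have h9 : (cycleCost - mergeCost) * logSize V m ≤ (cycleCost - mergeCost) * logSize V m₆ :=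
        Nat.mul_le_mul_left _ hmonlog
      have h10 : mergeCost ≤ cycleCost := by unfold cycleCost; omega
      rw [Nat.sub_mul, Nat.sub_mul] at h9
      have h11 := Nat.mul_le_mul_right (logSize V m) h10
      have h12 := Nat.mul_le_mul_right (logSize V m₆) h10
      have h13 : cycleCost * (A.card + 1) = (backCost + 100) * (A.card + 1) +
          forwardCost * (A.card + 1) + mergeCost * (8 * (A.card + 1)) + 100 * (A.card + 1) := by
        unfold cycleCost; ring
      rw [add_assoc (logSize V m₆), mul_add]
      omega

/-- Give `HEAD`, and what it reaches, at least the level `NEWLEV`. -/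
def raiseIfLower : Cmd := .ite (.lt (.read LEV (var HEAD)) (var NEWLEV)) raiseLevels .skip

/-- If the head is high enough, so is everything it reaches, and the empty set answers the same
description. -/
theorem raiseIfLower_runs {W V M : ℕ} {acc : ℕ → Prop} (hW : Fits W (V + M + 2)) {m : Mem}
    (h : SccInv acc V M M (M + 1) m) {L : ℕ} (hL : m NEWLEV 0 = L) (hLW : L ≤ W)
    (hhead : m HEAD 0 = m DST M) :
    Runs W raiseIfLower m fun t m' => ∃ F : Finset ℕ,
      (∀ y, y ∈ F ↔ y < V ∧ Rch (m SRC) (m DST) M (m DST M) y ∧ m LEV y < L) ∧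
      Frame [LEV, IDEG, ILST, QUE, QT, TMP, QH, IDX, CUR, ELM] m m' ∧
      (∀ y, m' LEV y = if y ∈ F then L else m LEV y) ∧
      (∀ x < V, (lst (m' IDEG) (m' ILST) (m COMP x)).Nodup) ∧
      (∀ x < V, ∀ e, e ∈ lst (m' IDEG) (m' ILST) (m COMP x) ↔
        ((∀ y ∈ F, m COMP y ≠ m COMP x) ∧ e ∈ lst (m IDEG) (m ILST) (m COMP x)) ∨
        (e < M + 1 ∧ m SRC e ∈ F ∧ m COMP (m DST e) = m COMP x ∧ m COMP (m SRC e) ≠ m COMP x ∧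
          m' LEV (m DST e) = L)) ∧
      t ≤ (raiseCost + 20) *
        (((Finset.range (M + 1)).filter fun e => m SRC e ∈ F).card + F.card + 1) := by
  refine Runs.ite (fun h0 => ?_) (fun h0 => ?_)
  · simp only [Expr.eval, eval_var, hhead, hL] at h0
    have h1 : m LEV (m DST M) < L := by by_contra h1; simp [h1] at h0
    refine (raiseLevels_runs hW h hL hLW hhead h1).mono ?_
    rintro t m' ⟨F, h2, h3, h4, h5, h6, h7⟩
    refine ⟨F, h2, h3, h4, h5, h6, ?_⟩
    rw [add_mul]
    simp only [Expr.cost, var]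
    omega
  · simp only [Expr.eval, eval_var, hhead, hL] at h0
    have h1 : L ≤ m LEV (m DST M) := by by_contra h1; simp [not_le.1 h1] at h0
    refine Runs.skip ⟨∅, fun y => ?_, Frame.refl _ _, by simp, h.inNodup, by simp, ?_⟩
    · simp only [Finset.notMem_empty, false_iff, not_and, not_lt]
      exact fun _ h2 => h1.trans (h2.lev_le h.lev.1)
    · simp only [Expr.cost, var, Finset.notMem_empty, Finset.filter_false, Finset.card_empty]
      omega

/-- Restore the levels and the lists of incoming arcs for a new arc from `TAIL` to `HEAD`. -/
def adjustLevels : Cmd :=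
  .seq (setv LIM (.add (.read LEV (var TAIL)) (.const 1)))
    (.seq searchBack
    (.seq (.ite (.lt (var QH) (var QT))
        (.seq (setv CPL (.const 0)) (setv NEWLEV (.add (.read LEV (var TAIL)) (.const 1))))
        (.seq (setv CPL (.const 1)) (setv NEWLEV (.read LEV (var TAIL)))))
    (.seq raiseIfLower
      (.ite (var CPL) (push IDEG ILST (.read COMP (var HEAD)) (var DONE)) .skip))))

/-- The factor in the running time of `adjustLevels`. -/
def adjustCost : ℕ := backCost + raiseCost + 200

/-- The result serves two purposes. The levels and incoming lists become correct for the new arc.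
And two sets account for the time: `F`, the raised vertices, and `A`, which contains whatever the
following search for a cycle can meet. The size of `A` is bounded by the level of the tail plus the
number of arcs with a raised tail, so this later search costs nothing new. -/
theorem adjustLevels_runs {W V M : ℕ} {acc : ℕ → Prop} (hW : Fits W (V + M + 3)) {m : Mem}
    (h : SccInv acc V M M (M + 1) m) (hDONE : m DONE 0 = M) (hTAIL : m TAIL 0 = m SRC M)
    (hHEAD : m HEAD 0 = m DST M) (hne : m COMP (m SRC M) ≠ m COMP (m DST M))
    (hle : m LEV (m DST M) ≤ m LEV (m SRC M)) (hσ : m STAMP 0 + 1 ≤ W) :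
    Runs W adjustLevels m fun t m' => SccInv acc V M (M + 1) (M + 1) m' ∧
      Frame [LEV, IDEG, ILST, MARK, STAMP, CNT, LIM, TDEG, TLST, TMP, NEWLEV, CPL, QUE, QT, QH, IDX,
        CUR, ELM] m m' ∧ m' STAMP 0 ≤ m STAMP 0 + 1 ∧ (∀ y, m LEV y ≤ m' LEV y) ∧
      ∃ F A : Finset ℕ, (∀ y ∈ F, y < V ∧ m LEV y < m' LEV y) ∧
        (m' LEV (m SRC M) = m' LEV (m DST M) → ∀ e < M + 1, m COMP (m SRC e) ≠ m COMP (m DST e) →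
          m' LEV (m SRC e) = m' LEV (m SRC M) → m' LEV (m DST e) = m' LEV (m SRC M) →
          Rch (m SRC) (m DST) M (m DST e) (m SRC M) → e ∈ A) ∧
        A.card ≤ m LEV (m SRC M) + 2 + ((Finset.range (M + 1)).filter fun e => m SRC e ∈ F).card ∧
        t ≤ adjustCost * (m LEV (m SRC M) + 2 +
          ((Finset.range (M + 1)).filter fun e => m SRC e ∈ F).card + F.card) := by
  classical
  obtain ⟨hvV, hwV⟩ := h.ends M (Nat.lt_succ_self _)
  set v := m SRC M with hv
  set w := m DST M with hw
  have hmon := h.lev.1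
  have hlevM : m LEV v ≤ 2 * M := (h.lev.le_sqrt hvV).trans (Nat.sqrt_le_self _)
  have hlv : m LEV v + 1 ≤ W := hW.lin _ (by omega)
  refine wp.seq_runs ?_
  simp only [wp_setv, Expr.eval, eval_var, hTAIL]
  refine ⟨hlv, ?_⟩
  set m₁ : Mem := m.write LIM 0 (m LEV v + 1) with hm₁
  have f1 : Frame [LIM] m m₁ := (Frame.refl _ _).write
  have hS1 : SccInv acc V M M (M + 1) m₁ := h.scratch f1.mono (by
    rw [f1 MARK (by decide), f1 STAMP (by decide)]; exact h.mark)
  have a1 : m₁ SRC = m SRC := f1 _ (by decide)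
  have a2 : m₁ DST = m DST := f1 _ (by decide)
  have a3 : m₁ COMP = m COMP := f1 _ (by decide)
  have a4 : m₁ LEV = m LEV := f1 _ (by decide)
  have a5 : m₁ IDEG = m IDEG := f1 _ (by decide)
  have a6 : m₁ ILST = m ILST := f1 _ (by decide)
  have a7 : m₁ STAMP = m STAMP := f1 _ (by decide)
  have hpre : BackPre V M m₁ :=
    ⟨fun e he => hS1.ends e (by omega), hS1.compLt, fun x hx y hy hxy => ((hS1.comp x hx y hy).1 hxy).1,
      hS1.inNodup, hS1.inn, hS1.lev.1, hS1.mark⟩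
  have hlim : m₁ LIM 0 = m LEV v + 1 := by simp [hm₁, write_same]
  refine Runs.seq ((searchBack_runs (hW.mono (by omega)) hpre hvV
    (by rw [f1 TAIL (by decide), hTAIL]) (by rw [a7]; omega)).mono ?_)
  rintro t₁ m₃ ⟨m₂, qs, dn, f2, hσ2, hB, ht₁, hqlen, hdn, hdnN, hdnL, -, ⟨A₁, hA₁, hA₁dn, hA₁e⟩, hend⟩
  simp only [a1, a2, a3, a4, a5, a6, a7, hlim] at hB hend hσ2 hA₁dn hA₁e hdn hdnL
  have f3 := hB.frame
  have f13 : Frame [MARK, STAMP, CNT, LIM, TDEG, TLST, TMP, QUE, QT, QH, IDX, CUR, ELM] m m₃ :=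
    (f1.trans (S'' := [STAMP, MARK, QUE, QT, CNT, TDEG, QH, IDX, LIM]) f2).trans f3
  have b7 : m₃ STAMP 0 = m STAMP 0 + 1 := by rw [f3 STAMP (by decide), hσ2]
  have hmark3 : ∀ c, m₃ MARK c ≤ m₃ STAMP 0 := by
    rw [b7, ← hσ2]; exact hB.mark_le
  -- the new level
  obtain ⟨cpl, L, hcpl, hinc, hcom⟩ : ∃ cpl L : ℕ,
      (∀ Q : Mem → Prop, Q ((m₃.write CPL 0 cpl).write NEWLEV 0 L) →
        wp W (.ite (.lt (var QH) (var QT))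
          (.seq (setv CPL (.const 0)) (setv NEWLEV (.add (.read LEV (var TAIL)) (.const 1))))
          (.seq (setv CPL (.const 1)) (setv NEWLEV (.read LEV (var TAIL))))) Q m₃) ∧
      (cpl = 0 → L = m LEV v + 1 ∧ m LEV v + 1 ≤ dn.card) ∧
      (cpl ≠ 0 → L = m LEV v ∧ (∀ c ∈ qs, ∀ i < m IDEG c, (c, i) ∈ dn) ∧
        ∀ x < V, Rch (m SRC) (m DST) M x v → m LEV x = m LEV v → m COMP x ∈ qs) := by
    have e1 : m₃ LEV = m LEV := f13 _ (by decide)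
    have e2 : m₃ TAIL 0 = v := by rw [f13 TAIL (by decide), hTAIL]
    rcases hend with ⟨h1, h2, h3⟩ | ⟨h1, h2⟩
    · refine ⟨1, m LEV v, fun Q hQ => ⟨fun h4 => ?_, fun _ => ?_⟩, by simp, fun _ => ⟨rfl, h2, h3⟩⟩
      · simp [Expr.eval, eval_var, h1] at h4
      · simp only [wp, wp_setv, Expr.eval, eval_var, write_other, ne_eq, Nat.reduceEqDiff,
          not_false_eq_true, e1, e2]
        exact ⟨by omega, by omega, hQ⟩
    · refine ⟨0, m LEV v + 1, fun Q hQ => ⟨fun _ => ?_, fun h4 => ?_⟩, fun _ => ⟨rfl, h2⟩, by simp⟩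
      · simp only [wp, wp_setv, Expr.eval, eval_var, write_other, ne_eq, Nat.reduceEqDiff,
          not_false_eq_true, e1, e2]
        exact ⟨by omega, hlv, hQ⟩
      · simp [Expr.eval, eval_var, h1] at h4
  have hLv : m LEV v ≤ L ∧ L ≤ m LEV v + 1 := by
    by_cases h1 : cpl = 0
    · have := (hinc h1).1; omega
    · have := (hcom h1).1; omega
  refine wp.seq_runs (hcpl _ ?_)
  set m₄ : Mem := (m₃.write CPL 0 cpl).write NEWLEV 0 L with hm₄
  have f4 : Frame [CPL, NEWLEV] m₃ m₄ := (Frame.refl _ _).write.write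
  have f14 : Frame [MARK, STAMP, CNT, LIM, TDEG, TLST, TMP, QUE, QT, QH, IDX, CUR, ELM, CPL, NEWLEV]
    m m₄ := f13.trans f4
  have b8 : m₄ STAMP 0 = m STAMP 0 + 1 := by rw [f4 STAMP (by decide), b7]
  have hmark4 : ∀ c, m₄ MARK c ≤ m₄ STAMP 0 := by
    rw [f4 MARK (by decide), b8, ← b7]; exact hmark3
  have hS4 : SccInv acc V M M (M + 1) m₄ := h.scratch f14.mono hmark4
  have d1 : m₄ SRC = m SRC := f14 _ (by decide)
  have d2 : m₄ DST = m DST := f14 _ (by decide)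
  have d3 : m₄ COMP = m COMP := f14 _ (by decide)
  have d4 : m₄ LEV = m LEV := f14 _ (by decide)
  have d5 : m₄ IDEG = m IDEG := f14 _ (by decide)
  have d6 : m₄ ILST = m ILST := f14 _ (by decide)
  refine Runs.seq ((raiseIfLower_runs (hW.mono (by omega)) hS4 (L := L) (by simp [hm₄, write_same])
    (by omega) (by rw [f14 HEAD (by decide), hHEAD, d2])).mono ?_)
  rintro t₂ m₅ ⟨F, hF, f5, hlev5, hnd5, hin5, ht₂⟩
  simp only [d1, d2, d3, d4, d5, d6, ← hw] at hF hlev5 hnd5 hin5 ht₂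
  have f15 : Frame [LEV, IDEG, ILST, MARK, STAMP, CNT, LIM, TDEG, TLST, TMP, NEWLEV, CPL, QUE, QT,
    QH, IDX, CUR, ELM] m m₅ := f14.trans f5
  have hFlt : ∀ y ∈ F, y < V ∧ m LEV y < m₅ LEV y := by
    intro y hy
    rw [hlev5, if_pos hy]
    have := (hF y).1 hy
    exact ⟨this.1, this.2.2⟩
  have hlevle : ∀ y, m LEV y ≤ m₅ LEV y := by
    intro y
    by_cases hy : y ∈ F
    · exact (hFlt y hy).2.le
    · rw [hlev5, if_neg hy]
  have hw5 : m₅ LEV w = L := by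
    rw [hlev5]
    split_ifs with h1
    · rfl
    · rw [hF] at h1
      push Not at h1
      have := h1 hwV (Rch.refl _)
      omega
  have hmon5 : ∀ e < M + 1, m₅ LEV (m SRC e) ≤ m₅ LEV (m DST e) := by
    intro e he
    rcases Nat.lt_succ_iff_lt_or_eq.1 he with he' | rfl
    · by_cases h1 : m SRC e ∈ F
      · rw [hlev5, if_pos h1, hlev5]
        split_ifs with h2
        · exact le_rfl
        · rw [hF] at h1 h2
          push Not at h2
          exact h2 (h.ends e he).2 (h1.2.1.trans (Rch.of_arc he'))
      · rw [hlev5, if_neg h1]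
        exact (hmon e he').trans (hlevle _)
    · rw [← hv, ← hw, hw5, hlev5]
      split_ifs
      · exact le_rfl
      · exact hLv.1
  -- An interrupted search provides the arcs behind the tail that allow a level above it. After a
  -- completed search `L` is only the level of the tail, and no witnesses are needed.
  have hlev' : LevelOK (m SRC) (m DST) V (M + 1) (m₅ LEV) := by
    refine h.lev.insert (L := L) hvV hlevle hmon5 ?_ ?_ fun e he => (h.ends e (by omega)).1
    · intro y hy hne
      rw [hlev5] at hne ⊢
      split_ifs at hne ⊢ with h1
      · exact ⟨rfl, ((hF y).1 h1).2.1⟩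
      · exact absurd rfl hne
    · by_cases h1 : cpl = 0
      · obtain ⟨h2, h3⟩ := hinc h1
        refine Or.inr ⟨h2, A₁, by rw [hA₁]; exact h3, fun e he => ?_⟩
        obtain ⟨h4, h5, h6, h7⟩ := hA₁e e he
        refine ⟨h4, fun h8 => h5 ?_, h6, h7⟩
        exact (h.comp _ (h.ends e (by omega)).2 _ (h.ends e (by omega)).1).2 ⟨h8, Rch.of_arc h4⟩
      · exact Or.inl (hcom h1).1.le
  -- Components are raised as a whole, so emptying the list of a component never destroys entries of
  -- an unraised part.
  have hFcomp : ∀ y ∈ F, ∀ x < V, m COMP y = m COMP x → x ∈ F := by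
    intro y hy x hx hyx
    obtain ⟨h1, h2, h3⟩ := (hF y).1 hy
    obtain ⟨h4, h5⟩ := (h.comp y h1 x hx).1 hyx
    exact (hF x).2 ⟨hx, h2.trans h4, (h5.lev_le hmon).trans_lt h3⟩
  -- The lists are complete except for the new arc. If the head of a one-level arc is raised to `L`,
  -- its tail was below `L` before, hence was raised too, and the arc was found among its outgoing
  -- arcs. The new arc is missing exactly when the search was completed: then the tail stays at
  -- level `L` and its outgoing arcs are not inspected.
  have hinF : ∀ x < V, ∀ e, (e < M + 1 ∧ m COMP (m DST e) = m COMP x ∧ m COMP (m SRC e) ≠ m COMP x ∧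
      m₅ LEV (m SRC e) = m₅ LEV (m DST e)) ↔
      e ∈ lst (m₅ IDEG) (m₅ ILST) (m COMP x) ∨ e = M ∧ cpl ≠ 0 ∧ m COMP x = m COMP w := by
    intro x hx e
    rw [hin5 x hx, h.inn x hx]
    by_cases hsF : m SRC e ∈ F
    · rw [hlev5 (m SRC e), if_pos hsF]
      have hs' := (hF _).1 hsF
      constructor
      · rintro ⟨h1, h2, h3, h4⟩
        exact Or.inl (Or.inr ⟨h1, hsF, h2, h3, h4.symm⟩)
      · rintro ((⟨h1, h2, h3, h4, h5⟩ | ⟨h1, h2, h3, h4, h5⟩) | ⟨rfl, h2, h3⟩)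
        · exfalso
          have h6 : m DST e ∉ F := fun h6 => h1 _ h6 h3
          rw [hF] at h6
          push Not at h6
          have := h6 (h.ends e (by omega)).2 (hs'.2.1.trans (Rch.of_arc h2))
          omega
        · exact ⟨h1, h3, h4, h5.symm⟩
        · exfalso
          have := (hcom h2).1
          rw [← hv] at hs'
          omega
    · rw [hlev5 (m SRC e), if_neg hsF]
      constructor
      · rintro ⟨h1, h2, h3, h4⟩
        rcases Nat.lt_succ_iff_lt_or_eq.1 h1 with he | rfl
        · have h5 : m DST e ∉ F := by
            intro h5
            rw [hlev5, if_pos h5] at h4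
            have := (hF _).1 h5
            have := hmon e he
            omega
          rw [hlev5, if_neg h5] at h4
          exact Or.inl (Or.inl ⟨fun y hy hyx => h5 (hFcomp y hy _ (h.ends e h1).2 (hyx.trans h2.symm)),
            he, h2, h3, h4⟩)
        · refine Or.inr ⟨rfl, fun h5 => ?_, h2.symm⟩
          rw [← hw, hw5, ← hv] at h4
          have := (hinc h5).1
          omega
      · rintro ((⟨h1, h2, h3, h4, h5⟩ | ⟨h1, h2, h3, h4, h5⟩) | ⟨rfl, h2, h3⟩)
        · have h6 : m DST e ∉ F := fun h6 => h1 _ h6 h3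
          rw [hlev5, if_neg h6]
          exact ⟨by omega, h3, h4, h5⟩
        · exact absurd h2 hsF
        · rw [← hw, hw5, ← hv, h3]
          exact ⟨Nat.lt_succ_self _, rfl, hne, (hcom h2).1.symm⟩
  have hS : ∀ m₆ : Mem, Frame [IDEG, ILST] m₅ m₆ →
      (∀ x < V, (lst (m₆ IDEG) (m₆ ILST) (m COMP x)).Nodup ∧
        ∀ e, e ∈ lst (m₆ IDEG) (m₆ ILST) (m COMP x) ↔
          e ∈ lst (m₅ IDEG) (m₅ ILST) (m COMP x) ∨ e = M ∧ cpl ≠ 0 ∧ m COMP x = m COMP w) →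
      SccInv acc V M (M + 1) (M + 1) m₆ := by
    intro m₆ f6 hl
    have f16 : Frame [LEV, IDEG, ILST, MARK, STAMP, CNT, LIM, TDEG, TLST, TMP, NEWLEV, CPL, QUE, QT,
      QH, IDX, CUR, ELM] m m₆ := f15.trans f6
    have e1 : m₆ SRC = m SRC := f16 _ (by decide)
    have e2 : m₆ DST = m DST := f16 _ (by decide)
    have e3 : m₆ COMP = m COMP := f16 _ (by decide)
    have e4 : m₆ LEV = m₅ LEV := f6 _ (by decide)
    have e5 : m₆ ODEG = m ODEG := f16 _ (by decide)
    have e6 : m₆ OLST = m OLST := f16 _ (by decide)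
    have e9 : m₆ SIZE = m SIZE := f16 _ (by decide)
    have e10 : m₆ MLST = m MLST := f16 _ (by decide)
    have e11 : m₆ ACC = m ACC := f16 _ (by decide)
    have e12 : m₆ 1 = m 1 := f16 _ (by decide)
    have e13 : m₆ MARK = m₄ MARK := by rw [f6 MARK (by decide), f5 MARK (by decide)]
    have e14 : m₆ STAMP = m₄ STAMP := by rw [f6 STAMP (by decide), f5 STAMP (by decide)]
    refine ⟨?_, ?_, ?_, ?_, ?_, ?_, ?_, ?_, ?_, ?_, ?_, ?_, ?_⟩ <;>
      simp only [e1, e2, e3, e4, e5, e6, e9, e10, e11, e12, e13, e14]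
    · exact h.ends
    · exact h.compLt
    · exact h.comp
    · exact h.outNodup
    · exact h.out
    · exact fun x hx => (hl x hx).1
    · intro x hx e
      rw [(hl x hx).2, ← hinF x hx]
    · exact h.memNodup
    · exact h.mem
    · exact h.accComp
    · exact h.found
    · exact hlev'
    · exact hmark4
  have hA₀ : ∀ (m₆ : Mem), m₆ LEV = m₅ LEV →
      ∀ t ≤ maxCost (setv LIM (.add (.read LEV (var TAIL)) (.const 1))), ∀ t' ≤ maxCost
      (.ite (.lt (var QH) (var QT))
          (.seq (setv CPL (.const 0)) (setv NEWLEV (.add (.read LEV (var TAIL)) (.const 1))))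
          (.seq (setv CPL (.const 1)) (setv NEWLEV (.read LEV (var TAIL))))), ∀ s ≤ 40,
      ∃ F A : Finset ℕ, (∀ y ∈ F, y < V ∧ m LEV y < m₆ LEV y) ∧
        (m₆ LEV v = m₆ LEV w → ∀ e < M + 1, m COMP (m SRC e) ≠ m COMP (m DST e) →
          m₆ LEV (m SRC e) = m₆ LEV v → m₆ LEV (m DST e) = m₆ LEV v →
          Rch (m SRC) (m DST) M (m DST e) v → e ∈ A) ∧
        A.card ≤ m LEV v + 2 + ((Finset.range (M + 1)).filter fun e => m SRC e ∈ F).card ∧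
        t + (t₁ + (t' + (t₂ + s))) ≤ adjustCost * (m LEV v + 2 +
          ((Finset.range (M + 1)).filter fun e => m SRC e ∈ F).card + F.card) := by
    intro m₆ e4 t ht t' ht' s hs
    rw [e4]
    -- Arcs of the first search, arcs with a raised tail, and the new arc. An old arc between two
    -- components, at the common level of both ends of the new arc, whose tail was not raised, had
    -- level `L` before and reaches `v`. So `L` is the old level of `v`, the first search was
    -- completed, and it has met this arc.
    refine ⟨F, A₁ ∪ ((Finset.range (M + 1)).filter fun e => m SRC e ∈ F) ∪ {M}, hFlt, ?_, ?_, ?_⟩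
    · intro h0 e he h1 h2 h3 h4
      rcases Nat.lt_succ_iff_lt_or_eq.1 he with he' | rfl
      · by_cases h5 : m SRC e ∈ F
        · simp [he, h5]
        · rw [h0, hw5] at h2 h3
          rw [hlev5, if_neg h5] at h2
          have h6 := h4.lev_le hmon
          have h7 := hmon e he'
          have h8 : cpl ≠ 0 := fun h8 => by have := (hinc h8).1; omega
          obtain ⟨-, h9, h10⟩ := hcom h8
          have h11 := h10 _ (h.ends e he).2 h4 (by omega)
          obtain ⟨i, hi, hie⟩ := mem_lst.1 ((h.inn _ (h.ends e he).2 e).2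
            ⟨he', rfl, h1, by omega⟩)
          have h12 : e ∈ A₁ := (hA₁dn e).2 ⟨_, h9 _ h11 i hi, hie⟩
          simp [h12]
      · simp
    · refine (Finset.card_union_le _ _).trans ?_
      have := Finset.card_union_le A₁ ((Finset.range (M + 1)).filter fun e => m SRC e ∈ F)
      rw [Finset.card_singleton]
      omega
    · simp only [maxCost, setv, Expr.cost, var] at ht ht'
      set r := ((Finset.range (M + 1)).filter fun e => m SRC e ∈ F).card
      have h5 : (backCost + 100) * (dn.card + 1) ≤ (backCost + 100) * (m LEV v + 2 + r + F.card) :=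
        Nat.mul_le_mul_left _ (by omega)
      have h6 : (raiseCost + 20) * (r + F.card + 1) ≤ (raiseCost + 20) * (m LEV v + 2 + r + F.card) :=
        Nat.mul_le_mul_left _ (by omega)
      have h7 : adjustCost * (m LEV v + 2 + r + F.card) =
        (backCost + 100) * (m LEV v + 2 + r + F.card) + (raiseCost + 20) * (m LEV v + 2 + r + F.card) +
          80 * (m LEV v + 2 + r + F.card) := by unfold adjustCost; ring
      omega
  have g1 : m₅ CPL 0 = cpl := by
    rw [f5 CPL (by decide)]; simp [hm₄, write_same, write_other]
  have hσ5 : m₅ STAMP 0 = m STAMP 0 + 1 := by rw [f5 STAMP (by decide), b8]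
  refine Runs.ite (fun h1 => ?_) (fun h1 => ?_)
  · rw [eval_var, g1] at h1
    have g2 : m₅ COMP (m₅ HEAD 0) = m COMP w := by
      rw [f15 COMP (by decide), f15 HEAD (by decide), hHEAD]
    have g3 : m₅ DONE 0 = M := by rw [f15 DONE (by decide), hDONE]
    -- With `CPL` set, the tail has level `L` already and is not raised, so the rebuilding has not
    -- entered the new arc.
    have hMnew : M ∉ lst (m₅ IDEG) (m₅ ILST) (m COMP w) := by
      rw [hin5 w hwV, h.inn w hwV]
      rintro (⟨-, h2, -⟩ | ⟨-, h2, -⟩)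
      · omega
      · have := (hF _).1 h2
        have := (hcom h1).1
        rw [← hv] at *
        omega
    have hlen : m₅ IDEG (m COMP w) ≤ M + 1 := by
      rw [← length_lst (d := m₅ IDEG) (a := m₅ ILST) (c := m COMP w)]
      refine length_le_of_lt (hnd5 w hwV) fun e he => ?_
      rcases (hin5 w hwV e).1 he with ⟨-, h2⟩ | ⟨h2, -⟩
      · have := ((h.inn w hwV e).1 h2).1; omega
      · exact h2
    have hcw := h.compLt w hwV
    refine (wp.runs (Q := fun m₆ => m₆ = (m₅.write ILST (pr (m COMP w) (m₅ IDEG (m COMP w))) M).write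
      IDEG (m COMP w) (m₅ IDEG (m COMP w) + 1)) ?_).mono ?_
    · simp only [push, wp, Expr.eval, eval_var, eval_prE, write_other, ne_eq, Nat.reduceEqDiff,
        not_false_eq_true, g2, g3, and_true]
      exact ⟨⟨hW.quad _ _ (by omega), hW.lin _ (by omega)⟩, hW.lin _ (by omega), hW.lin _ (by omega)⟩
    · rintro s _ ⟨hs, rfl⟩ s' hs' s'' hs''
      refine ⟨hS _ (Frame.refl _ _).write.write ?_, f15.write.write, ?_, ?_, ?_⟩
      · intro x hx
        simp only [write_same, write_other, ne_eq, Nat.reduceEqDiff, not_false_eq_true, lst_push]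
        split_ifs with h2
        · rw [h2]
          refine ⟨nodup_snoc (hnd5 w hwV) hMnew, fun e => ?_⟩
          simp [h1]
        · exact ⟨hnd5 x hx, fun e => by simp [h2]⟩
      · simp only [write_other, ne_eq, Nat.reduceEqDiff, not_false_eq_true]
        omega
      · simpa only [write_other, ne_eq, Nat.reduceEqDiff, not_false_eq_true] using hlevle
      · refine hA₀ _ (by simp [write_other]) _ hs'' _ hs' _ ?_
        simp only [maxCost, push, prE, Expr.cost, var] at hs ⊢
        omega
  · rw [eval_var, g1] at h1
    refine Runs.skip ?_
    intro s' hs' s'' hs''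
    refine ⟨hS _ (Frame.refl _ _) fun x hx => ⟨hnd5 x hx, fun e => by simp [h1]⟩, f15, by omega, hlevle,
      hA₀ _ rfl _ hs'' _ hs' _ (by simp [Expr.cost, var])⟩

/-- Insert the arc number `DONE` into the data structure for strongly connected components. -/
def insertArc : Cmd :=
  .seq (.seq (setv TAIL (.read SRC (var DONE))) (.seq (setv HEAD (.read DST (var DONE)))
      (push ODEG OLST (var TAIL) (var DONE))))
    (.seq (.ite (.mul (notE (.eq (.read COMP (var TAIL)) (.read COMP (var HEAD))))
        (notE (.lt (.read LEV (var TAIL)) (.read LEV (var HEAD)))))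
      (.seq adjustLevels closeCycle) .skip)
    (setv DONE (.add (var DONE) (.const 1))))

/-- The potential of the data structure. -/
def potential (V M : ℕ) (m : Mem) : ℕ :=
  ∑ i ∈ Finset.range M, (4 + Nat.sqrt (2 * i)) + ∑ y ∈ Finset.range V, m LEV y +
    ∑ e ∈ Finset.range M, m LEV (m SRC e) + logSize V m

/-- The factor in the amortized running time of `insertArc`. -/
def insertCost : ℕ := adjustCost + cycleCost + 100

theorem potential_congr {V M : ℕ} {m m' : Mem} (h1 : m' LEV = m LEV) (h2 : m' SRC = m SRC)
    (h3 : m' COMP = m COMP) (h4 : m' SIZE = m SIZE) : potential V M m' = potential V M m := by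
  simp only [potential, logSize, h1, h2, h3, h4]

/-- Each raised vertex adds one to the sum over the vertices, and each old arc with a raised tail
adds one to the sum over the arcs. The new summand `4 + √(2M)` pays for the first search and the
constants. -/
theorem potential_step {V M : ℕ} {m m' : Mem} (hsrc : m' SRC = m SRC) (hlev : ∀ y, m LEV y ≤ m' LEV y)
    {F : Finset ℕ} (hF : ∀ y ∈ F, y < V ∧ m LEV y < m' LEV y) (hlog : logSize V m ≤ logSize V m') :
    potential V M m + (3 + Nat.sqrt (2 * M) +
      ((Finset.range (M + 1)).filter fun e => m SRC e ∈ F).card + F.card + (logSize V m' - logSize V m)) ≤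
        potential V (M + 1) m' := by
  classical
  have h1 : ∑ y ∈ Finset.range V, m LEV y + F.card ≤ ∑ y ∈ Finset.range V, m' LEV y := by
    have hFV : F = (Finset.range V).filter (· ∈ F) := by
      ext y
      simp only [Finset.mem_filter, Finset.mem_range]
      exact ⟨fun h => ⟨(hF y h).1, h⟩, fun h => h.2⟩
    rw [hFV, Finset.card_filter, ← Finset.sum_add_distrib]
    refine Finset.sum_le_sum fun y _ => ?_
    split_ifs with h
    · exact (hF y h).2
    · exact hlev y
  have h2 : ∑ e ∈ Finset.range M, m LEV (m SRC e) +
      ((Finset.range M).filter fun e => m SRC e ∈ F).card ≤ ∑ e ∈ Finset.range M, m' LEV (m SRC e) := by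
    rw [Finset.card_filter, ← Finset.sum_add_distrib]
    refine Finset.sum_le_sum fun e _ => ?_
    split_ifs with h
    · exact (hF _ h).2
    · exact hlev _
  -- The new arc may have a raised tail, but it is not in the old sum over the arcs. This one unit
  -- is the difference between the 4 in the potential and the 3 claimed.
  have h3 : ((Finset.range (M + 1)).filter fun e => m SRC e ∈ F).card ≤
      ((Finset.range M).filter fun e => m SRC e ∈ F).card + 1 := by
    rw [Finset.range_add_one, Finset.filter_insert]
    split_ifs
    · exact Finset.card_insert_le _ _
    · omega
  unfold potential
  rw [Finset.sum_range_succ, Finset.sum_range_succ, hsrc]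
  omega

/-- An arc inside a component or going strictly upwards closes no new cycle and belongs to no
incoming list, so everything stays as it is. -/
theorem SccInv.insert_of_le {acc : ℕ → Prop} {V M : ℕ} {m : Mem} (h : SccInv acc V M M (M + 1) m)
    (hc : m COMP (m SRC M) = m COMP (m DST M) ∨ m LEV (m SRC M) < m LEV (m DST M)) :
    SccInv acc V (M + 1) (M + 1) (M + 1) m := by
  obtain ⟨hvV, hwV⟩ := h.ends M (Nat.lt_succ_self _)
  have hmon := h.lev.1
  have hle : m LEV (m SRC M) ≤ m LEV (m DST M) := by
    rcases hc with hc | hc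
    · exact ((h.comp _ hvV _ hwV).1 hc).1.lev_le hmon
    · exact hc.le
  have h1 := h.step (Nat.lt_succ_self _) (hc.imp_right fun h1 h2 => by
    have := h2.lev_le hmon
    omega)
  refine { h1 with inn := fun x hx e => ?_, lev := ?_ }
  · rw [h.inn x hx]
    refine ⟨fun ⟨h2, h3⟩ => ⟨by omega, h3⟩, fun ⟨h2, h3, h4, h5⟩ => ⟨?_, h3, h4, h5⟩⟩
    rcases Nat.lt_succ_iff_lt_or_eq.1 h2 with h6 | rfl
    · exact h6
    · rcases hc with hc | hc
      · exact absurd (hc.trans h3) h4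
      · omega
  -- No vertex is raised, and any `L` up to the level of the tail would do.
  · refine h.lev.insert (L := 0) hvV (fun _ => le_rfl) (fun e he => ?_) (fun y _ hy => absurd rfl hy)
      (Or.inl (Nat.zero_le _)) fun e he => (h.ends e (by omega)).1
    rcases Nat.lt_succ_iff_lt_or_eq.1 he with h6 | rfl
    · exact hmon e h6
    · exact hle

/-- The three counters of `SccInv` advance one after the other: the outgoing lists at once, the
levels and incoming lists in `adjustLevels`, the components in `closeCycle`. There are at most three
searches, hence at most three new stamps. -/
theorem insertArc_runs {W V M : ℕ} {acc : ℕ → Prop} (hW : Fits W (2 * V + M + 3)) {m : Mem}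
    (h : SccInv acc V M M M m) (hends : m SRC M < V ∧ m DST M < V) (hDONE : m DONE 0 = M)
    (hσ : m STAMP 0 + 3 ≤ W) :
    Runs W insertArc m fun t m' => SccInv acc V (M + 1) (M + 1) (M + 1) m' ∧ m' DONE 0 = M + 1 ∧
      Frame [1, COMP, LEV, ODEG, OLST, IDEG, ILST, SIZE, MLST, ACC, DONE, MARK, STAMP, CNT, LIM, TDEG,
        TLST, BUF, TMP, BIG, NEWLEV, CPL, QUE, QT, QH, IDX, CUR, ELM, TAIL, HEAD] m m' ∧
      (∀ i, i ≠ 1 → m' 1 i = m 1 i) ∧ m' STAMP 0 ≤ m STAMP 0 + 3 ∧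
      t + insertCost * potential V M m ≤ insertCost * potential V (M + 1) m' := by
  classical
  obtain ⟨hvV, hwV⟩ := hends
  set v := m SRC M with hv
  set w := m DST M with hw
  have hdeg : m ODEG v ≤ M := h.odeg_le hvV
  refine wp.seq_runs ?_
  simp only [push, wp, wp_setv, Expr.eval, eval_var, eval_prE, write_same, write_other, ne_eq,
    Nat.reduceEqDiff, not_false_eq_true, Function.update_self, hDONE]
  rw [← hv, ← hw]
  refine ⟨hW.lin _ (by omega), hW.lin _ (by omega), ⟨hW.quad _ _ (by omega), hW.lin _ (by omega)⟩,
    ⟨hW.lin _ (by omega), hW.lin _ (by omega)⟩, ?_⟩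
  set m₁ : Mem := (((m.write TAIL 0 v).write HEAD 0 w).write OLST (pr v (m ODEG v)) M).write ODEG v
    (m ODEG v + 1) with hm₁
  have f1 : Frame [TAIL, HEAD, OLST, ODEG] m m₁ := (Frame.refl _ _).write.write.write.write
  have a1 : m₁ SRC = m SRC := f1 _ (by decide)
  have a2 : m₁ DST = m DST := f1 _ (by decide)
  have a3 : m₁ COMP = m COMP := f1 _ (by decide)
  have a4 : m₁ LEV = m LEV := f1 _ (by decide)
  have a5 : m₁ IDEG = m IDEG := f1 _ (by decide)
  have a6 : m₁ ILST = m ILST := f1 _ (by decide)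
  have a7 : m₁ STAMP = m STAMP := f1 _ (by decide)
  have a8 : m₁ SIZE = m SIZE := f1 _ (by decide)
  have a9 : m₁ MLST = m MLST := f1 _ (by decide)
  have a10 : m₁ ACC = m ACC := f1 _ (by decide)
  have a11 : m₁ 1 = m 1 := f1 _ (by decide)
  have a12 : m₁ MARK = m MARK := f1 _ (by decide)
  have aT : m₁ TAIL 0 = v := by simp [hm₁, write_same, write_other]
  have aH : m₁ HEAD 0 = w := by simp [hm₁, write_same, write_other]
  have aD : m₁ DONE 0 = M := by rw [f1 DONE (by decide), hDONE]
  have hlst : ∀ x, lst (m₁ ODEG) (m₁ OLST) x =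
      if x = v then lst (m ODEG) (m OLST) v ++ [M] else lst (m ODEG) (m OLST) x := by
    intro x
    simp only [hm₁, write_same, write_other, ne_eq, Nat.reduceEqDiff, not_false_eq_true, lst_push]
  have hS1 : SccInv acc V M M (M + 1) m₁ := by
    refine ⟨?_, ?_, ?_, ?_, ?_, ?_, ?_, ?_, ?_, ?_, ?_, ?_, ?_⟩ <;>
      simp only [a1, a2, a3, a4, a5, a6, a7, a8, a9, a10, a11, a12, hlst]
    · intro e he
      rcases Nat.lt_succ_iff_lt_or_eq.1 he with h6 | rfl
      · exact h.ends e h6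
      · exact ⟨hvV, hwV⟩
    · exact h.compLt
    · exact h.comp
    · intro x hx
      split_ifs with h1
      · refine nodup_snoc (h.outNodup v hvV) fun h2 => ?_
        have := ((h.out v hvV M).1 h2).1
        omega
      · exact h.outNodup x hx
    · intro x hx e
      split_ifs with h1
      · rw [List.mem_append, h.out v hvV, List.mem_singleton, h1]
        constructor
        · rintro (⟨h2, h3⟩ | rfl)
          · exact ⟨by omega, h3⟩
          · exact ⟨Nat.lt_succ_self _, rfl⟩
        · rintro ⟨h2, h3⟩
          rcases Nat.lt_succ_iff_lt_or_eq.1 h2 with h6 | rfl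
          · exact Or.inl ⟨h6, h3⟩
          · exact Or.inr rfl
      · rw [h.out x hx]
        refine ⟨fun ⟨h2, h3⟩ => ⟨by omega, h3⟩, fun ⟨h2, h3⟩ => ⟨?_, h3⟩⟩
        rcases Nat.lt_succ_iff_lt_or_eq.1 h2 with h6 | rfl
        · exact h6
        · exact absurd h3.symm h1
    · exact h.inNodup
    · exact h.inn
    · exact h.memNodup
    · exact h.mem
    · exact h.accComp
    · exact h.found
    · exact h.lev
    · exact h.mark
  have hP1 : potential V M m₁ = potential V M m := potential_congr a4 a1 a3 a8
  have hlog1 : logSize V m₁ = logSize V m := by simp only [logSize, a3, a8]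
  have hsq : m LEV v ≤ Nat.sqrt (2 * M) := h.lev.le_sqrt hvV
  -- The common end of both branches. The 60 steps held back in the bound for `t₂` cover the
  -- straight-line commands at the beginning and at the end.
  have hlast : ∀ (m₂ : Mem) (t₂ : ℕ) (F : Finset ℕ), SccInv acc V (M + 1) (M + 1) (M + 1) m₂ →
      Frame [1, COMP, LEV, ODEG, OLST, IDEG, ILST, SIZE, MLST, ACC, MARK, STAMP, CNT, LIM, TDEG,
        TLST, BUF, TMP, BIG, NEWLEV, CPL, QUE, QT, QH, IDX, CUR, ELM, TAIL, HEAD] m m₂ →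
      (∀ i, i ≠ 1 → m₂ 1 i = m 1 i) → m₂ STAMP 0 ≤ m STAMP 0 + 3 →
      (∀ y, m LEV y ≤ m₂ LEV y) → (∀ y ∈ F, y < V ∧ m LEV y < m₂ LEV y) →
      logSize V m ≤ logSize V m₂ →
      t₂ ≤ insertCost * (3 + Nat.sqrt (2 * M) +
        ((Finset.range (M + 1)).filter fun e => m SRC e ∈ F).card + F.card +
          (logSize V m₂ - logSize V m)) - 60 →
      Runs W (setv DONE (.add (var DONE) (.const 1))) m₂ fun t' m' => ∀ t ≤ maxCost
        ((setv TAIL (.read SRC (var DONE))).seq ((setv HEAD (.read DST (var DONE))).seq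
          (push ODEG OLST (var TAIL) (var DONE)))),
        SccInv acc V (M + 1) (M + 1) (M + 1) m' ∧ m' DONE 0 = M + 1 ∧
        Frame [1, COMP, LEV, ODEG, OLST, IDEG, ILST, SIZE, MLST, ACC, DONE, MARK, STAMP, CNT, LIM, TDEG,
          TLST, BUF, TMP, BIG, NEWLEV, CPL, QUE, QT, QH, IDX, CUR, ELM, TAIL, HEAD] m m' ∧
        (∀ i, i ≠ 1 → m' 1 i = m 1 i) ∧ m' STAMP 0 ≤ m STAMP 0 + 3 ∧
        t + (t₂ + t') + insertCost * potential V M m ≤ insertCost * potential V (M + 1) m' := by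
    intro m₂ t₂ F hS f2 hone hst hl hF hlg ht₂
    refine (wp.runs (Q := fun m' => m' = m₂.write DONE 0 (M + 1)) ?_).mono ?_
    · simp only [wp_setv, Expr.eval, eval_var, f2 DONE (by decide), hDONE, and_true]
      exact hW.lin _ (by omega)
    · rintro t' _ ⟨ht', rfl⟩ t ht
      have f3 : Frame [DONE] m₂ (m₂.write DONE 0 (M + 1)) := (Frame.refl _ _).write
      refine ⟨hS.scratch f3.mono (by
        rw [f3 MARK (by decide), f3 STAMP (by decide)]; exact hS.mark), by simp [write_same],
        f2.trans f3, ?_, ?_, ?_⟩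
      · rw [f3 1 (by decide)]; exact hone
      · rw [f3 STAMP (by decide)]; exact hst
      · have h1 := potential_step (M := M) (f2 SRC (by decide)) hl hF hlg
        rw [potential_congr (f3 LEV (by decide)) (f3 SRC (by decide)) (f3 COMP (by decide))
          (f3 SIZE (by decide))]
        have h2 := Nat.mul_le_mul_left insertCost h1
        rw [mul_add] at h2
        simp only [maxCost, push, prE, setv, Expr.cost, var] at ht ht'
        have h3 : 100 * 3 ≤ insertCost * (3 + Nat.sqrt (2 * M) +
          ((Finset.range (M + 1)).filter fun e => m SRC e ∈ F).card + F.card +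
          (logSize V m₂ - logSize V m)) := Nat.mul_le_mul (by unfold insertCost; omega) (by omega)
        omega
  refine Runs.seq (Runs.ite (fun h1 => ?_) (fun h1 => ?_))
  swap
  · simp only [Expr.eval, eval_var, eval_notE, aT, aH, a3, a4] at h1
    have h2 : m COMP v = m COMP w ∨ m LEV v < m LEV w := by
      by_contra h2
      push Not at h2
      simp [h2.1, not_lt.2 h2.2] at h1
    refine Runs.skip (hlast _ _ ∅ (hS1.insert_of_le (by rw [a1, a2, a3, a4]; exact h2)) f1.mono
      (fun i _ => by rw [a11]) (by rw [a7]; omega) (fun y => by rw [a4]) (by simp) (by rw [hlog1]) ?_)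
    have h3 : 100 * 3 ≤ insertCost * (3 + Nat.sqrt (2 * M) +
      ((Finset.range (M + 1)).filter fun e => m SRC e ∈ (∅ : Finset ℕ)).card + (∅ : Finset ℕ).card +
          (logSize V m₁ - logSize V m)) := Nat.mul_le_mul (by unfold insertCost; omega) (by omega)
    simp only [notE, Expr.cost, var]
    omega
  simp only [Expr.eval, eval_var, eval_notE, aT, aH, a3, a4] at h1
  have hne : m COMP v ≠ m COMP w := by
    intro h2; simp [h2] at h1
  have hle : m LEV w ≤ m LEV v := by
    by_contra h2; simp [not_le.1 h2] at h1
  refine Runs.seq ((adjustLevels_runs (hW.mono (by omega)) hS1 aD (by rw [aT, a1]) (by rw [aH, a2])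
    (by rw [a1, a2, a3]; exact hne) (by rw [a1, a2, a4]; exact hle) (by rw [a7]; omega)).mono ?_)
  rintro t₂ m₂ ⟨hS2, f2, hst2, hlev2, F, A, hF, hA, hAcard, ht₂⟩
  simp only [a1, a2, a3, a4, a7, ← hv, ← hw] at hst2 hlev2 hF hA hAcard ht₂
  have b1 : m₂ SRC = m SRC := by rw [f2 SRC (by decide), a1]
  have b2 : m₂ DST = m DST := by rw [f2 DST (by decide), a2]
  have b3 : m₂ COMP = m COMP := by rw [f2 COMP (by decide), a3]
  have b4 : m₂ SIZE = m SIZE := by rw [f2 SIZE (by decide), a8]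
  have hlog2 : logSize V m₂ = logSize V m := by simp only [logSize, b3, b4]
  refine (closeCycle_runs hW hS2 (by rw [f2 DONE (by decide), aD])
    (by rw [f2 TAIL (by decide), aT, b1]) (by rw [f2 HEAD (by decide), aH, b2])
    (by rw [b1, b2, b3]; exact hne) (by omega) (A := A) (by rw [b1, b2, b3]; exact hA)).mono ?_
  rintro t₃ m₃ ⟨hS3, f3, hone, hst3, hlg, ht₃⟩
  have c4 : m₃ LEV = m₂ LEV := f3 _ (by decide)
  rw [hlog2] at ht₃ hlg
  refine hlast _ _ F hS3 ((f1.trans (S'' := [TAIL, HEAD, OLST, ODEG, LEV, IDEG, ILST, MARK, STAMP, CNT,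
    LIM, TDEG, TLST, TMP, NEWLEV, CPL, QUE, QT, QH, IDX, CUR, ELM]) f2).trans f3) ?_ (by omega)
    (by rw [c4]; exact hlev2) (by rw [c4]; exact hF) hlg ?_
  · intro i hi
    rw [hone i hi, f2 1 (by decide), a11]
  · obtain ⟨d, hd⟩ := Nat.exists_eq_add_of_le hlg
    rw [hd] at ht₃ ⊢
    rw [Nat.add_sub_cancel_left]
    set r := ((Finset.range (M + 1)).filter fun e => m SRC e ∈ F).card
    have h5 : t₃ ≤ cycleCost * (d + A.card + 1) := by
      rw [add_assoc, add_assoc, mul_add] at ht₃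
      rw [add_assoc]
      omega
    have h6 : cycleCost * (d + A.card + 1) ≤ cycleCost * (3 + Nat.sqrt (2 * M) + r + F.card + d) :=
      Nat.mul_le_mul_left _ (by omega)
    have h7 : adjustCost * (m LEV v + 2 + r + F.card) ≤
      adjustCost * (3 + Nat.sqrt (2 * M) + r + F.card + d) := Nat.mul_le_mul_left _ (by omega)
    have h8 : insertCost * (3 + Nat.sqrt (2 * M) + r + F.card + d) =
      cycleCost * (3 + Nat.sqrt (2 * M) + r + F.card + d) +
      adjustCost * (3 + Nat.sqrt (2 * M) + r + F.card + d) +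
      100 * (3 + Nat.sqrt (2 * M) + r + F.card + d) := by unfold insertCost; ring
    simp only [notE, Expr.cost, var]
    omega

/-! ### The product automaton in memory -/

notation "INP" => 2
notation "PQH" => 6
notation "LAB" => 7
notation "NUM" => 8
notation "DEG" => 9
notation "TADJ" => 10
notation "TEDGE" => 11
notation "ECNT" => 12
notation "PEDGE" => 13
notation "NEWS" => 14
notation "PVTX" => 15
notation "PRES" => 16
notation "NBR" => 17
notation "PQUE" => 18
notation "PQT" => 19
notation "PCUR" => 48

/-- The Büchi automaton with numbered states and letters: `labs s s'` lists the letters that lead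
from `s` to `s'`. -/
structure Table where
  K : ℕ
  labs : ℕ → ℕ → List ℕ
  nb : ℕ → Bool
  acc : ℕ → Bool
  ini : ℕ → Bool

/-- The number of times that the value of `le` occurs in a list. -/
def countE (le : Expr) (l : List ℕ) : Expr := l.foldr (fun k e => .add (.eq le (.const k)) e) (.const 0)

theorem eval_countE {m : Mem} {le : Expr} {l : List ℕ} :
    (countE le l).eval m ≠ 0 ↔ le.eval m ∈ l := by
  induction l with
  | nil => simp [countE, Expr.eval]
  | cons k l ih =>
    simp only [countE, List.foldr_cons, Expr.eval, List.mem_cons] at ih ⊢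
    rw [← ih]
    split_ifs with h
    · simp [h]
    · simp [h]

/-- The transitions of the product automaton. -/
def arcs (m : Mem) : Set (ℕ × ℕ) := {p | ∃ e < m 1 2, m SRC e = p.1 ∧ m DST e = p.2}

/-- Every transition is recorded once, and `PEDGE` is their indicator. -/
structure ArcTable (m : Mem) : Prop where
  pedge : ∀ p p', m PEDGE (pr p p') ≠ 0 ↔ (p, p') ∈ arcs m
  inj : ∀ e < m 1 2, ∀ e' < m 1 2, m SRC e = m SRC e' → m DST e = m DST e' → e = e'

/-- `m'` has the arcs of `m`, and possibly more of them. -/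
def ArcExt (m m' : Mem) : Prop :=
  m 1 2 ≤ m' 1 2 ∧ ∀ e < m 1 2, m' SRC e = m SRC e ∧ m' DST e = m DST e

theorem ArcExt.refl (m : Mem) : ArcExt m m := ⟨le_rfl, fun _ _ => ⟨rfl, rfl⟩⟩

theorem ArcExt.trans {m m' m'' : Mem} (h : ArcExt m m') (h' : ArcExt m' m'') : ArcExt m m'' :=
  ⟨h.1.trans h'.1, fun e he => by
    rw [(h'.2 e (he.trans_le h.1)).1, (h'.2 e (he.trans_le h.1)).2]; exact h.2 e he⟩

theorem ArcTable.congr {m m' : Mem} (h : ArcTable m) (h1 : m' 1 2 = m 1 2) (h2 : m' SRC = m SRC)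
    (h3 : m' DST = m DST) (h4 : m' PEDGE = m PEDGE) : ArcTable m' ∧ arcs m' = arcs m := by
  have h5 : arcs m' = arcs m := by simp only [arcs, h1, h2, h3]
  refine ⟨⟨?_, ?_⟩, h5⟩
  · rw [h4, h5]; exact h.pedge
  · rw [h1, h2, h3]; exact h.inj

/-- A crude count that is only needed for the word size; for the running time the arcs are counted
by transitions in `card_trans_le`. -/
theorem ArcTable.card_le {m : Mem} (h : ArcTable m) {V : ℕ} (hV : ∀ p ∈ arcs m, p.1 < V ∧ p.2 < V) :
    m 1 2 ≤ V * V := by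
  have : (Finset.range (m 1 2)).card ≤ (Finset.range V ×ˢ Finset.range V).card := by
    refine Finset.card_le_card_of_injOn (fun e => (m SRC e, m DST e)) ?_ ?_
    · intro e he
      have := hV (m SRC e, m DST e) ⟨e, by simpa using he, rfl, rfl⟩
      simpa using this
    · intro e he e' he' hee
      simp only [Prod.mk.injEq] at hee
      exact h.inj e (by simpa using he) e' (by simpa using he') hee.1 hee.2
  simpa using this

/-- Record the transition from `p` to `p'`. -/
def addArc (p p' : Expr) : Cmd :=
  .ite (notE (.read PEDGE (prE p p')))
    (.seq (.store PEDGE (prE p p') (.const 1))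
    (.seq (.store SRC (.read 1 (.const 2)) p)
    (.seq (.store DST (.read 1 (.const 2)) p')
      (.store 1 (.const 2) (.add (.read 1 (.const 2)) (.const 1))))))
    .skip

/-- The two expressions are evaluated again after each store, so they must keep their values while
the arrays of the arcs are changed. -/
theorem wp_addArc {W V : ℕ} (hW : Fits W (2 * V)) (hV : 1 ≤ V) {m : Mem} {p p' : Expr} {a b : ℕ}
    (h : ArcTable m) (hlt : ∀ p ∈ arcs m, p.1 < V ∧ p.2 < V) (ha : a < V) (hb : b < V)
    (hp : ∀ m', Frame [PEDGE, SRC, DST] m m' → p.eval m' = a ∧ p'.eval m' = b) {Q : Mem → Prop}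
    (hQ : ∀ m', Frame [1, PEDGE, SRC, DST] m m' → (∀ i, i ≠ 2 → m' 1 i = m 1 i) → ArcExt m m' →
      ArcTable m' → arcs m' = insert (a, b) (arcs m) → Q m') :
    wp W (addArc p p') Q m := by
  have hp0 := hp m (Frame.refl _ _)
  have h1W : 1 ≤ W := hW.lin _ (by omega)
  refine ⟨fun h0 => ?_, fun h0 => ?_⟩
  · simp only [Expr.eval, eval_notE, eval_prE, hp0] at h0
    have h1 : m PEDGE (pr a b) = 0 := by by_contra h1; simp [h1] at h0
    have hnew : (a, b) ∉ arcs m := fun h2 => (h.pedge a b).2 h2 h1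
    have hM : m 1 2 + 1 ≤ W := by
      have h2 := h.card_le hlt
      have h3 := hW.quad V 1 (by omega)
      unfold pr at h3
      nlinarith
    set m₁ := m.write PEDGE (pr a b) 1 with hm₁
    have f1 : Frame [PEDGE, SRC, DST] m m₁ := (Frame.refl _ _).write
    have e1 := hp m₁ f1
    set m₂ := m₁.write SRC (m 1 2) a with hm₂
    have f2 : Frame [PEDGE, SRC, DST] m m₂ := f1.write
    have e2 := hp m₂ f2
    have g1 : m₁ 1 = m 1 := f1 _ (by decide)
    have g2 : m₂ 1 = m 1 := f2 _ (by decide)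
    set m₃ := m₂.write DST (m 1 2) b with hm₃
    have f3 : Frame [PEDGE, SRC, DST] m m₃ := f2.write
    have g3 : m₃ 1 = m 1 := f3 _ (by decide)
    simp only [wp, Expr.eval, eval_prE, hp0, ← hm₁, g1, e1, ← hm₂, g2, e2, ← hm₃, g3]
    refine ⟨⟨hW.quad _ _ (by omega), h1W⟩, ⟨by omega, hW.lin _ (by omega)⟩,
      ⟨by omega, hW.lin _ (by omega)⟩, ⟨hW.lin _ (by omega), hM⟩, ?_⟩
    set m₄ := m₃.write 1 2 (m 1 2 + 1) with hm₄
    have s0 : m₄ 1 2 = m 1 2 + 1 := by simp [hm₄, write_same]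
    have s1 : m₄ SRC = Function.update (m SRC) (m 1 2) a := by
      simp [hm₄, hm₃, hm₂, hm₁, write_same, write_other]
    have s2 : m₄ DST = Function.update (m DST) (m 1 2) b := by
      simp [hm₄, hm₃, hm₂, hm₁, write_same, write_other]
    have s3 : m₄ PEDGE = Function.update (m PEDGE) (pr a b) 1 := by
      simp [hm₄, hm₃, hm₂, hm₁, write_same, write_other]
    have hext : ArcExt m m₄ := by
      refine ⟨by omega, fun e he => ?_⟩
      rw [s1, s2, Function.update_of_ne (by omega), Function.update_of_ne (by omega)]
      exact ⟨rfl, rfl⟩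
    have hend : m₄ SRC (m 1 2) = a ∧ m₄ DST (m 1 2) = b := by rw [s1, s2]; simp
    have harcs : arcs m₄ = insert (a, b) (arcs m) := by
      ext ⟨p, p'⟩
      simp only [arcs, Set.mem_ofPred_eq, Set.mem_insert_iff, Prod.mk.injEq, s0]
      constructor
      · rintro ⟨e, he, h2, h3⟩
        rcases Nat.lt_succ_iff_lt_or_eq.1 he with h6 | rfl
        · rw [(hext.2 e h6).1] at h2
          rw [(hext.2 e h6).2] at h3
          exact Or.inr ⟨e, h6, h2, h3⟩
        · rw [hend.1] at h2
          rw [hend.2] at h3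
          exact Or.inl ⟨h2.symm, h3.symm⟩
      · rintro (⟨rfl, rfl⟩ | ⟨e, h6, h2, h3⟩)
        · exact ⟨m 1 2, by omega, hend.1, hend.2⟩
        · exact ⟨e, by omega, by rw [(hext.2 e h6).1]; exact h2, by rw [(hext.2 e h6).2]; exact h3⟩
    refine hQ m₄ (f3.mono.write) (fun i hi => ?_) hext ⟨fun p p' => ?_, ?_⟩ harcs
    · rw [hm₄, write_same, Function.update_of_ne hi, g3]
    · rw [harcs, s3, Function.update_apply, Set.mem_insert_iff, Prod.mk.injEq, ← h.pedge, ← pr_inj]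
      split_ifs with h2
      · simp [h2]
      · simp [h2]
    · intro e he e' he' h2 h3
      rw [s0] at he he'
      rcases Nat.lt_succ_iff_lt_or_eq.1 he with h6 | rfl <;>
      rcases Nat.lt_succ_iff_lt_or_eq.1 he' with h7 | rfl
      · rw [(hext.2 e h6).1, (hext.2 e' h7).1] at h2
        rw [(hext.2 e h6).2, (hext.2 e' h7).2] at h3
        exact h.inj e h6 e' h7 h2 h3
      · rw [(hext.2 e h6).1, hend.1] at h2
        rw [(hext.2 e h6).2, hend.2] at h3
        exact absurd ⟨e, h6, h2, h3⟩ hnew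
      · rw [(hext.2 e' h7).1, hend.1] at h2
        rw [(hext.2 e' h7).2, hend.2] at h3
        exact absurd ⟨e', h7, h2.symm, h3.symm⟩ hnew
      · rfl
  · simp only [Expr.eval, eval_notE, eval_prE, hp0] at h0
    have h1 : m PEDGE (pr a b) ≠ 0 := by intro h1; simp [h1] at h0
    refine hQ m (Frame.refl _ _) (fun _ _ => rfl) (ArcExt.refl m) h ?_
    rw [Set.insert_eq_of_mem ((h.pedge a b).1 h1)]

/-! ### The product transitions over a new transition -/

/-- The number of the product state over the vertex `x` with automaton state `s`. -/
def codeE (K : ℕ) (x : Expr) (s : ℕ) : Expr := .add (.mul x (.const K)) (.const s)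

/-- The pairs of automaton states. -/
def pairs (K : ℕ) : List (ℕ × ℕ) := (List.range K) ×ˢ (List.range K)

theorem mem_pairs {K : ℕ} {c : ℕ × ℕ} : c ∈ pairs K ↔ c.1 < K ∧ c.2 < K := by
  rcases c with ⟨s, s'⟩
  simp [pairs]

/-- Record the product transition over the transition of the arguments from `s` to `s'`. -/
def enterPair (τ : Table) (c : ℕ × ℕ) : Cmd :=
  .ite (.mul (.const (if τ.nb c.2 then 1 else 0)) (.mul (.read INP (codeE τ.K (.read 0 (.const 0)) c.1))
      (countE (.read 0 (.const 2)) (τ.labs c.1 c.2))))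
    (.seq (addArc (codeE τ.K (.read 0 (.const 0)) c.1) (codeE τ.K (.read 0 (.const 1)) c.2))
      (.seq (.store NEWS (.const c.2) (.const 1)) (.store 1 (.const 0) (.const 1))))
    .skip

/-- There is a product transition over the transition of the arguments from `s` to the non-blocking
state `s'`. -/
def Enters (τ : Table) (m : Mem) (c : ℕ × ℕ) : Prop :=
  τ.nb c.2 = true ∧ m INP (m 0 0 * τ.K + c.1) ≠ 0 ∧ m 0 2 ∈ τ.labs c.1 c.2

/-- Record the product transitions over the transition of the arguments. -/
def enterArcs (τ : Table) : Cmd :=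
  .seq (.store 1 (.const 0) (.const 0))
    (.seq (seqs ((List.range τ.K).map fun s => .store NEWS (.const s) (.const 0)))
      (seqs ((pairs τ.K).map (enterPair τ))))

/-- This part runs before it is known whether the call succeeds. If no pair enters, only `NEWS` and
the return flag have been touched, so a rejected call needs no undoing. -/
theorem wp_enterArcs {W V : ℕ} {τ : Table} (hW : Fits W (2 * V)) {m : Mem} (h : ArcTable m)
    (hlt : ∀ p ∈ arcs m, p.1 < V ∧ p.2 < V) (hx : m 0 0 * τ.K + τ.K ≤ V)
    (hx' : m 0 1 * τ.K + τ.K ≤ V) (hV : 1 ≤ V) {Q : Mem → Prop}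
    (hQ : ∀ m', Frame [1, PEDGE, SRC, DST, NEWS] m m' →
      (∀ i, i ≠ 0 → i ≠ 2 → m' 1 i = m 1 i) → ArcExt m m' → ArcTable m' →
      (∀ p p', (p, p') ∈ arcs m' ↔ (p, p') ∈ arcs m ∨ ∃ c : ℕ × ℕ, c.1 < τ.K ∧ c.2 < τ.K ∧
        Enters τ m c ∧ p = m 0 0 * τ.K + c.1 ∧ p' = m 0 1 * τ.K + c.2) →
      (∀ s' < τ.K, m' NEWS s' ≠ 0 ↔ ∃ s < τ.K, Enters τ m (s, s')) →
      (m' 1 0 ≠ 0 ↔ ∃ s < τ.K, ∃ s' < τ.K, Enters τ m (s, s')) → Q m') :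
    wp W (enterArcs τ) Q m := by
  have h1W : 1 ≤ W := hW.lin _ (by omega)
  refine ⟨⟨Nat.zero_le _, Nat.zero_le _⟩, ?_⟩
  simp only [Expr.eval]
  set m₁ := m.write 1 0 0 with hm₁
  refine (wp_seqs (fun s => .store NEWS (.const s) (.const 0)) (fun l m' =>
    Frame [NEWS] m₁ m' ∧ ∀ s ∈ l, m' NEWS s = 0) (List.range τ.K) ?_ (m := m₁)
    ⟨Frame.refl _ _, by simp⟩).mono ?_
  · rintro l s m' hl ⟨f, h0⟩
    have hs : s < τ.K := by
      have := hl.subset (a := s) (by simp)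
      simpa using this
    refine ⟨⟨?_, Nat.zero_le _⟩, f.write, ?_⟩
    · simp only [Expr.eval]; exact hW.lin _ (by omega)
    · intro s' hs'
      simp only [Expr.eval, write_same, Function.update_apply]
      split_ifs with h1
      · rfl
      · rw [List.mem_append, List.mem_singleton] at hs'
        exact h0 s' (hs'.resolve_right h1)
  rintro m₂ ⟨f2, hnews⟩
  have f12 : Frame [1, NEWS] m m₂ := ((Frame.refl _ m).write (S := [1])).trans f2
  have hone : ∀ i, i ≠ 0 → m₂ 1 i = m 1 i := by
    intro i hi
    rw [f2 1 (by decide), hm₁, write_same, Function.update_of_ne hi]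
  have hzero : m₂ 1 0 = 0 := by rw [f2 1 (by decide), hm₁, write_same]; simp
  obtain ⟨hT, harcs⟩ := h.congr (hone 2 (by decide)) (f12 SRC (by decide)) (f12 DST (by decide))
    (f12 PEDGE (by decide))
  refine (wp_seqs (enterPair τ) (fun l m' => Frame [1, PEDGE, SRC, DST, NEWS] m m' ∧
      (∀ i, i ≠ 0 → i ≠ 2 → m' 1 i = m 1 i) ∧ ArcExt m m' ∧ ArcTable m' ∧
      (∀ p p', (p, p') ∈ arcs m' ↔ (p, p') ∈ arcs m ∨ ∃ c ∈ l,
        Enters τ m c ∧ p = m 0 0 * τ.K + c.1 ∧ p' = m 0 1 * τ.K + c.2) ∧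
      (∀ s' < τ.K, m' NEWS s' ≠ 0 ↔ ∃ s, (s, s') ∈ l ∧ Enters τ m (s, s')) ∧
      (m' 1 0 ≠ 0 ↔ ∃ c ∈ l, Enters τ m c)) (pairs τ.K) ?_ (m := m₂)
    ⟨f12.mono, fun i hi _ => hone i hi, ⟨(hone 2 (by decide)).ge, fun e _ => ⟨by
      rw [f12 SRC (by decide)], by rw [f12 DST (by decide)]⟩⟩, hT, ?_, ?_, ?_⟩).mono ?_
  · rintro l c m₃ hl ⟨f3, hone3, hext, hT3, harcs3, hnews3, hflag⟩
    have hc := mem_pairs.1 (hl.subset (a := c) (by simp))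
    have e0 : m₃ 0 = m 0 := f3 _ (by decide)
    have e2 : m₃ INP = m INP := f3 _ (by decide)
    have hcond : (Expr.mul (.const (if τ.nb c.2 then 1 else 0)) (.mul (.read INP
        (codeE τ.K (.read 0 (.const 0)) c.1)) (countE (.read 0 (.const 2)) (τ.labs c.1 c.2)))).eval m₃ ≠ 0
        ↔ Enters τ m c := by
      rw [Expr.eval, Nat.mul_ne_zero_iff, Expr.eval, Expr.eval, Nat.mul_ne_zero_iff, eval_countE]
      simp only [Expr.eval, codeE, e0, e2, Enters]
      simp
    refine ⟨fun h1 => ?_, fun h1 => ?_⟩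
    · rw [hcond] at h1
      refine wp_addArc hW hV (a := m 0 0 * τ.K + c.1) (b := m 0 1 * τ.K + c.2) hT3 ?_ (by omega)
        (by omega) ?_ ?_
      · rintro ⟨p, p'⟩ hp
        rcases (harcs3 p p').1 hp with hp | ⟨c', hc', -, rfl, rfl⟩
        · exact hlt _ hp
        · have := mem_pairs.1 (hl.subset (a := c') (by simp [hc']))
          simp only
          omega
      · intro m' hm'
        simp only [codeE, Expr.eval, hm' 0 (by decide), e0]
        exact ⟨trivial, trivial⟩
      · intro m' f' hone' hext' hT' harcs'
        simp only [wp, Expr.eval]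
        refine ⟨⟨hW.lin _ (by omega), h1W⟩, ⟨Nat.zero_le _, h1W⟩, ?_⟩
        set m'' := (m'.write NEWS c.2 1).write 1 0 1 with hm''
        have t1 : ∀ i, i ≠ 0 → m'' 1 i = m' 1 i := by
          intro i hi
          simp [hm'', write_same, write_other, hi]
        have t2 : m'' 1 0 = 1 := by simp [hm'', write_same]
        have t3 : m'' NEWS = Function.update (m' NEWS) c.2 1 := by simp [hm'', write_same, write_other]
        have f'' : Frame [1, NEWS] m' m'' := (Frame.refl _ _).write.write
        obtain ⟨hT'', harcs''⟩ := hT'.congr (t1 2 (by decide)) (f'' SRC (by decide))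
          (f'' DST (by decide)) (f'' PEDGE (by decide))
        refine ⟨f3.trans (S'' := [1, PEDGE, SRC, DST, NEWS]) f' |>.trans f'', fun i hi hi' => ?_,
          (hext.trans hext').trans ⟨(t1 2 (by decide)).ge, fun e _ => ⟨by rw [f'' SRC (by decide)], by
            rw [f'' DST (by decide)]⟩⟩, hT'', ?_, ?_, ?_⟩
        · rw [t1 i hi, hone' i hi', hone3 i hi hi']
        · intro p p'
          rw [harcs'', harcs', Set.mem_insert_iff, harcs3, Prod.mk.injEq]
          constructor
          · rintro (⟨rfl, rfl⟩ | h2 | ⟨c', h2, h3⟩)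
            · exact Or.inr ⟨c, by simp, h1, rfl, rfl⟩
            · exact Or.inl h2
            · exact Or.inr ⟨c', by simp [h2], h3⟩
          · rintro (h2 | ⟨c', h2, h3, h4, h5⟩)
            · exact Or.inr (Or.inl h2)
            · rcases List.mem_append.1 h2 with h2 | h2
              · exact Or.inr (Or.inr ⟨c', h2, h3, h4, h5⟩)
              · rw [List.mem_singleton] at h2
                subst h2
                exact Or.inl ⟨h4, h5⟩
        · intro s' hs'
          rw [t3, Function.update_apply]
          split_ifs with h2
          · simp only [ne_eq, one_ne_zero, not_false_eq_true, true_iff]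
            exact ⟨c.1, by simp [h2], by rw [h2]; exact h1⟩
          · rw [f' NEWS (by decide), hnews3 s' hs']
            refine exists_congr fun s => and_congr_left fun _ => ?_
            simp only [List.mem_append, List.mem_singleton]
            refine ⟨Or.inl, fun h3 => h3.resolve_right ?_⟩
            rintro rfl
            exact h2 rfl
        · rw [t2]
          simp only [ne_eq, one_ne_zero, not_false_eq_true, true_iff]
          exact ⟨c, by simp, h1⟩
    · have h1 : ¬ Enters τ m c := by
        rw [← hcond]; simpa using h1
      refine ⟨f3, hone3, hext, hT3, ?_, ?_, ?_⟩
      · intro p p'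
        rw [harcs3]
        refine or_congr_right (exists_congr fun c' => ?_)
        simp only [List.mem_append, List.mem_singleton]
        refine ⟨fun h2 => ⟨Or.inl h2.1, h2.2⟩, fun h2 => ⟨h2.1.resolve_right ?_, h2.2⟩⟩
        rintro rfl
        exact h1 h2.2.1
      · intro s' hs'
        rw [hnews3 s' hs']
        refine exists_congr fun s => ?_
        simp only [List.mem_append, List.mem_singleton]
        refine ⟨fun h2 => ⟨Or.inl h2.1, h2.2⟩, fun h2 => ⟨h2.1.resolve_right ?_, h2.2⟩⟩
        rintro rfl
        exact h1 h2.2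
      · rw [hflag]
        refine exists_congr fun c' => ?_
        simp only [List.mem_append, List.mem_singleton]
        refine ⟨fun h2 => ⟨Or.inl h2.1, h2.2⟩, fun h2 => ⟨h2.1.resolve_right ?_, h2.2⟩⟩
        rintro rfl
        exact h1 h2.2
  · intro p p'
    rw [harcs]; simp
  · intro s' hs'
    simp [hnews s' (by simpa using hs')]
  · simp [hzero]
  · rintro m' ⟨h1, h2, h3, h4, h5, h6, h7⟩
    refine hQ m' h1 h2 h3 h4 ?_ ?_ ?_
    · intro p p'
      rw [h5]
      refine or_congr_right (exists_congr fun c => ?_)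
      rw [mem_pairs, and_assoc]
    · intro s' hs'
      rw [h6 s' hs']
      refine exists_congr fun s => ?_
      rw [mem_pairs]
      exact ⟨fun h => ⟨h.1.1, h.2⟩, fun h => ⟨⟨h.1, hs'⟩, h.2⟩⟩
    · rw [h7]
      constructor
      · rintro ⟨⟨s, s'⟩, hc, h8⟩
        have := mem_pairs.1 hc
        exact ⟨s, this.1, s', this.2, h8⟩
      · rintro ⟨s, hs, s', hs', h8⟩
        exact ⟨(s, s'), mem_pairs.2 ⟨hs, hs'⟩, h8⟩

/-! ### New vertices -/

theorem Rch.eq_of_isolated {src dst : ℕ → ℕ} {M a b : ℕ} (h : Rch src dst M a b)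
    (hs : ∀ e < M, src e ≠ a) : a = b := by
  induction h using Relation.ReflTransGen.head_induction_on with
  | refl => rfl
  | head h _ _ => obtain ⟨e, he, rfl, -⟩ := h; exact absurd rfl (hs e he)

/-- The data structure with the new isolated vertex `V`. -/
structure AddedVertex (V b : ℕ) (m m' : Mem) : Prop where
  frame : Frame [COMP, SIZE, MLST, LEV, ODEG, IDEG, ACC] m m'
  comp : m' COMP = Function.update (m COMP) V V
  size : m' SIZE = Function.update (m SIZE) V 1
  mlst : m' MLST = Function.update (m MLST) (pr V 0) V
  lev : m' LEV = Function.update (m LEV) V 0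
  odeg : m' ODEG = Function.update (m ODEG) V 0
  ideg : m' IDEG = Function.update (m IDEG) V 0
  acc : m' ACC = Function.update (m ACC) V b

/-- Component names are vertices below `V`, so `V` is free as the name of the new component. -/
theorem SccInv.addVertex {acc : ℕ → Prop} {V M b : ℕ} {m m' : Mem} (h : SccInv acc V M M M m)
    (hm : AddedVertex V b m m') (hb : b ≠ 0 ↔ acc V) : SccInv acc (V + 1) M M M m' := by
  have e1 : m' SRC = m SRC := hm.frame _ (by decide)
  have e2 : m' DST = m DST := hm.frame _ (by decide)
  have e3 : m' OLST = m OLST := hm.frame _ (by decide)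
  have e4 : m' ILST = m ILST := hm.frame _ (by decide)
  have e5 : m' 1 = m 1 := hm.frame _ (by decide)
  have e6 : m' MARK = m MARK := hm.frame _ (by decide)
  have e7 : m' STAMP = m STAMP := hm.frame _ (by decide)
  have hc : ∀ x < V, m' COMP x = m COMP x := fun x hx => by
    rw [hm.comp, Function.update_of_ne (by omega)]
  have hcV : m' COMP V = V := by rw [hm.comp, Function.update_self]
  have hcne : ∀ x < V, m COMP x ≠ V := fun x hx => (h.compLt x hx).ne
  have hl : ∀ x < V, m' LEV x = m LEV x := fun x hx => by
    rw [hm.lev, Function.update_of_ne (by omega)]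
  have hcases : ∀ {x}, x < V + 1 → x < V ∨ x = V := fun hx => Nat.lt_succ_iff_lt_or_eq.1 hx
  have hsne : ∀ e < M, m SRC e ≠ V := fun e he => (h.ends e he).1.ne
  have hdne : ∀ e < M, m DST e ≠ V := fun e he => (h.ends e he).2.ne
  have hm1 : ∀ c, c ≠ V → lst (m' SIZE) (m' MLST) c = lst (m SIZE) (m MLST) c := by
    intro c hc
    simp only [lst, hm.size, hm.mlst, Function.update_of_ne hc]
    refine List.map_congr_left fun i _ => ?_
    rw [Function.update_of_ne (by rw [Ne, pr_inj]; tauto)]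
  have hm2 : lst (m' SIZE) (m' MLST) V = [V] := by simp [lst, hm.size, hm.mlst]
  have ho1 : ∀ c, c ≠ V → lst (m' ODEG) (m' OLST) c = lst (m ODEG) (m OLST) c := by
    intro c hc
    simp only [lst, hm.odeg, e3, Function.update_of_ne hc]
  have ho2 : lst (m' ODEG) (m' OLST) V = [] := by simp [lst, hm.odeg]
  have hi1 : ∀ c, c ≠ V → lst (m' IDEG) (m' ILST) c = lst (m IDEG) (m ILST) c := by
    intro c hc
    simp only [lst, hm.ideg, e4, Function.update_of_ne hc]
  have hi2 : lst (m' IDEG) (m' ILST) V = [] := by simp [lst, hm.ideg]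
  have ha : ∀ c, c ≠ V → m' ACC c = m ACC c := fun c hc => by
    rw [hm.acc, Function.update_of_ne hc]
  have haV : m' ACC V = b := by rw [hm.acc, Function.update_self]
  refine ⟨?_, ?_, ?_, ?_, ?_, ?_, ?_, ?_, ?_, ?_, ?_, ?_, ?_⟩
  · rw [e1, e2]
    exact fun e he => ⟨(h.ends e he).1.trans (by omega), (h.ends e he).2.trans (by omega)⟩
  · intro x hx
    rcases hcases hx with hx | rfl
    · rw [hc x hx]; exact (h.compLt x hx).trans (by omega)
    · omega
  · intro x hx y hy
    rw [e1, e2]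
    rcases hcases hx with hx | rfl <;> rcases hcases hy with hy | rfl
    · rw [hc x hx, hc y hy, h.comp x hx y hy]
    · rw [hc x hx, hcV]
      exact ⟨fun h1 => absurd h1 (hcne x hx), fun h1 => absurd (h1.2.eq_of_isolated hsne) hx.ne'⟩
    · rw [hc y hy, hcV]
      exact ⟨fun h1 => absurd h1.symm (hcne y hy), fun h1 => absurd (h1.1.eq_of_isolated hsne) hy.ne'⟩
    · exact ⟨fun _ => Mut.refl _, fun _ => rfl⟩
  · intro x hx
    rcases hcases hx with hx | rfl
    · rw [ho1 x hx.ne]; exact h.outNodup x hx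
    · rw [ho2]; exact List.nodup_nil
  · intro x hx e
    rw [e1]
    rcases hcases hx with hx | rfl
    · rw [ho1 x hx.ne]; exact h.out x hx e
    · rw [ho2]
      simp only [List.not_mem_nil, false_iff]
      exact fun h1 => hsne e h1.1 h1.2
  · intro x hx
    rcases hcases hx with hx | rfl
    · rw [hc x hx, hi1 _ (hcne x hx)]; exact h.inNodup x hx
    · rw [hcV, hi2]; exact List.nodup_nil
  · intro x hx e
    rw [e1, e2]
    rcases hcases hx with hx | rfl
    · rw [hc x hx, hi1 _ (hcne x hx), h.inn x hx]
      refine and_congr_right fun he => ?_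
      rw [hc _ (h.ends e he).1, hc _ (h.ends e he).2, hl _ (h.ends e he).1, hl _ (h.ends e he).2]
    · rw [hcV, hi2]
      simp only [List.not_mem_nil, false_iff]
      rintro ⟨h1, h2, -⟩
      rw [hc _ (h.ends e h1).2] at h2
      exact hcne _ (h.ends e h1).2 h2
  · intro x hx
    rcases hcases hx with hx | rfl
    · rw [hc x hx, hm1 _ (hcne x hx)]; exact h.memNodup x hx
    · rw [hcV, hm2]; exact List.nodup_singleton _
  · intro x hx z
    rcases hcases hx with hx | rfl
    · rw [hc x hx, hm1 _ (hcne x hx), h.mem x hx]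
      constructor
      · rintro ⟨h1, h2⟩
        exact ⟨by omega, by rw [hc z h1]; exact h2⟩
      · rintro ⟨h1, h2⟩
        rcases hcases h1 with h1 | rfl
        · exact ⟨h1, by rw [← hc z h1]; exact h2⟩
        · exact absurd (hcV.symm.trans h2).symm (hcne x hx)
    · rw [hcV, hm2, List.mem_singleton]
      constructor
      · rintro rfl; exact ⟨by omega, hcV⟩
      · rintro ⟨h1, h2⟩
        rcases hcases h1 with h1 | rfl
        · rw [hc z h1] at h2; exact absurd h2 (hcne z h1)
        · rfl
  · intro x hx
    rcases hcases hx with hx | rfl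
    · rw [hc x hx, ha _ (hcne x hx), h.accComp x hx]
      constructor
      · rintro ⟨z, hz, h1, h2⟩
        exact ⟨z, by omega, by rw [hc z hz]; exact h1, h2⟩
      · rintro ⟨z, hz, h1, h2⟩
        rcases hcases hz with hz | rfl
        · exact ⟨z, hz, by rw [← hc z hz]; exact h1, h2⟩
        · exact absurd (hcV.symm.trans h1).symm (hcne x hx)
    · rw [hcV, haV, hb]
      constructor
      · intro h1; exact ⟨x, by omega, hcV, h1⟩
      · rintro ⟨z, hz, h1, h2⟩
        rcases hcases hz with hz | rfl
        · rw [hc z hz] at h1; exact absurd h1 (hcne z hz)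
        · exact h2
  · rw [e5, h.found]
    constructor
    · rintro ⟨x, hx, y, hy, h1, h2, h3⟩
      exact ⟨x, by omega, y, by omega, h1, by rw [hc x hx, hc y hy]; exact h2, h3⟩
    · rintro ⟨x, hx, y, hy, h1, h2, h3⟩
      rcases hcases hx with hx | rfl <;> rcases hcases hy with hy | rfl
      · exact ⟨x, hx, y, hy, h1, by rw [← hc x hx, ← hc y hy]; exact h2, h3⟩
      · rw [hcV, hc x hx] at h2; exact absurd h2 (hcne x hx)
      · rw [hcV, hc y hy] at h2; exact absurd h2.symm (hcne y hy)
      · exact absurd rfl h1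
  · rw [e1, e2]
    refine h.lev.extend (Nat.le_succ _) h.ends hl fun x hx hx' => ?_
    obtain rfl : x = V := by omega
    rw [hm.lev, Function.update_self]
  · rw [e6, e7]; exact h.mark

/-- A single vertex at level 0 contributes nothing, because `log 1 = 0`. -/
theorem potential_addVertex {acc : ℕ → Prop} {V M b : ℕ} {m m' : Mem} (h : SccInv acc V M M M m)
    (hm : AddedVertex V b m m') : potential (V + 1) M m' = potential V M m := by
  have e1 : m' SRC = m SRC := hm.frame _ (by decide)
  have hc : ∀ x < V, m' COMP x = m COMP x := fun x hx => by
    rw [hm.comp, Function.update_of_ne (by omega)]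
  have h1 : ∑ y ∈ Finset.range (V + 1), m' LEV y = ∑ y ∈ Finset.range V, m LEV y := by
    rw [Finset.sum_range_succ, hm.lev, Function.update_self, add_zero]
    refine Finset.sum_congr rfl fun y hy => ?_
    rw [Function.update_of_ne (by rw [Finset.mem_range] at hy; omega)]
  have h2 : ∑ e ∈ Finset.range M, m' LEV (m' SRC e) = ∑ e ∈ Finset.range M, m LEV (m SRC e) := by
    refine Finset.sum_congr rfl fun e he => ?_
    rw [Finset.mem_range] at he
    rw [e1, hm.lev, Function.update_of_ne (h.ends e he).1.ne]
  have h3 : logSize (V + 1) m' = logSize V m := by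
    unfold logSize
    rw [Finset.sum_range_succ, hm.comp, Function.update_self, hm.size, Function.update_self]
    simp only [Nat.log_one_right, add_zero]
    refine Finset.sum_congr rfl fun y hy => ?_
    rw [Finset.mem_range] at hy
    rw [Function.update_of_ne hy.ne, Function.update_of_ne (h.compLt y hy).ne]
  unfold potential
  rw [h1, h2, h3]

/-- The data structure does not depend on the other arrays, nor on the arcs that are not yet
inserted. -/
theorem SccInv.congr_extend {acc : ℕ → Prop} {V M : ℕ} {m m' : Mem} {S : List ℕ}
    (h : SccInv acc V M M M m) (hf : Frame S m m') (h1 : m' 1 1 = m 1 1)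
    (he : ∀ e < M, m' SRC e = m SRC e ∧ m' DST e = m DST e)
    (hS : ∀ a ∈ [COMP, LEV, ODEG, OLST, IDEG, ILST, SIZE, MLST, ACC, MARK, STAMP], a ∉ S := by decide) :
    SccInv acc V M M M m' ∧ potential V M m' = potential V M m := by
  have e3 : m' COMP = m COMP := hf _ (hS _ (by decide))
  have e4 : m' LEV = m LEV := hf _ (hS _ (by decide))
  have e5 : m' ODEG = m ODEG := hf _ (hS _ (by decide))
  have e6 : m' OLST = m OLST := hf _ (hS _ (by decide))
  have e7 : m' IDEG = m IDEG := hf _ (hS _ (by decide))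
  have e8 : m' ILST = m ILST := hf _ (hS _ (by decide))
  have e9 : m' SIZE = m SIZE := hf _ (hS _ (by decide))
  have e10 : m' MLST = m MLST := hf _ (hS _ (by decide))
  have e11 : m' ACC = m ACC := hf _ (hS _ (by decide))
  have e13 : m' MARK = m MARK := hf _ (hS _ (by decide))
  have e14 : m' STAMP = m STAMP := hf _ (hS _ (by decide))
  have hR : ∀ a b, Rch (m' SRC) (m' DST) M a b ↔ Rch (m SRC) (m DST) M a b := fun a b =>
    (Rch.congr (fun e h => (he e h).1) fun e h => (he e h).2)
  constructor
  · refine ⟨?_, ?_, ?_, ?_, ?_, ?_, ?_, ?_, ?_, ?_, ?_, ?_, ?_⟩ <;>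
      try simp only [e3, e4, e5, e6, e7, e8, e9, e10, e11, e13, e14, h1]
    · intro e h'
      rw [(he e h').1, (he e h').2]; exact h.ends e h'
    · exact h.compLt
    · intro x hx y hy
      rw [h.comp x hx y hy, Mut, Mut, hR, hR]
    · exact h.outNodup
    · intro x hx e
      rw [h.out x hx]
      exact and_congr_right fun h' => by rw [(he e h').1]
    · exact h.inNodup
    · intro x hx e
      rw [h.inn x hx]
      exact and_congr_right fun h' => by rw [(he e h').1, (he e h').2]
    · exact h.memNodup
    · exact h.mem
    · exact h.accComp
    · exact h.found
    · obtain ⟨hm, l, hl, hk⟩ := h.lev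
      refine ⟨fun e h' => by rw [(he e h').1, (he e h').2]; exact hm e h', l, fun e h' hr => ?_,
        fun k u hu hku hmin => ?_⟩
      · rw [hR, (he e h').1, (he e h').2] at hr
        rw [(he e h').1]; exact hl e h' hr
      · obtain ⟨A, hA, hA'⟩ := hk k u hu hku fun x hx h2 h3 => hmin x hx ((hR _ _).2 h2) (by rwa [hR])
        refine ⟨A, hA, fun e h' => ?_⟩
        obtain ⟨h2, h3, h4⟩ := hA' e h'
        exact ⟨h2, h3, by rw [hR, (he e h2).2]; exact h4⟩
    · exact h.mark
  · have h2 : ∑ e ∈ Finset.range M, m LEV (m' SRC e) = ∑ e ∈ Finset.range M, m LEV (m SRC e) :=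
      Finset.sum_congr rfl fun e h' => by rw [(he e (by simpa using h')).1]
    simp only [potential, logSize, e3, e4, e9, h2]

/-- Create the product state with automaton state `s` over the vertex `xE`. -/
def addVertex (τ : Table) (xE : Expr) (s : ℕ) : Cmd :=
  .seq (.store COMP (codeE τ.K xE s) (codeE τ.K xE s))
    (.seq (.store SIZE (codeE τ.K xE s) (.const 1))
    (.seq (.store MLST (prE (codeE τ.K xE s) (.const 0)) (codeE τ.K xE s))
    (.seq (.store LEV (codeE τ.K xE s) (.const 0))
    (.seq (.store ODEG (codeE τ.K xE s) (.const 0))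
    (.seq (.store IDEG (codeE τ.K xE s) (.const 0))
      (.store ACC (codeE τ.K xE s) (.const (if τ.acc s then 1 else 0))))))))

/-- The accepting product states. -/
def Table.Acc (τ : Table) (p : ℕ) : Prop := τ.acc (p % τ.K) = true

/-- Create the product states over the vertex `xE`. -/
def addVertices (τ : Table) (xE : Expr) : Cmd := seqs ((List.range τ.K).map (addVertex τ xE))

/-- All `K` product states over a vertex are created at once, as isolated vertices, whether or not
they belong to the product automaton. This fixes the numbering `x * K + s`; membership is kept
apart, in `INP`. -/
theorem wp_addVertices {W n M : ℕ} {τ : Table} {xE : Expr} (hW : Fits W ((n + 1) * τ.K)) {m : Mem}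
    (h : SccInv τ.Acc (n * τ.K) M M M m)
    (hx : ∀ m', Frame [COMP, SIZE, MLST, LEV, ODEG, IDEG, ACC] m m' → xE.eval m' = n)
    {Q : Mem → Prop}
    (hQ : ∀ m', Frame [COMP, SIZE, MLST, LEV, ODEG, IDEG, ACC] m m' →
      SccInv τ.Acc ((n + 1) * τ.K) M M M m' →
      potential ((n + 1) * τ.K) M m' = potential (n * τ.K) M m → Q m') :
    wp W (addVertices τ xE) Q m := by
  refine (wp_seqs (addVertex τ xE) (fun l m' => Frame [COMP, SIZE, MLST, LEV, ODEG, IDEG, ACC] m m' ∧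
    SccInv τ.Acc (n * τ.K + l.length) M M M m' ∧
    potential (n * τ.K + l.length) M m' = potential (n * τ.K) M m) _ ?_ (m := m)
    ⟨Frame.refl _ _, by simpa using h, by simp⟩).mono ?_
  · rintro l s m₁ hl ⟨f, hS, hP⟩
    have hs : s < τ.K ∧ l.length = s := by
      have h1 := hl.getElem (i := l.length) (by simp)
      have h2 := hl.length_le
      simp only [List.length_append, List.length_range, List.length_singleton] at h2
      simp at h1
      omega
    obtain ⟨hsK, hls⟩ := hs
    rw [hls] at hS hP
    set V := n * τ.K + s with hV
    have hVlt : V < (n + 1) * τ.K := by rw [add_mul, one_mul]; omega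
    have h1W : 1 ≤ W := hW.lin _ (by omega)
    have hVW : V ≤ W := hW.lin _ (by omega)
    have hprW : pr V 0 ≤ W := hW.quad _ _ (by omega)
    have hcode : ∀ m', Frame [COMP, SIZE, MLST, LEV, ODEG, IDEG, ACC] m m' →
        (codeE τ.K xE s).eval m' = V := fun m' hm' => by
      simp only [codeE, Expr.eval, hx m' hm']; rw [hV]
    have hpr : ∀ m', Frame [COMP, SIZE, MLST, LEV, ODEG, IDEG, ACC] m m' →
        (prE (codeE τ.K xE s) (.const 0)).eval m' = pr V 0 := fun m' hm' => by
      rw [eval_prE, hcode m' hm']; rfl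
    set b := if τ.acc s then 1 else 0 with hb
    have hb1 : b ≤ 1 := by rw [hb]; split_ifs <;> omega
    set n1 := m₁.write COMP V V with hn1
    have g1 := f.write (a := COMP) (i := V) (v := V)
    set n2 := n1.write SIZE V 1 with hn2
    have g2 := g1.write (a := SIZE) (i := V) (v := 1)
    set n3 := n2.write MLST (pr V 0) V with hn3
    have g3 := g2.write (a := MLST) (i := pr V 0) (v := V)
    set n4 := n3.write LEV V 0 with hn4
    have g4 := g3.write (a := LEV) (i := V) (v := 0)
    set n5 := n4.write ODEG V 0 with hn5
    have g5 := g4.write (a := ODEG) (i := V) (v := 0)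
    set n6 := n5.write IDEG V 0 with hn6
    have g6 := g5.write (a := IDEG) (i := V) (v := 0)
    have hadd : AddedVertex V b m₁ (n6.write ACC V b) := by
      refine ⟨(Frame.refl _ _).write.write.write.write.write.write.write, ?_, ?_, ?_, ?_, ?_, ?_, ?_⟩ <;>
        simp [hn6, hn5, hn4, hn3, hn2, hn1, write_same, write_other]
    have hacc : b ≠ 0 ↔ τ.Acc V := by
      rw [hb, Table.Acc, hV, Nat.mul_add_mod_self_right, Nat.mod_eq_of_lt hsK]
      split_ifs with h1 <;> simp [h1]
    simp only [addVertex, wp, hcode m₁ f, ← hn1, hcode n1 g1, ← hn2, hcode n2 g2, hpr n2 g2, ← hn3,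
      hcode n3 g3, ← hn4, hcode n4 g4, ← hn5, hcode n5 g5, ← hn6, hcode n6 g6, Expr.eval, ← hb,
      List.length_append, List.length_singleton, hls]
    refine ⟨⟨hVW, hVW⟩, ⟨hVW, h1W⟩, ⟨hprW, hVW⟩, ⟨hVW, Nat.zero_le _⟩, ⟨hVW, Nat.zero_le _⟩,
      ⟨hVW, Nat.zero_le _⟩, ⟨hVW, by omega⟩, g6.write, ?_, ?_⟩
    · exact hS.addVertex hadd hacc
    · rw [← add_assoc, potential_addVertex hS hadd, hP]
  · rintro m' ⟨f, hS, hP⟩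
    rw [List.length_range] at hS hP
    rw [← Nat.succ_mul] at hS hP
    exact hQ m' f hS hP

/-! ### The transition system in memory -/

/-- The transition system has `n` vertices; `lst (m DEG) (m TADJ) x` lists the successors of `x`. -/
structure TransInv (n : ℕ) (m : Mem) : Prop where
  num : m NUM 0 = n
  deg : ∀ x, n ≤ x → m DEG x = 0
  adj : ∀ x, ∀ y ∈ lst (m DEG) (m TADJ) x, y < n
  nodup : ∀ x, (lst (m DEG) (m TADJ) x).Nodup
  tedge : ∀ x y, m TEDGE (pr x y) ≠ 0 ↔ y ∈ lst (m DEG) (m TADJ) x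

theorem TransInv.congr {n : ℕ} {m m' : Mem} (h : TransInv n m) (h1 : m' NUM = m NUM)
    (h2 : m' DEG = m DEG) (h3 : m' TADJ = m TADJ) (h4 : m' TEDGE = m TEDGE) : TransInv n m' := by
  refine ⟨?_, ?_, ?_, ?_, ?_⟩ <;> simp only [h1, h2, h3, h4]
  exacts [h.num, h.deg, h.adj, h.nodup, h.tedge]

/-- Add the transition of the arguments to the transition system. -/
def recordTransition (τ : Table) : Cmd :=
  .seq (.ite (.eq (.read 0 (.const 1)) (var NUM))
      (.seq (.store LAB (var NUM) (.read 0 (.const 3)))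
        (.seq (setv NUM (.add (var NUM) (.const 1))) (addVertices τ (.read 0 (.const 1)))))
      .skip)
    (.ite (notE (.read TEDGE (prE (.read 0 (.const 0)) (.read 0 (.const 1)))))
      (.seq (.store TEDGE (prE (.read 0 (.const 0)) (.read 0 (.const 1))) (.const 1))
        (push DEG TADJ (.read 0 (.const 0)) (.read 0 (.const 1))))
      .skip)

/-- A new target has the number `n`, an old one a smaller number, so `max n (x' + 1)` is the new
number of vertices in both cases. The indicator `TEDGE` keeps the successor lists free of duplicates
when a transition is offered again. -/
theorem wp_recordTransition {W n M : ℕ} {τ : Table} (hW : Fits W ((n + 1) * τ.K + 2 * n + 2)) {m : Mem}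
    (hS : SccInv τ.Acc (n * τ.K) M M M m) (hT : TransInv n m) (hx : m 0 0 < n) (hx' : m 0 1 ≤ n)
    (hb : m 0 3 ≤ W) {Q : Mem → Prop}
    (hQ : ∀ m', Frame [COMP, SIZE, MLST, LEV, ODEG, IDEG, ACC, NUM, LAB, DEG, TADJ, TEDGE] m m' →
      SccInv τ.Acc ((max n (m 0 1 + 1)) * τ.K) M M M m' →
      potential ((max n (m 0 1 + 1)) * τ.K) M m' = potential (n * τ.K) M m →
      TransInv (max n (m 0 1 + 1)) m' →
      (∀ y < n, m' LAB y = m LAB y) → (m 0 1 = n → m' LAB n = m 0 3) →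
      (∀ y, lst (m' DEG) (m' TADJ) y = if y = m 0 0 ∧ m 0 1 ∉ lst (m DEG) (m TADJ) y then
        lst (m DEG) (m TADJ) y ++ [m 0 1] else lst (m DEG) (m TADJ) y) → Q m') :
    wp W (recordTransition τ) Q m := by
  have h1W : 1 ≤ W := hW.lin _ (by omega)
  set x := m 0 0 with hxd
  set x' := m 0 1 with hxd'
  suffices H : ∀ m₁ : Mem, Frame [COMP, SIZE, MLST, LEV, ODEG, IDEG, ACC, NUM, LAB] m m₁ →
      SccInv τ.Acc ((max n (x' + 1)) * τ.K) M M M m₁ →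
      potential ((max n (x' + 1)) * τ.K) M m₁ = potential (n * τ.K) M m →
      m₁ NUM 0 = max n (x' + 1) →
      (∀ y < n, m₁ LAB y = m LAB y) → (x' = n → m₁ LAB n = m 0 3) →
      wp W (.ite (notE (.read TEDGE (prE (.read 0 (.const 0)) (.read 0 (.const 1)))))
        (.seq (.store TEDGE (prE (.read 0 (.const 0)) (.read 0 (.const 1))) (.const 1))
          (push DEG TADJ (.read 0 (.const 0)) (.read 0 (.const 1))))
        .skip) Q m₁ by
    refine ⟨fun h0 => ?_, fun h0 => ?_⟩
    · simp only [Expr.eval, eval_var, ← hxd', hT.num] at h0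
      have h1 : x' = n := by by_contra h1; simp [h1] at h0
      have h2 : max n (x' + 1) = n + 1 := by omega
      simp only [wp, wp_setv, Expr.eval, eval_var, write_other, ne_eq, Nat.reduceEqDiff,
        not_false_eq_true, hT.num]
      refine ⟨⟨hW.lin _ (by omega), hb⟩, hW.lin _ (by omega), ?_⟩
      set m₂ := (m.write LAB n (m 0 3)).write NUM 0 (n + 1) with hm₂
      have f2 : Frame [LAB, NUM] m m₂ := (Frame.refl _ _).write.write
      obtain ⟨hS2, hP2⟩ := hS.congr_extend f2 (by rw [f2 1 (by decide)]) fun e _ =>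
        ⟨by rw [f2 SRC (by decide)], by rw [f2 DST (by decide)]⟩
      refine wp_addVertices (hW.mono (by omega)) hS2 (fun m' hm' => ?_) fun m' hm' hS' hP' => ?_
      · simp only [Expr.eval, hm' 0 (by decide), f2 0 (by decide), ← hxd', h1]
      · refine H m' (f2.trans hm') (by rw [h2]; exact hS') (by rw [h2, hP', hP2]) ?_ ?_ ?_
        · rw [hm' NUM (by decide), h2]; simp [hm₂, write_same]
        · intro y hy
          rw [hm' LAB (by decide)]
          simp [hm₂, write_same, write_other, hy.ne]
        · intro _
          rw [hm' LAB (by decide)]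
          simp [hm₂, write_same, write_other]
    · simp only [Expr.eval, eval_var, ← hxd', hT.num] at h0
      have h1 : x' ≠ n := by intro h1; simp [h1] at h0
      have h2 : max n (x' + 1) = n := by omega
      exact H m (Frame.refl _ _) (by rw [h2]; exact hS) (by rw [h2]) (by rw [h2, hT.num])
        (fun _ _ => rfl) fun h3 => absurd h3 h1
  intro m₁ f1 hS1 hP1 hnum hlab hlab'
  have a0 : m₁ 0 = m 0 := f1 _ (by decide)
  have a1 : m₁ DEG = m DEG := f1 _ (by decide)
  have a2 : m₁ TADJ = m TADJ := f1 _ (by decide)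
  have a3 : m₁ TEDGE = m TEDGE := f1 _ (by decide)
  have hdegx : m DEG x ≤ n := by
    rw [← length_lst (d := m DEG) (a := m TADJ) (c := x)]
    exact length_le_of_lt (hT.nodup x) (hT.adj x)
  refine ⟨fun h0 => ?_, fun h0 => ?_⟩
  · simp only [Expr.eval, eval_notE, eval_prE, a0, ← hxd, ← hxd', a3] at h0
    have h1 : x' ∉ lst (m DEG) (m TADJ) x := by
      rw [← hT.tedge]; intro h1; simp [h1] at h0
    simp only [push, wp, Expr.eval, eval_prE, write_other, ne_eq,
      Nat.reduceEqDiff, not_false_eq_true, OfNat.zero_ne_ofNat, a0, ← hxd, ← hxd', a1]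
    refine ⟨⟨hW.quad _ _ (by omega), h1W⟩, ⟨hW.quad _ _ (by omega), hW.lin _ (by omega)⟩,
      ⟨hW.lin _ (by omega), hW.lin _ (by omega)⟩, ?_⟩
    set m₂ := ((m₁.write TEDGE (pr x x') 1).write TADJ (pr x (m DEG x)) x').write DEG x (m DEG x + 1)
      with hm₂
    have f2 : Frame [TEDGE, TADJ, DEG] m₁ m₂ := (Frame.refl _ _).write.write.write
    have b1 : m₂ DEG = Function.update (m DEG) x (m DEG x + 1) := by
      simp [hm₂, write_same, write_other, a1]
    have b2 : m₂ TADJ = Function.update (m TADJ) (pr x (m DEG x)) x' := by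
      simp [hm₂, write_same, write_other, a2]
    have b3 : m₂ TEDGE = Function.update (m TEDGE) (pr x x') 1 := by
      simp [hm₂, write_same, write_other, a3]
    have hlst : ∀ y, lst (m₂ DEG) (m₂ TADJ) y = if y = x ∧ x' ∉ lst (m DEG) (m TADJ) y then
        lst (m DEG) (m TADJ) y ++ [x'] else lst (m DEG) (m TADJ) y := by
      intro y
      rw [b1, b2, lst_push]
      by_cases hy : y = x
      · subst hy; simp [h1]
      · simp [hy]
    obtain ⟨hS2, hP2⟩ := hS1.congr_extend f2 (by rw [f2 1 (by decide)]) fun e _ =>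
      ⟨by rw [f2 SRC (by decide)], by rw [f2 DST (by decide)]⟩
    refine hQ m₂ (f1.trans f2) hS2 ?_ ⟨?_, ?_, ?_, ?_, ?_⟩ ?_ ?_ hlst
    · rw [hP2, hP1]
    · rw [f2 NUM (by decide), hnum]
    · intro y hy
      rw [b1, Function.update_of_ne (by omega)]
      exact hT.deg y (by omega)
    · intro y z hz
      rw [hlst] at hz
      split_ifs at hz with h2
      · rcases List.mem_append.1 hz with hz | hz
        · exact (hT.adj y z hz).trans_le (by omega)
        · rw [List.mem_singleton] at hz
          omega
      · exact (hT.adj y z hz).trans_le (by omega)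
    · intro y
      rw [hlst]
      split_ifs with h2
      · exact nodup_snoc (hT.nodup y) h2.2
      · exact hT.nodup y
    · intro y z
      rw [hlst, b3, Function.update_apply]
      by_cases h2 : y = x ∧ z = x'
      · obtain ⟨rfl, rfl⟩ := h2
        simp [h1]
      · rw [if_neg (by rw [pr_inj]; exact h2), hT.tedge]
        split_ifs with h3
        · simp only [List.mem_append, List.mem_singleton]
          refine ⟨Or.inl, fun h4 => h4.resolve_right fun h5 => h2 ⟨h3.1, h5⟩⟩
        · rfl
    · rw [f2 LAB (by decide)]; exact hlab
    · rw [f2 LAB (by decide)]; exact hlab'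
  · simp only [Expr.eval, eval_notE, eval_prE, a0, ← hxd, ← hxd', a3] at h0
    have h1 : x' ∈ lst (m DEG) (m TADJ) x := by
      rw [← hT.tedge]; intro h1; simp [h1] at h0
    have hx'n : x' < n := hT.adj x x' h1
    refine hQ m₁ f1.mono hS1 hP1 ⟨hnum, ?_, ?_, ?_, ?_⟩ hlab hlab' fun y => ?_
    · rw [a1]; exact fun y hy => hT.deg y (by omega)
    · rw [a1, a2]; exact fun y z hz => (hT.adj y z hz).trans_le (by omega)
    · rw [a1, a2]; exact hT.nodup
    · rw [a1, a2, a3]; exact hT.tedge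
    · rw [a1, a2, if_neg]
      rintro ⟨rfl, h3⟩
      exact h3 h1

/-! ### Expansion of product states -/

/-- There is a product transition from `p` to `p'` over the `i`-th transition of its vertex. -/
def Via (τ : Table) (m : Mem) (p i p' : ℕ) : Prop :=
  i < m DEG (p / τ.K) ∧ ∃ s' < τ.K, p' = m TADJ (pr (p / τ.K) i) * τ.K + s' ∧
    m LAB (p / τ.K) ∈ τ.labs (p % τ.K) s'

/-- There is a product transition from `p` to `p'`. -/
def Step (τ : Table) (m : Mem) (p p' : ℕ) : Prop := ∃ i, Via τ m p i p'

theorem Via.congr {τ : Table} {m m' : Mem} (h1 : m' DEG = m DEG) (h2 : m' TADJ = m TADJ)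
    (h3 : m' LAB = m LAB) : Via τ m' = Via τ m := by
  funext p i p'
  simp only [Via, h1, h2, h3]

/-- The product states that a traversal from the states in `Q` expands. -/
def Visited (τ : Table) (m : Mem) (Q : ℕ → Prop) (p : ℕ) : Prop :=
  ∃ s, Q s ∧ Relation.ReflTransGen (fun a b => Step τ m a b ∧ m INP b = 0) s p

/-- The recorded transitions of `p` are in the product automaton. -/
structure ExpandInv (τ : Table) (m : Mem) : Prop where
  le : ∀ p, m ECNT p ≤ m DEG (p / τ.K)
  expanded : ∀ p, ∀ i < m ECNT p, ∀ p', Via τ m p i p' → m INP p' ≠ 0 ∧ (p, p') ∈ arcs m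

/-- Add `p` to the product automaton and to the queue if it is new. -/
def addState (p : Expr) : Cmd :=
  .ite (notE (.read INP p))
    (.seq (.store INP p (.const 1)) (.seq (.store PQUE (var PQT) p)
      (setv PQT (.add (var PQT) (.const 1)))))
    .skip

/-- Add the transition from the state `PCUR` over the current transition to `NBR`. -/
def expandPair (τ : Table) (c : ℕ × ℕ) : Cmd :=
  .ite (.mul (.eq (var PRES) (.const c.1)) (countE (.read LAB (var PVTX)) (τ.labs c.1 c.2)))
    (.seq (addArc (var PCUR) (codeE τ.K (var NBR) c.2)) (addState (codeE τ.K (var NBR) c.2)))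
    .skip

/-- One step of the expansion of the first state of the queue. -/
def expandBody (τ : Table) : Cmd :=
  .seq (setv PCUR (.read PQUE (var PQH))) (.seq (setv PVTX (.div (var PCUR) (.const τ.K)))
    (.ite (.lt (.read ECNT (var PCUR)) (.read DEG (var PVTX)))
      (.seq (setv PRES (.sub (var PCUR) (.mul (var PVTX) (.const τ.K))))
        (.seq (setv NBR (.read TADJ (prE (var PVTX) (.read ECNT (var PCUR)))))
        (.seq (seqs ((pairs τ.K).map (expandPair τ)))
          (.store ECNT (var PCUR) (.add (.read ECNT (var PCUR)) (.const 1))))))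
      (setv PQH (.add (var PQH) (.const 1)))))

/-- Expand all states of the queue. -/
def expandLoop (τ : Table) : Cmd := .loop (.lt (var PQH) (var PQT)) (expandBody τ)

/-- The invariant of the traversal from the queue `qs₀`; the states `new` were pushed. -/
structure TravInv (τ : Table) (V : ℕ) (m₀ : Mem) (qs₀ new : List ℕ) (m : Mem) : Prop where
  frame : Frame [1, PEDGE, SRC, DST, INP, PQUE, PQT, PQH, PCUR, PVTX, PRES, NBR, ECNT] m₀ m
  one : ∀ i, i ≠ 2 → m 1 i = m₀ 1 i
  ext : ArcExt m₀ m
  table : ArcTable m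
  nodup : new.Nodup
  new0 : ∀ p ∈ new, m₀ INP p = 0
  qt : m PQT 0 = (qs₀ ++ new).length
  que : ∀ k c : ℕ, (qs₀ ++ new)[k]? = some c → m PQUE k = c
  vis : ∀ p ∈ new, Visited τ m₀ (· ∈ qs₀) p ∧ p < V
  inp : ∀ p, m INP p ≠ 0 ↔ m₀ INP p ≠ 0 ∨ p ∈ new
  inpStep : ∀ p ∈ new, ∃ q, Visited τ m₀ (· ∈ qs₀) q ∧ Step τ m₀ q p
  arc : ∀ p p', (p, p') ∈ arcs m → (p, p') ∈ arcs m₀ ∨ Visited τ m₀ (· ∈ qs₀) p ∧ Step τ m₀ p p'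
  arcLt : ∀ p ∈ arcs m, p.1 < V ∧ p.2 < V

theorem ArcExt.subset {m m' : Mem} (h : ArcExt m m') : arcs m ⊆ arcs m' := by
  rintro p ⟨e, he, h1, h2⟩
  exact ⟨e, he.trans_le h.1, by rw [(h.2 e he).1]; exact h1, by rw [(h.2 e he).2]; exact h2⟩

theorem arcs_congr {m m' : Mem} {S : List ℕ} (f : Frame S m m') (h1 : m' 1 2 = m 1 2)
    (hS : SRC ∉ S ∧ DST ∉ S := by decide) : arcs m' = arcs m := by
  simp only [arcs, h1, f SRC hS.1, f DST hS.2]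

theorem TravInv.scratch {τ : Table} {V : ℕ} {m₀ : Mem} {qs₀ new : List ℕ} {m m' : Mem}
    (h : TravInv τ V m₀ qs₀ new m) (f : Frame [PQH, PCUR, PVTX, PRES, NBR, ECNT] m m') :
    TravInv τ V m₀ qs₀ new m' := by
  have e1 : m' 1 = m 1 := f _ (by decide)
  have e2 : m' PQT = m PQT := f _ (by decide)
  have e3 : m' PQUE = m PQUE := f _ (by decide)
  have e4 : m' INP = m INP := f _ (by decide)
  have e5 : m' SRC = m SRC := f _ (by decide)
  have e6 : m' DST = m DST := f _ (by decide)
  obtain ⟨h1, h2⟩ := h.table.congr (m' := m') (by rw [e1]) e5 e6 (f _ (by decide))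
  refine ⟨h.frame.trans f, by rw [e1]; exact h.one, h.ext.trans ⟨by rw [e1], fun e _ => by rw [e5, e6]; exact ⟨rfl, rfl⟩⟩,
    h1, h.nodup, h.new0, by rw [e2]; exact h.qt, by rw [e3]; exact h.que, h.vis, by rw [e4]; exact h.inp,
    h.inpStep, by rw [h2]; exact h.arc, by rw [h2]; exact h.arcLt⟩

/-- If the target was absent, it is pushed, and the path that visits `p` extends to it. If it was
present, only the arc is added. The queue invariant holds in both cases. -/
theorem wp_attempt {W V n : ℕ} {τ : Table} (hW : Fits W (2 * V + n + 1)) {m₀ : Mem}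
    {qs₀ new : List ℕ} {m : Mem} (h : TravInv τ V m₀ qs₀ new m) (hq0 : (qs₀ ++ new).length ≤ V)
    {pE bE : Expr} {p b : ℕ}
    (hp : Visited τ m₀ (· ∈ qs₀) p) (hpV : p < V) (hstep : Step τ m₀ p b) (hbV : b < V)
    (hE : ∀ m', Frame [1, PEDGE, SRC, DST, INP, PQUE, PQT] m m' → pE.eval m' = p ∧ bE.eval m' = b)
    {Q : Mem → Prop}
    (hQ : ∀ m' new', Frame [1, PEDGE, SRC, DST, INP, PQUE, PQT] m m' → TravInv τ V m₀ qs₀ new' m' →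
      new <+: new' → (p, b) ∈ arcs m' → arcs m ⊆ arcs m' → m' INP b ≠ 0 →
      (∀ y, m INP y ≠ 0 → m' INP y ≠ 0) → Q m') :
    wp W (.seq (addArc pE bE) (addState bE)) Q m := by
  refine wp_addArc (V := V) (hW.mono (by omega)) (by omega) h.table h.arcLt hpV hbV
    (fun m' f => hE m' f.mono) fun m₁ f1 hone hext htab harcs => ?_
  have e1 : m₁ PQT = m PQT := f1 _ (by decide)
  have e3 : m₁ PQUE = m PQUE := f1 _ (by decide)
  have e4 : m₁ INP = m INP := f1 _ (by decide)
  have b1 := (hE m₁ f1.mono).2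
  have h1 : TravInv τ V m₀ qs₀ new m₁ := by
    refine ⟨h.frame.trans f1, fun i hi => by rw [hone i hi, h.one i hi], h.ext.trans hext, htab, h.nodup,
      h.new0, by rw [e1]; exact h.qt, by rw [e3]; exact h.que, h.vis, by rw [e4]; exact h.inp, h.inpStep,
      ?_, ?_⟩
    · intro a a' ha
      rw [harcs, Set.mem_insert_iff, Prod.mk.injEq] at ha
      rcases ha with ⟨rfl, rfl⟩ | ha
      · exact Or.inr ⟨hp, hstep⟩
      · exact h.arc a a' ha
    · intro a ha
      rw [harcs, Set.mem_insert_iff] at ha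
      rcases ha with rfl | ha
      · exact ⟨hpV, hbV⟩
      · exact h.arcLt a ha
  have hmem : (p, b) ∈ arcs m₁ := by rw [harcs]; exact Set.mem_insert _ _
  refine ⟨fun h0 => ?_, fun h0 => ?_⟩
  · simp only [eval_notE, Expr.eval, b1, e4] at h0
    have hb0 : m INP b = 0 := by by_contra h2; simp [h2] at h0
    have hb0' : m₀ INP b = 0 ∧ b ∉ new := by
      have := mt (h.inp b).2 (by simpa using hb0)
      push Not at this
      exact this
    have g2 : Frame [1, PEDGE, SRC, DST, INP, PQUE, PQT] m (m₁.write INP b 1) := f1.mono.write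
    set m₂ := m₁.write INP b 1 with hm₂
    have b2 := (hE m₂ g2).2
    simp only [wp, wp_setv, Expr.eval, eval_var, b1, ← hm₂, b2]
    have s1 : m₂ PQT 0 = (qs₀ ++ new).length := by
      rw [hm₂, write_other _ _ _ (by decide), e1, h.qt]
    rw [s1]
    set m₃ := m₂.write PQUE (qs₀ ++ new).length b with hm₃
    have s2 : m₃ PQT 0 = (qs₀ ++ new).length := by
      rw [hm₃, write_other _ _ _ (by decide), s1]
    rw [s2]
    refine ⟨⟨hW.lin _ (by omega), hW.lin _ (by omega)⟩, ⟨hW.lin _ (by omega), hW.lin _ (by omega)⟩,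
      hW.lin _ (by omega), ?_⟩
    set m₄ := m₃.write PQT 0 ((qs₀ ++ new).length + 1) with hm₄
    have f4 : Frame [INP, PQUE, PQT] m₁ m₄ := (Frame.refl _ _).write.write.write
    have i1 : m₄ INP = Function.update (m INP) b 1 := by
      simp [hm₄, hm₃, hm₂, write_same, write_other, e4]
    have i2 : m₄ PQT 0 = (qs₀ ++ new).length + 1 := by simp [hm₄, write_same]
    have i3 : m₄ PQUE = Function.update (m PQUE) (qs₀ ++ new).length b := by
      simp [hm₄, hm₃, hm₂, write_same, write_other, e3]
    have i4 : m₄ 1 = m₁ 1 := f4 _ (by decide)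
    obtain ⟨j1, j2⟩ := htab.congr (m' := m₄) (by rw [i4]) (f4 _ (by decide)) (f4 _ (by decide))
      (f4 _ (by decide))
    have hvb : Visited τ m₀ (· ∈ qs₀) b := by
      obtain ⟨s, hs, hr⟩ := hp
      exact ⟨s, hs, hr.tail ⟨hstep, hb0'.1⟩⟩
    refine hQ m₄ (new ++ [b]) (g2.write.write) ⟨h1.frame.trans f4, by rw [i4]; exact h1.one,
      h1.ext.trans ⟨by rw [i4], fun e _ => by rw [f4 SRC (by decide), f4 DST (by decide)]; exact ⟨rfl, rfl⟩⟩,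
      j1, nodup_snoc h.nodup hb0'.2, ?_, ?_, ?_, ?_, ?_, ?_, ?_, ?_⟩ (List.prefix_append _ _) ?_ ?_ ?_ ?_
    · intro a ha
      rcases List.mem_append.1 ha with ha | ha
      · exact h.new0 a ha
      · rw [List.mem_singleton] at ha; subst ha; exact hb0'.1
    · rw [i2]; simp; omega
    · intro k c hk
      rw [i3]
      rw [← List.append_assoc] at hk
      exact que_snoc h.que hk
    · intro a ha
      rcases List.mem_append.1 ha with ha | ha
      · exact h.vis a ha
      · rw [List.mem_singleton] at ha; subst ha; exact ⟨hvb, hbV⟩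
    · intro a
      rw [i1, Function.update_apply, List.mem_append, List.mem_singleton]
      split_ifs with h2
      · simp [h2]
      · rw [h.inp]; simp [h2]
    · intro a ha
      rcases List.mem_append.1 ha with ha | ha
      · exact h.inpStep a ha
      · rw [List.mem_singleton] at ha; subst ha; exact ⟨p, hp, hstep⟩
    · rw [j2]; exact h1.arc
    · rw [j2]; exact h1.arcLt
    · rw [j2]; exact hmem
    · rw [j2]; exact hext.subset
    · rw [i1]; simp
    · intro y hy
      rw [i1, Function.update_apply]
      split_ifs
      · exact one_ne_zero
      · exact hy
  · simp only [eval_notE, Expr.eval, b1, e4] at h0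
    have hb0 : m INP b ≠ 0 := by intro h2; simp [h2] at h0
    exact hQ m₁ new f1.mono h1 (List.prefix_refl _) hmem hext.subset (by rw [e4]; exact hb0)
      (by rw [e4]; exact fun _ h => h)

/-- The number of expansion steps so far and of product states so far. -/
def expandPotential (V : ℕ) (m : Mem) : ℕ :=
  ∑ p ∈ Finset.range V, (m ECNT p + if m INP p = 0 then 0 else 1)

/-- The factor in the running time of the traversal. -/
def expandCost (τ : Table) : ℕ := maxCost (expandBody τ) + 10

/-- The counters `ECNT` survive from call to call. A state that is popped again resumes with the
first transition of its vertex that it has not expanded; by `ExpandInv` the skipped ones would add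
nothing. So each iteration either advances a counter, which never exceeds the degree of its vertex,
or finishes a queue entry, which is an initial one or a state new to the product automaton. The
result is nevertheless that of a full expansion of every visited state. -/
theorem expandLoop_runs {W n : ℕ} {τ : Table} (hW : Fits W (2 * (n * τ.K) + n + 1)) {m₀ : Mem}
    {qs₀ : List ℕ} (hT : TransInv n m₀) (hA : ArcTable m₀) (hX : ExpandInv τ m₀)
    (harcLt : ∀ p ∈ arcs m₀, p.1 < n * τ.K ∧ p.2 < n * τ.K)
    (hnodup : qs₀.Nodup) (hq : ∀ p ∈ qs₀, p < n * τ.K ∧ m₀ INP p ≠ 0)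
    (hqt : m₀ PQT 0 = qs₀.length) (hque : ∀ k c : ℕ, qs₀[k]? = some c → m₀ PQUE k = c)
    (hqh : m₀ PQH 0 = 0) :
    Runs W (expandLoop τ) m₀ fun t m =>
      Frame [1, PEDGE, SRC, DST, INP, PQUE, PQT, PQH, PCUR, PVTX, PRES, NBR, ECNT] m₀ m ∧
      (∀ i, i ≠ 2 → m 1 i = m₀ 1 i) ∧ ArcExt m₀ m ∧ ArcTable m ∧ ExpandInv τ m ∧
      (∀ p ∈ arcs m, p.1 < n * τ.K ∧ p.2 < n * τ.K) ∧
      (∀ p, m INP p ≠ 0 → m₀ INP p ≠ 0 ∨ p < n * τ.K) ∧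
      (∀ p, m INP p ≠ 0 ↔ m₀ INP p ≠ 0 ∨ ∃ q, Visited τ m₀ (· ∈ qs₀) q ∧ Step τ m₀ q p) ∧
      (∀ p p', (p, p') ∈ arcs m ↔
        (p, p') ∈ arcs m₀ ∨ Visited τ m₀ (· ∈ qs₀) p ∧ Step τ m₀ p p') ∧
      expandPotential (n * τ.K) m₀ ≤ expandPotential (n * τ.K) m ∧
      t + expandCost τ * expandPotential (n * τ.K) m₀ ≤
        expandCost τ * (expandPotential (n * τ.K) m + qs₀.length + 1) := by
  classical
  set K := τ.K with hK
  set V := n * K with hV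
  set E : Mem → ℕ := fun m => ∑ p ∈ Finset.range V, m ECNT p with hE
  set D : ℕ := ∑ p ∈ Finset.range V, m₀ DEG (p / K) with hD
  have hlen : ∀ new m, TravInv τ V m₀ qs₀ new m → (qs₀ ++ new).length ≤ V := by
    intro new m h
    refine length_le_of_nodup (List.nodup_append.2 ⟨hnodup, h.nodup, fun a ha b hb hab => ?_⟩) fun c hc => ?_
    · subst hab
      exact (hq a ha).2 (h.new0 a hb)
    · rcases List.mem_append.1 hc with hc | hc
      exacts [(hq c hc).1, (h.vis c hc).2]
  -- The variant adds the expansions still possible, out of the total degree `D`, and the queue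
  -- positions still possible. Time is measured by the sum `E m + m PQH 0`, which grows by one per
  -- iteration.
  refine (Runs.loop (fun k t m => (∃ new, TravInv τ V m₀ qs₀ new m ∧ m PQH 0 ≤ (qs₀ ++ new).length ∧
      ∀ k < m PQH 0, ∀ c, (qs₀ ++ new)[k]? = some c → m ECNT c = m₀ DEG (c / K)) ∧
      ExpandInv τ m ∧ E m₀ ≤ E m ∧ k = D - E m + (V - m PQH 0) ∧
      t + expandCost τ * E m₀ ≤ expandCost τ * (E m + m PQH 0))
    (Q := fun t m => (∃ new, TravInv τ V m₀ qs₀ new m ∧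
      ∀ c ∈ qs₀ ++ new, m ECNT c = m₀ DEG (c / K)) ∧
      ExpandInv τ m ∧ E m₀ ≤ E m ∧
      t + expandCost τ * E m₀ ≤ expandCost τ * (E m + m PQT 0) + 10) ?_ ?_
    (k := D - E m₀ + (V - m₀ PQH 0)) ⟨⟨[], ⟨Frame.refl _ _, fun _ _ => rfl, ArcExt.refl _, hA, by simp,
      by simp, by simpa using hqt, by simpa using hque, by simp, by simp, by simp,
      fun _ _ h => Or.inl h, harcLt⟩, by simp [hqh], by simp [hqh]⟩, hX, le_rfl, rfl, by simp [hqh]⟩).mono ?_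
  · rintro k t m ⟨⟨new, h, hqh1, hdone⟩, hX, hEle, hk, ht⟩ hg
    have hlenm := hlen new m h
    simp only [Expr.eval, eval_var, h.qt] at hg
    have hlt : m PQH 0 < (qs₀ ++ new).length := by by_contra hc; simp only [hc, if_false] at hg; exact hg rfl
    set p := (qs₀ ++ new)[m PQH 0] with hp
    have hp? : (qs₀ ++ new)[m PQH 0]? = some p := List.getElem?_eq_getElem hlt
    have hpq : m PQUE (m PQH 0) = p := h.que _ _ hp?
    have hpmem : p ∈ qs₀ ++ new := List.getElem_mem hlt
    have hpV : p < V ∧ Visited τ m₀ (· ∈ qs₀) p := by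
      rcases List.mem_append.1 hpmem with hc | hc
      exacts [⟨(hq p hc).1, p, hc, Relation.ReflTransGen.refl⟩, ⟨(h.vis p hc).2, (h.vis p hc).1⟩]
    obtain ⟨hpV, hvis⟩ := hpV
    have hKpos : 0 < K := by
      rcases Nat.eq_zero_or_pos K with h0 | h0
      · rw [hV, h0] at hpV; omega
      · exact h0
    have hxn : p / K < n := (Nat.div_lt_iff_lt_mul hKpos).2 hpV
    have hED : E m ≤ D := Finset.sum_le_sum fun q _ => by
      rw [← h.frame DEG (by decide)]; exact hX.le q
    have hdegm : m DEG = m₀ DEG := h.frame _ (by decide)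
    have hadjm : m TADJ = m₀ TADJ := h.frame _ (by decide)
    have hlabm : m LAB = m₀ LAB := h.frame _ (by decide)
    set x := p / K with hx
    have hxp : x ≤ p := Nat.div_le_self _ _
    have hdegx : m₀ DEG x ≤ n := by
      rw [← length_lst (d := m₀ DEG) (a := m₀ TADJ) (c := x)]
      exact length_le_of_lt (hT.nodup x) (hT.adj x)
    suffices H : wp W (expandBody τ) (fun m' => (∃ new', TravInv τ V m₀ qs₀ new' m' ∧
        m' PQH 0 ≤ (qs₀ ++ new').length ∧
        ∀ k < m' PQH 0, ∀ c, (qs₀ ++ new')[k]? = some c → m' ECNT c = m₀ DEG (c / K)) ∧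
        ExpandInv τ m' ∧ (E m' = E m + 1 ∧ E m + 1 ≤ D ∧ m' PQH 0 = m PQH 0 ∨
          E m' = E m ∧ m' PQH 0 = m PQH 0 + 1)) m by
      refine H.runs.mono ?_
      rintro t' m' ⟨ht', hQ, hX', hor⟩
      refine ⟨_, ?_, hQ, hX', by omega, rfl, ?_⟩
      · rcases hor with ⟨h1, h2, h3⟩ | ⟨h1, h2⟩
        · rw [h1, h3]; omega
        · rw [h1, h2]; omega
      · have h4 : (Expr.lt (var PQH) (var PQT)).cost = 5 := rfl
        have h5 : E m' + m' PQH 0 = E m + m PQH 0 + 1 := by omega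
        rw [h5, mul_add, mul_one, h4]
        have h6 : expandCost τ = maxCost (expandBody τ) + 10 := rfl
        omega
    set m₁ := (m.write PCUR 0 p).write PVTX 0 x with hm₁
    have f1 : Frame [PCUR, PVTX] m m₁ := (Frame.refl _ _).write.write
    have hS1 := h.scratch (f1.mono)
    have a1 : m₁ PCUR 0 = p := by simp [hm₁, write_same, write_other]
    have a2 : m₁ PVTX 0 = x := by simp [hm₁, write_same]
    have a3 : m₁ ECNT = m ECNT := f1 _ (by decide)
    have a4 : m₁ DEG = m₀ DEG := by rw [f1 DEG (by decide), hdegm]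
    have a5 : m₁ TADJ = m₀ TADJ := by rw [f1 TADJ (by decide), hadjm]
    have a6 : m₁ PQH = m PQH := f1 _ (by decide)
    simp only [expandBody, wp, wp_setv, Expr.eval, eval_var, hpq, write_same, Function.update_self,
      ← hK, ← hx, ← hm₁, a1, a3, a4]
    refine ⟨hW.lin _ (by omega), hW.lin _ (by omega), fun h0 => ?_, fun h0 => ?_⟩
    · have hilt : m ECNT p < m₀ DEG x := by by_contra hc; simp [hc] at h0
      set i := m ECNT p with hi
      -- The machine has a division but no remainder.
      have hres : p - x * K = p % K := by
        have := Nat.div_add_mod p K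
        rw [mul_comm, ← hx] at this
        omega
      set y := m₀ TADJ (pr x i) with hy
      have hyn : y < n := hT.adj x y (mem_lst.2 ⟨i, hilt, rfl⟩)
      set m₂ := (m₁.write PRES 0 (p % K)).write NBR 0 y with hm₂
      have f2 : Frame [PRES, NBR] m₁ m₂ := (Frame.refl _ _).write.write
      simp only [eval_prE, hres, write_other, ne_eq, Nat.reduceEqDiff, not_false_eq_true,
        Expr.eval, eval_var, a1, a2, a3, a5, ← hi, ← hy, ← hm₂]
      refine ⟨hW.lin _ (by have := Nat.mod_le p K; omega), hW.lin _ (by omega), ?_⟩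
      have hS2 := hS1.scratch f2.mono
      have hybound : ∀ s' < K, y * K + s' < V := by
        intro s' hs'
        have : (y + 1) * K ≤ n * K := Nat.mul_le_mul_right _ hyn
        rw [add_mul, one_mul] at this
        omega
      refine (wp_seqs (expandPair τ) (fun l m' => ∃ new', TravInv τ V m₀ qs₀ new' m' ∧ new <+: new' ∧
        Frame [1, PEDGE, SRC, DST, INP, PQUE, PQT] m₂ m' ∧ arcs m₂ ⊆ arcs m' ∧
        (∀ y, m₂ INP y ≠ 0 → m' INP y ≠ 0) ∧
        ∀ c ∈ l, c.1 = p % K → m₀ LAB x ∈ τ.labs c.1 c.2 →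
          m' INP (y * K + c.2) ≠ 0 ∧ (p, y * K + c.2) ∈ arcs m') (pairs τ.K) ?_ (m := m₂)
        ⟨new, hS2, List.prefix_refl _, Frame.refl _ _, subset_rfl, fun _ h => h, by simp⟩).mono ?_
      · rintro l c m₃ hl ⟨new', h3, hpre, f3, hsub, hinp, hdn⟩
        have hc := mem_pairs.1 (hl.subset (a := c) (by simp))
        have c1 : m₃ PCUR 0 = p := by rw [f3 PCUR (by decide), f2 PCUR (by decide), a1]
        have c2 : m₃ PVTX 0 = x := by rw [f3 PVTX (by decide), f2 PVTX (by decide), a2]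
        have c3 : m₃ PRES 0 = p % K := by
          rw [f3 PRES (by decide)]; simp [hm₂, write_same, write_other]
        have c4 : m₃ NBR 0 = y := by rw [f3 NBR (by decide)]; simp [hm₂, write_same]
        have c5 : m₃ LAB = m₀ LAB := h3.frame _ (by decide)
        have hcond : (Expr.mul (.eq (var PRES) (.const c.1))
            (countE (.read LAB (var PVTX)) (τ.labs c.1 c.2))).eval m₃ ≠ 0 ↔
            c.1 = p % K ∧ m₀ LAB x ∈ τ.labs c.1 c.2 := by
          rw [Expr.eval, Nat.mul_ne_zero_iff, eval_countE]
          simp only [Expr.eval, eval_var, c2, c3, c5]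
          refine and_congr_left fun _ => ?_
          by_cases h4 : p % K = c.1
          · simp [h4]
          · simp [h4, Ne.symm h4]
        refine ⟨fun h4 => ?_, fun h4 => ?_⟩
        · rw [hcond] at h4
          have hvia : Via τ m₀ p i (y * K + c.2) := ⟨hilt, c.2, hc.2, rfl, by rw [← h4.1]; exact h4.2⟩
          refine wp_attempt hW h3 (hlen new' m₃ h3) hvis hpV ⟨i, hvia⟩ (hybound c.2 hc.2) ?_ ?_
          · intro m' hm'
            simp only [codeE, Expr.eval, eval_var, hm' PCUR (by decide), hm' NBR (by decide), c1, c4]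
            exact ⟨trivial, rfl⟩
          · intro m' new'' f' h' hpre' harc' hsub' hinp1 hinp'
            refine ⟨new'', h', hpre.trans hpre', f3.trans f', hsub.trans hsub',
              fun z hz => hinp' z (hinp z hz), ?_⟩
            intro c' hc' h5 h6
            rcases List.mem_append.1 hc' with hc' | hc'
            · obtain ⟨h7, h8⟩ := hdn c' hc' h5 h6
              exact ⟨hinp' _ h7, hsub' h8⟩
            · rw [List.mem_singleton] at hc'
              subst hc'
              exact ⟨hinp1, harc'⟩
        · have h4 : ¬ (c.1 = p % K ∧ m₀ LAB x ∈ τ.labs c.1 c.2) := by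
            rw [← hcond]; simpa using h4
          refine ⟨new', h3, hpre, f3, hsub, hinp, fun c' hc' h5 h6 => ?_⟩
          rcases List.mem_append.1 hc' with hc' | hc'
          · exact hdn c' hc' h5 h6
          · rw [List.mem_singleton] at hc'
            subst hc'
            exact absurd ⟨h5, h6⟩ h4
      · rintro m₃ ⟨new', h3, hpre, f3, hsub, hinp, hdn⟩
        have c1 : m₃ PCUR 0 = p := by rw [f3 PCUR (by decide), f2 PCUR (by decide), a1]
        have c2 : m₃ ECNT = m ECNT := by rw [f3 ECNT (by decide), f2 ECNT (by decide), a3]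
        have c3 : m₃ PQH = m PQH := by rw [f3 PQH (by decide), f2 PQH (by decide), a6]
        simp only [c1, c2, ← hi]
        refine ⟨⟨hW.lin _ (by omega), hW.lin _ (by omega)⟩, ?_⟩
        set m₄ := m₃.write ECNT p (i + 1) with hm₄
        have f4 : Frame [ECNT] m₃ m₄ := (Frame.refl _ _).write
        have h4 := h3.scratch f4.mono
        have d1 : m₄ ECNT = Function.update (m ECNT) p (i + 1) := by
          rw [hm₄, write_same, c2]
        have d2 : m₄ PQH = m PQH := by rw [f4 PQH (by decide), c3]
        have d3 : Via τ m₄ = Via τ m₀ :=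
          Via.congr (h4.frame _ (by decide)) (h4.frame _ (by decide)) (h4.frame _ (by decide))
        have d3' : Via τ m = Via τ m₀ := Via.congr hdegm hadjm hlabm
        have d4 : m₄ INP = m₃ INP := f4 _ (by decide)
        have d5 : arcs m₄ = arcs m₃ := arcs_congr f4 (by rw [f4 1 (by decide)])
        have d6 : arcs m₂ = arcs m := arcs_congr (f1.trans (S'' := [PCUR, PVTX, PRES, NBR]) f2)
          (by rw [f2 1 (by decide), f1 1 (by decide)])
        have d7 : m₂ INP = m INP := by rw [f2 INP (by decide), f1 INP (by decide)]
        have d8 : m₄ DEG = m₀ DEG := h4.frame _ (by decide)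
        obtain ⟨rest, hrest⟩ := hpre
        have hget : ∀ k < m PQH 0, (qs₀ ++ new')[k]? = (qs₀ ++ new)[k]? := by
          intro k hk
          rw [← hrest, ← List.append_assoc, List.getElem?_append_left (by omega)]
        refine ⟨⟨new', h4, ?_, ?_⟩, ⟨?_, ?_⟩, Or.inl ⟨?_, ?_, by rw [c3]⟩⟩
        · rw [c3, ← hrest, ← List.append_assoc, List.length_append]; omega
        · rw [c3]
          intro k hk c hc
          rw [hget k hk] at hc
          have h5 := hdone k hk c hc
          rw [Function.update_apply]
          split_ifs with h6
          · subst h6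
            rw [← hx, ← hi] at h5
            omega
          · exact h5
        · intro q
          rw [d1, d8, Function.update_apply]
          split_ifs with h6
          · rw [h6]; exact hilt
          · rw [← hdegm]; exact hX.le q
        · intro q j hj q' hvia
          rw [d3] at hvia
          rw [d4, d5]
          have hold : j < m ECNT q → m₃ INP q' ≠ 0 ∧ (q, q') ∈ arcs m₃ := by
            intro hj'
            obtain ⟨h7, h8⟩ := hX.expanded q j hj' q' (by rw [d3']; exact hvia)
            exact ⟨hinp _ (by rw [d7]; exact h7), hsub (by rw [d6]; exact h8)⟩
          rw [d1, Function.update_apply] at hj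
          split_ifs at hj with h6
          · subst h6
            rcases Nat.lt_succ_iff_lt_or_eq.1 hj with hj | hj
            · exact hold hj
            · subst hj
              obtain ⟨-, s', hs', rfl, h7⟩ := hvia
              exact hdn (p % K, s') (mem_pairs.2 ⟨Nat.mod_lt _ hKpos, hs'⟩) rfl h7
          · exact hold hj
        · simp only [hE]
          rw [d1, Finset.sum_update_of_mem (by simpa using hpV),
            Finset.sum_eq_add_sum_sdiff_singleton_of_mem (Finset.mem_range.2 hpV) (fun q => m ECNT q)]
          omega
        · have : E m < D := Finset.sum_lt_sum (fun q _ => by rw [← hdegm]; exact hX.le q)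
            ⟨p, by simpa using hpV, hilt⟩
          exact this
    · have hige : m₀ DEG x ≤ m ECNT p := by by_contra hc; simp [not_le.1 hc] at h0
      have hieq : m ECNT p = m₀ DEG x := le_antisymm (by rw [← hdegm]; exact hX.le p) hige
      rw [a6]
      refine ⟨hW.lin _ (by omega), ?_⟩
      set m₂ := m₁.write PQH 0 (m PQH 0 + 1) with hm₂
      have f2 : Frame [PQH] m₁ m₂ := (Frame.refl _ _).write
      have h2 := hS1.scratch f2.mono
      have c1 : m₂ PQH 0 = m PQH 0 + 1 := by simp [hm₂, write_same]
      have f12 : Frame [PCUR, PVTX, PQH] m m₂ := f1.trans f2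
      have c2 : m₂ ECNT = m ECNT := f12 _ (by decide)
      have c3 : arcs m₂ = arcs m := arcs_congr f12 (by rw [f12 1 (by decide)])
      have c4 : Via τ m₂ = Via τ m := Via.congr (f12 _ (by decide)) (f12 _ (by decide)) (f12 _ (by decide))
      refine ⟨⟨new, h2, by omega, ?_⟩, ⟨?_, ?_⟩, Or.inr ⟨by simp only [hE, c2], c1⟩⟩
      · rw [c2]
        intro k hk c hc
        rcases Nat.lt_succ_iff_lt_or_eq.1 hk with hk | rfl
        · exact hdone k hk c hc
        · rw [hp?, Option.some.injEq] at hc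
          subst hc
          exact hieq
      · rw [c2, f12 DEG (by decide)]; exact hX.le
      · rw [c2, c3, c4, f12 INP (by decide)]; exact hX.expanded
  · rintro k t m ⟨⟨new, h, hqh1, hdone⟩, hX, hEle, hk, ht⟩ hg
    simp only [Expr.eval, eval_var, h.qt] at hg
    have hge : m PQH 0 = (qs₀ ++ new).length := by
      by_contra hc
      have : m PQH 0 < (qs₀ ++ new).length := by omega
      simp only [this, if_true] at hg
      exact one_ne_zero hg
    refine ⟨⟨new, h, fun c hc => ?_⟩, hX, hEle, ?_⟩
    · obtain ⟨k, hk, rfl⟩ := List.getElem_of_mem hc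
      exact hdone k (by omega) _ (List.getElem?_eq_getElem hk)
    · have h4 : (Expr.lt (var PQH) (var PQT)).cost = 5 := rfl
      rw [h.qt, ← hge, h4]
      omega
  · rintro t m ⟨⟨new, h, hdone⟩, hX, hEle, ht⟩
    have hdegm : m DEG = m₀ DEG := h.frame _ (by decide)
    have hvia : Via τ m = Via τ m₀ :=
      Via.congr hdegm (h.frame _ (by decide)) (h.frame _ (by decide))
    have hall : ∀ p ∈ qs₀ ++ new, ∀ p', Step τ m₀ p p' → m INP p' ≠ 0 ∧ (p, p') ∈ arcs m := by
      rintro p hp p' ⟨i, hi⟩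
      refine hX.expanded p i ?_ p' (by rw [hvia]; exact hi)
      rw [hdone p hp]
      exact hi.1
    -- At the end every queued state is fully expanded, so the queue is closed under steps to states
    -- that were absent at the start.
    have hvis : ∀ p, Visited τ m₀ (· ∈ qs₀) p → p ∈ qs₀ ++ new := by
      rintro p ⟨s, hs, hr⟩
      induction hr with
      | refl => exact List.mem_append_left _ hs
      | tail _ h1 ih =>
        have h2 := (hall _ ih _ h1.1).1
        rcases (h.inp _).1 h2 with h3 | h3
        · exact absurd h1.2 h3
        · exact List.mem_append_right _ h3
    -- Pushed states were not in the product automaton before, so their queue entries are paid for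
    -- by the growth of `INP`.
    have h1 : ∑ p ∈ Finset.range V, (if m₀ INP p = 0 then 0 else 1) + new.length ≤
        ∑ p ∈ Finset.range V, (if m INP p = 0 then 0 else 1) := by
      have h2 : ∀ m : Mem, ∑ p ∈ Finset.range V, (if m INP p = 0 then 0 else 1) =
          ((Finset.range V).filter fun p => m INP p ≠ 0).card := by
        intro m
        rw [Finset.card_filter]
        refine Finset.sum_congr rfl fun p _ => ?_
        by_cases h3 : m INP p = 0 <;> simp [h3]
      rw [h2, h2, ← List.toFinset_card_of_nodup h.nodup, ← Finset.card_union_of_disjoint]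
      · refine Finset.card_le_card fun p hp => ?_
        simp only [Finset.mem_union, Finset.mem_filter, Finset.mem_range, List.mem_toFinset] at hp ⊢
        rcases hp with ⟨h3, h4⟩ | h3
        · exact ⟨h3, (h.inp p).2 (Or.inl h4)⟩
        · exact ⟨(h.vis p h3).2, (h.inp p).2 (Or.inr h3)⟩
      · rw [Finset.disjoint_left]
        intro p hp hp'
        simp only [Finset.mem_filter, List.mem_toFinset] at hp hp'
        exact hp.2 (h.new0 p hp')
    refine ⟨h.frame, h.one, h.ext, h.table, hX, h.arcLt, fun p hp => ?_, fun p => ⟨fun hp => ?_, ?_⟩,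
      fun p p' => ⟨h.arc p p', ?_⟩, ?_, ?_⟩
    · exact ((h.inp p).1 hp).imp_right fun h1 => (h.vis p h1).2
    · exact ((h.inp p).1 hp).imp_right fun h1 => h.inpStep p h1
    · rintro (h1 | ⟨q, h1, h2⟩)
      · exact (h.inp p).2 (Or.inl h1)
      · exact (hall q (hvis q h1) p h2).1
    · rintro (h1 | ⟨h1, h2⟩)
      · exact h.ext.subset h1
      · exact (hall p (hvis p h1) p' h2).2
    · simp only [expandPotential, Finset.sum_add_distrib]
      exact add_le_add hEle (by omega)
    · rw [h.qt, List.length_append] at ht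
      simp only [expandPotential, Finset.sum_add_distrib]
      have h3 : 10 ≤ expandCost τ := by unfold expandCost; omega
      set a := ∑ p ∈ Finset.range V, (if m₀ INP p = 0 then 0 else 1)
      set b := ∑ p ∈ Finset.range V, (if m INP p = 0 then 0 else 1)
      have h4 : expandCost τ * (E m + (qs₀.length + new.length)) + expandCost τ * a + expandCost τ * 1 ≤
          expandCost τ * (E m + b + qs₀.length + 1) := by
        rw [← mul_add, ← mul_add]
        exact Nat.mul_le_mul_left _ (by omega)
      have h5 : expandCost τ * (E m₀ + a) = expandCost τ * E m₀ + expandCost τ * a := mul_add _ _ _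
      change t + expandCost τ * (E m₀ + a) ≤ expandCost τ * (E m + b + qs₀.length + 1)
      omega

/-! ### One call of the incremental search -/

/-- Put the new product state over the target with the `s`-th automaton state into the queue. -/
def initPush (τ : Table) (s : ℕ) : Cmd :=
  .ite (.read NEWS (.const s))
    (.seq (.store INP (codeE τ.K (.read 0 (.const 1)) s) (.const 1))
      (.seq (.store PQUE (var PQT) (codeE τ.K (.read 0 (.const 1)) s))
        (setv PQT (.add (var PQT) (.const 1)))))
    .skip

/-- Fill the queue with the new product states over the target. -/
def initQueue (τ : Table) : Cmd :=
  .seq (setv PQT (.const 0)) (.seq (setv PQH (.const 0)) (seqs ((List.range τ.K).map (initPush τ))))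

/-- All entered states are queued, also those that were in the product automaton before: the
traversal starts from all of them. There are at most `K`, hence only a constant cost per call. -/
theorem wp_initQueue {W V : ℕ} {τ : Table} (hW : Fits W V) {m : Mem} (hx : m 0 1 * τ.K + τ.K ≤ V)
    {Q : Mem → Prop}
    (hQ : ∀ m' (qs : List ℕ), Frame [INP, PQUE, PQT, PQH] m m' → qs.Nodup → qs.length ≤ τ.K →
      (∀ p, p ∈ qs ↔ ∃ s < τ.K, m NEWS s ≠ 0 ∧ p = m 0 1 * τ.K + s) →
      m' PQT 0 = qs.length → (∀ k c : ℕ, qs[k]? = some c → m' PQUE k = c) → m' PQH 0 = 0 →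
      (∀ p, m' INP p ≠ 0 ↔ m INP p ≠ 0 ∨ p ∈ qs) → Q m') :
    wp W (initQueue τ) Q m := by
  simp only [initQueue, wp, wp_setv, Expr.eval]
  refine ⟨Nat.zero_le _, Nat.zero_le _, ?_⟩
  set m₁ := (m.write PQT 0 0).write PQH 0 0 with hm₁
  have f1 : Frame [PQT, PQH] m m₁ := (Frame.refl _ _).write.write
  have hT0 : m₁ PQT 0 = 0 := by simp [hm₁, write_same, write_other]
  have hH0 : m₁ PQH 0 = 0 := by simp [hm₁, write_same]
  refine (wp_seqs (initPush τ) (fun l m' => ∃ qs : List ℕ, Frame [INP, PQUE, PQT] m₁ m' ∧ qs.Nodup ∧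
    qs.length ≤ l.length ∧
    (∀ p, p ∈ qs ↔ ∃ s ∈ l, m NEWS s ≠ 0 ∧ p = m 0 1 * τ.K + s) ∧ m' PQT 0 = qs.length ∧
    (∀ k c : ℕ, qs[k]? = some c → m' PQUE k = c) ∧
    (∀ p, m' INP p ≠ 0 ↔ m INP p ≠ 0 ∨ p ∈ qs)) (List.range τ.K) ?_ (m := m₁)
    ⟨[], Frame.refl _ _, by simp, by simp, by simp, by simpa using hT0, by simp, ?_⟩).mono ?_
  · rintro l s m₂ hl ⟨qs, f, hnd, hlen, hmem, hqt, hque, hinp⟩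
    have hs : s < τ.K := by
      have := hl.subset (a := s) (by simp)
      simpa using this
    have hsl : s ∉ l := by
      have h1 : (l ++ [s]).Nodup := hl.sublist.nodup List.nodup_range
      rw [List.nodup_append] at h1
      exact fun h2 => h1.2.2 s h2 s (by simp) rfl
    have hlK : l.length + 1 ≤ τ.K := by
      have := hl.length_le
      simpa using this
    have e0 : m₂ 0 = m 0 := by rw [f 0 (by decide), f1 0 (by decide)]
    have e1 : m₂ NEWS = m NEWS := by rw [f NEWS (by decide), f1 NEWS (by decide)]
    refine ⟨fun h0 => ?_, fun h0 => ?_⟩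
    · simp only [Expr.eval, e1] at h0
      simp only [wp, wp_setv, codeE, Expr.eval, eval_var, write_other, ne_eq, Nat.reduceEqDiff,
        not_false_eq_true, OfNat.zero_ne_ofNat, e0, hqt]
      refine ⟨⟨hW.lin _ (by omega), hW.lin _ (by omega)⟩, ⟨hW.lin _ (by omega), hW.lin _ (by omega)⟩,
        hW.lin _ (by omega), qs ++ [m 0 1 * τ.K + s], f.write.write.write, nodup_snoc hnd ?_, ?_, ?_,
        ?_, ?_, ?_⟩
      · rw [hmem]
        rintro ⟨s', hs', -, h1⟩
        have : s = s' := by omega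
        exact hsl (this ▸ hs')
      · simpa using hlen
      · intro p
        simp only [List.mem_append, hmem, List.mem_singleton]
        constructor
        · rintro (⟨s', h1, h2⟩ | rfl)
          exacts [⟨s', Or.inl h1, h2⟩, ⟨s, Or.inr rfl, h0, rfl⟩]
        · rintro ⟨s', h1 | rfl, h2⟩
          exacts [Or.inl ⟨s', h1, h2⟩, Or.inr h2.2]
      · simp [write_same]
      · simp only [write_same, write_other, ne_eq, Nat.reduceEqDiff, not_false_eq_true]
        intro k c hk
        exact que_snoc hque hk
      · intro p
        simp only [write_same,
          Function.update_apply, List.mem_append, List.mem_singleton]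
        split_ifs with h1
        · simp [h1]
        · have := hinp p
          simp only [ne_eq] at this
          simp [this, h1]
    · simp only [Expr.eval, e1] at h0
      refine ⟨qs, f, hnd, by simp; omega, fun p => ?_, hqt, hque, hinp⟩
      rw [hmem]
      simp only [List.mem_append, List.mem_singleton]
      constructor
      · rintro ⟨s', h1, h2⟩
        exact ⟨s', Or.inl h1, h2⟩
      · rintro ⟨s', h1 | rfl, h2⟩
        exacts [⟨s', h1, h2⟩, absurd h0 h2.1]
  · intro p
    rw [f1 INP (by decide)]
    simp
  · rintro m₂ ⟨qs, f, hnd, hlen, hmem, hqt, hque, hinp⟩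
    refine hQ m₂ qs (f1.trans f) hnd (by simpa using hlen) ?_ hqt hque
      (by rw [f PQH (by decide), hH0]) hinp
    simpa using hmem

/-- Insert the recorded transitions into the data structure for the components. -/
def insertLoop : Cmd := .loop (.lt (var DONE) (.read 1 (.const 2))) insertArc

/-- The traversal only records arcs; the component structure follows here, one arc at a time, until
`DONE` reaches their number. The 6 per arc pays for the loop test, and the final 6 for its last
failure. -/
theorem insertLoop_runs {W V M D : ℕ} {acc : ℕ → Prop} (hW : Fits W (2 * V + M + 3)) {m : Mem}
    (h : SccInv acc V D D D m) (hends : ∀ e < M, m SRC e < V ∧ m DST e < V) (hM : m 1 2 = M)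
    (hDM : D ≤ M) (hDONE : m DONE 0 = D) (hσ : m STAMP 0 ≤ 3 * D) :
    Runs W insertLoop m fun t m' => SccInv acc V M M M m' ∧ m' DONE 0 = M ∧
      Frame [1, COMP, LEV, ODEG, OLST, IDEG, ILST, SIZE, MLST, ACC, DONE, MARK, STAMP, CNT, LIM, TDEG,
        TLST, BUF, TMP, BIG, NEWLEV, CPL, QUE, QT, QH, IDX, CUR, ELM, TAIL, HEAD] m m' ∧
      (∀ i, i ≠ 1 → m' 1 i = m 1 i) ∧ m' STAMP 0 ≤ 3 * M ∧ potential V D m ≤ potential V M m' ∧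
      t + insertCost * potential V D m + 6 * D ≤ insertCost * potential V M m' + 6 * M + 6 := by
  have hcost : (Expr.lt (var DONE) (.read 1 (.const 2))).cost = 5 := rfl
  refine Runs.loop (fun k t m' => ∃ d, d + k = M ∧ SccInv acc V d d d m' ∧ m' DONE 0 = d ∧
      Frame [1, COMP, LEV, ODEG, OLST, IDEG, ILST, SIZE, MLST, ACC, DONE, MARK, STAMP, CNT, LIM, TDEG,
        TLST, BUF, TMP, BIG, NEWLEV, CPL, QUE, QT, QH, IDX, CUR, ELM, TAIL, HEAD] m m' ∧
      (∀ i, i ≠ 1 → m' 1 i = m 1 i) ∧ m' STAMP 0 ≤ 3 * d ∧ potential V D m ≤ potential V d m' ∧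
      t + insertCost * potential V D m + 6 * D ≤ insertCost * potential V d m' + 6 * d)
    ?_ ?_ (k := M - D) ⟨D, by omega, h, hDONE, Frame.refl _ _, fun _ _ => rfl, hσ, le_rfl, by omega⟩
  · rintro k t m₁ ⟨d, hd, h1, hd1, f1, hone, hσ1, hp1, ht⟩ hg
    simp only [Expr.eval, eval_var, hone 2 (by decide), hM, hd1] at hg
    have hdM : d < M := by by_contra hc; simp [hc] at hg
    have e1 : m₁ SRC = m SRC := f1 _ (by decide)
    have e2 : m₁ DST = m DST := f1 _ (by decide)
    refine (insertArc_runs (hW.mono (by omega)) h1 (by rw [e1, e2]; exact hends d hdM) hd1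
      (hW.lin _ (by omega))).mono ?_
    rintro t' m₂ ⟨h2, hd2, f2, hone2, hσ2, ht2⟩
    refine ⟨k - 1, by omega, d + 1, by omega, h2, hd2, f1.trans f2, fun i hi => by
      rw [hone2 i hi, hone i hi], by omega, hp1.trans ?_, ?_⟩
    · have h3 : 0 < insertCost := by unfold insertCost; omega
      exact Nat.le_of_mul_le_mul_left (by omega) h3
    rw [hcost]
    omega
  · rintro k t m₁ ⟨d, hd, h1, hd1, f1, hone, hσ1, hp1, ht⟩ hg
    simp only [Expr.eval, eval_var, hone 2 (by decide), hM, hd1] at hg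
    have hdM : d = M := by
      by_contra hc
      have : d < M := by omega
      simp [this] at hg
    subst hdM
    refine ⟨h1, hd1, f1, hone, hσ1, hp1, ?_⟩
    rw [hcost]
    omega

/-- The program for one call of the incremental search. -/
def callProgram (τ : Table) : Cmd :=
  .seq (enterArcs τ) (.ite (.read 1 (.const 0))
    (.seq (recordTransition τ) (.seq (initQueue τ) (.seq (expandLoop τ) insertLoop))) .skip)

/-- The invariant between two calls. -/
structure PlanInv (τ : Table) (n : ℕ) (m : Mem) : Prop where
  scc : SccInv τ.Acc (n * τ.K) (m 1 2) (m 1 2) (m 1 2) m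
  done : m DONE 0 = m 1 2
  stamp : m STAMP 0 ≤ 3 * m 1 2
  trans : TransInv n m
  table : ArcTable m
  expand : ExpandInv τ m
  inpLt : ∀ p, m INP p ≠ 0 → p < n * τ.K

theorem PlanInv.arcs_lt {τ : Table} {n : ℕ} {m : Mem} (h : PlanInv τ n m) :
    ∀ p ∈ arcs m, p.1 < n * τ.K ∧ p.2 < n * τ.K := by
  rintro ⟨p, p'⟩ ⟨e, he, rfl, rfl⟩
  exact h.scc.ends e he

/-- The states that are entered from the source of the call. -/
def Entered (τ : Table) (m : Mem) (p : ℕ) : Prop :=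
  ∃ s' < τ.K, (∃ s < τ.K, Enters τ m (s, s')) ∧ p = m 0 1 * τ.K + s'

/-- The states that are expanded in a call that leads from `m` to `m'`. -/
def CallVisited (τ : Table) (m m' : Mem) (p : ℕ) : Prop :=
  ∃ s, Entered τ m s ∧
    Relation.ReflTransGen (fun a b => Step τ m' a b ∧ m INP b = 0 ∧ ¬ Entered τ m b) s p

/-- The potential of the whole data structure. -/
def planPotential (τ : Table) (n : ℕ) (m : Mem) : ℕ :=
  insertCost * potential (n * τ.K) (m 1 2) m + 6 * m 1 2 + expandCost τ * expandPotential (n * τ.K) m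

/-- The effect of a call that returns false. -/
structure Rejects (τ : Table) (n : ℕ) (m m' : Mem) : Prop where
  none : ¬ ∃ p, Entered τ m p
  flag : m' 1 0 = 0
  inv : PlanInv τ n m'
  arcs_eq : arcs m' = arcs m
  inp : m' INP = m INP
  lab : m' LAB = m LAB
  lst_eq : ∀ y, lst (m' DEG) (m' TADJ) y = lst (m DEG) (m TADJ) y
  pot : planPotential τ n m' = planPotential τ n m

/-- The effect of a call that returns true. -/
structure Accepts (τ : Table) (n : ℕ) (m m' : Mem) : Prop where
  some : ∃ p, Entered τ m p
  flag : m' 1 0 ≠ 0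
  inv : PlanInv τ (max n (m 0 1 + 1)) m'
  arcs_iff : ∀ p p', (p, p') ∈ arcs m' ↔ (p, p') ∈ arcs m ∨
    (∃ c : ℕ × ℕ, c.1 < τ.K ∧ c.2 < τ.K ∧ Enters τ m c ∧ p = m 0 0 * τ.K + c.1 ∧
      p' = m 0 1 * τ.K + c.2) ∨ CallVisited τ m m' p ∧ Step τ m' p p'
  inp_iff : ∀ p, m' INP p ≠ 0 ↔ m INP p ≠ 0 ∨ Entered τ m p ∨
    ∃ q, CallVisited τ m m' q ∧ Step τ m' q p
  lab : ∀ y < n, m' LAB y = m LAB y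
  lab_new : m 0 1 = n → m' LAB n = m 0 3
  mem_lst : ∀ y z, z ∈ lst (m' DEG) (m' TADJ) y ↔ z ∈ lst (m DEG) (m TADJ) y ∨ y = m 0 0 ∧ z = m 0 1

/-- The amortized running time of a call. -/
def callCost (τ : Table) : ℕ :=
  maxCost (enterArcs τ) + maxCost (recordTransition τ) + maxCost (initQueue τ) + insertCost +
    expandCost τ * (τ.K + 2) + 20

theorem adj_eq_of_isPrefix {d a d' a' : ℕ → ℕ} {y i : ℕ} (h : lst d a y <+: lst d' a' y) (hi : i < d y) :
    a' (pr y i) = a (pr y i) := by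
  have h1 := h.getElem (i := i) (by rwa [length_lst])
  simp only [lst, List.getElem_map, List.getElem_range] at h1
  exact h1.symm

theorem ArcExt.count_eq {m m' : Mem} (h : ArcExt m m') (hT : ArcTable m') (he : arcs m' ⊆ arcs m) :
    m' 1 2 = m 1 2 := by
  refine le_antisymm ?_ h.1
  by_contra hlt
  push Not at hlt
  obtain ⟨e, he, h1, h2⟩ := he (show (m' SRC (m 1 2), m' DST (m 1 2)) ∈ arcs m' from ⟨_, hlt, rfl, rfl⟩)
  have h3 := h.2 e he
  have := hT.inj e (he.trans hlt) _ hlt (h3.1.trans h1) (h3.2.trans h2)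
  omega

theorem expandPotential_congr {V V' : ℕ} {m m' : Mem} (hV : V ≤ V')
    (h : ∀ p < V, m' ECNT p = m ECNT p ∧ m' INP p = m INP p)
    (h0 : ∀ p, V ≤ p → m' ECNT p = 0 ∧ m' INP p = 0) :
    expandPotential V' m' = expandPotential V m := by
  unfold expandPotential
  have h1 := Finset.sum_subset (Finset.range_mono hV)
    (f := fun p => m' ECNT p + if m' INP p = 0 then 0 else 1) fun p _ hp => by
      rw [Finset.mem_range, not_lt] at hp
      simp [h0 p hp]
  rw [← h1]
  refine Finset.sum_congr rfl fun p hp => ?_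
  rw [(h p (Finset.mem_range.1 hp)).1, (h p (Finset.mem_range.1 hp)).2]

theorem expandPotential_mono {V : ℕ} {m m' : Mem} (h1 : m' ECNT = m ECNT)
    (h2 : ∀ p, m INP p ≠ 0 → m' INP p ≠ 0) : expandPotential V m ≤ expandPotential V m' := by
  refine Finset.sum_le_sum fun p _ => ?_
  rw [h1]
  refine Nat.add_le_add_left ?_ _
  by_cases h3 : m INP p = 0
  · simp [h3]
  · simp [h3, h2 p h3]

theorem PlanInv.rejects {τ : Table} {n : ℕ} {m m' : Mem} (h : PlanInv τ n m)
    (f : Frame [1, PEDGE, SRC, DST, NEWS] m m') (hone : ∀ i, i ≠ 0 → i ≠ 2 → m' 1 i = m 1 i)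
    (hext : ArcExt m m') (hT : ArcTable m') (harcs : arcs m' = arcs m) (hnone : ¬ ∃ p, Entered τ m p)
    (hflag : m' 1 0 = 0) : Rejects τ n m m' := by
  have hM : m' 1 2 = m 1 2 := hext.count_eq hT harcs.le
  obtain ⟨hS, hP⟩ := h.scc.congr_extend f (hone 1 (by decide) (by decide)) hext.2
  have e1 : m' DEG = m DEG := f _ (by decide)
  have e2 : m' TADJ = m TADJ := f _ (by decide)
  have e3 : m' LAB = m LAB := f _ (by decide)
  have e4 : m' ECNT = m ECNT := f _ (by decide)
  have e5 : m' INP = m INP := f _ (by decide)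
  refine ⟨hnone, hflag, ⟨by rw [hM]; exact hS, ?_, ?_, h.trans.congr (f _ (by decide)) e1 e2
    (f _ (by decide)), hT, ⟨by rw [e4, e1]; exact h.expand.le, ?_⟩, by rw [e5]; exact h.inpLt⟩, harcs,
    e5, e3, fun y => by rw [e1, e2], ?_⟩
  · rw [hM, f DONE (by decide), h.done]
  · rw [hM, f STAMP (by decide)]; exact h.stamp
  · rw [e4, e5, harcs, Via.congr e1 e2 e3]; exact h.expand.expanded
  · simp only [planPotential, hM, hP, expandPotential, e4, e5]

/-- Successor lists grow only at their ends, so the first `ECNT p` transitions remain the same ones.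
-/
theorem ExpandInv.extend {τ : Table} {n : ℕ} {m m' : Mem} (h : ExpandInv τ m) (hT : TransInv n m)
    (hlst : ∀ y, lst (m DEG) (m TADJ) y <+: lst (m' DEG) (m' TADJ) y)
    (hlab : ∀ y < n, m' LAB y = m LAB y) (hE : m' ECNT = m ECNT)
    (hI : ∀ p, m INP p ≠ 0 → m' INP p ≠ 0) (ha : arcs m ⊆ arcs m') : ExpandInv τ m' := by
  refine ⟨fun p => ?_, fun p i hi p' hvia => ?_⟩
  · have := (hlst (p / τ.K)).length_le
    rw [length_lst, length_lst] at this
    rw [hE]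
    exact (h.le p).trans this
  · rw [hE] at hi
    have h1 : i < m DEG (p / τ.K) := hi.trans_le (h.le p)
    have h2 : p / τ.K < n := by
      by_contra h3
      rw [hT.deg _ (not_lt.1 h3)] at h1
      omega
    obtain ⟨-, s', hs', h3, h4⟩ := hvia
    rw [adj_eq_of_isPrefix (hlst _) h1] at h3
    rw [hlab _ h2] at h4
    obtain ⟨h5, h6⟩ := h.expanded p i hi p' ⟨h1, s', hs', h3, h4⟩
    exact ⟨hI _ h5, ha h6⟩

/-- A rejected call takes constant time and leaves the potential as it is. An accepted one pays for
the traversal and the insertions by the rise of the potential, up to a constant. That the potential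
does not fall is recorded separately, since it allows some calls to be left out when times are added
up. The large index bound leaves room for `V * V` arcs and concerns the word size only. -/
theorem callProgram_runs {W n : ℕ} {τ : Table}
    (hW : Fits W ((n + 1) * τ.K * ((n + 1) * τ.K) + 3 * ((n + 1) * τ.K) + 3 * n + 5)) {m : Mem}
    (h : PlanInv τ n m) (hx : m 0 0 < n) (hx' : m 0 1 ≤ n) (hb : m 0 3 ≤ W) :
    Runs W (callProgram τ) m fun t m' =>
      Rejects τ n m m' ∧ t ≤ callCost τ ∨
      Accepts τ n m m' ∧ planPotential τ n m ≤ planPotential τ (max n (m 0 1 + 1)) m' ∧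
        t + planPotential τ n m ≤ planPotential τ (max n (m 0 1 + 1)) m' + callCost τ := by
  obtain ⟨U, hU⟩ : ∃ U, U = (n + 1) * τ.K := ⟨_, rfl⟩
  rw [← hU] at hW
  have hnU : n * τ.K + τ.K = U := by rw [hU, add_mul, one_mul]
  have hxU : m 0 0 * τ.K + τ.K ≤ n * τ.K := by
    have : (m 0 0 + 1) * τ.K ≤ n * τ.K := Nat.mul_le_mul_right _ hx
    rwa [add_mul, one_mul] at this
  set n' := max n (m 0 1 + 1) with hn'
  have hn'U : n' * τ.K ≤ U := hU ▸ Nat.mul_le_mul_right _ (by omega)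
  have hnn' : n * τ.K ≤ n' * τ.K := Nat.mul_le_mul_right _ (by omega)
  have hxU' : m 0 1 * τ.K + τ.K ≤ n' * τ.K := by
    have : (m 0 1 + 1) * τ.K ≤ n' * τ.K := Nat.mul_le_mul_right _ (by omega)
    rwa [add_mul, one_mul] at this
  have hlt := h.arcs_lt
  have hcost : (Expr.read 1 (.const 0)).cost = 2 := rfl
  have hCC : callCost τ = maxCost (enterArcs τ) + maxCost (recordTransition τ) +
    maxCost (initQueue τ) + insertCost + expandCost τ * (τ.K + 2) + 20 := rfl
  have hW4 : Fits W (2 * (n' * τ.K) + n' + 1) := hW.mono (by omega)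
  have hW5 : ∀ M ≤ n' * τ.K * (n' * τ.K), Fits W (2 * (n' * τ.K) + M + 3) := fun M hM => hW.mono (by
    have := Nat.mul_le_mul hn'U hn'U
    omega)
  have hentV : ∀ p, Entered τ m p → p < n' * τ.K := by
    rintro p ⟨s', hs', -, rfl⟩
    omega
  refine wp.seq_runs (wp_enterArcs (V := U + 1) (hW.mono (by omega)) h.table
    (fun p hp => by have := hlt p hp; omega) (by omega) (by omega) (by omega) ?_)
  intro m₁ f1 hone1 hext1 htab1 harcs1 hnews1 hflag1
  have harcs1' : ∀ p p', (p, p') ∈ arcs m₁ ↔ (p, p') ∈ arcs m ∨ ∃ c : ℕ × ℕ, c.1 < τ.K ∧ c.2 < τ.K ∧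
      Enters τ m c ∧ p = m 0 0 * τ.K + c.1 ∧ p' = m 0 1 * τ.K + c.2 := harcs1
  have hent : (∃ p, Entered τ m p) ↔ m₁ 1 0 ≠ 0 := by
    rw [hflag1]
    constructor
    · rintro ⟨p, s', hs', ⟨s, hs, h1⟩, -⟩
      exact ⟨s, hs, s', hs', h1⟩
    · rintro ⟨s, hs, s', hs', h1⟩
      exact ⟨_, s', hs', ⟨s, hs, h1⟩, rfl⟩
  have hlt1 : ∀ p ∈ arcs m₁, p.1 < n' * τ.K ∧ p.2 < n' * τ.K := by
    rintro ⟨p, p'⟩ hp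
    rcases (harcs1' p p').1 hp with hp | ⟨c, h1, h2, -, rfl, rfl⟩
    · have := hlt _ hp
      simp only at this ⊢
      omega
    · simp only
      omega
  refine Runs.ite (fun hg => ?_) fun hg => ?_
  swap
  · simp only [Expr.eval] at hg
    have hno : ¬ ∃ p, Entered τ m p := fun h1 => hent.1 h1 hg
    refine Runs.skip fun t ht => Or.inl ⟨h.rejects f1 hone1 hext1 htab1 ?_ hno hg, by omega⟩
    ext ⟨p, p'⟩
    rw [harcs1']
    constructor
    · rintro (h1 | ⟨c, hc1, hc2, hc3, -⟩)
      · exact h1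
      · exact absurd ⟨_, c.2, hc2, ⟨c.1, hc1, hc3⟩, rfl⟩ hno
    · exact Or.inl
  simp only [Expr.eval] at hg
  set D := m 1 2 with hD
  obtain ⟨hS1, hP1⟩ := h.scc.congr_extend f1 (hone1 1 (by decide) (by decide)) hext1.2
  have a0 : m₁ 0 = m 0 := f1 _ (by decide)
  have aD : m₁ DEG = m DEG := f1 _ (by decide)
  have aA : m₁ TADJ = m TADJ := f1 _ (by decide)
  have aL : m₁ LAB = m LAB := f1 _ (by decide)
  have aI : m₁ INP = m INP := f1 _ (by decide)
  have aE : m₁ ECNT = m ECNT := f1 _ (by decide)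
  have hT1 : TransInv n m₁ := h.trans.congr (f1 _ (by decide)) aD aA (f1 _ (by decide))
  refine wp.seq_runs (wp_recordTransition (hW.mono (by omega)) hS1 hT1 (by rw [a0]; exact hx)
    (by rw [a0]; exact hx') (by rw [a0]; exact hb) ?_)
  rw [a0, aD, aA, aL]
  intro m₂ f2 hS2 hP2 hT2 hlab2 hlabn2 hlst2
  have b0 : m₂ 0 = m 0 := by rw [f2 0 (by decide), a0]
  have bI : m₂ INP = m INP := by rw [f2 INP (by decide), aI]
  have bE : m₂ ECNT = m ECNT := by rw [f2 ECNT (by decide), aE]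
  have b1 : m₂ 1 = m₁ 1 := f2 _ (by decide)
  have bar : arcs m₂ = arcs m₁ := arcs_congr f2 (by rw [b1])
  refine wp.seq_runs (wp_initQueue (V := U) (hW.mono (by omega)) (by rw [b0]; omega) ?_)
  rw [b0, f2 NEWS (by decide), bI]
  intro m₃ qs f3 hnd hqlen hqmem hqt hque hqh hinp3
  have hqs : ∀ p, p ∈ qs ↔ Entered τ m p := by
    intro p
    rw [hqmem]
    exact exists_congr fun s' => and_congr_right fun hs' => and_congr_left' (hnews1 s' hs')
  have cE : m₃ ECNT = m ECNT := by rw [f3 ECNT (by decide), bE]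
  have cD : m₃ DEG = m₂ DEG := f3 _ (by decide)
  have cA : m₃ TADJ = m₂ TADJ := f3 _ (by decide)
  have cL : m₃ LAB = m₂ LAB := f3 _ (by decide)
  have c1 : m₃ 1 = m₁ 1 := by rw [f3 1 (by decide), b1]
  have car : arcs m₃ = arcs m₁ := by rw [arcs_congr f3 (by rw [c1, b1]), bar]
  obtain ⟨hS3, hP3⟩ := hS2.congr_extend f3 (by rw [c1, b1])
    (fun e _ => ⟨by rw [f3 SRC (by decide)], by rw [f3 DST (by decide)]⟩)
  have hT3 : TransInv n' m₃ := hT2.congr (f3 _ (by decide)) cD cA (f3 _ (by decide))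
  have htab3 : ArcTable m₃ := (htab1.congr (by rw [c1]) (by rw [f3 SRC (by decide), f2 SRC (by decide)])
    (by rw [f3 DST (by decide), f2 DST (by decide)]) (by rw [f3 PEDGE (by decide), f2 PEDGE (by decide)])).1
  have hpre : ∀ y, lst (m DEG) (m TADJ) y <+: lst (m₃ DEG) (m₃ TADJ) y := by
    intro y
    rw [cD, cA, hlst2]
    split_ifs
    exacts [List.prefix_append _ _, List.prefix_refl _]
  have hX3 : ExpandInv τ m₃ := h.expand.extend h.trans hpre (by rw [cL]; exact hlab2) cE
    (fun p hp => (hinp3 p).2 (Or.inl hp)) (by rw [car]; exact hext1.subset)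
  have hinpV3 : ∀ p, m₃ INP p ≠ 0 → p < n' * τ.K := by
    intro p hp
    rcases (hinp3 p).1 hp with h1 | h1
    · have := h.inpLt p h1
      omega
    · exact hentV p ((hqs p).1 h1)
  -- Product states over a vertex that is not yet there contribute nothing to the old potential, so
  -- the range of the sum may be enlarged first.
  have hE3 : expandPotential (n * τ.K) m ≤ expandPotential (n' * τ.K) m₃ := by
    rcases Nat.eq_zero_or_pos τ.K with hK0 | hK0
    · simp [expandPotential, hK0]
    rw [← expandPotential_congr (m' := m) hnn' (fun _ _ => ⟨rfl, rfl⟩) fun p hp => ⟨?_, ?_⟩]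
    · exact expandPotential_mono cE fun p hp => (hinp3 p).2 (Or.inl hp)
    · have h1 := h.expand.le p
      rw [h.trans.deg (p / τ.K) ?_] at h1
      · omega
      · exact (Nat.le_div_iff_mul_le hK0).2 hp
    · by_contra h1
      have := h.inpLt p h1
      omega
  refine Runs.seq ((expandLoop_runs hW4 hT3 htab3 hX3 (by rw [car]; exact hlt1) hnd
    (fun p hp => ⟨hentV p ((hqs p).1 hp), (hinp3 p).2 (Or.inr hp)⟩) hqt hque hqh).mono ?_)
  rintro t₄ m₄ ⟨f4, hone4, hext4, htab4, hX4, hlt4, hinpV4, hinp4, harcs4, hE4, ht4⟩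
  obtain ⟨hS4, hP4⟩ := hS3.congr_extend f4 (hone4 1 (by decide)) fun e he =>
    hext4.2 e (by rw [c1]; exact he.trans_le hext1.1)
  have hDM : D ≤ m₄ 1 2 := by
    have := hext4.1
    rw [c1] at this
    exact hext1.1.trans this
  have hdone4 : m₄ DONE 0 = D := by
    rw [f4 DONE (by decide), f3 DONE (by decide), f2 DONE (by decide), f1 DONE (by decide), h.done]
  have hstamp4 : m₄ STAMP 0 ≤ 3 * D := by
    rw [f4 STAMP (by decide), f3 STAMP (by decide), f2 STAMP (by decide), f1 STAMP (by decide)]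
    exact h.stamp
  refine (insertLoop_runs (hW5 _ (htab4.card_le hlt4)) hS4 (fun e he => hlt4 (m₄ SRC e, m₄ DST e) ⟨e, he, rfl, rfl⟩) rfl hDM
    hdone4 hstamp4).mono ?_
  rintro t₅ m₅ ⟨hS5, hdone5, f5, hone5, hstamp5, hP5, ht5⟩ t₃ ht₃ t₂ ht₂ t₁ ht₁
  have d1 : m₅ 1 2 = m₄ 1 2 := hone5 2 (by decide)
  have dS : m₅ SRC = m₄ SRC := f5 _ (by decide)
  have dT : m₅ DST = m₄ DST := f5 _ (by decide)
  have dI : m₅ INP = m₄ INP := f5 _ (by decide)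
  have dE : m₅ ECNT = m₄ ECNT := f5 _ (by decide)
  have dD4 : m₄ DEG = m₃ DEG := f4 _ (by decide)
  have dA4 : m₄ TADJ = m₃ TADJ := f4 _ (by decide)
  have dL4 : m₄ LAB = m₃ LAB := f4 _ (by decide)
  have dD : m₅ DEG = m₄ DEG := f5 _ (by decide)
  have dA : m₅ TADJ = m₄ TADJ := f5 _ (by decide)
  have dL : m₅ LAB = m₄ LAB := f5 _ (by decide)
  obtain ⟨htab5, har5⟩ := htab4.congr d1 dS dT (f5 PEDGE (by decide))
  have hvia4 : Via τ m₅ = Via τ m₄ := Via.congr dD dA dL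
  have hvia3 : Via τ m₅ = Via τ m₃ := Via.congr (dD.trans dD4) (dA.trans dA4) (dL.trans dL4)
  have hstep3 : Step τ m₅ = Step τ m₃ := by
    funext p p'
    simp only [Step, hvia3]
  -- Absent when the traversal starts means absent before the call and not just entered: the entered
  -- states are marked in `INP` before the loop.
  have hvis : ∀ p, Visited τ m₃ (· ∈ qs) p ↔ CallVisited τ m m₅ p := by
    intro p
    have h1 : (fun a b => Step τ m₃ a b ∧ m₃ INP b = 0) =
        fun a b => Step τ m₅ a b ∧ m INP b = 0 ∧ ¬ Entered τ m b := by
      funext a b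
      have h2 := not_congr (hinp3 b)
      push Not at h2
      rw [hstep3, h2, hqs]
    simp only [Visited, CallVisited, h1, hqs]
  refine Or.inr ⟨⟨hent.2 hg, ?_, ⟨by rw [d1]; exact hS5, by rw [hdone5, d1], by rw [d1]; exact hstamp5, ?_,
    htab5, ⟨?_, ?_⟩, ?_⟩, ?_, ?_, ?_, ?_, ?_⟩, ?_⟩
  · rw [hone5 0 (by decide), hone4 0 (by decide), c1]; exact hg
  · exact hT3.congr (by rw [f5 NUM (by decide), f4 NUM (by decide)]) (dD.trans dD4) (dA.trans dA4)
      (by rw [f5 TEDGE (by decide), f4 TEDGE (by decide)])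
  · rw [dE, dD]; exact hX4.le
  · rw [dE, dI, har5, hvia4]; exact hX4.expanded
  · rw [dI]
    intro p hp
    rcases hinpV4 p hp with h1 | h1
    exacts [hinpV3 p h1, h1]
  · intro p p'
    rw [har5, harcs4, car, harcs1', or_assoc, hstep3, hvis]
  · intro p
    rw [dI, hinp4, hinp3, or_assoc, hqs, hstep3]
    simp only [hvis]
  · intro y hy
    rw [dL, dL4, cL, hlab2 y hy]
  · intro hn
    rw [dL, dL4, cL, hlabn2 hn]
  · intro y z
    rw [dD, dA, dD4, dA4, cD, cA, hlst2]
    split_ifs with h1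
    · rw [List.mem_append, List.mem_singleton]
      simp [h1.1]
    · constructor
      · exact Or.inl
      · rintro (h2 | ⟨rfl, rfl⟩)
        · exact h2
        · by_contra h2
          exact h1 ⟨rfl, h2⟩
  · have hEE : expandPotential (n' * τ.K) m₅ = expandPotential (n' * τ.K) m₄ := by
      simp only [expandPotential, dE, dI]
    have hPP : potential (n' * τ.K) D m₄ = potential (n * τ.K) D m := by
      rw [hP4, hP3, hP2, hP1]
    rw [hPP] at ht5 hP5
    simp only [planPotential, d1, hEE, ← hD]
    have h1 : expandCost τ * expandPotential (n * τ.K) m ≤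
        expandCost τ * expandPotential (n' * τ.K) m₃ := Nat.mul_le_mul_left _ hE3
    have h2 : expandCost τ * qs.length ≤ expandCost τ * τ.K := Nat.mul_le_mul_left _ hqlen
    rw [mul_add, mul_add] at ht4
    rw [mul_add] at hCC
    refine ⟨?_, by omega⟩
    have h3 := Nat.mul_le_mul_left insertCost hP5
    have h4 := Nat.mul_le_mul_left (expandCost τ) (hE3.trans hE4)
    omega

/-! ### Setup -/

/-- Create the first vertex and the initial product states. -/
def setupProgram (τ : Table) : Cmd :=
  .seq (.store LAB (.const 0) (.read 0 (.const 2))) (.seq (setv NUM (.const 1))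
    (.seq (addVertices τ (.const 0))
      (seqs (((List.range τ.K).filter τ.ini).map fun s => .store INP (.const s) (.const 1)))))

theorem wp_setupProgram {W : ℕ} {τ : Table} (hW : Fits W (τ.K + 1)) {m : Mem}
    (hm : ∀ a, a ≠ 0 → ∀ i, m a i = 0) (hl : m 0 2 ≤ W) {Q : Mem → Prop}
    (hQ : ∀ m', PlanInv τ 1 m' → arcs m' = ∅ → (∀ p, m' INP p ≠ 0 ↔ p < τ.K ∧ τ.ini p = true) →
      m' LAB 0 = m 0 2 → (∀ y, lst (m' DEG) (m' TADJ) y = []) → Q m') :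
    wp W (setupProgram τ) Q m := by
  simp only [setupProgram, wp, wp_setv, Expr.eval]
  refine ⟨⟨Nat.zero_le _, hl⟩, hW.lin _ (by omega), ?_⟩
  set m₁ := (m.write LAB 0 (m 0 2)).write NUM 0 1 with hm₁
  have f1 : Frame [LAB, NUM] m m₁ := (Frame.refl _ _).write.write
  have h0 : ∀ a, a ∉ [0, LAB, NUM] → m₁ a = fun _ => 0 := fun a ha => by
    simp only [List.mem_cons, not_or] at ha
    rw [f1 a (by simp [ha])]
    exact funext (hm a ha.1)
  have hS : SccInv τ.Acc (0 * τ.K) 0 0 0 m₁ := by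
    have h11 : m₁ 1 1 = 0 := by rw [h0 1 (by decide)]
    rw [zero_mul]
    constructor <;> try intro x hx; omega
    · simp [h11]
    · exact ⟨fun e he => absurd he (by omega), fun _ => 0, fun e he => absurd he (by omega),
        fun k u hu => absurd hu (by omega)⟩
    · intro c
      rw [h0 MARK (by decide), h0 STAMP (by decide)]
  refine wp_addVertices (n := 0) (hW.mono (by omega)) hS (fun _ _ => rfl) fun m₂ f2 hS2 _ => ?_
  rw [zero_add, one_mul] at hS2
  have g0 : ∀ a, a ∉ [0, LAB, NUM, COMP, SIZE, MLST, LEV, ODEG, IDEG, ACC] → m₂ a = fun _ => 0 := fun a ha => by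
    simp only [List.mem_cons, not_or] at ha
    rw [f2 a (by simp [ha]), h0 a (by simp [ha])]
  refine (wp_seqs (fun s => .store INP (.const s) (.const 1)) (fun l m' => Frame [INP] m₂ m' ∧
    ∀ p, m' INP p ≠ 0 ↔ p ∈ l) _ ?_ (m := m₂) ⟨Frame.refl _ _, by simp [g0 INP (by decide)]⟩).mono ?_
  · rintro l s m' hl ⟨f, hI⟩
    have hs : s < τ.K := by
      have := hl.subset (a := s) (by simp)
      simp only [List.mem_filter, List.mem_range] at this
      exact this.1
    refine ⟨⟨hW.lin _ (by simp only [Expr.eval]; omega), hW.lin _ (by simp only [Expr.eval]; omega)⟩,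
      f.write, fun p => ?_⟩
    simp only [Expr.eval, write_same, Function.update_apply, List.mem_append, List.mem_singleton, ← hI]
    split_ifs with h1 <;> simp [h1]
  · rintro m₃ ⟨f3, hI⟩
    have k0 : ∀ a, a ∉ [0, INP, LAB, NUM, COMP, SIZE, MLST, LEV, ODEG, IDEG, ACC] → m₃ a = fun _ => 0 :=
      fun a ha => by
        simp only [List.mem_cons, not_or] at ha
        rw [f3 a (by simp [ha]), g0 a (by simp [ha])]
    have hone : m₃ 1 2 = 0 := by rw [k0 1 (by decide)]
    obtain ⟨hS3, -⟩ := hS2.congr_extend f3 (by rw [f3 1 (by decide)]) (fun e he => absurd he (by omega))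
    have hlst : ∀ y, lst (m₃ DEG) (m₃ TADJ) y = [] := fun y => by simp [lst, k0 DEG (by decide)]
    have harcs : arcs m₃ = ∅ := by
      ext p
      simp [arcs, hone]
    have hI' : ∀ p, m₃ INP p ≠ 0 ↔ p < τ.K ∧ τ.ini p = true := fun p => by
      rw [hI, List.mem_filter, List.mem_range]
    refine hQ m₃ ⟨by rw [hone, one_mul]; exact hS3, by rw [hone, k0 DONE (by decide)], ?_, ?_, ?_, ?_, ?_⟩
      harcs hI' ?_ hlst
    · rw [k0 STAMP (by decide)]; exact Nat.zero_le _
    · refine ⟨?_, fun x _ => by rw [k0 DEG (by decide)], ?_, ?_, ?_⟩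
      · rw [f3 NUM (by decide), f2 NUM (by decide)]
        simp [hm₁, write_same]
      · simp [hlst]
      · simp [hlst]
      · simp [hlst, k0 TEDGE (by decide)]
    · refine ⟨?_, by simp [hone]⟩
      simp [harcs, k0 PEDGE (by decide)]
    · refine ⟨by simp [k0 ECNT (by decide)], by simp [k0 ECNT (by decide)]⟩
    · intro p hp
      rw [one_mul]
      exact ((hI' p).1 hp).1
    · rw [f3 LAB (by decide), f2 LAB (by decide)]
      simp [hm₁, write_same, write_other]

/-! ### The size of the potential -/

/-- This absorbs the cost of renaming, of order `V log V`, into `V √V`. -/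
theorem log_two_le_sqrt (V : ℕ) : Nat.log 2 V ≤ 2 * Nat.sqrt V + 1 := by
  rcases Nat.eq_zero_or_pos V with rfl | hV
  · simp
  have h1 : 2 ^ Nat.log 2 V ≤ V := Nat.pow_log_le_self 2 (by omega)
  have h2 : 2 ^ (Nat.log 2 V / 2) ≤ Nat.sqrt V := by
    rw [Nat.le_sqrt, ← pow_add]
    exact (Nat.pow_le_pow_right (by omega) (by omega)).trans h1
  have h3 := (Nat.lt_two_pow_self (n := Nat.log 2 V / 2)).trans_le h2
  omega

theorem sum_range_mul_div (f : ℕ → ℕ) (n K : ℕ) (hK : 0 < K) :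
    ∑ p ∈ Finset.range (n * K), f (p / K) = K * ∑ x ∈ Finset.range n, f x := by
  induction n with
  | zero => simp
  | succ n ih =>
    rw [add_mul, one_mul, Finset.sum_range_add, ih, Finset.sum_range_succ, mul_add]
    congr 1
    rw [Finset.sum_congr rfl (g := fun _ => f n)]
    · simp
    · intro i hi
      rw [Finset.mem_range] at hi
      rw [mul_comm n K, Nat.mul_add_div hK, Nat.div_eq_of_lt hi, add_zero]

theorem SccInv.potential_le {acc : ℕ → Prop} {V M : ℕ} {m : Mem} (h : SccInv acc V M M M m) :
    potential V M m ≤ M * (4 + Nat.sqrt (2 * M)) + V * Nat.sqrt (2 * M) + M * Nat.sqrt (2 * M) +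
      V * (2 * Nat.sqrt V + 1) := by
  have hlev : ∀ y < V, m LEV y ≤ Nat.sqrt (2 * M) := fun y hy => h.lev.le_sqrt hy
  unfold potential logSize
  refine add_le_add (add_le_add (add_le_add ?_ ?_) ?_) ?_
  · refine (Finset.sum_le_card_nsmul _ _ (4 + Nat.sqrt (2 * M)) fun i hi => ?_).trans_eq (by simp)
    rw [Finset.mem_range] at hi
    exact Nat.add_le_add_left (Nat.sqrt_le_sqrt (by omega)) _
  · refine (Finset.sum_le_card_nsmul _ _ (Nat.sqrt (2 * M)) fun y hy => ?_).trans_eq (by simp)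
    exact hlev y (Finset.mem_range.1 hy)
  · refine (Finset.sum_le_card_nsmul _ _ (Nat.sqrt (2 * M)) fun e he => ?_).trans_eq (by simp)
    exact hlev _ (h.ends e (Finset.mem_range.1 he)).1
  · refine (Finset.sum_le_card_nsmul _ _ (2 * Nat.sqrt V + 1) fun y hy => ?_).trans_eq (by simp)
    rw [Finset.mem_range] at hy
    refine (Nat.log_mono_right ?_).trans (log_two_le_sqrt V)
    rw [← length_lst (d := m SIZE) (a := m MLST)]
    exact length_le_of_nodup (h.memNodup y hy) fun z hz => ((h.mem y hy z).1 hz).1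

/-- The factor of `m ^ (3 / 2)` in the bound for the potential. -/
def potentialFactor (τ : Table) : ℕ := 40 * (τ.K + 1) ^ 3 * (insertCost + 6 + expandCost τ)

/-- For fixed `K` there are `O(N)` vertices and arcs, while levels and logarithms are `O(√N)`, so
every summand is `O(N √N)`. Here `q` plays the role of `⌊√N⌋`. The hypothesis `n ≤ 2 N` comes from
`n ≤ N + 1` with `N ≥ 1`. -/
theorem PlanInv.potential_le {τ : Table} {n N q : ℕ} {m : Mem} (h : PlanInv τ n m)
    (hM : m 1 2 ≤ τ.K * τ.K * N) (hn : n ≤ 2 * N) (hdeg : ∑ x ∈ Finset.range n, m DEG x ≤ N)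
    (hq : N < (q + 1) * (q + 1)) (hq1 : 1 ≤ q) :
    planPotential τ n m ≤ potentialFactor τ * (N * q) := by
  have h1 := h.scc.potential_le
  have hs : Nat.sqrt (2 * m 1 2) ≤ 4 * τ.K * q := by
    refine (Nat.sqrt_le_sqrt (Nat.mul_le_mul_left 2 hM)).trans ?_
    rw [← Nat.sqrt_eq (4 * τ.K * q)]
    refine Nat.sqrt_le_sqrt ?_
    -- Because `N < (q + 1)²` and `q + 1 ≤ 2 q`.
    have h3 : N ≤ 4 * (q * q) := by nlinarith
    calc 2 * (τ.K * τ.K * N) ≤ 2 * (τ.K * τ.K * (4 * (q * q))) := by gcongr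
      _ ≤ 4 * τ.K * q * (4 * τ.K * q) := by nlinarith [Nat.zero_le (τ.K * τ.K * (q * q))]
  have hV : n * τ.K ≤ 2 * τ.K * N := by nlinarith [Nat.mul_le_mul_right τ.K hn]
  have hsV : Nat.sqrt (n * τ.K) ≤ 3 * τ.K * q := by
    rw [← Nat.sqrt_eq (3 * τ.K * q)]
    refine Nat.sqrt_le_sqrt (hV.trans ?_)
    have h3 : N ≤ 4 * (q * q) := by nlinarith
    calc 2 * τ.K * N ≤ 2 * τ.K * (4 * (q * q)) := by gcongr
      _ ≤ 3 * τ.K * q * (3 * τ.K * q) := by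
        rcases Nat.eq_zero_or_pos τ.K with h0 | h0
        · simp [h0]
        · nlinarith [Nat.mul_le_mul_right (τ.K * (q * q)) h0]
  have hE : expandPotential (n * τ.K) m ≤ 3 * τ.K * N := by
    unfold expandPotential
    rw [Finset.sum_add_distrib]
    rcases Nat.eq_zero_or_pos τ.K with h0 | h0
    · simp [h0]
    have h3 : ∑ p ∈ Finset.range (n * τ.K), m ECNT p ≤ τ.K * N := by
      refine (Finset.sum_le_sum fun p _ => h.expand.le p).trans ?_
      rw [sum_range_mul_div _ _ _ h0]
      exact Nat.mul_le_mul_left _ hdeg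
    have h4 : ∑ p ∈ Finset.range (n * τ.K), (if m INP p = 0 then 0 else 1) ≤ n * τ.K := by
      refine (Finset.sum_le_card_nsmul _ _ 1 fun p _ => ?_).trans_eq (by simp)
      split_ifs <;> omega
    nlinarith
  have hb : N ≤ N * q := Nat.le_mul_of_pos_right _ hq1
  have hpot : potential (n * τ.K) (m 1 2) m ≤ 40 * (τ.K + 1) ^ 3 * (N * q) := by
    refine h1.trans ?_
    calc _ ≤ τ.K * τ.K * N * (4 + 4 * τ.K * q) + 2 * τ.K * N * (4 * τ.K * q) +
          τ.K * τ.K * N * (4 * τ.K * q) + 2 * τ.K * N * (2 * (3 * τ.K * q) + 1) := by gcongr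
      _ = (4 * τ.K ^ 2 + 2 * τ.K) * N + (8 * τ.K ^ 3 + 20 * τ.K ^ 2) * (N * q) := by ring
      _ ≤ (4 * τ.K ^ 2 + 2 * τ.K) * (N * q) + (8 * τ.K ^ 3 + 20 * τ.K ^ 2) * (N * q) := by gcongr
      _ = (4 * τ.K ^ 2 + 2 * τ.K + (8 * τ.K ^ 3 + 20 * τ.K ^ 2)) * (N * q) := by ring
      _ ≤ 40 * (τ.K + 1) ^ 3 * (N * q) := by
        refine Nat.mul_le_mul_right _ ?_
        ring_nf
        omega
  have hM' : m 1 2 ≤ 40 * (τ.K + 1) ^ 3 * (N * q) := by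
    calc m 1 2 ≤ τ.K * τ.K * N := hM
      _ ≤ 40 * (τ.K + 1) ^ 3 * (N * q) := Nat.mul_le_mul (by ring_nf; omega) hb
  have hE' : expandPotential (n * τ.K) m ≤ 40 * (τ.K + 1) ^ 3 * (N * q) :=
    hE.trans (Nat.mul_le_mul (by ring_nf; omega) hb)
  calc planPotential τ n m ≤ insertCost * (40 * (τ.K + 1) ^ 3 * (N * q)) +
        6 * (40 * (τ.K + 1) ^ 3 * (N * q)) + expandCost τ * (40 * (τ.K + 1) ^ 3 * (N * q)) := by
        unfold planPotential
        gcongr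
    _ = potentialFactor τ * (N * q) := by unfold potentialFactor; ring

/-! ### The planner itself, without its memory. -/

section Planner

variable {α AP S : Type*}

/-! ### The traversal -/

/-- The states that the traversal from `stack` expands. -/
def Expanded (T : DTS α AP) (B : BuchiAutomaton AP S) (P : ProductGraph α S) (stack : Set (α × S)) :
    Set (α × S) :=
  {p | ∃ s ∈ stack, Relation.ReflTransGen (fun a b => ProductStep T B a b ∧ b ∉ P.states) s p}

/-- A path from the stack is cut at its last visit to a successor of `p`. That successor was absent,
so it is pushed now, and the rest of the path avoids all successors of `p`, so it still runs through
absent states after the expansion. A path that meets no successor of `p` starts at another stack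
element or is just `p`. -/
theorem expanded_pop {T : DTS α AP} {B : BuchiAutomaton AP S} {P : ProductGraph α S}
    {stack : Set (α × S)} {p : α × S} (hp : p ∈ stack) :
    Expanded T B P stack = insert p (Expanded T B (P.expand T B p)
      ((stack \ {p}) ∪ {p' | ProductStep T B p p' ∧ p' ∉ P.states})) := by
  set stack' := (stack \ {p}) ∪ {p' | ProductStep T B p p' ∧ p' ∉ P.states} with hs'
  apply Set.Subset.antisymm
  · rintro y ⟨s, hs, hr⟩
    induction hr with
    | refl =>
      by_cases h1 : s = p
      · exact Or.inl h1
      · exact Or.inr ⟨s, Or.inl ⟨hs, h1⟩, .refl⟩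
    | @tail b c _ h1 ih =>
      by_cases h2 : ProductStep T B p c
      · exact Or.inr ⟨c, Or.inr ⟨h2, h1.2⟩, .refl⟩
      · rcases ih with rfl | ⟨s', h3, h4⟩
        · exact absurd h1.1 h2
        · exact Or.inr ⟨s', h3, h4.tail ⟨h1.1, fun h5 => h5.elim h1.2 h2⟩⟩
  · rintro y (rfl | ⟨s, hs, hr⟩)
    · exact ⟨y, hp, .refl⟩
    · have h1 : Relation.ReflTransGen (fun a b => ProductStep T B a b ∧ b ∉ P.states) s y :=
        Relation.ReflTransGen.mono (fun a b h => ⟨h.1, fun h2 => h.2 (Or.inl h2)⟩) s y hr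
      rcases hs with hs | hs
      · exact ⟨s, hs.1, h1⟩
      · exact ⟨p, hp, h1.head hs⟩

/-- The outcome is described without reference to the popping order, so a first-in-first-out queue
computes the same product automaton as any other choice. -/
theorem traverse_eq {T : DTS α AP} {B : BuchiAutomaton AP S} {P P' : ProductGraph α S}
    {stack : Set (α × S)} (h : Traverse T B P stack P') :
    P'.states = P.states ∪ {p' | ∃ p ∈ Expanded T B P stack, ProductStep T B p p'} ∧
    P'.trans = P.trans ∪ {e | e.1 ∈ Expanded T B P stack ∧ ProductStep T B e.1 e.2} := by
  induction h with
  | done P => simp [Expanded]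
  | pop P P' stack p hp h ih =>
    rw [ih.1, ih.2, expanded_pop hp]
    constructor
    · ext y
      simp [ProductGraph.expand, or_assoc]
    · ext ⟨y, y'⟩
      simp only [ProductGraph.expand, Set.mem_union, Set.mem_ofPred_eq, Set.mem_insert_iff, or_assoc]
      refine or_congr_right ?_
      constructor
      · rintro (⟨rfl, h1⟩ | ⟨h1, h2⟩)
        exacts [⟨Or.inl rfl, h1⟩, ⟨Or.inr h1, h2⟩]
      · rintro ⟨rfl | h1, h2⟩
        exacts [Or.inl ⟨rfl, h2⟩, Or.inr ⟨h1, h2⟩]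

/-! ### The sequence of calls -/

/-- The calls of `tr` lead from `st` to the last argument. -/
def CallChain (B : BuchiAutomaton AP S) :
    SearchState α AP S → List (CallRecord α AP S) → SearchState α AP S → Prop
  | st, [], st' => st = st'
  | st, c :: tr, st' => c.pre = st ∧ c.src ∈ st.T.states ∧ UpdatePA B st c.src c.dst c.added c.post ∧
      CallChain B c.post tr st'

theorem CallChain.append {B : BuchiAutomaton AP S} {tr tr' : List (CallRecord α AP S)}
    {st st' st'' : SearchState α AP S} (h : CallChain B st tr st') (h' : CallChain B st' tr' st'') :
    CallChain B st (tr ++ tr') st'' := by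
  induction tr generalizing st with
  | nil => cases h; exact h'
  | cons c tr ih => exact ⟨h.1, h.2.1, h.2.2.1, ih h.2.2.2⟩

theorem updatePA_states_mono {B : BuchiAutomaton AP S} {st st' : SearchState α AP S} {x x' : α} {b : Bool}
    (h : UpdatePA B st x x' b st') :
    st.T.states ⊆ st'.T.states ∧ (b = true → x' ∈ st'.T.states) := by
  cases h with
  | rejected => simp
  | accepted =>
    refine ⟨fun y hy => ?_, fun _ => ?_⟩ <;> simp [DTS.addTransition]
    tauto

section RRG

variable {n : ℕ} {env : Environment n AP}
  {steer : EuclideanSpace ℝ (Fin n) → EuclideanSpace ℝ (Fin n) → EuclideanSpace ℝ (Fin n)}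
  {B : BuchiAutomaton AP S}

theorem callChain_of_exploreLoop {xr : EuclideanSpace ℝ (Fin n)} {L tr X' st st'}
    (h : ExploreLoop env steer B xr L st tr X' st') (hL : ∀ x ∈ L, x ∈ st.T.states) :
    CallChain B st tr st' ∧ st.T.states ⊆ st'.T.states ∧ ∀ y ∈ X', y ∈ st'.T.states := by
  induction h with
  | nil st => exact ⟨rfl, subset_rfl, by simp⟩
  | skip x L st tr X' st' _ _ ih => exact ih fun y hy => hL y (by simp [hy])
  | call x L st b st₁ tr X' st' _ hc _ ih =>
    obtain ⟨h1, h2⟩ := updatePA_states_mono hc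
    obtain ⟨h3, h4, h5⟩ := ih fun y hy => h1 (hL y (by simp [hy]))
    refine ⟨⟨rfl, hL x (by simp), hc, h3⟩, h1.trans h4, ?_⟩
    rintro y (⟨hb, rfl⟩ | hy)
    · exact h4 (h2 hb)
    · exact h5 y hy

theorem callChain_of_closeInner {x' : EuclideanSpace ℝ (Fin n)} {L tr st st'}
    (h : CloseInner env steer B x' L st tr st') (hx' : x' ∈ st.T.states) :
    CallChain B st tr st' ∧ st.T.states ⊆ st'.T.states := by
  induction h with
  | nil st => exact ⟨rfl, subset_rfl⟩
  | skip x L st tr st' _ _ ih => exact ih hx'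
  | call x L st b st₁ tr st' _ hc _ ih =>
    obtain ⟨h1, -⟩ := updatePA_states_mono hc
    obtain ⟨h3, h4⟩ := ih (h1 hx')
    exact ⟨⟨rfl, hx', hc, h3⟩, h1.trans h4⟩

theorem callChain_of_closeLoop {η₂ : ℕ → ℝ} {L tr st st'}
    (h : CloseLoop env steer η₂ B L st tr st') (hL : ∀ x ∈ L, x ∈ st.T.states) :
    CallChain B st tr st' := by
  induction h with
  | nil st => exact rfl
  | cons x' L M st tr₁ st₁ tr₂ st₂ _ h₁ _ ih =>
    obtain ⟨h3, h4⟩ := callChain_of_closeInner h₁ (hL x' (by simp))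
    exact h3.append (ih fun y hy => h4 (hL y (by simp [hy])))

/-- What remains of the geometry is that the source of every call is already a state: far states are
states, and the second loop starts from states that the first one has added. Steering, distances and
bound functions play no further part. -/
theorem callChain_of_sparseRRG {x₀ : EuclideanSpace ℝ (Fin n)} {η₁ η₂ : ℕ → ℝ} {tr st}
    (h : SparseRRG env x₀ steer η₁ η₂ B tr st) : CallChain B (startState env x₀ B) tr st := by
  induction h with
  | start => exact rfl
  | iterate tr st xr L X' tr₁ st₁ L' tr₂ st₂ _ _ _ hL h₁ hL' h₂ ih =>
    obtain ⟨h3, h4, h5⟩ := callChain_of_exploreLoop h₁ fun x hx => ((hL.2 x).1 hx).1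
    exact (ih.append h3).append (callChain_of_closeLoop h₂ fun x hx => h5 x ((hL'.2 x).1 hx))

end RRG

/-! ### Invariants of the planner -/

/-- Invariants of the planner. -/
structure Valid (B : BuchiAutomaton AP S) (st : SearchState α AP S) : Prop where
  nodup : st.order.Nodup
  mem : ∀ x, x ∈ st.order ↔ x ∈ st.T.states
  length : st.order.length ≤ st.T.trans.card + 1
  states : ∀ p ∈ st.P.states, p.1 ∈ st.order
  trans : ∀ e ∈ st.P.trans, e.1 ∈ st.P.states ∧ e.2 ∈ st.P.states ∧ ProductStep st.T B e.1 e.2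

theorem productStep_addTransition {T : DTS α AP} {B : BuchiAutomaton AP S} {x x' : α} {p p' : α × S}
    (h : ProductStep T B p p') : ProductStep (T.addTransition x x') B p p' := by
  refine ⟨?_, h.2⟩
  simp only [DTS.addTransition, Finset.mem_insert]
  exact Or.inr h.1

/-- The clause `length` bounds the number of vertices by the number of transitions: each state
except the first comes with a transition of its own. -/
theorem Valid.update {B : BuchiAutomaton AP S} {st st' : SearchState α AP S} {x x' : α} {b : Bool}
    (h : Valid B st) (hx : x ∈ st.T.states) (hu : UpdatePA B st x x' b st') : Valid B st' := by
  classical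
  cases hu with
  | rejected => exact h
  | accepted P' hne hP =>
    obtain ⟨h1, h2⟩ := traverse_eq hP
    set X := Expanded (st.T.addTransition x x') B
      ⟨st.P.states ∪ newStates st.T.label B st.P x x', st.P.trans ∪ newTrans st.T.label B st.P x x'⟩
      (newStates st.T.label B st.P x x')
    have hX : ∀ p ∈ X, p ∈ P'.states := by
      rintro p ⟨s, hs, hr⟩
      rw [h1]
      cases hr with
      | refl => exact Or.inl (Or.inr hs)
      | tail h3 h4 => exact Or.inr ⟨_, ⟨s, hs, h3⟩, h4.1⟩
    have hmem : ∀ y, (y ∈ if x' ∈ st.order then st.order else st.order ++ [x']) ↔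
        y ∈ (st.T.addTransition x x').states := by
      intro y
      simp only [DTS.addTransition, Finset.mem_insert, ← h.mem]
      rw [← h.mem] at hx
      split_ifs with h3
      · refine ⟨fun h4 => by tauto, ?_⟩
        rintro (rfl | rfl | h4) <;> assumption
      · simp only [List.mem_append, List.mem_singleton]
        refine ⟨fun h4 => by tauto, ?_⟩
        rintro (rfl | rfl | h4)
        exacts [Or.inr rfl, Or.inl hx, Or.inl h4]
    have hmono : ∀ y ∈ st.order, y ∈ if x' ∈ st.order then st.order else st.order ++ [x'] := by
      intro y hy
      split_ifs <;> simp [hy]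
    refine ⟨?_, hmem, ?_, ?_, ?_⟩
    · show (if x' ∈ st.order then st.order else st.order ++ [x']).Nodup
      split_ifs with h3
      exacts [h.nodup, nodup_snoc h.nodup h3]
    · show (if x' ∈ st.order then st.order else st.order ++ [x']).length ≤
        (insert (x, x') st.T.trans).card + 1
      split_ifs with h3
      · exact h.length.trans (Nat.add_le_add_right (Finset.card_le_card (Finset.subset_insert _ _)) _)
      -- A transition into a new state is itself new, because old transitions join old states.
      · rw [Finset.card_insert_of_notMem, List.length_append, List.length_singleton]
        · exact Nat.add_le_add_right h.length _
        · intro h4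
          exact h3 ((h.mem _).2 (st.T.trans_mem _ h4).2)
    · intro p hp
      rw [h1] at hp
      show p.1 ∈ if x' ∈ st.order then st.order else st.order ++ [x']
      rcases hp with (hp | hp) | ⟨p₀, hp₀, hp⟩
      · exact hmono _ (h.states p hp)
      · rw [hp.1, hmem]
        simp [DTS.addTransition]
      · rw [hmem]
        exact (DTS.trans_mem _ _ hp.1).2
    · rintro ⟨p, p'⟩ he
      show p ∈ P'.states ∧ p' ∈ P'.states ∧ _
      rw [h2] at he
      rcases he with (he | he) | he
      · obtain ⟨h3, h4, h5⟩ := h.trans _ he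
        rw [h1]
        exact ⟨Or.inl (Or.inl h3), Or.inl (Or.inl h4), productStep_addTransition h5⟩
      · obtain ⟨rfl, h3, h4, h5⟩ := he
        rw [h1]
        refine ⟨Or.inl (Or.inl h3), Or.inl (Or.inr h5), ?_, h4⟩
        rw [h5.1]
        simp [DTS.addTransition]
      · refine ⟨hX _ he.1, ?_, he.2⟩
        rw [h1]
        exact Or.inr ⟨p, he.1, he.2⟩

end Planner

/-! ### The relation between planner and memory. -/

section Simulation

open Classical

variable {α AP S : Type*} {K : ℕ}

/-! ### Numbering -/

/-- The Büchi automaton with numbered states and letters. -/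
noncomputable def table [Finite AP] (B : BuchiAutomaton AP S) (lab : Set AP ↪ ℕ) (q : S ≃ Fin K) :
    Table where
  K := K
  labs k k' := (Set.toFinite {σ : Set AP | ∃ s s', (q s : ℕ) = k ∧ (q s' : ℕ) = k' ∧
    s' ∈ B.step s σ}).toFinset.toList.map lab
  nb k := decide (∃ s, (q s : ℕ) = k ∧ B.NonBlocking s)
  acc k := decide (∃ s, (q s : ℕ) = k ∧ s ∈ B.accept)
  ini k := decide (∃ s, (q s : ℕ) = k ∧ s ∈ B.start)

theorem numbering_inj {q : S ≃ Fin K} {s s' : S} : (q s : ℕ) = q s' ↔ s = s' := by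
  rw [Fin.val_inj, q.injective.eq_iff]

theorem exists_numbering {q : S ≃ Fin K} {P : S → Prop} {s : S} :
    (∃ s', (q s' : ℕ) = q s ∧ P s') ↔ P s :=
  ⟨fun ⟨_, h, h'⟩ => numbering_inj.1 h ▸ h', fun h => ⟨s, rfl, h⟩⟩

theorem exists_of_lt (q : S ≃ Fin K) {k : ℕ} (hk : k < K) : ∃ s, (q s : ℕ) = k :=
  ⟨q.symm ⟨k, hk⟩, by simp⟩

theorem exists_lt_numbering {q : S ≃ Fin K} {P : ℕ → Prop} : (∃ k < K, P k) ↔ ∃ s, P (q s) := by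
  constructor
  · rintro ⟨k, hk, h⟩
    obtain ⟨s, rfl⟩ := exists_of_lt q hk
    exact ⟨s, h⟩
  · rintro ⟨s, h⟩
    exact ⟨q s, (q s).2, h⟩

theorem mem_table_labs [Finite AP] {B : BuchiAutomaton AP S} {lab : Set AP ↪ ℕ} {q : S ≃ Fin K}
    {s s' : S} {σ : Set AP} : lab σ ∈ (table B lab q).labs (q s) (q s') ↔ s' ∈ B.step s σ := by
  simp only [table, List.mem_map, Finset.mem_toList, Set.Finite.mem_toFinset, Set.mem_ofPred_eq,
    lab.injective.eq_iff, exists_eq_right, numbering_inj]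
  constructor
  · rintro ⟨_, _, rfl, rfl, h⟩
    exact h
  · exact fun h => ⟨s, s', rfl, rfl, h⟩

theorem stateCode_lt {q : S ≃ Fin K} {o : List α} {p : α × S} (hp : p.1 ∈ o) :
    stateCode q o p < o.length * K := by
  have h1 : (o.idxOf p.1 + 1) * K ≤ o.length * K :=
    Nat.mul_le_mul_right _ (List.idxOf_lt_length_iff.2 hp)
  have h2 := (q p.2).2
  rw [add_mul, one_mul] at h1
  unfold stateCode
  omega

theorem stateCode_div {q : S ≃ Fin K} {o : List α} {p : α × S} : stateCode q o p / K = o.idxOf p.1 := by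
  have h2 := (q p.2).2
  unfold stateCode
  rw [mul_comm, Nat.mul_add_div (by omega), Nat.div_eq_of_lt h2, add_zero]

theorem stateCode_mod {q : S ≃ Fin K} {o : List α} {p : α × S} : stateCode q o p % K = q p.2 := by
  unfold stateCode
  rw [mul_comm, Nat.mul_add_mod_self_left, Nat.mod_eq_of_lt (q p.2).2]

theorem stateCode_inj {q : S ≃ Fin K} {o : List α} {p p' : α × S} (hp : p.1 ∈ o) :
    stateCode q o p = stateCode q o p' ↔ p = p' := by
  refine ⟨fun h => ?_, fun h => h ▸ rfl⟩
  have h1 := congrArg (· / K) h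
  have h2 := congrArg (· % K) h
  simp only [stateCode_div, stateCode_mod] at h1 h2
  exact Prod.ext ((List.idxOf_inj hp).1 h1) (numbering_inj.1 h2)

theorem exists_stateCode (q : S ≃ Fin K) {o : List α} (ho : o.Nodup) {a : ℕ} (ha : a < o.length * K) :
    ∃ p : α × S, p.1 ∈ o ∧ stateCode q o p = a := by
  have hK : 0 < K := Nat.pos_of_ne_zero fun h => by simp [h] at ha
  have h1 : a / K < o.length := (Nat.div_lt_iff_lt_mul hK).2 ha
  obtain ⟨s, hs⟩ := exists_of_lt q (Nat.mod_lt a hK)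
  refine ⟨(o[a / K], s), List.getElem_mem h1, ?_⟩
  unfold stateCode
  simp only [ho.idxOf_getElem, hs]
  rw [mul_comm]
  exact Nat.div_add_mod a K

/-! ### The transition system in memory -/

/-- The memory holds the labels and the transitions of `T`. -/
structure TransMatches (lab : Set AP ↪ ℕ) (T : DTS α AP) (o : List α) (m : Mem) : Prop where
  lab : ∀ x ∈ o, m LAB (o.idxOf x) = lab (T.label x)
  adj : ∀ x ∈ o, ∀ y ∈ o, o.idxOf y ∈ lst (m DEG) (m TADJ) (o.idxOf x) ↔ (x, y) ∈ T.trans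

theorem TransMatches.step_iff [Finite AP] {B : BuchiAutomaton AP S} {lab : Set AP ↪ ℕ} {q : S ≃ Fin K}
    {T : DTS α AP} {o : List α} {m : Mem} (h : TransMatches lab T o m) (hT : TransInv o.length m)
    (ho : o.Nodup) (hmem : ∀ x, x ∈ T.states → x ∈ o) {p : α × S} (hp : p.1 ∈ o) {b : ℕ} :
    Step (table B lab q) m (stateCode q o p) b ↔ ∃ p', ProductStep T B p p' ∧ b = stateCode q o p' := by
  have hd : stateCode q o p / (table B lab q).K = o.idxOf p.1 := stateCode_div
  have hm : stateCode q o p % (table B lab q).K = q p.2 := stateCode_mod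
  simp only [Step, Via, hd, hm, h.lab _ hp]
  constructor
  · rintro ⟨i, hi, s', hs', rfl, hl⟩
    obtain ⟨s', rfl⟩ := exists_of_lt q hs'
    have hy := mem_lst.2 ⟨i, hi, (rfl : m TADJ (pr (o.idxOf p.1) i) = _)⟩
    set k := m TADJ (pr (o.idxOf p.1) i)
    have hk : k < o.length := hT.adj _ _ hy
    refine ⟨(o[k], s'), ⟨(h.adj _ hp _ (List.getElem_mem hk)).1 ?_, mem_table_labs.1 hl⟩, ?_⟩
    · rwa [ho.idxOf_getElem]
    · simp only [stateCode, ho.idxOf_getElem]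
      rfl
  · rintro ⟨⟨y, s'⟩, ⟨h1, h2⟩, rfl⟩
    obtain ⟨i, hi, h3⟩ := mem_lst.1 ((h.adj _ hp _ (hmem _ (T.trans_mem _ h1).2)).2 h1)
    exact ⟨i, hi, q s', (q s').2, by rw [h3]; rfl, mem_table_labs.2 h2⟩

/-! ### The planner in memory -/

/-- The memory holds the state of the planner. -/
structure Matches [Finite AP] (B : BuchiAutomaton AP S) (lab : Set AP ↪ ℕ) (q : S ≃ Fin K)
    (st : SearchState α AP S) (m : Mem) : Prop where
  inv : PlanInv (table B lab q) st.order.length m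
  trans : TransMatches lab st.T st.order m
  inp : ∀ p : α × S, p.1 ∈ st.order → (m INP (stateCode q st.order p) ≠ 0 ↔ p ∈ st.P.states)
  arcs_iff : ∀ a b, (a, b) ∈ arcs m ↔
    ∃ f ∈ st.P.trans, a = stateCode q st.order f.1 ∧ b = stateCode q st.order f.2

theorem Matches.rch_iff [Finite AP] {B : BuchiAutomaton AP S} {lab : Set AP ↪ ℕ} {q : S ≃ Fin K}
    {st : SearchState α AP S} {m : Mem} (h : Matches B lab q st m) (hv : Valid B st) {p : α × S}
    (hp : p ∈ st.P.states) {b : ℕ} : Rch (m SRC) (m DST) (m 1 2) (stateCode q st.order p) b ↔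
      ∃ p' ∈ st.P.states, b = stateCode q st.order p' ∧
        Relation.ReflTransGen (fun a b => (a, b) ∈ st.P.trans) p p' := by
  constructor
  · intro hr
    induction hr with
    | refl => exact ⟨p, hp, rfl, .refl⟩
    | tail _ h1 ih =>
      obtain ⟨p', hp', rfl, hr'⟩ := ih
      obtain ⟨⟨f, f'⟩, hf, h3, rfl⟩ := (h.arcs_iff _ _).1 h1
      obtain ⟨-, h4, -⟩ := hv.trans _ hf
      have h5 : p' = f := (stateCode_inj (q := q) (hv.states _ hp')).1 h3
      subst h5
      exact ⟨f', h4, rfl, hr'.tail hf⟩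
  · rintro ⟨p', -, rfl, hr⟩
    induction hr with
    | refl => exact Rch.refl _
    | tail _ h1 ih => exact Relation.ReflTransGen.tail ih ((h.arcs_iff _ _).2 ⟨_, h1, rfl, rfl⟩)

theorem Matches.mut_iff [Finite AP] {B : BuchiAutomaton AP S} {lab : Set AP ↪ ℕ} {q : S ≃ Fin K}
    {st : SearchState α AP S} {m : Mem} (h : Matches B lab q st m) (hv : Valid B st) {p p' : α × S}
    (hp : p ∈ st.P.states) (hp' : p' ∈ st.P.states) :
    m COMP (stateCode q st.order p) = m COMP (stateCode q st.order p') ↔ st.P.SameSCC p p' := by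
  rw [h.inv.scc.comp _ (stateCode_lt (q := q) (hv.states _ hp)) _ (stateCode_lt (q := q) (hv.states _ hp')), Mut,
    h.rch_iff hv hp, h.rch_iff hv hp']
  refine and_congr ⟨?_, fun h1 => ⟨p', hp', rfl, h1⟩⟩ ⟨?_, fun h1 => ⟨p, hp, rfl, h1⟩⟩
  · rintro ⟨r, -, h1, h2⟩
    rw [stateCode_inj (hv.states _ hp')] at h1
    rwa [h1]
  · rintro ⟨r, -, h1, h2⟩
    rw [stateCode_inj (hv.states _ hp)] at h1
    rwa [h1]

theorem table_Acc [Finite AP] {B : BuchiAutomaton AP S} {lab : Set AP ↪ ℕ} {q : S ≃ Fin K}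
    {o : List α} {p : α × S} : (table B lab q).Acc (stateCode q o p) ↔ p.2 ∈ B.accept := by
  have hm : stateCode q o p % (table B lab q).K = q p.2 := stateCode_mod
  rw [Table.Acc, hm]
  simp only [table, decide_eq_true_eq]
  exact exists_numbering

theorem Matches.represents [Finite AP] {B : BuchiAutomaton AP S} {lab : Set AP ↪ ℕ} {q : S ≃ Fin K}
    {st : SearchState α AP S} {m : Mem} (h : Matches B lab q st m) (hv : Valid B st) :
    Represents B q st m := by
  refine ⟨fun x hx s => h.inp (x, s) hx, ?_, fun p hp p' hp' => h.mut_iff hv hp hp', ?_⟩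
  · ext ⟨a, b⟩
    simp only [Set.mem_ofPred_eq, Prod.mk.injEq]
    rw [← h.arcs_iff]
    simp only [arcs, Set.mem_ofPred_eq, eq_comm]
  · rw [h.inv.scc.found]
    constructor
    · rintro ⟨a, ha, b, hb, hab, hc, hacc⟩
      obtain ⟨p, hp, rfl⟩ := exists_stateCode q hv.nodup ha
      obtain ⟨h1, h2⟩ := (h.inv.scc.comp _ ha _ hb).1 hc
      -- Numbers that do not belong to the product automaton are isolated vertices, so a vertex that
      -- reaches a different one belongs to it.
      have hps : p ∈ st.P.states := by
        rcases Relation.ReflTransGen.cases_head h1 with h3 | ⟨c, h3, -⟩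
        · exact absurd h3 hab
        · obtain ⟨f, hf, h4, -⟩ := (h.arcs_iff _ _).1 h3
          rw [(stateCode_inj (q := q) hp).1 h4]
          exact (hv.trans _ hf).1
      obtain ⟨p', hp', rfl, -⟩ := (h.rch_iff hv hps).1 h1
      refine ⟨p, hps, table_Acc.1 hacc, Set.one_lt_encard_iff.2 ⟨p, p', ⟨hps, .refl, .refl⟩,
        ⟨hp', (h.mut_iff hv hps hp').1 hc⟩, ?_⟩⟩
      rintro rfl
      exact hab rfl
    · rintro ⟨p, hp, hacc, h1⟩
      obtain ⟨p', ⟨hp', h2⟩, h3⟩ : ∃ p' ∈ st.P.scc p, p' ≠ p := by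
        obtain ⟨a, b, ha, hb, hab⟩ := Set.one_lt_encard_iff.1 h1
        by_cases hap : a = p
        · exact ⟨b, hb, fun h => hab (hap.trans h.symm)⟩
        · exact ⟨a, ha, hap⟩
      refine ⟨_, stateCode_lt (q := q) (hv.states _ hp), _, stateCode_lt (q := q) (hv.states _ hp'), ?_,
        (h.mut_iff hv hp hp').2 h2, table_Acc.2 hacc⟩
      rw [Ne, stateCode_inj (hv.states _ hp)]
      exact h3.symm

end Simulation

section Simulation

open Classical

variable {α AP S : Type*} {K : ℕ}

/-! ### Simulation of a call -/

theorem args_frame (m : Mem) (i j a b : ℕ) : Frame [0] m (m.args i j a b) :=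
  (Frame.refl _ _).write.write.write.write

theorem args_apply (m : Mem) (i j a b : ℕ) : m.args i j a b 0 0 = i ∧ m.args i j a b 0 1 = j ∧
    m.args i j a b 0 2 = a ∧ m.args i j a b 0 3 = b := by
  simp [Mem.args, write_same]

theorem PlanInv.congr {τ : Table} {n : ℕ} {m m' : Mem} (h : PlanInv τ n m) (f : Frame [0] m m') :
    PlanInv τ n m' ∧ planPotential τ n m' = planPotential τ n m := by
  have e : ∀ a ≠ 0, m' a = m a := fun a ha => f a (by simpa using ha)
  obtain ⟨h1, h2⟩ := h.scc.congr_extend f (by rw [e 1 (by decide)])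
    fun _ _ => ⟨by rw [e SRC (by decide)], by rw [e DST (by decide)]⟩
  have e1 := e 1 (by decide)
  obtain ⟨h3, h4⟩ := h.table.congr (by rw [e1]) (e SRC (by decide)) (e DST (by decide)) (e PEDGE (by decide))
  refine ⟨⟨by rw [e1]; exact h1, by rw [e1, e DONE (by decide)]; exact h.done,
    by rw [e1, e STAMP (by decide)]; exact h.stamp, h.trans.congr (e _ (by decide)) (e _ (by decide))
      (e _ (by decide)) (e _ (by decide)), h3, ⟨?_, ?_⟩, by rw [e INP (by decide)]; exact h.inpLt⟩, ?_⟩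
  · rw [e ECNT (by decide), e DEG (by decide)]; exact h.expand.le
  · rw [e ECNT (by decide), e INP (by decide), h4, Via.congr (e _ (by decide)) (e _ (by decide))
      (e _ (by decide))]
    exact h.expand.expanded
  · simp only [planPotential, e1, h2, expandPotential, e ECNT (by decide), e INP (by decide)]

variable [Finite AP] {B : BuchiAutomaton AP S} {lab : Set AP ↪ ℕ} {q : S ≃ Fin K}
  {st : SearchState α AP S} {m : Mem}

theorem Matches.congr {m' : Mem} (h : Matches B lab q st m) (f : Frame [0] m m') :
    Matches B lab q st m' := by
  have e : ∀ a ≠ 0, m' a = m a := fun a ha => f a (by simpa using ha)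
  have h4 : arcs m' = arcs m := arcs_congr f (by rw [e 1 (by decide)])
  refine ⟨(h.inv.congr f).1, ⟨?_, ?_⟩, ?_, ?_⟩
  · rw [e LAB (by decide)]; exact h.trans.lab
  · rw [e DEG (by decide), e TADJ (by decide)]; exact h.trans.adj
  · rw [e INP (by decide)]; exact h.inp
  · rw [h4]; exact h.arcs_iff

/-- The arguments of the call for the transition from `x` to `x'`. -/
structure HasArgs (lab : Set AP ↪ ℕ) (st : SearchState α AP S) (x x' : α) (m : Mem) : Prop where
  src : m 0 0 = st.order.idxOf x
  dst : m 0 1 = st.order.idxOf x'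
  labSrc : m 0 2 = lab (st.T.label x)
  labDst : m 0 3 = lab (st.T.label x')

theorem Matches.enters_iff {x x' : α} (h : Matches B lab q st m) (ha : HasArgs lab st x x' m)
    (hx : x ∈ st.order) {s s' : S} : Enters (table B lab q) m (q s, q s') ↔
      B.NonBlocking s' ∧ (x, s) ∈ st.P.states ∧ s' ∈ B.step s (st.T.label x) := by
  have h1 : (table B lab q).nb (q s') = true ↔ B.NonBlocking s' := by
    simp only [table, decide_eq_true_eq]
    exact exists_numbering
  have h2 := h.inp (x, s) hx
  simp only [Enters, h1, ha.src, ha.labSrc, mem_table_labs]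
  rw [← h2]
  rfl

theorem Matches.entered_iff {x x' : α} (h : Matches B lab q st m) (ha : HasArgs lab st x x' m)
    (hx : x ∈ st.order) {a : ℕ} : Entered (table B lab q) m a ↔
      ∃ p ∈ newStates st.T.label B st.P x x', a = stateCode q st.order p := by
  have h1 : Entered (table B lab q) m a ↔ ∃ s', (∃ s, Enters (table B lab q) m (q s, q s')) ∧
      a = m 0 1 * K + q s' := by
    unfold Entered
    refine (exists_lt_numbering (q := q)).trans (exists_congr fun s' => and_congr_left' ?_)
    exact exists_lt_numbering (q := q)
  rw [h1]
  simp only [h.enters_iff ha hx, ha.dst]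
  constructor
  · rintro ⟨s', ⟨s, h2, h3, h4⟩, rfl⟩
    exact ⟨(x', s'), ⟨rfl, ⟨s, h3, h4⟩, h2⟩, rfl⟩
  · rintro ⟨⟨y, s'⟩, ⟨rfl, ⟨s, h3, h4⟩, h2⟩, rfl⟩
    exact ⟨s', ⟨s, h2, h3, h4⟩, rfl⟩

theorem Matches.rejects {m' : Mem} (h : Matches B lab q st m)
    (hr : Rejects (table B lab q) st.order.length m m') : Matches B lab q st m' := by
  refine ⟨hr.inv, ⟨?_, ?_⟩, ?_, ?_⟩
  · rw [hr.lab]; exact h.trans.lab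
  · simp only [hr.lst_eq]; exact h.trans.adj
  · rw [hr.inp]; exact h.inp
  · rw [hr.arcs_eq]; exact h.arcs_iff

/-- The order of creation after a call. -/
theorem idxOf_extend {o : List α} {x' y : α} (hy : y ∈ if x' ∈ o then o else o ++ [x']) :
    (if x' ∈ o then o else o ++ [x']).idxOf y = o.idxOf y := by
  split_ifs at hy ⊢ with h1
  · rfl
  · by_cases h2 : y ∈ o
    · exact List.idxOf_append_of_mem h2
    · have h3 : y = x' := by simpa [h2] using hy
      rw [List.idxOf_append_of_notMem h2, h3, List.idxOf_eq_length h1]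
      simp

theorem length_extend {o : List α} {x' : α} :
    (if x' ∈ o then o else o ++ [x']).length = max o.length (o.idxOf x' + 1) := by
  split_ifs with h1
  · have := List.idxOf_lt_length_iff.2 h1
    omega
  · rw [List.idxOf_eq_length h1]
    simp

theorem Matches.trans_accepts {x x' : α} {m' : Mem} {o' : List α} (h : Matches B lab q st m)
    (hv : Valid B st) (ha : HasArgs lab st x x' m) (hx : x ∈ st.order)
    (hr : Accepts (table B lab q) st.order.length m m')
    (ho' : o' = if x' ∈ st.order then st.order else st.order ++ [x']) :
    TransMatches lab (st.T.addTransition x x') o' m' := by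
  have hidx : ∀ y ∈ o', o'.idxOf y = st.order.idxOf y := fun y hy => by
    subst ho'
    exact idxOf_extend hy
  have hcase : ∀ y ∈ o', y ∈ st.order ∨ y = x' ∧ st.order.idxOf x' = st.order.length := by
    intro y hy
    rw [ho'] at hy
    split_ifs at hy with h1
    · exact Or.inl hy
    · simp only [List.mem_append, List.mem_singleton] at hy
      exact hy.imp_right fun h2 => ⟨h2, List.idxOf_eq_length h1⟩
  have hmem : ∀ y ∈ st.order, y ∈ o' := by
    intro y hy
    rw [ho']
    split_ifs <;> simp [hy]
  have hx'mem : x' ∈ o' := by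
    rw [ho']
    split_ifs with h1 <;> simp [h1]
  refine ⟨fun y hy => ?_, fun y hy z hz => ?_⟩
  · rw [hidx y hy]
    by_cases h1 : y ∈ st.order
    · rw [hr.lab _ (List.idxOf_lt_length_iff.2 h1)]
      exact h.trans.lab y h1
    · obtain ⟨rfl, h2⟩ := (hcase y hy).resolve_left h1
      rw [h2, hr.lab_new (by rw [ha.dst, h2]), ha.labDst]
      rfl
  · rw [hr.mem_lst, ha.src, ha.dst, ← hidx x (hmem x hx), ← hidx x' hx'mem, List.idxOf_inj hy,
      List.idxOf_inj hz]
    simp only [DTS.addTransition, Finset.mem_insert, Prod.mk.injEq]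
    rw [or_comm]
    refine or_congr_right ?_
    rw [hidx y hy, hidx z hz]
    by_cases h1 : y ∈ st.order
    · by_cases h2 : z ∈ st.order
      · exact h.trans.adj y h1 z h2
      · rw [List.idxOf_eq_length h2]
        constructor
        · intro h3
          exact absurd (h.inv.trans.adj _ _ h3) (lt_irrefl _)
        · intro h3
          exact absurd ((hv.mem _).2 (st.T.trans_mem _ h3).2) h2
    · rw [List.idxOf_eq_length h1]
      constructor
      · intro h3
        rw [mem_lst, h.inv.trans.deg _ le_rfl] at h3
        obtain ⟨i, hi, -⟩ := h3
        omega
      · intro h3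
        exact absurd ((hv.mem _).2 (st.T.trans_mem _ h3).1) h1

/-- States are numbered in the order of their creation, so old numbers do not change. Hence the sets
in `Accepts`, described by reachability between numbers, translate term by term into those of
`traverse_eq`. -/
theorem Matches.accepts {x x' : α} {m' : Mem} {st' : SearchState α AP S} (h : Matches B lab q st m)
    (hv : Valid B st) (ha : HasArgs lab st x x' m) (hx : x ∈ st.order)
    (hr : Accepts (table B lab q) st.order.length m m') (hu : UpdatePA B st x x' true st') :
    Matches B lab q st' m' := by
  have hv' : Valid B st' := hv.update ((hv.mem _).1 hx) hu
  cases hu with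
  | accepted P' hne hP =>
  set o' := if x' ∈ st.order then st.order else st.order ++ [x'] with ho'
  set T' := st.T.addTransition x x' with hT'
  set N := newStates st.T.label B st.P x x' with hN
  have hidx : ∀ y ∈ o', o'.idxOf y = st.order.idxOf y := fun y hy => idxOf_extend hy
  have hcode : ∀ p : α × S, p.1 ∈ o' → stateCode q o' p = stateCode q st.order p := fun p hp => by
    unfold stateCode
    rw [hidx _ hp]
  have hmono : ∀ y ∈ st.order, y ∈ o' := by
    intro y hy
    rw [ho']
    split_ifs <;> simp [hy]
  have hx'mem : x' ∈ o' := by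
    rw [ho']
    split_ifs with h1 <;> simp [h1]
  have hmem' : ∀ y, y ∈ T'.states → y ∈ o' := fun y hy => (hv'.mem y).2 hy
  have hNmem : ∀ p ∈ N, p.1 ∈ o' := fun p hp => by rw [hp.1]; exact hx'mem
  have hinv : PlanInv (table B lab q) o'.length m' := by
    rw [ho', length_extend, ← ha.dst]
    exact hr.inv
  have htm : TransMatches lab T' o' m' := h.trans_accepts hv ha hx hr ho'
  have hstep : ∀ p : α × S, p.1 ∈ o' → ∀ b, Step (table B lab q) m' (stateCode q o' p) b ↔
      ∃ p', ProductStep T' B p p' ∧ b = stateCode q o' p' :=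
    fun p hp b => htm.step_iff hinv.trans hv'.nodup hmem' hp
  have hstepmem : ∀ p p' : α × S, ProductStep T' B p p' → p'.1 ∈ o' :=
    fun p p' hs => hmem' _ (T'.trans_mem _ hs.1).2
  -- If the target is new, the numbers over it lie beyond the range in which `INP` can be set, and
  -- no product state lies over it yet.
  have hinp : ∀ p : α × S, p.1 ∈ o' → (m INP (stateCode q o' p) ≠ 0 ↔ p ∈ st.P.states) := by
    intro p hp
    rw [hcode p hp]
    by_cases h1 : p.1 ∈ st.order
    · exact h.inp p h1
    · constructor
      · intro h2
        have h3 := h.inv.inpLt _ h2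
        have h4 : st.order.length * K ≤ stateCode q st.order p := by
          unfold stateCode
          rw [List.idxOf_eq_length h1]
          exact Nat.le_add_right _ _
        exact absurd h3 (not_lt.2 h4)
      · intro h2
        exact absurd (hv.states p h2) h1
  have hent : ∀ a, Entered (table B lab q) m a ↔ ∃ p ∈ N, a = stateCode q o' p := by
    intro a
    rw [h.entered_iff ha hx]
    refine exists_congr fun p => and_congr_right fun hp => ?_
    rw [hcode p (hNmem p hp)]
  have hentc : ∀ p : α × S, p.1 ∈ o' → (Entered (table B lab q) m (stateCode q o' p) ↔ p ∈ N) := by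
    intro p hp
    rw [hent]
    constructor
    · rintro ⟨p', h1, h2⟩
      rwa [(stateCode_inj (q := q) hp).1 h2]
    · exact fun h1 => ⟨p, h1, rfl⟩
  set P₀ : ProductGraph α S := ⟨st.P.states ∪ N, st.P.trans ∪ newTrans st.T.label B st.P x x'⟩ with hP₀
  set X := Expanded T' B P₀ N with hX
  have hXmem : ∀ p ∈ X, p.1 ∈ o' := by
    rintro p ⟨s, hs, hp⟩
    cases hp with
    | refl => exact hNmem _ hs
    | tail _ h1 => exact hstepmem _ _ h1.1
  have hvis : ∀ a, CallVisited (table B lab q) m m' a ↔ ∃ p ∈ X, a = stateCode q o' p := by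
    intro a
    constructor
    · rintro ⟨b, hb, hp⟩
      induction hp with
      | refl =>
        obtain ⟨p, hp, rfl⟩ := (hent b).1 hb
        exact ⟨p, ⟨p, hp, .refl⟩, rfl⟩
      | tail _ h1 ih =>
        obtain ⟨p, hp, rfl⟩ := ih
        obtain ⟨p', h2, rfl⟩ := (hstep p (hXmem p hp) _).1 h1.1
        obtain ⟨s, hs, hp⟩ := hp
        refine ⟨p', ⟨s, hs, hp.tail ⟨h2, ?_⟩⟩, rfl⟩
        rintro (h3 | h3)
        · exact (hinp p' (hstepmem _ _ h2)).2 h3 h1.2.1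
        · exact h1.2.2 ((hentc p' (hstepmem _ _ h2)).2 h3)
    · rintro ⟨p, ⟨s, hs, hp⟩, rfl⟩
      refine ⟨_, (hentc s (hNmem s hs)).2 hs, ?_⟩
      induction hp with
      | refl => exact .refl
      | @tail b c h0 h1 ih =>
        have hb : b.1 ∈ o' := hXmem b ⟨s, hs, h0⟩
        have hc : c.1 ∈ o' := hstepmem _ _ h1.1
        refine ih.tail ⟨(hstep b hb _).2 ⟨c, h1.1, rfl⟩, ?_, ?_⟩
        · by_contra h2
          exact h1.2 (Or.inl ((hinp c hc).1 h2))
        · exact fun h2 => h1.2 (Or.inr ((hentc c hc).1 h2))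
  have hvstep : ∀ a b, CallVisited (table B lab q) m m' a ∧ Step (table B lab q) m' a b ↔
      ∃ p ∈ X, ∃ p', ProductStep T' B p p' ∧ a = stateCode q o' p ∧ b = stateCode q o' p' := by
    intro a b
    rw [hvis]
    constructor
    · rintro ⟨⟨p, hp, rfl⟩, h1⟩
      obtain ⟨p', h2, rfl⟩ := (hstep p (hXmem p hp) _).1 h1
      exact ⟨p, hp, p', h2, rfl, rfl⟩
    · rintro ⟨p, hp, p', h2, rfl, rfl⟩
      exact ⟨⟨p, hp, rfl⟩, (hstep p (hXmem p hp) _).2 ⟨p', h2, rfl⟩⟩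
  obtain ⟨hP1, hP2⟩ := traverse_eq hP
  refine ⟨hinv, htm, fun p hp => ?_, fun a b => ?_⟩
  · rw [hr.inp_iff, hinp p hp, hentc p hp, hP1, ← or_assoc]
    refine or_congr Iff.rfl ?_
    constructor
    · rintro ⟨a, h1⟩
      obtain ⟨p₁, h2, p₂, h3, -, h4⟩ := (hvstep _ _).1 h1
      rw [stateCode_inj hp] at h4
      subst h4
      exact ⟨p₁, h2, h3⟩
    · rintro ⟨p₁, h2, h3⟩
      exact ⟨_, (hvstep _ _).2 ⟨p₁, h2, p, h3, rfl, rfl⟩⟩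
  · rw [hr.arcs_iff, hvstep, hP2, h.arcs_iff, ← or_assoc]
    have hnew : (∃ c : ℕ × ℕ, c.1 < (table B lab q).K ∧ c.2 < (table B lab q).K ∧
        Enters (table B lab q) m c ∧ a = m 0 0 * (table B lab q).K + c.1 ∧
        b = m 0 1 * (table B lab q).K + c.2) ↔ ∃ f ∈ newTrans st.T.label B st.P x x',
          a = stateCode q o' f.1 ∧ b = stateCode q o' f.2 := by
      constructor
      · rintro ⟨⟨k, k'⟩, hk, hk', h1, rfl, rfl⟩
        obtain ⟨s, rfl⟩ := exists_of_lt q hk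
        obtain ⟨s', rfl⟩ := exists_of_lt q hk'
        obtain ⟨h2, h3, h4⟩ := (h.enters_iff ha hx).1 h1
        refine ⟨((x, s), (x', s')), ⟨rfl, h3, h4, rfl, ⟨s, h3, h4⟩, h2⟩, ?_, ?_⟩
        · rw [hcode _ (hmono x hx), ha.src]; rfl
        · rw [hcode _ hx'mem, ha.dst]; rfl
      · rintro ⟨⟨⟨y, s⟩, ⟨y', s'⟩⟩, ⟨rfl, h3, h4, rfl, -, h2⟩, rfl, rfl⟩
        refine ⟨(q s, q s'), (q s).2, (q s').2, (h.enters_iff ha hx).2 ⟨h2, h3, h4⟩, ?_, ?_⟩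
        · rw [hcode _ (hmono _ hx), ha.src]; rfl
        · rw [hcode _ hx'mem, ha.dst]; rfl
    rw [hnew]
    have hold : (∃ f ∈ st.P.trans, a = stateCode q st.order f.1 ∧ b = stateCode q st.order f.2) ↔
        ∃ f ∈ st.P.trans, a = stateCode q o' f.1 ∧ b = stateCode q o' f.2 := by
      refine exists_congr fun f => and_congr_right fun hf => ?_
      obtain ⟨h1, h2, -⟩ := hv.trans f hf
      rw [hcode _ (hmono _ (hv.states _ h1)), hcode _ (hmono _ (hv.states _ h2))]
    rw [hold]
    constructor
    · rintro ((⟨f, h1, h2⟩ | ⟨f, h1, h2⟩) | ⟨p, h1, p', h2, h3⟩)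
      exacts [⟨f, Or.inl (Or.inl h1), h2⟩, ⟨f, Or.inl (Or.inr h1), h2⟩, ⟨(p, p'), Or.inr ⟨h1, h2⟩, h3⟩]
    · rintro ⟨f, (h1 | h1) | h1, h2⟩
      exacts [Or.inl (Or.inl ⟨f, h1, h2⟩), Or.inl (Or.inr ⟨f, h1, h2⟩),
        Or.inr ⟨f.1, h1.1, f.2, h1.2, h2⟩]

end Simulation

/-! ### Summation over a whole run. -/

section Simulation

open Classical

variable {α AP S : Type*} {K : ℕ} {B : BuchiAutomaton AP S}

theorem card_trans_update {st st' : SearchState α AP S} {x x' : α} {b : Bool}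
    (hu : UpdatePA B st x x' b st') : st'.T.trans.card =
      st.T.trans.card + if CallRecord.AddsTransition ⟨st, x, x', b, st'⟩ then 1 else 0 := by
  cases hu with
  | rejected => simp [CallRecord.AddsTransition]
  | accepted P' =>
    simp only [CallRecord.AddsTransition, true_and, DTS.addTransition]
    split_ifs with h1
    · rw [Finset.insert_eq_of_mem h1, add_zero]
    · exact Finset.card_insert_of_notMem h1

theorem order_length_update {st st' : SearchState α AP S} {x x' : α} {b : Bool}
    (hu : UpdatePA B st x x' b st') : st'.order.length ≤ st.order.length + 1 := by
  cases hu with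
  | rejected => omega
  | accepted =>
    simp only
    split_ifs <;> simp

variable [Finite AP] {lab : Set AP ↪ ℕ} {q : S ≃ Fin K}

/-- The bound for indices in a call with at most `n` vertices. -/
def indexBound (K n : ℕ) : ℕ := (n + 1) * K * ((n + 1) * K) + 3 * ((n + 1) * K) + 3 * n + 5

theorem indexBound_mono {K n n' : ℕ} (h : n ≤ n') : indexBound K n ≤ indexBound K n' := by
  unfold indexBound
  gcongr

theorem Matches.call {W : ℕ} {st st' : SearchState α AP S} {m : Mem} {x x' : α} {b : Bool}
    (hW : Fits W (indexBound K st.order.length)) (hlab : ∀ σ, lab σ ≤ W) (h : Matches B lab q st m)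
    (hv : Valid B st) (hx : x ∈ st.T.states) (hu : UpdatePA B st x x' b st') :
    Runs W (callProgram (table B lab q)) (m.args (st.order.idxOf x) (st.order.idxOf x')
      (lab (st.T.label x)) (lab (st.T.label x'))) fun t m' =>
      Matches B lab q st' m' ∧ (m' 1 0 ≠ 0 ↔ b = true) ∧
      planPotential (table B lab q) st.order.length m ≤
        planPotential (table B lab q) st'.order.length m' ∧
      t + planPotential (table B lab q) st.order.length m ≤
        planPotential (table B lab q) st'.order.length m' + callCost (table B lab q) := by
  have f := args_frame m (st.order.idxOf x) (st.order.idxOf x') (lab (st.T.label x)) (lab (st.T.label x'))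
  obtain ⟨a0, a1, a2, a3⟩ := args_apply m (st.order.idxOf x) (st.order.idxOf x') (lab (st.T.label x))
    (lab (st.T.label x'))
  set mL := m.args (st.order.idxOf x) (st.order.idxOf x') (lab (st.T.label x)) (lab (st.T.label x'))
  have hxo : x ∈ st.order := (hv.mem x).2 hx
  have hL : Matches B lab q st mL := h.congr f
  have ha : HasArgs lab st x x' mL := ⟨a0, a1, a2, a3⟩
  have hpot := (h.inv.congr f).2
  have hne : (newStates st.T.label B st.P x x').Nonempty ↔ ∃ a, Entered (table B lab q) mL a := by
    simp only [hL.entered_iff ha hxo]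
    exact ⟨fun ⟨p, hp⟩ => ⟨_, p, hp, rfl⟩, fun ⟨_, p, hp, _⟩ => ⟨p, hp⟩⟩
  refine (callProgram_runs hW hL.inv (by rw [a0]; exact List.idxOf_lt_length_iff.2 hxo)
    (by rw [a1]; exact List.idxOf_le_length) (by rw [a3]; exact hlab _)).mono ?_
  rintro t m' (⟨hr, ht⟩ | ⟨hr, hmono, ht⟩)
  · cases hu with
    | rejected _ =>
      have hp := hr.pot
      exact ⟨hL.rejects hr, by simp [hr.flag], by omega, by omega⟩
    | accepted P' hn _ => exact absurd (hne.1 hn) hr.none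
  · cases hu with
    | rejected hn => exact absurd (hne.2 hr.some) (by simp [hn])
    | accepted P' hn hP =>
      have hlen := length_extend (o := st.order) (x' := x')
      rw [a1, hpot, ← hlen] at hmono ht
      exact ⟨hL.accepts hv ha hxo hr (.accepted _ _ _ P' hn hP), by simp [hr.flag], hmono, ht⟩

/-- The amortized bounds of the calls telescope. The word size is fixed in advance for `L` vertices,
and it suffices throughout because a call adds at most one vertex. -/
theorem exists_simulation {W L : ℕ} (hW : Fits W (indexBound K L)) (hlab : ∀ σ, lab σ ≤ W)
    {tr : List (CallRecord α AP S)} {st st' : SearchState α AP S} {m : Mem} (h : Matches B lab q st m)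
    (hv : Valid B st) (hc : CallChain B st tr st') (hL : st.order.length + tr.length ≤ L) :
    ∃ (mem : ℕ → Mem) (time : ℕ → ℕ), mem 0 = m ∧ Matches B lab q st' (mem tr.length) ∧ Valid B st' ∧
      (∀ i : Fin tr.length,
        Exec W (callProgram (table B lab q)) ((tr.get i).load lab (mem i)) (time i) (mem (i + 1)) ∧
        Represents B q (tr.get i).post (mem (i + 1)) ∧
        (mem (i + 1) 1 0 ≠ 0 ↔ (tr.get i).added = true)) ∧
      (∑ i : Fin tr.length, (if (tr.get i).AddsTransition then time i else 0)) +
          planPotential (table B lab q) st.order.length m ≤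
        planPotential (table B lab q) st'.order.length (mem tr.length) +
          callCost (table B lab q) * ∑ i : Fin tr.length, (if (tr.get i).AddsTransition then 1 else 0) ∧
      (∑ i : Fin tr.length, time i) + planPotential (table B lab q) st.order.length m ≤
        planPotential (table B lab q) st'.order.length (mem tr.length) +
          callCost (table B lab q) * tr.length ∧
      st'.T.trans.card = st.T.trans.card +
        ∑ i : Fin tr.length, (if (tr.get i).AddsTransition then 1 else 0) := by
  induction tr generalizing st m with
  | nil =>
    cases hc
    exact ⟨fun _ => m, fun _ => 0, rfl, h, hv, fun i => i.elim0, by simp, by simp, by simp⟩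
  | cons c tr ih =>
    obtain ⟨rfl, hx, hu, hc⟩ := hc
    rw [List.length_cons] at hL
    obtain ⟨t, m₁, hex, h1, hflag, hmono, ht⟩ :=
      h.call (hW.mono (indexBound_mono (by omega))) hlab hv hx hu
    have hv1 := hv.update hx hu
    have hlen := order_length_update hu
    obtain ⟨mem, time, rfl, h2, hv2, hsteps, hadd, hall, hcard⟩ := ih h1 hv1 hc (by omega)
    refine ⟨fun i => Nat.casesOn i m mem, fun i => Nat.casesOn i t time, rfl, h2, hv2, ?_, ?_, ?_, ?_⟩
    · intro i
      refine Fin.cases ?_ (fun i => ?_) i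
      · exact ⟨hex, h1.represents hv1, hflag⟩
      · exact hsteps i
    · have e1 := Fin.sum_univ_succ fun i : Fin (tr.length + 1) =>
        if ((c :: tr).get i).AddsTransition then (Nat.casesOn (i : ℕ) t time : ℕ) else 0
      have e2 := Fin.sum_univ_succ fun i : Fin (tr.length + 1) =>
        if ((c :: tr).get i).AddsTransition then 1 else 0
      change (∑ i : Fin (tr.length + 1), if ((c :: tr).get i).AddsTransition then
        (Nat.casesOn (i : ℕ) t time : ℕ) else 0) + _ ≤ _ + _ * ∑ i : Fin (tr.length + 1),
          if ((c :: tr).get i).AddsTransition then 1 else 0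
      rw [e1, e2, mul_add]
      change ((if c.AddsTransition then t else 0) + ∑ i : Fin tr.length,
        if (tr.get i).AddsTransition then time i else 0) + _ ≤ planPotential _ _ (mem tr.length) +
        (_ * (if c.AddsTransition then 1 else 0) + _ * ∑ i : Fin tr.length, if (tr.get i).AddsTransition then 1 else 0)
      -- A call that adds no transition enters this sum with time 0, and then it is enough that the
      -- potential does not fall (`hmono`).
      split_ifs <;> omega
    · have e1 := Fin.sum_univ_succ fun i : Fin (tr.length + 1) => (Nat.casesOn (i : ℕ) t time : ℕ)
      change (∑ i : Fin (tr.length + 1), (Nat.casesOn (i : ℕ) t time : ℕ)) + _ ≤ _ + _ * (tr.length + 1)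
      rw [e1, mul_add, mul_one]
      change (t + ∑ i : Fin tr.length, time i) + _ ≤ planPotential _ _ (mem tr.length) + _
      omega
    · have e2 := Fin.sum_univ_succ fun i : Fin (tr.length + 1) =>
        if ((c :: tr).get i).AddsTransition then 1 else 0
      change _ = _ + ∑ i : Fin (tr.length + 1), if ((c :: tr).get i).AddsTransition then 1 else 0
      rw [e2, hcard, card_trans_update hu, add_assoc]
      rfl

/-! ### The bounds -/

/-- A product arc is determined by two automaton states and the transition below it. This count,
linear in the number of transitions, is the one that enters the running time. -/
theorem card_trans_le {st : SearchState α AP S} {m : Mem} (h : Matches B lab q st m) (hv : Valid B st) :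
    m 1 2 ≤ K * K * st.T.trans.card := by
  have h1 : (Finset.range (m 1 2)).card ≤
      ((Finset.range K ×ˢ Finset.range K) ×ˢ st.T.trans).card := by
    refine Finset.card_le_card_of_injOn (fun e => ((m SRC e % K, m DST e % K),
      (st.order.getD (m SRC e / K) st.T.start, st.order.getD (m DST e / K) st.T.start))) ?_ ?_
    · intro e he
      obtain ⟨⟨f, f'⟩, hf, h2, h3⟩ := (h.arcs_iff _ _).1 ⟨e, by simpa using he, rfl, rfl⟩
      obtain ⟨h4, h5, h6⟩ := hv.trans _ hf
      have h7 := hv.states _ h4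
      have h8 := hv.states _ h5
      simp only [h2, h3, stateCode_mod, stateCode_div, Finset.coe_product, Set.mem_prod,
        Finset.mem_coe, Finset.mem_range]
      refine ⟨⟨(q f.2).2, (q f'.2).2⟩, ?_⟩
      rw [List.getD_eq_getElem _ _ (List.idxOf_lt_length_iff.2 h7),
        List.getD_eq_getElem _ _ (List.idxOf_lt_length_iff.2 h8), List.getElem_idxOf, List.getElem_idxOf]
      exact h6.1
    · intro e he e' he' hee
      obtain ⟨⟨f, f'⟩, hf, h2, h3⟩ := (h.arcs_iff _ _).1 ⟨e, by simpa using he, rfl, rfl⟩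
      obtain ⟨⟨g, g'⟩, hg, h2', h3'⟩ := (h.arcs_iff _ _).1 ⟨e', by simpa using he', rfl, rfl⟩
      obtain ⟨h4, h5, h6⟩ := hv.trans _ hf
      obtain ⟨h4', h5', h6'⟩ := hv.trans _ hg
      simp only [h2, h3, h2', h3', stateCode_mod, stateCode_div, Prod.mk.injEq, numbering_inj] at hee
      rw [List.getD_eq_getElem _ _ (List.idxOf_lt_length_iff.2 (hv.states _ h4)),
        List.getD_eq_getElem _ _ (List.idxOf_lt_length_iff.2 (hv.states _ h5)),
        List.getD_eq_getElem _ _ (List.idxOf_lt_length_iff.2 (hv.states _ h4')),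
        List.getD_eq_getElem _ _ (List.idxOf_lt_length_iff.2 (hv.states _ h5')), List.getElem_idxOf,
        List.getElem_idxOf, List.getElem_idxOf, List.getElem_idxOf] at hee
      have e1 : f = g := Prod.ext hee.2.1 hee.1.1
      have e2 : f' = g' := Prod.ext hee.2.2 hee.1.2
      subst e1 e2
      exact h.inv.table.inj e (by simpa using he) e' (by simpa using he') (h2.trans h2'.symm)
        (h3.trans h3'.symm)
  simpa using h1

theorem sum_deg_le {st : SearchState α AP S} {m : Mem} (h : Matches B lab q st m) (hv : Valid B st) :
    ∑ x ∈ Finset.range st.order.length, m DEG x ≤ st.T.trans.card := by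
  have h1 : ∑ x ∈ Finset.range st.order.length, m DEG x =
      ((Finset.range st.order.length).sigma fun x => (lst (m DEG) (m TADJ) x).toFinset).card := by
    rw [Finset.card_sigma]
    refine Finset.sum_congr rfl fun x _ => ?_
    rw [List.toFinset_card_of_nodup (h.inv.trans.nodup x), length_lst]
  rw [h1]
  refine Finset.card_le_card_of_injOn (fun e => (st.order.getD e.1 st.T.start, st.order.getD e.2 st.T.start))
    ?_ ?_
  · rintro ⟨x, y⟩ he
    simp only [Finset.coe_sigma, Set.mem_sigma_iff, Finset.mem_coe, Finset.mem_range,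
      List.mem_toFinset] at he ⊢
    have hy := h.inv.trans.adj _ _ he.2
    rw [List.getD_eq_getElem _ _ he.1, List.getD_eq_getElem _ _ hy]
    rw [← h.trans.adj _ (List.getElem_mem _) _ (List.getElem_mem _), hv.nodup.idxOf_getElem,
      hv.nodup.idxOf_getElem]
    exact he.2
  · rintro ⟨x, y⟩ he ⟨x', y'⟩ he' hee
    simp only [Finset.coe_sigma, Set.mem_sigma_iff, Finset.mem_coe, Finset.mem_range,
      List.mem_toFinset] at he he'
    have hy := h.inv.trans.adj _ _ he.2
    have hy' := h.inv.trans.adj _ _ he'.2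
    simp only [Prod.mk.injEq] at hee
    rw [List.getD_eq_getElem _ _ he.1, List.getD_eq_getElem _ _ hy, List.getD_eq_getElem _ _ he'.1,
      List.getD_eq_getElem _ _ hy', hv.nodup.getElem_inj_iff, hv.nodup.getElem_inj_iff] at hee
    obtain ⟨rfl, rfl⟩ := hee
    rfl

theorem potential_bound {st : SearchState α AP S} {m : Mem} (h : Matches B lab q st m) (hv : Valid B st)
    {N : ℕ} (hN : st.T.trans.card ≤ N) (hN1 : 1 ≤ N) :
    planPotential (table B lab q) st.order.length m ≤ potentialFactor (table B lab q) * (N * Nat.sqrt N) := by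
  refine h.inv.potential_le ((card_trans_le h hv).trans (Nat.mul_le_mul_left _ hN)) ?_
    ((sum_deg_le h hv).trans hN) (Nat.lt_succ_sqrt N) (Nat.sqrt_pos.2 hN1)
  have := hv.length
  omega

end Simulation

/-! ### The start of the planner and the numerical estimates. -/

section Start

open Classical

variable {α AP S : Type*} {K : ℕ} {B : BuchiAutomaton AP S}

/-- The planner with one vertex. -/
def initialState (B : BuchiAutomaton AP S) (x₀ : α) (l : α → Set AP) : SearchState α AP S :=
  ⟨DTS.single x₀ l, [x₀], productAutomaton (DTS.single x₀ l) B⟩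

theorem mem_initialState_states {x₀ : α} {l : α → Set AP} {p : α × S} :
    p ∈ (initialState B x₀ l).P.states ↔ p.1 = x₀ ∧ p.2 ∈ B.start := by
  constructor
  · rintro ⟨s, hs, hp⟩
    induction hp with
    | refl => exact ⟨rfl, hs⟩
    | tail _ h _ => exact absurd h.1 (by simp [DTS.single])
  · obtain ⟨y, s⟩ := p
    rintro ⟨rfl, hs⟩
    exact ⟨s, hs, .refl⟩

theorem initialState_trans {x₀ : α} {l : α → Set AP} : (initialState B x₀ l).P.trans = ∅ := by
  ext e
  simp [initialState, productAutomaton, ProductStep, DTS.single]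

theorem valid_initialState {x₀ : α} {l : α → Set AP} : Valid B (initialState B x₀ l) := by
  refine ⟨by simp [initialState], by simp [initialState, DTS.single], by simp [initialState], ?_, ?_⟩
  · intro p hp
    rw [mem_initialState_states] at hp
    simp [initialState, hp.1]
  · rw [initialState_trans]
    simp

variable [Finite AP] {lab : Set AP ↪ ℕ} {q : S ≃ Fin K}

theorem setupProgram_runs {W : ℕ} {x₀ : α} {l : α → Set AP} (hW : Fits W (K + 1)) (hlab : lab (l x₀) ≤ W) :
    Runs W (setupProgram (table B lab q)) (Mem.args (fun _ _ => 0) 0 0 (lab (l x₀)) 0) fun t m =>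
      t ≤ maxCost (setupProgram (table B lab q)) ∧ Matches B lab q (initialState B x₀ l) m := by
  obtain ⟨a0, a1, a2, a3⟩ := args_apply (fun _ _ => 0) 0 0 (lab (l x₀)) 0
  refine (wp_setupProgram hW (fun a ha i => ?_) (by rw [a2]; exact hlab) ?_).runs
  · rw [args_frame _ _ _ _ _ a (by simpa using ha)]
  · intro m hinv harcs hinp hl hlst
    have hcode : ∀ p : α × S, p.1 ∈ (initialState B x₀ l).order →
        stateCode q (initialState B x₀ l).order p = q p.2 := by
      intro p hp
      simp only [initialState, List.mem_singleton] at hp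
      simp [stateCode, initialState, hp]
    refine ⟨hinv, ⟨?_, ?_⟩, ?_, ?_⟩
    · intro x hx
      simp only [initialState, List.mem_singleton] at hx
      subst hx
      simpa [initialState, DTS.single, a2] using hl
    · intro x _ y _
      simp [hlst, initialState, DTS.single]
    · intro p hp
      rw [hcode p hp, hinp, mem_initialState_states]
      simp only [initialState, List.mem_singleton] at hp
      have h1 : (table B lab q).ini (q p.2) = true ↔ p.2 ∈ B.start := by
        simp only [table, decide_eq_true_eq]
        exact exists_numbering
      rw [h1]
      exact and_congr_left' ⟨fun _ => hp, fun _ => (q p.2).2⟩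
    · rw [harcs, initialState_trans]
      simp

theorem indexBound_succ_le (K N : ℕ) :
    indexBound K (N + 1) ≤ (4 * K * K + 6 * K + 8) * (N + 1) ^ 2 := by
  unfold indexBound
  have h1 : (N + 1 + 1) * K ≤ 2 * K * (N + 1) := by nlinarith [Nat.zero_le (K * N)]
  have h2 : N + 1 ≤ (N + 1) ^ 2 := Nat.le_self_pow two_ne_zero _
  calc _ ≤ 2 * K * (N + 1) * (2 * K * (N + 1)) + 3 * (2 * K * (N + 1)) + 3 * (N + 1) + 5 * (N + 1) := by
        gcongr
        omega
    _ = 4 * K * K * (N + 1) ^ 2 + (6 * K + 8) * (N + 1) := by ring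
    _ ≤ 4 * K * K * (N + 1) ^ 2 + (6 * K + 8) * (N + 1) ^ 2 := by gcongr
    _ = _ := by ring

/-- Indices are quadratic in the number of calls, and pairs of them quadratic again, so a multiple
of `(N + 1) ^ 4` is enough. Since `C ≥ 4`, the exponent `C` covers this. -/
theorem fits_indexBound {K C N : ℕ}
    (hC : (4 * K * K + 6 * K + 8) ^ 2 + 4 * (4 * K * K + 6 * K + 8) ≤ C) :
    Fits (C * (N + 1) ^ C) (indexBound K (N + 1)) := by
  set a := 4 * K * K + 6 * K + 8 with ha
  have h1 := indexBound_succ_le K N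
  rw [← ha] at h1
  have hC4 : 4 ≤ C := by nlinarith
  refine fits_of_le ?_
  calc _ ≤ a * (N + 1) ^ 2 * (a * (N + 1) ^ 2) + 4 * (a * (N + 1) ^ 2) := by gcongr
    _ ≤ a * (N + 1) ^ 2 * (a * (N + 1) ^ 2) + 4 * (a * (N + 1) ^ 4) := by
      gcongr <;> omega
    _ = (a ^ 2 + 4 * a) * (N + 1) ^ 4 := by ring
    _ ≤ C * (N + 1) ^ C := by gcongr; omega

theorem mul_sqrt_le_rpow (M : ℕ) : ((M * Nat.sqrt M : ℕ) : ℝ) ≤ (M : ℝ) ^ (3 / 2 : ℝ) := by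
  rcases Nat.eq_zero_or_pos M with rfl | hM
  · simp
  · have h1 : (0 : ℝ) < M := by exact_mod_cast hM
    have h2 : (M : ℝ) ^ (3 / 2 : ℝ) = M * Real.sqrt M := by
      rw [Real.sqrt_eq_rpow, show (3 / 2 : ℝ) = 1 + 1 / 2 by norm_num, Real.rpow_add h1, Real.rpow_one]
    rw [h2]
    push_cast
    gcongr
    exact Real.nat_sqrt_le_real_sqrt

/-- The case `M = 0` is separate: `M √M` vanishes while the potential need not. Then no call adds a
transition, and either there is no call at all or `R ≥ 1` carries the constant. -/
theorem amortized_bounds {A T M R L P F c : ℕ} (hL : M + R = L) (hadd : A ≤ P + c * M)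
    (hall : T ≤ P + c * L) (hA : M = 0 → A = 0) (hT : L = 0 → T = 0) (hP0 : M = 0 → P ≤ F)
    (hP : 1 ≤ M → P ≤ F * (M * Nat.sqrt M)) :
    A ≤ (F + c) * (M * Nat.sqrt M) ∧ T ≤ (F + c) * (M * Nat.sqrt M + R) := by
  rcases Nat.eq_zero_or_pos M with rfl | hpos
  · rw [hA rfl]
    refine ⟨Nat.zero_le _, ?_⟩
    have h1 := hP0 rfl
    rw [zero_add] at hL
    subst hL
    rcases Nat.eq_zero_or_pos R with h2 | h2
    · rw [hT h2]
      exact Nat.zero_le _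
    · have h3 := Nat.le_mul_of_pos_right F h2
      rw [zero_mul, zero_add, add_mul]
      omega
  · have h1 := hP hpos
    have h2 := Nat.mul_le_mul_left c (Nat.le_mul_of_pos_right M (Nat.sqrt_pos.2 hpos))
    rw [← hL, mul_add] at hall
    rw [mul_add, add_mul, add_mul]
    constructor <;> omega

end Start

end IncSCC

/-! ### The main theorem. -/

open Classical in
theorem theorem1 {AP S : Type*} [Finite AP] {K : ℕ} (B : BuchiAutomaton AP S)
    (lab : Set AP ↪ ℕ) (q : S ≃ Fin K) :
    ∃ (setup call : Cmd) (C : ℕ),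
      ∀ (n : ℕ) (env : Environment n AP) (x₀ : EuclideanSpace ℝ (Fin n))
        (steer : EuclideanSpace ℝ (Fin n) → EuclideanSpace ℝ (Fin n) → EuclideanSpace ℝ (Fin n))
        (η₁ η₂ : ℕ → ℝ) (tr : List (CallRecord (EuclideanSpace ℝ (Fin n)) AP S))
        (st : SearchState (EuclideanSpace ℝ (Fin n)) AP S),
        x₀ ∈ env.space → env.IsSteer steer → IsBoundPair η₁ η₂ →
        SparseRRG env x₀ steer η₁ η₂ B tr st →
        ∃ (t₀ : ℕ) (mem : ℕ → Mem) (time : ℕ → ℕ),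
          Implements B lab q setup call (C * (tr.length + 1) ^ C) (startState env x₀ B) tr
            t₀ mem time ∧
          t₀ ≤ C ∧
          ((∑ i : Fin tr.length with (tr.get i).AddsTransition, time i : ℕ) : ℝ) ≤
            C * (st.T.trans.card : ℝ) ^ (3 / 2 : ℝ) ∧
          ((∑ i : Fin tr.length, time i : ℕ) : ℝ) ≤
            C * ((st.T.trans.card : ℝ) ^ (3 / 2 : ℝ) +
              ((Finset.univ.filter fun i : Fin tr.length =>
                ¬ (tr.get i).AddsTransition).card : ℝ)) := by
  -- There are finitely many letters, so one constant bounds all their numbers and lets them fit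
  -- into a word.
  obtain ⟨ℓ, hℓ⟩ := (Set.finite_range lab).bddAbove
  set τ := IncSCC.table B lab q
  set D := IncSCC.potentialFactor τ + IncSCC.callCost τ
  obtain ⟨C, hC, hCℓ, hCD, hCs⟩ : ∃ C, (4 * K * K + 6 * K + 8) ^ 2 + 4 * (4 * K * K + 6 * K + 8) ≤ C ∧
      ℓ ≤ C ∧ D ≤ C ∧ IncSCC.maxCost (IncSCC.setupProgram τ) ≤ C :=
    ⟨(4 * K * K + 6 * K + 8) ^ 2 + 4 * (4 * K * K + 6 * K + 8) + ℓ + D +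
      IncSCC.maxCost (IncSCC.setupProgram τ), by omega, by omega, by omega, by omega⟩
  refine ⟨IncSCC.setupProgram τ, IncSCC.callProgram τ, C, ?_⟩
  intro n env x₀ steer η₁ η₂ tr st _ _ _ hrrg
  have hW : IncSCC.Fits (C * (tr.length + 1) ^ C) (IncSCC.indexBound K (tr.length + 1)) :=
    IncSCC.fits_indexBound hC
  have hlab : ∀ σ, lab σ ≤ C * (tr.length + 1) ^ C := fun σ =>
    (hℓ ⟨σ, rfl⟩ : lab σ ≤ ℓ).trans (hCℓ.trans
      (Nat.le_mul_of_pos_right _ (Nat.pow_pos (Nat.succ_pos _))))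
  have hK : K + 1 ≤ IncSCC.indexBound K (tr.length + 1) := by
    unfold IncSCC.indexBound
    have : K ≤ (tr.length + 1 + 1) * K := Nat.le_mul_of_pos_left _ (by omega)
    omega
  obtain ⟨t₀, m₀, hsetup, ht₀, hm₀⟩ := IncSCC.setupProgram_runs (B := B) (q := q) (x₀ := x₀)
    (l := env.label) (hW.mono hK) (hlab _)
  obtain ⟨mem, time, rfl, hend, hvend, hsteps, hadd, hall, hcard⟩ := IncSCC.exists_simulation hW hlab hm₀
    IncSCC.valid_initialState (IncSCC.callChain_of_sparseRRG hrrg)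
    (Nat.add_comm 1 _).le
  refine ⟨t₀, mem, time, ⟨hsetup, hm₀.represents IncSCC.valid_initialState, hsteps⟩,
    ht₀.trans hCs, ?_⟩
  set M := st.T.trans.card with hM
  set Q := (Finset.univ.filter fun i : Fin tr.length => ¬ (tr.get i).AddsTransition).card with hQ
  have hMcard : (Finset.univ.filter fun i : Fin tr.length => (tr.get i).AddsTransition).card = M := by
    rw [Finset.card_filter, hcard]
    simp [IncSCC.initialState, DTS.single]
  have hMQ : M + Q = tr.length := by
    rw [← hMcard, hQ, Finset.card_filter_add_card_filter_not]
    simp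
  rw [← Finset.sum_filter, ← Finset.card_filter, hMcard] at hadd
  set A := ∑ i : Fin tr.length with (tr.get i).AddsTransition, time i with hA
  have hmain : A ≤ D * (M * Nat.sqrt M) ∧ ∑ i : Fin tr.length, time i ≤ D * (M * Nat.sqrt M + Q) := by
    refine IncSCC.amortized_bounds hMQ ((Nat.le_add_right _ _).trans hadd)
      ((Nat.le_add_right _ _).trans hall) (fun h0 => ?_) (fun h0 => ?_) (fun h0 => ?_)
      (IncSCC.potential_bound hend hvend le_rfl)
    · rw [hA, Finset.card_eq_zero.1 (hMcard.trans h0), Finset.sum_empty]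
    · exact Finset.sum_eq_zero fun i _ => absurd i.2 (by omega)
    -- Without transitions the bound is used with `N = 1`, where it is the constant
    -- `potentialFactor`.
    · have hpot := IncSCC.potential_bound hend hvend (N := 1) (h0.trans_le zero_le_one) le_rfl
      rwa [Nat.sqrt_one, mul_one, mul_one] at hpot
  have hDC : (D : ℝ) ≤ C := by exact_mod_cast hCD
  have hrpow := IncSCC.mul_sqrt_le_rpow M
  constructor
  · calc ((A : ℕ) : ℝ) ≤ ((D * (M * Nat.sqrt M) : ℕ) : ℝ) := by exact_mod_cast hmain.1
      _ = D * ((M * Nat.sqrt M : ℕ) : ℝ) := by push_cast; ring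
      _ ≤ C * (M : ℝ) ^ (3 / 2 : ℝ) := by gcongr
  · calc ((∑ i : Fin tr.length, time i : ℕ) : ℝ) ≤ ((D * (M * Nat.sqrt M + Q) : ℕ) : ℝ) := by
          exact_mod_cast hmain.2
      _ = D * (((M * Nat.sqrt M : ℕ) : ℝ) + Q) := by push_cast; ring
      _ ≤ C * ((M : ℝ) ^ (3 / 2 : ℝ) + Q) := by gcongr
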